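/- **Algebraic data.** Let $k$ be a field of characteristic $0$ and $A=A_0\oplus A_1$ a finite-dimensional $\mathbb Z/2$-graded associative (not necessarily unital) $k$-algebra with an odd non-degenerate scalar product $g$: $g(a,b)=0$ unless $|a|+|b|=1$, $g(a,b)=(-1)^{|a||b|}g(b,a)$ and $g(ab,c)=g(a,bc)$. Let $I$ be an odd derivation of $A$, $I(ab)=I(a)b+(-1)^{|a|}aI(b)$, that is anti-self-adjoint, $g(Ia,b)+(-1)^{|a|}g(a,Ib)=0$. Let $\widetilde I$ be an odd self-adjoint operator, $g(\widetilde Ia,b)=(-1)^{|a|}g(a,\widetilde Ib)$, with $[I,\widetilde I]=I\widetilde I+\widetilde II=1$. Suppose that the supertrace $\mathrm{Tr}(l_a)$ of the left multiplication $l_a$ vanishes for every $a\in A$. Let $(e_\mu)$ be any homogeneous basis of $A$ and $(e^\mu)$ the dual basis, $g(e^\mu,e_\nu)=\delta_{\mu\nu}$; $|e^\mu|=|e_\mu|+1$. Denote by $\Pi A$ the space $A$ with reversed parity, and by $\pi a$ the element of $\Pi A$ given by $a$. **Graphs.** A connected stable ribbon graph $\widehat G$ consists of a finite non-empty set $F$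 of flags, a permutation $\sigma$ of $F$ (its cycles, including those of length one, form the set $\mathrm{Cycle}$), a fixed-point free involution $\eta$ of $F$ (its orbits are the edges), a partition of $F$ into $\sigma$-stable subsets (the vertices) and an integer $\gamma_v\ge 0$ for each vertex $v$, such that the graph is connected and $2(2\gamma_v+b_v-2)+n_v>0$ for every $v$, where $n_v$ and $b_v$ are the numbers of flags and of cycles of $v$. An orientation $or$ of $\widehat G$ is an orientation of the vector space $k^{F}\oplus k^{\mathrm{Cycle}}$, i.e. a function from the orderings of the basis $F\sqcup\mathrm{Cycle}$ to $\{\pm1\}$ that is multiplied by the sign of a permutation of the basis. Let $e=\{f,f'\}$, $f'=\eta(f)$, be an edge. If $\sigma(f)=f'$, or $\sigma(f')=f$, or both $\sigma(f)=f$ and $\sigma(f')=f'$ (that is, if a boundary component consists of this edge only), put $\widehat G/e=\varnothing$. Otherwise $\widehat G/e$ is the connected stable ribbon graph with flags $F\setminus\{f,f'\}$, with the permutation that is induced on $F\setminus\{f,f'\}$ by the multi-cyclic order $(f\,f')\circ\sigma$, with the restriction of $\eta$, and with the vertices of $f$ and $f'$ united. The integer of the united vertex is $\gamma_v+\gamma_{v'}$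 if $e$ joins distinct vertices $v,v'$; it is $\gamma_v$ if $e$ is a loop at $v$ and $f,f'$ are in the same cycle; it is $\gamma_v+1$ if $e$ is a loop at $v$ and $f,f'$ are in distinct cycles. The other integers are unchanged. The induced orientation of $\widehat G/e$ is: if $f\in c$, $f'\in c'$ with $c\ne c'$, then $f\wedge c\wedge f'\wedge c'\wedge\omega$ induces $c''\wedge\omega$, where $c''$ is the cycle into which $c$ and $c'$ are joined; if $f,f'\in c$, then $c\wedge f\wedge f'\wedge\omega$ induces $c_1\wedge c_2\wedge\omega$, where $c_1,c_2$ are the two cycles into which $c$ is cut, $\sigma^{-1}(f)\in c_1$ and $\sigma^{-1}(f')\in c_2$. A cochain of the dual stable ribbon graph complex is a $k$-valued function $\varphi$ on isomorphism classes of oriented connected stable ribbon graphs with $\varphi(\widehat G,-or)=-\varphi(\widehat G,or)$. The differential is $$(d\varphi)(\widehat G,or)=\sum_{e\,:\,\widehat G/e\neq\varnothing}\varphi(\widehat G/e,\text{induced orientation}),$$ the sum being over all edges, loops included. **The cochain $\widehat Z_{\widetilde I}$.** Put $l(a_1a_2\cdots a_m)=g(a_1,a_2\cdots a_m)$ for $m\ge2$,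 and $$T(a)=\sum_\mu(-1)^{|e^\mu|(|a|+1)}e^\mu a e_\mu,\qquad \Gamma=\sum_{\xi,\zeta}(-1)^{|e^\xi||e^\zeta|}e^\xi e^\zeta e_\xi e_\zeta .$$ For a vertex $v$ with $n$ flags whose cycles are written as $\sigma_v=(\rho_1\dots\rho_r)\cdots(\tau_1\dots\tau_t)$, let $A_1,\dots,A_b$ be the corresponding words $a_{\rho_1}\cdots a_{\rho_r},\dots,a_{\tau_1}\cdots a_{\tau_t}$ of homogeneous elements, and define $$\alpha_{\sigma_v,\gamma_v}(\pi a_{\rho_1}\otimes\cdots\otimes\pi a_{\tau_t})=(-1)^{\epsilon}\,l\bigl(T(A_1)\cdots T(A_{b-1})\,A_b\,\Gamma^{\gamma_v}\bigr),\qquad \epsilon=\sum_{i=1}^n(n-i)|a_i|+\sum_{j=1}^b(j-1)|A_j|,$$ where $a_1,\dots,a_n$ denotes the sequence $a_{\rho_1},\dots,a_{\tau_t}$. To every edge attach the element $$\sum_{\mu,\nu}(-1)^{|\pi e_\nu|}\,g(\widetilde Ie^\mu,e^\nu)\;\pi e_\mu\otimes\pi e_\nu\in\Pi A\otimes\Pi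 A$$ of the propagator $g^{-1}(\widetilde I^*\cdot,\cdot)$. Write the graph down by choosing an order of the vertices, an order of the cycles of each vertex, and a first flag in each cycle (whose further flags then follow in the order given by $\sigma$). Reorder the tensor product of the elements of all edges (taking for each edge the two flags in the order in which they occur) by the Koszul sign rule of $\Pi A$ into the resulting order of the flags, and apply to it the product of the $\alpha_{\sigma_v,\gamma_v}$ in the order of the vertices, each to its own block of factors (with no further sign). Let $w$ be the resulting number. The choice also determines an ordered basis of $k^{F}\oplus k^{\mathrm{Cycle}}$: vertex after vertex, the flags $\rho_1,\dots,\tau_t$ and then the cycles of the vertex in the reverse order, from $(\tau_1\dots\tau_t)$ to $(\rho_1\dots\rho_r)$. Put $\widehat Z_{\widetilde I}(\widehat G,or)=w$ if this ordered basis is positive for $or$, and $\widehat Z_{\widetilde I}(\widehat G,or)=-w$ otherwise. **Theorem.** The number $\widehat Z_{\widetilde I}(\widehat G,or)$ does not depend on the choices made in writing the graph down, $\widehat Z_{\widetilde I}$ is a cochain of the dual stable ribbon graph complex, and $$d\widehat Z_{\widetilde I}=0 .$$ -/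

import Mathlib

namespace StableRibbon

open Equiv Equiv.Perm

/-! ### Permutations -/

section Permutations

variable {α : Type*}

theorem sameCycle_lift {β : Type*} {π : Perm α} (s : Setoid β) (r : α → β)
    (h : ∀ a, s (r a) (r (π a))) {x y : α} (hxy : π.SameCycle x y) : s (r x) (r y) := by
  obtain ⟨i, rfl⟩ := hxy
  induction i using Int.induction_on with
  | zero => exact s.refl _
  | succ n ih =>
    have := h ((π ^ (n : ℤ)) x)
    rw [← Perm.mul_apply, ← zpow_one_add, add_comm] at this
    exact s.trans ih this
  | pred n ih =>
    have := h ((π ^ (-(n : ℤ) - 1)) x)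
    rw [← Perm.mul_apply, ← zpow_one_add, add_sub_cancel] at this
    exact s.trans ih (s.symm this)

/-- The partition obtained from `s` by uniting the classes of `a` and of `b`. -/
def mergeSetoid (s : Setoid α) (a b : α) : Setoid α where
  r x y := s x y ∨ ((s a x ∨ s b x) ∧ (s a y ∨ s b y))
  iseqv := by
    have key : ∀ {x y}, s x y → (s a x ∨ s b x) → (s a y ∨ s b y) := fun h h' =>
      h'.imp (fun k => s.trans k h) (fun k => s.trans k h)
    refine ⟨fun x => Or.inl (s.refl x), fun h => h.imp s.symm And.symm, fun {x y z} h₁ h₂ => ?_⟩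
    rcases h₁ with h₁ | h₁ <;> rcases h₂ with h₂ | h₂
    · exact Or.inl (s.trans h₁ h₂)
    · exact Or.inr ⟨key (s.symm h₁) h₂.1, h₂.2⟩
    · exact Or.inr ⟨h₁.1, key h₂ h₁.2⟩
    · exact Or.inr ⟨h₁.1, h₂.2⟩

theorem mergeSetoid_iff (s : Setoid α) (a b x y : α) :
    mergeSetoid s a b x y ↔ s x y ∨ ((s a x ∨ s b x) ∧ (s a y ∨ s b y)) := Iff.rfl

variable [DecidableEq α]

/-- The multi-cyclic order `π` with the element `a` left out: `a` becomes a fixed point, and the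
predecessor of `a` is sent to the successor of `a`. -/
def skip (π : Perm α) (a : α) : Perm α := swap a (π a) * π

theorem skip_self (π : Perm α) (a : α) : skip π a a = a := by simp [skip]

theorem skip_of_ne (π : Perm α) {a x : α} (hx : x ≠ a) (h : π x ≠ a) : skip π a x = π x := by
  simp only [skip, Perm.mul_apply]
  exact swap_apply_of_ne_of_ne h (fun h' => hx (π.injective h'))

theorem skip_of_eq (π : Perm α) {a x : α} (h : π x = a) : skip π a x = π a := by
  simp [skip, h]

theorem skip_sameCycle (π : Perm α) {a x y : α} (hx : x ≠ a) (hy : y ≠ a) :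
    (skip π a).SameCycle x y ↔ π.SameCycle x y := by
  constructor
  · refine sameCycle_lift (SameCycle.setoid π) id (fun b => ?_)
    change π.SameCycle b (skip π a b)
    by_cases hb : b = a
    · subst hb; rw [skip_self]
    by_cases h : π b = a
    · rw [skip_of_eq π h, ← h, sameCycle_apply_right, sameCycle_apply_right]
    · rw [skip_of_ne π hb h, sameCycle_apply_right]
  · intro h
    have := sameCycle_lift (SameCycle.setoid (skip π a)) (fun z => if z = a then π a else z)
      (fun b => ?_) h
    · have this : (skip π a).SameCycle (if x = a then π a else x) (if y = a then π a else y) := this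
      simpa [hx, hy] using this
    change (skip π a).SameCycle _ _
    by_cases hb : b = a
    · subst hb
      by_cases h : π b = b <;> simp [h, SameCycle.refl]
    by_cases h : π b = a
    · simp only [hb, h, if_true, if_false]
      rw [← skip_of_eq π h, sameCycle_apply_right]
    · simp only [hb, h, if_false]
      rw [← skip_of_ne π hb h, sameCycle_apply_right]

/-- The product `(f f') ∘ σ`. -/
def glue (σ : Perm α) (f f' : α) : Perm α := swap f f' * σ

/-- The multi-cyclic order induced by `(f f') ∘ σ` on the complement of `{f, f'}`. -/
def contractPerm (σ : Perm α) (f f' : α) (hne : f' ≠ f) :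
    Perm {x : α // x ≠ f ∧ x ≠ f'} :=
  (skip (skip (glue σ f f') f) f').subtypePerm (by
    have h1 : skip (skip (glue σ f f') f) f' f = f := by
      have : skip (glue σ f f') f f = f := skip_self _ _
      rw [skip_of_ne _ hne.symm (by rw [this]; exact hne.symm), this]
    have h2 : skip (skip (glue σ f f') f) f' f' = f' := skip_self _ _
    intro x
    have e1 : skip (skip (glue σ f f') f) f' x = f ↔ x = f :=
      ⟨fun h => Equiv.injective _ (h.trans h1.symm), fun h => h ▸ h1⟩
    have e2 : skip (skip (glue σ f f') f) f' x = f' ↔ x = f' :=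
      ⟨fun h => Equiv.injective _ (h.trans h2.symm), fun h => h ▸ h2⟩
    simp only [ne_eq, e1, e2])

theorem contractPerm_sameCycle (σ : Perm α) (f f' : α) (hne : f' ≠ f)
    (x y : {x : α // x ≠ f ∧ x ≠ f'}) :
    (contractPerm σ f f' hne).SameCycle x y ↔ (glue σ f f').SameCycle x y := by
  rw [contractPerm, sameCycle_subtypePerm, skip_sameCycle _ x.2.2 y.2.2,
    skip_sameCycle _ x.2.1 y.2.1]

theorem glue_apply (σ : Perm α) (f f' x : α) : glue σ f f' x = swap f f' (σ x) := rfl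

theorem glue_glue (σ : Perm α) (f f' : α) : glue (glue σ f f') f f' = σ := by
  ext x; simp [glue_apply]

theorem glue_sameCycle (σ : Perm α) (f f' : α) {x y : α} (h : (glue σ f f').SameCycle x y) :
    σ.SameCycle x y ∨ ((σ.SameCycle f x ∨ σ.SameCycle f' x) ∧
      (σ.SameCycle f y ∨ σ.SameCycle f' y)) := by
  refine sameCycle_lift (mergeSetoid (SameCycle.setoid σ) f f') id (fun a => ?_) h
  change σ.SameCycle _ _ ∨ ((σ.SameCycle _ _ ∨ σ.SameCycle _ _) ∧
      (σ.SameCycle _ _ ∨ σ.SameCycle _ _))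
  simp only [glue_apply, id]
  by_cases h1 : σ a = f
  · rw [h1, swap_apply_left]
    exact Or.inr ⟨Or.inl (h1 ▸ (SameCycle.refl σ a).apply_left), Or.inr (SameCycle.refl _ _)⟩
  by_cases h2 : σ a = f'
  · rw [h2, swap_apply_right]
    exact Or.inr ⟨Or.inr (h2 ▸ (SameCycle.refl σ a).apply_left), Or.inl (SameCycle.refl _ _)⟩
  rw [swap_apply_of_ne_of_ne h1 h2]
  exact Or.inl (SameCycle.refl σ a).apply_right

theorem sameCycle_glue (σ : Perm α) (f f' : α) {x y : α} (h : σ.SameCycle x y) :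
    (glue σ f f').SameCycle x y ∨
      (((glue σ f f').SameCycle f x ∨ (glue σ f f').SameCycle f' x) ∧
      ((glue σ f f').SameCycle f y ∨ (glue σ f f').SameCycle f' y)) := by
  apply glue_sameCycle (glue σ f f') f f'
  rwa [glue_glue]

theorem glue_pow (σ : Perm α) (f f' : α) (n : ℕ)
    (h : ∀ j, 0 < j → j ≤ n → (σ ^ j) f ≠ f ∧ (σ ^ j) f ≠ f') :
    ((glue σ f f') ^ n) f = (σ ^ n) f := by
  induction n with
  | zero => rfl
  | succ n ih =>
    rw [pow_succ', Perm.mul_apply, ih (fun j h0 h1 => h j h0 (by omega)), pow_succ',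
      Perm.mul_apply]
    have := h (n + 1) (by omega) le_rfl
    rw [pow_succ', Perm.mul_apply] at this
    rw [glue_apply, swap_apply_of_ne_of_ne this.1 this.2]

/-- Two different cycles of `σ` are joined in `(f f') ∘ σ`. -/
theorem glue_sameCycle_of_not [Finite α] (σ : Perm α) (f f' : α) (h : ¬ σ.SameCycle f f') :
    (glue σ f f').SameCycle f f' := by
  classical
  have hex : ∃ n, 0 < n ∧ (σ ^ n) f = f := ⟨orderOf σ, orderOf_pos σ, by simp [pow_orderOf_eq_one]⟩
  obtain ⟨hn0, hn⟩ := Nat.find_spec hex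
  have hmin := fun m => @Nat.find_min _ _ hex m
  generalize Nat.find hex = n at hn0 hn hmin
  obtain ⟨m, rfl⟩ : ∃ m, n = m + 1 := ⟨n - 1, by omega⟩
  have := glue_pow σ f f' m (fun j h0 h1 =>
    ⟨fun h' => hmin j (by omega) ⟨h0, h'⟩, fun h' => h ⟨j, by simpa using h'⟩⟩)
  refine ⟨(m + 1 : ℕ), ?_⟩
  rw [zpow_natCast, pow_succ', Perm.mul_apply, this, glue_apply, ← Perm.mul_apply σ,
    ← pow_succ', hn, swap_apply_left]

/-- One cycle of `σ` is cut into two in `(f f') ∘ σ`. -/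
theorem glue_not_sameCycle_of [Finite α] (σ : Perm α) (f f' : α) (hne : f' ≠ f)
    (h : σ.SameCycle f f') : ¬ (glue σ f f').SameCycle f f' := by
  classical
  have hex : ∃ n, (σ ^ n) f = f' := h.exists_nat_pow_eq
  have hn := Nat.find_spec hex
  have hmin := fun m => @Nat.find_min _ _ hex m
  generalize Nat.find hex = n at hn hmin
  have hn0 : n ≠ 0 := by rintro rfl; exact hne (by simpa using hn.symm)
  obtain ⟨m, rfl⟩ : ∃ m, n = m + 1 := ⟨n - 1, by omega⟩
  have hret : ∀ j, 0 < j → j ≤ m → (σ ^ j) f ≠ f := by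
    intro j h0 h1 hj
    refine hmin (m + 1 - j) (by omega) ?_
    have : (σ ^ (m + 1 - j)) ((σ ^ j) f) = f' := by
      rw [← Perm.mul_apply, ← pow_add, Nat.sub_add_cancel (by omega), hn]
    rwa [hj] at this
  have hp := fun k (hk : k ≤ m) => glue_pow σ f f' k (fun j h0 h1 =>
    ⟨hret j h0 (by omega), hmin j (by omega)⟩)
  have hper : ((glue σ f f') ^ (m + 1)) f = f := by
    rw [pow_succ', Perm.mul_apply, hp m le_rfl, glue_apply, ← Perm.mul_apply σ,
      ← pow_succ', hn, swap_apply_right]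
  intro hc
  obtain ⟨N, hN⟩ := hc.exists_nat_pow_eq
  have hmod : ∀ q : ℕ, ((glue σ f f') ^ ((m + 1) * q)) f = f := by
    intro q
    induction q with
    | zero => rfl
    | succ q ih => rw [Nat.mul_succ, pow_add, Perm.mul_apply, hper, ih]
  rw [← Nat.mod_add_div N (m + 1), pow_add, Perm.mul_apply, hmod,
    hp _ (Nat.le_of_lt_succ (Nat.mod_lt _ (Nat.succ_pos m)))] at hN
  exact hmin _ (Nat.mod_lt _ (Nat.succ_pos m)) hN

end Permutations

/-! ### Contraction of a pair of points in a multi-cyclic order -/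

section Contraction

variable {α : Type*}

/-- The cycles of a permutation (fixed points are cycles of length one). -/
abbrev Cyc (σ : Perm α) : Type _ := Quotient (SameCycle.setoid σ)

/-- The cycle through a given point. -/
abbrev cyc (σ : Perm α) (x : α) : Cyc σ := Quotient.mk (SameCycle.setoid σ) x

theorem cyc_eq_iff (σ : Perm α) {x y : α} : cyc σ x = cyc σ y ↔ σ.SameCycle x y := Quotient.eq

open Classical in
/-- The basis elements that disappear in the contraction. -/
noncomputable def contractPrefix (σ : Perm α) (f f' : α) : List (α ⊕ Cyc σ) :=
  if σ.SameCycle f f' then [.inr (cyc σ f)] else [.inl f, .inr (cyc σ f), .inl f']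

theorem contractPrefix_nodup (σ : Perm α) (f f' : α) (hne : f' ≠ f) :
    (contractPrefix σ f f').Nodup := by
  unfold contractPrefix
  split_ifs <;> simp [hne.symm]

variable [DecidableEq α]

open Classical in
/-- Comparison of the bases of `k^Flag ⊕ k^Cycle` after and before the contraction of `{f, f'}`.
If `f` and `f'` lie in two cycles, then the joined cycle corresponds to the cycle of `f'`. If they
lie in one cycle, then this cycle is cut into the cycle of the successor of `f` and the cycle of the
successor of `f'`, which correspond to `f'` and to `f`. All other flags and cycles are unchanged. -/
noncomputable def contractBasis (σ : Perm α) (f f' : α) (hne : f' ≠ f) :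
    {x : α // x ≠ f ∧ x ≠ f'} ⊕ Cyc (contractPerm σ f f' hne) → α ⊕ Cyc σ
  | .inl x => .inl x
  | .inr q =>
    if σ.SameCycle f f' then
      if (glue σ f f').SameCycle f q.out then .inl f'
      else if (glue σ f f').SameCycle f' q.out then .inl f
      else .inr (cyc σ q.out)
    else
      if (glue σ f f').SameCycle f q.out then .inr (cyc σ f')
      else .inr (cyc σ q.out)

theorem cyc_eq_of_glue (σ : Perm α) (f f' : α) {x y : α} (h : (glue σ f f').SameCycle x y)
    (h1 : ¬ (glue σ f f').SameCycle f x) (h2 : ¬ (glue σ f f').SameCycle f' x) :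
    σ.SameCycle x y := by
  rcases glue_sameCycle σ f f' h with h' | ⟨hx | hx, _⟩
  · exact h'
  · rcases sameCycle_glue σ f f' hx with h' | h'
    · exact absurd h' h1
    · exact absurd h'.2 (by tauto)
  · rcases sameCycle_glue σ f f' hx with h' | h'
    · exact absurd h' h2
    · exact absurd h'.2 (by tauto)

theorem glue_eq_of_cyc (σ : Perm α) (f f' : α) {x y : α} (h : σ.SameCycle x y)
    (h1 : ¬ (glue σ f f').SameCycle f x) (h2 : ¬ (glue σ f f').SameCycle f' x) :
    (glue σ f f').SameCycle x y := by
  rcases sameCycle_glue σ f f' h with h' | h'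
  · exact h'
  · exact absurd h'.1 (by tauto)

theorem contractBasis_cut (σ : Perm α) (f f' : α) (hne : f' ≠ f) (hs : σ.SameCycle f f')
    (y : {x : α // x ≠ f ∧ x ≠ f'}) :
    contractBasis σ f f' hne (.inr (cyc _ y)) =
      open Classical in
      if (glue σ f f').SameCycle f y then .inl f'
      else if (glue σ f f').SameCycle f' y then .inl f
      else .inr (cyc σ y) := by
  classical
  have h : (glue σ f f').SameCycle (cyc (contractPerm σ f f' hne) y).out y := by
    rw [← contractPerm_sameCycle σ f f' hne]
    exact (cyc_eq_iff _).1 (Quotient.out_eq _)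
  have e : ∀ a, (glue σ f f').SameCycle a (cyc (contractPerm σ f f' hne) y).out ↔
      (glue σ f f').SameCycle a y := fun a => ⟨fun k => k.trans h, fun k => k.trans h.symm⟩
  simp only [contractBasis, hs, if_true, e]
  split_ifs with h1 h2
  · rfl
  · rfl
  · rw [(cyc_eq_iff σ).2 (cyc_eq_of_glue σ f f' h (by rwa [e]) (by rwa [e]))]

theorem contractBasis_join [Finite α] (σ : Perm α) (f f' : α) (hne : f' ≠ f)
    (hs : ¬ σ.SameCycle f f') (y : {x : α // x ≠ f ∧ x ≠ f'}) :
    contractBasis σ f f' hne (.inr (cyc _ y)) =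
      open Classical in
      if (glue σ f f').SameCycle f y then .inr (cyc σ f') else .inr (cyc σ y) := by
  classical
  have h : (glue σ f f').SameCycle (cyc (contractPerm σ f f' hne) y).out y := by
    rw [← contractPerm_sameCycle σ f f' hne]
    exact (cyc_eq_iff _).1 (Quotient.out_eq _)
  have e : ∀ a, (glue σ f f').SameCycle a (cyc (contractPerm σ f f' hne) y).out ↔
      (glue σ f f').SameCycle a y := fun a => ⟨fun k => k.trans h, fun k => k.trans h.symm⟩
  simp only [contractBasis, hs, if_false, e]
  split_ifs with h1
  · rfl
  · have hff := glue_sameCycle_of_not σ f f' hs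
    rw [(cyc_eq_iff σ).2 (cyc_eq_of_glue σ f f' h (by rwa [e])
      (by rw [e]; exact fun k => h1 (hff.trans k)))]

theorem contractBasis_injective [Finite α] (σ : Perm α) (f f' : α) (hne : f' ≠ f) :
    Function.Injective (contractBasis σ f f' hne) := by
  classical
  rintro (x | q) (y | r) h
  · simp only [contractBasis, Sum.inl.injEq] at h
    rw [Subtype.ext h]
  · induction r using Quotient.inductionOn with | h r => ?_
    exfalso
    by_cases hs : σ.SameCycle f f'
    · have := contractBasis_cut σ f f' hne hs r
      rw [← h] at this
      simp only [contractBasis] at this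
      split_ifs at this <;> simp_all [x.2.1, x.2.2]
    · have := contractBasis_join σ f f' hne hs r
      rw [← h] at this
      simp only [contractBasis] at this
      split_ifs at this
  · induction q using Quotient.inductionOn with | h r => ?_
    exfalso
    by_cases hs : σ.SameCycle f f'
    · have := contractBasis_cut σ f f' hne hs r
      rw [h] at this
      simp only [contractBasis] at this
      split_ifs at this <;> simp_all [y.2.1, y.2.2]
    · have := contractBasis_join σ f f' hne hs r
      rw [h] at this
      simp only [contractBasis] at this
      split_ifs at this
  · induction q using Quotient.inductionOn with | h x => ?_
    induction r using Quotient.inductionOn with | h y => ?_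
    congr 1
    change cyc _ x = cyc _ y
    rw [cyc_eq_iff, contractPerm_sameCycle]
    by_cases hs : σ.SameCycle f f'
    · have hx := contractBasis_cut σ f f' hne hs x
      have hy := contractBasis_cut σ f f' hne hs y
      have h := hx.symm.trans (h.trans hy)
      split_ifs at h with h1 h2 h3 h4 h5 h6
      · exact h1.symm.trans h2
      · exact absurd (Sum.inl.inj h) hne
      · exact absurd (Sum.inl.inj h) hne.symm
      · exact h4.symm.trans h6
      · exact glue_eq_of_cyc σ f f' ((cyc_eq_iff σ).1 (Sum.inr.inj h)) h1 h4
    · have hff := glue_sameCycle_of_not σ f f' hs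
      have hx := contractBasis_join σ f f' hne hs x
      have hy := contractBasis_join σ f f' hne hs y
      have h := hx.symm.trans (h.trans hy)
      split_ifs at h with h1 h2 h3
      · exact h1.symm.trans h2
      · exact absurd (hff.trans (glue_eq_of_cyc σ f f' ((cyc_eq_iff σ).1 (Sum.inr.inj h)).symm h2
          (fun k => h2 (hff.trans k))).symm) (fun k => h2 k)
      · exact absurd (hff.trans (glue_eq_of_cyc σ f f' ((cyc_eq_iff σ).1 (Sum.inr.inj h)) h1
          (fun k => h1 (hff.trans k))).symm) (fun k => h1 k)
      · exact glue_eq_of_cyc σ f f' ((cyc_eq_iff σ).1 (Sum.inr.inj h)) h1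
          (fun k => h1 (hff.trans k))

theorem mem_contractPrefix_iff [Finite α] (σ : Perm α) (f f' : α) (hne : f' ≠ f)
    (h1 : ∃ y, y ≠ f ∧ y ≠ f' ∧ (glue σ f f').SameCycle f y)
    (h2 : ∃ y, y ≠ f ∧ y ≠ f' ∧ (glue σ f f').SameCycle f' y) (z : α ⊕ Cyc σ) :
    z ∈ contractPrefix σ f f' ↔ z ∉ Set.range (contractBasis σ f f' hne) := by
  classical
  obtain ⟨y1, a1, b1, c1⟩ := h1
  obtain ⟨y2, a2, b2, c2⟩ := h2
  by_cases hs : σ.SameCycle f f'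
  · have hn := glue_not_sameCycle_of σ f f' hne hs
    have hcut := contractBasis_cut σ f f' hne hs
    simp only [contractPrefix, hs, if_true, List.mem_singleton]
    rcases z with z | q
    · simp only [reduceCtorEq, false_iff, not_not]
      by_cases hz : z = f
      · subst hz
        refine ⟨.inr (cyc _ ⟨y2, a2, b2⟩), ?_⟩
        rw [hcut, if_neg (fun k => hn (k.trans c2.symm)), if_pos c2]
      by_cases hz' : z = f'
      · subst hz'
        refine ⟨.inr (cyc _ ⟨y1, a1, b1⟩), ?_⟩
        rw [hcut, if_pos c1]
      · exact ⟨.inl ⟨z, hz, hz'⟩, rfl⟩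
    · induction q using Quotient.inductionOn with | h z => ?_
      constructor
      · rintro h ⟨x | q, hx⟩
        · simp [contractBasis] at hx
        · induction q using Quotient.inductionOn with | h x => ?_
          have hx := (hcut x).symm.trans hx
          split_ifs at hx with k1 k2
          have hxz := Sum.inr.inj (hx.trans h)
          exact k1 (glue_eq_of_cyc σ f f' ((cyc_eq_iff σ).1 hxz) k1 k2).symm
      · intro h
        by_contra hzf
        have hzf' : ¬ σ.SameCycle f z := fun k =>
          hzf (congrArg Sum.inr ((cyc_eq_iff σ).2 k.symm))
        have k1 : z ≠ f := by rintro rfl; exact hzf' (SameCycle.refl _ _)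
        have k2 : z ≠ f' := by rintro rfl; exact hzf' hs
        apply h
        refine ⟨.inr (cyc _ ⟨z, k1, k2⟩), ?_⟩
        have aux : ∀ a, σ.SameCycle f a → ¬ (glue σ f f').SameCycle a z := by
          intro a ha k
          rcases glue_sameCycle σ f f' k with k | ⟨_, k | k⟩
          · exact hzf' (ha.trans k)
          · exact hzf' k
          · exact hzf' (hs.trans k)
        rw [hcut, if_neg (aux f (SameCycle.refl _ _)), if_neg (aux f' hs)]
  · have hn := glue_sameCycle_of_not σ f f' hs
    have hjoin := contractBasis_join σ f f' hne hs
    simp only [contractPrefix, hs, if_false, List.mem_cons, List.not_mem_nil, or_false]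
    rcases z with z | q
    · by_cases hz : z = f
      · subst hz
        simp only [true_or, true_iff]
        rintro ⟨x | q, hx⟩
        · exact x.2.1 (Sum.inl.inj hx)
        · induction q using Quotient.inductionOn with | h x => ?_
          have hx := (hjoin x).symm.trans hx
          split_ifs at hx
      by_cases hz' : z = f'
      · subst hz'
        simp only [reduceCtorEq, or_true, true_iff]
        rintro ⟨x | q, hx⟩
        · exact x.2.2 (Sum.inl.inj hx)
        · induction q using Quotient.inductionOn with | h x => ?_
          have hx := (hjoin x).symm.trans hx
          split_ifs at hx
      · simp only [Sum.inl.injEq, hz, hz', reduceCtorEq, or_false, false_iff, not_not]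
        exact ⟨.inl ⟨z, hz, hz'⟩, rfl⟩
    · induction q using Quotient.inductionOn with | h z => ?_
      simp only [reduceCtorEq, false_or, or_false, Sum.inr.injEq]
      constructor
      · rintro h ⟨x | q, hx⟩
        · simp [contractBasis] at hx
        · induction q using Quotient.inductionOn with | h x => ?_
          have hx := (hjoin x).symm.trans hx
          split_ifs at hx with k1
          · exact hs ((cyc_eq_iff σ).1 (Sum.inr.inj hx |>.trans h)).symm
          · exact k1 (glue_eq_of_cyc σ f f' ((cyc_eq_iff σ).1 (Sum.inr.inj hx |>.trans h)) k1
              (fun k => k1 (hn.trans k))).symm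
      · intro h
        by_contra hzf
        have hzf1 : ¬ σ.SameCycle f z := fun k => hzf ((cyc_eq_iff σ).2 k.symm)
        apply h
        by_cases hzf2 : σ.SameCycle f' z
        · refine ⟨.inr (cyc _ ⟨y1, a1, b1⟩), ?_⟩
          rw [hjoin, if_pos c1]
          exact congrArg Sum.inr ((cyc_eq_iff σ).2 hzf2)
        · have k1 : z ≠ f := by rintro rfl; exact hzf1 (SameCycle.refl _ _)
          have k2 : z ≠ f' := by rintro rfl; exact hzf2 (SameCycle.refl _ _)
          refine ⟨.inr (cyc _ ⟨z, k1, k2⟩), ?_⟩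
          rw [hjoin, if_neg]
          intro k
          rcases glue_sameCycle σ f f' k with k | ⟨_, k | k⟩
          · exact hzf1 k
          · exact hzf1 k
          · exact hzf2 k

end Contraction

/-! ### Orientations -/

section Orientations

/-- A total ordering of a finite set `X`, written as a list. -/
structure BasisOrder (X : Type*) where
  list : List X
  nodup : list.Nodup
  mem : ∀ x, x ∈ list

/-- Transport of an ordering along a bijection. -/
def BasisOrder.map {X Y : Type*} (o : BasisOrder X) (e : X ≃ Y) : BasisOrder Y where
  list := o.list.map e
  nodup := o.nodup.map e.injective
  mem y := List.mem_map.2 ⟨e.symm y, o.mem _, e.apply_symm_apply y⟩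

/-- An orientation of the vector space `k^X` with basis the finite set `X`: every ordering of the
basis is positive or negative, and a permutation of the basis changes this by its sign. -/
@[ext]
structure BasisOrientation (X : Type*) [Fintype X] [DecidableEq X] where
  sign : BasisOrder X → ℤˣ
  alternating : ∀ (o : BasisOrder X) (τ : Perm X), sign (o.map τ) = Perm.sign τ * sign o

variable {X Y : Type*} [Fintype X] [DecidableEq X] [Fintype Y] [DecidableEq Y]

namespace BasisOrientation

/-- The opposite orientation. -/
instance : Neg (BasisOrientation X) where
  neg w :=
    { sign := fun o => - w.sign o
      alternating := fun o τ => by rw [w.alternating, mul_neg] }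

/-- Transport of an orientation along a bijection of the bases. -/
def map (w : BasisOrientation X) (e : X ≃ Y) : BasisOrientation Y where
  sign o := w.sign (o.map e.symm)
  alternating o τ := by
    have h : (o.map τ).map e.symm = (o.map e.symm).map ((e.trans τ).trans e.symm) := by
      simp [BasisOrder.map]
    rw [h, w.alternating, Perm.sign_trans_trans_symm]

/-- Let `ι` embed the basis `Y` into the basis `X`, and let `pre` list the remaining elements of
`X`. The orientation `w` of `k^X` induces the orientation of `k^Y` in which `y₁ ∧ … ∧ yₙ` is positive
if and only if `pre ∧ ι y₁ ∧ … ∧ ι yₙ` is positive. -/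
def pull (w : BasisOrientation X) (pre : List X) (ι : Y → X) (hι : Function.Injective ι)
    (hpre : pre.Nodup) (hmem : ∀ x, x ∈ pre ↔ x ∉ Set.range ι) : BasisOrientation Y where
  sign o := w.sign
    { list := pre ++ o.list.map ι
      nodup := by
        refine List.nodup_append.2 ⟨hpre, o.nodup.map hι, ?_⟩
        rintro a ha b hb rfl
        obtain ⟨y, _, rfl⟩ := List.mem_map.1 hb
        exact (hmem _).1 ha ⟨y, rfl⟩
      mem := fun x => by
        by_cases hx : x ∈ Set.range ι
        · obtain ⟨y, rfl⟩ := hx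
          exact List.mem_append_right _ (List.mem_map_of_mem (o.mem y))
        · exact List.mem_append_left _ ((hmem x).2 hx) }
  alternating o τ := by
    rw [← Perm.viaFintypeEmbedding_sign τ ⟨ι, hι⟩, ← w.alternating]
    congr 1
    simp only [BasisOrder.map, List.map_append, List.map_map, BasisOrder.mk.injEq]
    congr 1
    · conv_lhs => rw [← List.map_id pre]
      refine List.map_congr_left fun x hx => ?_
      exact (Perm.viaFintypeEmbedding_apply_notMem_range τ ⟨ι, hι⟩ ((hmem x).1 hx)).symm
    · refine List.map_congr_left fun y _ => ?_
      exact (Perm.viaFintypeEmbedding_apply_image τ ⟨ι, hι⟩ y).symm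

end BasisOrientation

end Orientations

/-! ### Stable ribbon graphs -/

/-- The number of cycles of `σ` that meet the set `S` (for `S` a vertex: the cycles of the vertex). -/
noncomputable def cycleCount {α : Type*} (σ : Perm α) (S : Set α) : ℕ := (cyc σ '' S).ncard

/-- A connected stable ribbon graph: a finite set of flags with a permutation `σ` (its cycles are the
cyclically ordered subsets of flags), a fixed-point free involution `η` (its orbits are the edges), a
partition `lam` stabilized by `σ` (its clusters are the vertices) and a nonnegative integer for every
vertex, recorded as a function `genus` of the flags that is constant on clusters. -/
structure StableRibbonGraph where
  Flag : Type
  [fintypeFlag : Fintype Flag]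
  [decidableEqFlag : DecidableEq Flag]
  σ : Perm Flag
  η : Perm Flag
  lam : Setoid Flag
  genus : Flag → ℕ
  η_η : ∀ x, η (η x) = x
  η_ne : ∀ x, η x ≠ x
  lam_σ : ∀ x, lam x (σ x)
  genus_eq : ∀ x y, lam x y → genus x = genus y
  stable : ∀ x, 0 < 2 * (2 * (genus x : ℤ) + cycleCount σ {y | lam x y} - 2)
    + ({y | lam x y}.ncard : ℤ)
  nonempty : Nonempty Flag
  connected : ∀ x y, Relation.EqvGen (fun a b => lam a b ∨ b = η a) x y

theorem glue_mem_iff {α : Type*} [DecidableEq α] {σ : Perm α} {f f' : α} {S : Set α}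
    (hS : ∀ x y, σ.SameCycle x y → (x ∈ S ↔ y ∈ S)) (hff : f ∈ S ↔ f' ∈ S) {x y : α}
    (h : (glue σ f f').SameCycle x y) : x ∈ S ↔ y ∈ S := by
  have key : ∀ z, σ.SameCycle f z ∨ σ.SameCycle f' z → (z ∈ S ↔ f ∈ S) := fun z hz =>
    hz.elim (fun k => (hS _ _ k).symm) (fun k => ((hS _ _ k).symm).trans hff.symm)
  rcases glue_sameCycle _ _ _ h with h | ⟨h1, h2⟩
  · exact hS _ _ h
  · exact (key _ h1).trans (key _ h2).symm

section Count

variable {α : Type*} [DecidableEq α] [Finite α] {σ : Perm α} {f f' : α} (hne : f' ≠ f)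
  {S : Set α}

theorem cycleCount_contract_eq :
    cycleCount (contractPerm σ f f' hne) {y | (y : α) ∈ S} =
      {z | ∃ y : {x : α // x ≠ f ∧ x ≠ f'}, (y : α) ∈ S ∧
        contractBasis σ f f' hne (.inr (cyc _ y)) = z}.ncard := by
  rw [cycleCount, ← Set.ncard_image_of_injective _
    ((contractBasis_injective σ f f' hne).comp Sum.inr_injective), Set.image_image]
  rfl

theorem cycleCount_contract_of_notMem
    (hS : ∀ x y, σ.SameCycle x y → (x ∈ S ↔ y ∈ S)) (hff : f ∈ S ↔ f' ∈ S) (hf : f ∉ S) :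
    cycleCount (contractPerm σ f f' hne) {y | (y : α) ∈ S} = cycleCount σ S := by
  classical
  have hg : ∀ y ∈ S, ¬ (glue σ f f').SameCycle f y ∧ ¬ (glue σ f f').SameCycle f' y := fun y hy =>
    ⟨fun k => hf ((glue_mem_iff hS hff k).2 hy),
      fun k => hf (hff.2 ((glue_mem_iff hS hff k).2 hy))⟩
  have hv : ∀ y : {x : α // x ≠ f ∧ x ≠ f'}, (y : α) ∈ S →
      contractBasis σ f f' hne (.inr (cyc _ y)) = .inr (cyc σ y) := by
    intro y hy
    by_cases hs : σ.SameCycle f f'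
    · rw [contractBasis_cut σ f f' hne hs, if_neg (hg y hy).1, if_neg (hg y hy).2]
    · rw [contractBasis_join σ f f' hne hs, if_neg (hg y hy).1]
  rw [cycleCount_contract_eq, cycleCount,
    ← Set.ncard_image_of_injective (cyc σ '' S) (Sum.inr_injective (α := α)), Set.image_image]
  congr 1
  ext z
  constructor
  · rintro ⟨y, hy, rfl⟩
    exact ⟨y, hy, (hv y hy).symm⟩
  · rintro ⟨y, hy, rfl⟩
    have h1 : y ≠ f := by rintro rfl; exact hf hy
    have h2 : y ≠ f' := by rintro rfl; exact hf (hff.2 hy)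
    exact ⟨⟨y, h1, h2⟩, hy, hv ⟨y, h1, h2⟩ hy⟩

theorem cycleCount_contract_join
    (hS : ∀ x y, σ.SameCycle x y → (x ∈ S ↔ y ∈ S)) (hff : f ∈ S ↔ f' ∈ S)
    (h1 : ∃ y, y ≠ f ∧ y ≠ f' ∧ (glue σ f f').SameCycle f y)
    (h2 : ∃ y, y ≠ f ∧ y ≠ f' ∧ (glue σ f f').SameCycle f' y)
    (hf : f ∈ S) (hs : ¬ σ.SameCycle f f') :
    cycleCount (contractPerm σ f f' hne) {y | (y : α) ∈ S} + 1 = cycleCount σ S := by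
  classical
  have hm : cyc σ f ∈ cyc σ '' S := ⟨f, hf, rfl⟩
  rw [cycleCount_contract_eq, cycleCount, ← Set.ncard_sdiff_singleton_add_one hm (Set.toFinite _),
    ← Set.ncard_image_of_injective (cyc σ '' S \ _) (Sum.inr_injective (α := α))]
  congr 2
  ext z
  have hp := mem_contractPrefix_iff σ f f' hne h1 h2 z
  simp only [contractPrefix, hs, if_false, List.mem_cons, List.not_mem_nil, or_false] at hp
  constructor
  · rintro ⟨y, hy, rfl⟩
    have hp := fun k => hp.1 k ⟨_, rfl⟩
    rw [contractBasis_join σ f f' hne hs] at hp ⊢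
    split_ifs at hp ⊢ with k
    · exact ⟨_, ⟨⟨f', hff.1 hf, rfl⟩, fun k => hp (Or.inr (Or.inl (congrArg Sum.inr k)))⟩, rfl⟩
    · exact ⟨_, ⟨⟨y, hy, rfl⟩, fun k => hp (Or.inr (Or.inl (congrArg Sum.inr k)))⟩, rfl⟩
  · rintro ⟨_, ⟨⟨w, hw, rfl⟩, hwf⟩, rfl⟩
    have : ¬ ¬ (Sum.inr (cyc σ w) ∈ Set.range (contractBasis σ f f' hne)) := by
      rw [← hp]
      simpa using hwf
    obtain ⟨x | q, hq⟩ := not_not.1 this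
    · simp [contractBasis] at hq
    · induction q using Quotient.inductionOn with | h y => ?_
      refine ⟨y, ?_, hq⟩
      have hq := (contractBasis_join σ f f' hne hs y).symm.trans hq
      split_ifs at hq with k
      · exact (glue_mem_iff hS hff k).1 hf
      · exact (hS _ _ ((cyc_eq_iff σ).1 (Sum.inr.inj hq))).2 hw

theorem cycleCount_contract_cut
    (hS : ∀ x y, σ.SameCycle x y → (x ∈ S ↔ y ∈ S)) (hff : f ∈ S ↔ f' ∈ S)
    (h1 : ∃ y, y ≠ f ∧ y ≠ f' ∧ (glue σ f f').SameCycle f y)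
    (h2 : ∃ y, y ≠ f ∧ y ≠ f' ∧ (glue σ f f').SameCycle f' y)
    (hf : f ∈ S) (hs : σ.SameCycle f f') :
    cycleCount (contractPerm σ f f' hne) {y | (y : α) ∈ S} = cycleCount σ S + 1 := by
  classical
  have hm : cyc σ f ∈ cyc σ '' S := ⟨f, hf, rfl⟩
  have hset : {z | ∃ y : {x : α // x ≠ f ∧ x ≠ f'}, (y : α) ∈ S ∧
        contractBasis σ f f' hne (.inr (cyc _ y)) = z} =
      insert (Sum.inl f) (insert (Sum.inl f') (Sum.inr '' (cyc σ '' S \ {cyc σ f}))) := by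
    ext z
    have hp := mem_contractPrefix_iff σ f f' hne h1 h2 z
    simp only [contractPrefix, hs, if_true, List.mem_singleton] at hp
    constructor
    · rintro ⟨y, hy, rfl⟩
      have hp := fun k => hp.1 k ⟨_, rfl⟩
      rw [contractBasis_cut σ f f' hne hs] at hp ⊢
      split_ifs at hp ⊢ with k k'
      · simp
      · simp
      · exact Or.inr (Or.inr ⟨_, ⟨⟨y, hy, rfl⟩, fun k => hp (congrArg Sum.inr k)⟩, rfl⟩)
    · intro hz
      have : z ∈ Set.range (contractBasis σ f f' hne) := by
        by_contra hc
        rw [hp.2 hc] at hz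
        simp at hz
      obtain ⟨x | q, hq⟩ := this
      · exfalso
        subst hq
        rcases hz with hz | hz | ⟨_, _, hz⟩
        · exact x.2.1 (Sum.inl.inj hz)
        · exact x.2.2 (Sum.inl.inj hz)
        · simp [contractBasis] at hz
      · induction q using Quotient.inductionOn with | h y => ?_
        refine ⟨y, ?_, hq⟩
        have hq := (contractBasis_cut σ f f' hne hs y).symm.trans hq
        split_ifs at hq with k k'
        · exact (glue_mem_iff hS hff k).1 hf
        · exact (glue_mem_iff hS hff k').1 (hff.1 hf)
        · subst hq
          rcases hz with hz | hz | ⟨_, ⟨⟨w, hw, rfl⟩, _⟩, hz⟩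
          · simp at hz
          · simp at hz
          · exact (hS _ _ ((cyc_eq_iff σ).1 (Sum.inr.inj hz))).1 hw
  rw [cycleCount_contract_eq, hset, Set.ncard_insert_of_notMem (by simp [hne.symm]),
    Set.ncard_insert_of_notMem (by simp), Set.ncard_image_of_injective _ Sum.inr_injective,
    Set.ncard_sdiff_singleton_add_one hm (Set.toFinite _), cycleCount]

end Count

namespace StableRibbonGraph

attribute [instance] fintypeFlag decidableEqFlag

variable (G : StableRibbonGraph)

/-- The set of all cycles of the graph. -/
abbrev Cycle : Type := Cyc G.σ

/-- The edges are the orbits of the involution. -/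
abbrev Edge : Type := Cyc G.η

noncomputable instance : Fintype G.Cycle := Fintype.ofFinite _

noncomputable instance : DecidableEq G.Cycle := Classical.decEq _

noncomputable instance : Fintype G.Edge := Fintype.ofFinite _

/-- The basis of the vector space `k^Flag ⊕ k^Cycle`. -/
abbrev Basis : Type := G.Flag ⊕ G.Cycle

/-- An orientation of the graph: an orientation of `k^Flag ⊕ k^Cycle`. -/
abbrev Orient : Type := BasisOrientation G.Basis

/-- The edge of the flag `f` can be contracted, unless one of the boundary components consists of
this edge only. The latter means that `f` and `η f` are neighbours in a cycle, or that both of them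
are cycles of length one. -/
def Contractible (f : G.Flag) : Prop :=
  G.σ f ≠ G.η f ∧ G.σ (G.η f) ≠ f ∧ ¬ (G.σ f = f ∧ G.σ (G.η f) = G.η f)

variable {G}

theorem Contractible.exists_left {f : G.Flag} (h : G.Contractible f) :
    ∃ y, y ≠ f ∧ y ≠ G.η f ∧ (glue G.σ f (G.η f)).SameCycle f y := by
  obtain ⟨h1, h2, h3⟩ := h
  have hne := G.η_ne f
  by_cases hf : G.σ f = f
  · have h4 : G.σ (G.η f) ≠ G.η f := fun k => h3 ⟨hf, k⟩
    refine ⟨G.σ (G.η f), h2, h4, ⟨2, ?_⟩⟩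
    change (glue G.σ f (G.η f)) ((glue G.σ f (G.η f)) f) = _
    simp only [glue_apply, hf, swap_apply_left]
    exact swap_apply_of_ne_of_ne h2 h4
  · refine ⟨G.σ f, hf, h1, ⟨1, ?_⟩⟩
    rw [zpow_one, glue_apply, swap_apply_of_ne_of_ne hf h1]

theorem glue_comm {α : Type*} [DecidableEq α] (σ : Perm α) (f f' : α) :
    glue σ f f' = glue σ f' f := by
  rw [glue, glue, swap_comm]

theorem Contractible.exists_right {f : G.Flag} (h : G.Contractible f) :
    ∃ y, y ≠ f ∧ y ≠ G.η f ∧ (glue G.σ f (G.η f)).SameCycle (G.η f) y := by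
  have h' : G.Contractible (G.η f) := by
    obtain ⟨h1, h2, h3⟩ := h
    rw [Contractible, G.η_η]
    exact ⟨h2, h1, fun k => h3 k.symm⟩
  obtain ⟨y, h1, h2, h3⟩ := h'.exists_left
  rw [G.η_η] at h2 h3
  rw [glue_comm]
  exact ⟨y, h2, h1, h3⟩

theorem lam_of_sameCycle {x y : G.Flag} (h : G.σ.SameCycle x y) : G.lam x y :=
  sameCycle_lift G.lam id G.lam_σ h

theorem merge_of_glue {f f' x y : G.Flag} (h : (glue G.σ f f').SameCycle x y) :
    mergeSetoid G.lam f f' x y := by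
  rcases glue_sameCycle _ _ _ h with h | ⟨h1, h2⟩
  · exact Or.inl (lam_of_sameCycle h)
  · exact Or.inr ⟨h1.imp lam_of_sameCycle lam_of_sameCycle,
      h2.imp lam_of_sameCycle lam_of_sameCycle⟩

open Classical in
/-- The integer attached to the vertex of a flag after the contraction of the edge `{f, η f}`. -/
noncomputable def contractGenus (G : StableRibbonGraph) (f x : G.Flag) : ℕ :=
  if G.lam f x ∨ G.lam (G.η f) x then
    if G.lam f (G.η f) then
      if G.σ.SameCycle f (G.η f) then G.genus f else G.genus f + 1
    else G.genus f + G.genus (G.η f)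
  else G.genus x

end StableRibbonGraph

namespace StableRibbonGraph

variable {G : StableRibbonGraph}

theorem contract_stable {f : G.Flag} (h : G.Contractible f)
    (x : {x : G.Flag // x ≠ f ∧ x ≠ G.η f}) :
    0 < 2 * (2 * (contractGenus G f x : ℤ) +
      cycleCount (contractPerm G.σ f (G.η f) (G.η_ne f))
        {y | (y : G.Flag) ∈ {y | mergeSetoid G.lam f (G.η f) x y}} - 2) +
      ({y : {x : G.Flag // x ≠ f ∧ x ≠ G.η f} |
        (y : G.Flag) ∈ {y | mergeSetoid G.lam f (G.η f) x y}}.ncard : ℤ) := by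
  classical
  set S : Set G.Flag := {y | mergeSetoid G.lam f (G.η f) x y} with hSdef
  have hS : ∀ a b, G.σ.SameCycle a b → (a ∈ S ↔ b ∈ S) := fun a b k =>
    ⟨fun ha => (mergeSetoid G.lam f (G.η f)).trans ha (Or.inl (lam_of_sameCycle k)),
      fun hb => (mergeSetoid G.lam f (G.η f)).trans hb (Or.inl (lam_of_sameCycle k.symm))⟩
  have hfm : mergeSetoid G.lam f (G.η f) f (G.η f) :=
    Or.inr ⟨Or.inl (G.lam.refl _), Or.inr (G.lam.refl _)⟩
  have hff : f ∈ S ↔ G.η f ∈ S :=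
    ⟨fun ha => (mergeSetoid G.lam f (G.η f)).trans ha hfm,
      fun hb => (mergeSetoid G.lam f (G.η f)).trans hb ((mergeSetoid G.lam f (G.η f)).symm hfm)⟩
  have hcard : {y : {x : G.Flag // x ≠ f ∧ x ≠ G.η f} | (y : G.Flag) ∈ S}.ncard =
      (S \ {f, G.η f}).ncard := by
    rw [← Set.ncard_image_of_injective _ Subtype.val_injective]
    congr 1
    ext z
    simp only [Set.mem_image, Set.mem_ofPred_eq, Subtype.exists, exists_and_right,
      exists_eq_right, Set.mem_sdiff, Set.mem_insert_iff, Set.mem_singleton_iff, not_or]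
    tauto
  by_cases hfS : f ∈ S
  · have hx : G.lam f x ∨ G.lam (G.η f) x := by
      rcases hfS with k | k
      · exact Or.inl (G.lam.symm k)
      · exact k.1
    have hSeq : S = {y | G.lam f y} ∪ {y | G.lam (G.η f) y} := by
      ext y
      simp only [hSdef, Set.mem_ofPred_eq, mergeSetoid_iff, Set.mem_union]
      constructor
      · rintro (k | k)
        · exact hx.imp (fun h => G.lam.trans h k) (fun h => G.lam.trans h k)
        · exact k.2
      · exact fun k => Or.inr ⟨hx, k⟩
    have hn : (S \ {f, G.η f}).ncard + 2 = S.ncard := by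
      have hsub : ({f, G.η f} : Set G.Flag) ⊆ S := by
        rintro z (rfl | rfl)
        · exact hfS
        · exact hff.1 hfS
      rw [← Set.ncard_pair (G.η_ne f).symm, Set.ncard_sdiff_add_ncard_of_subset hsub]
    by_cases hl : G.lam f (G.η f)
    · have hSf : S = {y | G.lam f y} := by
        rw [hSeq]
        ext y
        simp only [Set.mem_union, Set.mem_ofPred_eq]
        exact ⟨fun k => k.elim id (fun k => G.lam.trans hl k), Or.inl⟩
      have hst := G.stable f
      rw [← hSf] at hst
      by_cases hs : G.σ.SameCycle f (G.η f)
      · have hc := cycleCount_contract_cut (G.η_ne f) hS hff h.exists_left h.exists_right hfS hs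
        rw [contractGenus, if_pos hx, if_pos hl, if_pos hs, hc, hcard]
        push_cast
        omega
      · have hc := cycleCount_contract_join (G.η_ne f) hS hff h.exists_left h.exists_right hfS hs
        rw [contractGenus, if_pos hx, if_pos hl, if_neg hs, hcard]
        push_cast
        omega
    · have hs : ¬ G.σ.SameCycle f (G.η f) := fun k => hl (lam_of_sameCycle k)
      have hc := cycleCount_contract_join (G.η_ne f) hS hff h.exists_left h.exists_right hfS hs
      have hd : Disjoint {y | G.lam f y} {y | G.lam (G.η f) y} := by
        rw [Set.disjoint_left]
        exact fun y h1 h2 => hl (G.lam.trans h1 (G.lam.symm h2))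
      have hd' : Disjoint (cyc G.σ '' {y | G.lam f y}) (cyc G.σ '' {y | G.lam (G.η f) y}) := by
        rw [Set.disjoint_left]
        rintro _ ⟨y, h1, rfl⟩ ⟨z, h2, hyz⟩
        exact hl (G.lam.trans h1 (G.lam.trans
          (lam_of_sameCycle ((cyc_eq_iff _).1 hyz)|> G.lam.symm) (G.lam.symm h2)))
      have e1 : S.ncard = {y | G.lam f y}.ncard + {y | G.lam (G.η f) y}.ncard := by
        rw [hSeq, Set.ncard_union_eq hd]
      have e2 : cycleCount G.σ S = cycleCount G.σ {y | G.lam f y} +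
          cycleCount G.σ {y | G.lam (G.η f) y} := by
        rw [cycleCount, hSeq, Set.image_union, Set.ncard_union_eq hd']; rfl
      have hst1 := G.stable f
      have hst2 := G.stable (G.η f)
      rw [contractGenus, if_pos hx, if_neg hl, hcard]
      push_cast
      omega
  · have hx : ¬ (G.lam f x ∨ G.lam (G.η f) x) := fun k =>
      hfS (Or.inr ⟨k, Or.inl (G.lam.refl _)⟩)
    have hSx : S = {y | G.lam x y} := by
      ext y
      simp only [hSdef, Set.mem_ofPred_eq, mergeSetoid_iff]
      tauto
    have hn : S \ {f, G.η f} = S := by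
      refine sdiff_eq_left.2 (Set.disjoint_right.2 ?_)
      rintro z (rfl | rfl)
      · exact hfS
      · exact fun k => hfS (hff.2 k)
    have hc := cycleCount_contract_of_notMem (G.η_ne f) hS hff hfS
    have hst := G.stable x
    rw [contractGenus, if_neg hx, hc, hcard, hn, hSx]
    exact hst

theorem contract_connected {f : G.Flag} (h : G.Contractible f)
    (hη : ∀ x, (x ≠ f ∧ x ≠ G.η f) ↔ (G.η x ≠ f ∧ G.η x ≠ G.η f))
    (x y : {x : G.Flag // x ≠ f ∧ x ≠ G.η f}) :
    Relation.EqvGen (fun a b : {x : G.Flag // x ≠ f ∧ x ≠ G.η f} =>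
      (mergeSetoid G.lam f (G.η f)).comap Subtype.val a b ∨
        b = (G.η.subtypePerm fun x => (hη x).symm) a) x y := by
  set m := mergeSetoid G.lam f (G.η f) with hm
  have hr : ∀ a : G.Flag, ∃ a' : {x : G.Flag // x ≠ f ∧ x ≠ G.η f}, m a a' := by
    intro a
    by_cases h1 : a = f
    · obtain ⟨z, k1, k2, k3⟩ := h.exists_left
      refine ⟨⟨z, k1, k2⟩, ?_⟩
      rw [h1]
      exact merge_of_glue k3
    by_cases h2 : a = G.η f
    · obtain ⟨z, k1, k2, k3⟩ := h.exists_right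
      refine ⟨⟨z, k1, k2⟩, ?_⟩
      rw [h2]
      exact merge_of_glue k3
    exact ⟨⟨a, h1, h2⟩, m.refl _⟩
  choose r hr using hr
  have hfm : m f (G.η f) := Or.inr ⟨Or.inl (G.lam.refl _), Or.inr (G.lam.refl _)⟩
  have hstep : ∀ a b, (G.lam a b ∨ b = G.η a) →
      Relation.EqvGen (fun a b : {x : G.Flag // x ≠ f ∧ x ≠ G.η f} =>
      m.comap Subtype.val a b ∨ b = (G.η.subtypePerm fun x => (hη x).symm) a) (r a) (r b) := by
    intro a b hab
    have hmm : ∀ a b, m a b → m.comap Subtype.val (r a) (r b) := fun a b k =>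
      m.trans (m.symm (hr a)) (m.trans k (hr b))
    rcases hab with k | rfl
    · exact .rel _ _ (Or.inl (hmm _ _ (Or.inl k)))
    · by_cases h1 : a = f
      · subst h1; exact .rel _ _ (Or.inl (hmm _ _ hfm))
      by_cases h2 : a = G.η f
      · subst h2
        rw [G.η_η]
        exact .rel _ _ (Or.inl (hmm _ _ (m.symm hfm)))
      refine .trans _ ⟨a, h1, h2⟩ _ (.rel _ _ (Or.inl (m.symm (hr a)))) ?_
      refine .trans _ ((G.η.subtypePerm fun x => (hη x).symm) ⟨a, h1, h2⟩) _
        (.rel _ _ (Or.inr rfl)) (.rel _ _ (Or.inl ?_))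
      exact hr (G.η a)
  have main : ∀ a b, Relation.EqvGen (fun a b => G.lam a b ∨ b = G.η a) a b →
      Relation.EqvGen (fun a b : {x : G.Flag // x ≠ f ∧ x ≠ G.η f} =>
      m.comap Subtype.val a b ∨ b = (G.η.subtypePerm fun x => (hη x).symm) a) (r a) (r b) := by
    intro a b hab
    induction hab with
    | rel a b k => exact hstep a b k
    | refl a => exact .refl _
    | symm a b _ ih => exact .symm _ _ ih
    | trans a b c _ _ ih1 ih2 => exact .trans _ _ _ ih1 ih2
  refine .trans _ (r x) _ (.rel _ _ (Or.inl (hr x))) (.trans _ (r y) _ (main _ _ (G.connected x y))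
    (.rel _ _ (Or.inl (m.symm (hr y)))))

theorem η_mem_iff (f x : G.Flag) :
    (G.η x ≠ f ∧ G.η x ≠ G.η f) ↔ (x ≠ f ∧ x ≠ G.η f) := by
  have : ∀ a b, G.η a = b ↔ a = G.η b := fun a b =>
    ⟨fun k => by rw [← k, G.η_η], fun k => by rw [k, G.η_η]⟩
  rw [ne_eq, ne_eq, this x f, G.η.injective.eq_iff]
  tauto

/-- The contraction of the edge `{f, η f}`. The flags `f` and `η f` are removed; the multi-cyclic
order is the one induced by `(f, η f) ∘ σ`; the vertices of `f` and `η f` are united. The integer of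
the new vertex is the sum of the two integers if the edge is not a loop; for a loop it is unchanged
if `f`, `η f` belong to one cycle, and it grows by one if they belong to different cycles. -/
noncomputable def contract (G : StableRibbonGraph) (f : G.Flag) (h : G.Contractible f) :
    StableRibbonGraph where
  Flag := {x : G.Flag // x ≠ f ∧ x ≠ G.η f}
  σ := contractPerm G.σ f (G.η f) (G.η_ne f)
  η := G.η.subtypePerm (η_mem_iff f)
  lam := (mergeSetoid G.lam f (G.η f)).comap Subtype.val
  genus x := contractGenus G f x
  η_η x := Subtype.ext (G.η_η x)
  η_ne x k := G.η_ne x (congrArg Subtype.val k)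
  lam_σ x := merge_of_glue
    ((contractPerm_sameCycle G.σ f (G.η f) (G.η_ne f) _ _).1 (SameCycle.refl _ x).apply_right)
  genus_eq x y k := by
    have e1 : (G.lam f x ∨ G.lam (G.η f) x) ↔ (G.lam f y ∨ G.lam (G.η f) y) := by
      rcases k with k | k
      · exact ⟨Or.imp (fun h => G.lam.trans h k) (fun h => G.lam.trans h k),
          Or.imp (fun h => G.lam.trans h (G.lam.symm k)) (fun h => G.lam.trans h (G.lam.symm k))⟩
      · exact ⟨fun _ => k.2, fun _ => k.1⟩
    unfold contractGenus
    by_cases hx : G.lam f x ∨ G.lam (G.η f) x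
    · rw [if_pos hx, if_pos (e1.1 hx)]
    · rw [if_neg hx, if_neg (fun h => hx (e1.2 h))]
      exact G.genus_eq _ _ (k.resolve_right fun k => hx k.1)
  stable x := contract_stable h x
  nonempty := by
    obtain ⟨y, h1, h2, _⟩ := h.exists_left
    exact ⟨⟨y, h1, h2⟩⟩
  connected := contract_connected h fun x => (η_mem_iff f x).symm

/-- The orientation induced on the contraction. Write `c`, `c'` for the cycles of `f`, `f' = η f`.
If `c ≠ c'`, then `f ∧ c ∧ f' ∧ c' ∧ ω` induces `c'' ∧ ω` with the joined cycle `c''`. If `c = c'`,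
then `c ∧ f ∧ f' ∧ ω` induces `c₁ ∧ c₂ ∧ ω`, where `c₁` and `c₂` are the parts of `c` that contain
the predecessors of `f` and of `f'`. -/
noncomputable def contractOrient (G : StableRibbonGraph) (w : G.Orient) (f : G.Flag)
    (h : G.Contractible f) : (G.contract f h).Orient :=
  w.pull (contractPrefix G.σ f (G.η f)) (contractBasis G.σ f (G.η f) (G.η_ne f))
    (contractBasis_injective G.σ f (G.η f) (G.η_ne f))
    (contractPrefix_nodup G.σ f (G.η f) (G.η_ne f))
    (mem_contractPrefix_iff G.σ f (G.η f) (G.η_ne f) h.exists_left h.exists_right)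

end StableRibbonGraph

/-! ### The dual stable ribbon graph complex -/

/-- An isomorphism of stable ribbon graphs. -/
structure GraphIso (G H : StableRibbonGraph) where
  toEquiv : G.Flag ≃ H.Flag
  map_σ : ∀ x, toEquiv (G.σ x) = H.σ (toEquiv x)
  map_η : ∀ x, toEquiv (G.η x) = H.η (toEquiv x)
  map_lam : ∀ x y, G.lam x y ↔ H.lam (toEquiv x) (toEquiv y)
  map_genus : ∀ x, H.genus (toEquiv x) = G.genus x

theorem GraphIso.sameCycle_iff {G H : StableRibbonGraph} (i : GraphIso G H) (x y : G.Flag) :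
    G.σ.SameCycle x y ↔ H.σ.SameCycle (i.toEquiv x) (i.toEquiv y) := by
  constructor
  · refine sameCycle_lift (SameCycle.setoid H.σ) i.toEquiv fun a => ?_
    rw [i.map_σ]
    exact (SameCycle.refl H.σ (i.toEquiv a)).apply_right
  · intro h
    have := sameCycle_lift (SameCycle.setoid G.σ) i.toEquiv.symm (fun a => ?_) h
    · simp only [Equiv.symm_apply_apply] at this
      exact this
    · obtain ⟨a, rfl⟩ := i.toEquiv.surjective a
      rw [← i.map_σ, Equiv.symm_apply_apply, Equiv.symm_apply_apply]
      exact (SameCycle.refl G.σ a).apply_right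

/-- The bijection between the bases of `k^Flag ⊕ k^Cycle` given by an isomorphism. -/
def GraphIso.basisEquiv {G H : StableRibbonGraph} (i : GraphIso G H) : G.Basis ≃ H.Basis :=
  Equiv.sumCongr i.toEquiv (Quotient.congr i.toEquiv i.sameCycle_iff)

/-- A connected stable ribbon graph with an orientation. -/
structure OrientedGraph where
  graph : StableRibbonGraph
  orient : graph.Orient

/-- The space of cochains: the linear dual of the space generated by the equivalence classes of
oriented connected stable ribbon graphs with the relation `(G, -or) = -(G, or)`. -/
def cochains (k : Type*) [Field k] : Submodule k (OrientedGraph → k) where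
  carrier := {φ |
    (∀ (G : StableRibbonGraph) (w : G.Orient), φ ⟨G, -w⟩ = - φ ⟨G, w⟩) ∧
    (∀ (G H : StableRibbonGraph) (i : GraphIso G H) (w : G.Orient),
      φ ⟨H, w.map i.basisEquiv⟩ = φ ⟨G, w⟩)}
  zero_mem' := by simp
  add_mem' := by
    rintro φ ψ ⟨h1, h2⟩ ⟨h3, h4⟩
    refine ⟨fun G w => ?_, fun G H i w => ?_⟩
    · simp only [Pi.add_apply, h1, h3]; ring
    · simp only [Pi.add_apply, h2, h4]
  smul_mem' := by
    rintro c φ ⟨h1, h2⟩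
    refine ⟨fun G w => ?_, fun G H i w => ?_⟩
    · simp only [Pi.smul_apply, h1, smul_neg]
    · simp only [Pi.smul_apply, h2]

open Classical in
/-- The differential of the dual complex: the value of `d φ` on an oriented graph is the sum over
all edges `e`, loops included, of the values of `φ` on the contractions with the induced orientation;
the edges that cannot be contracted contribute zero. -/
noncomputable def coboundary (k : Type*) [Field k] :
    (OrientedGraph → k) →ₗ[k] (OrientedGraph → k) where
  toFun φ Γ := ∑ e : Γ.graph.Edge,
    if h : Γ.graph.Contractible e.out then
      φ ⟨Γ.graph.contract e.out h, Γ.graph.contractOrient Γ.orient e.out h⟩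
    else 0
  map_add' φ ψ := by
    funext Γ
    simp only [Pi.add_apply, ← Finset.sum_add_distrib]
    refine Finset.sum_congr rfl fun e _ => ?_
    split_ifs <;> simp
  map_smul' c φ := by
    funext Γ
    simp only [Pi.smul_apply, RingHom.id_apply, Finset.smul_sum]
    refine Finset.sum_congr rfl fun e _ => ?_
    split_ifs <;> simp

/-! ### Presentations of a stable ribbon graph -/

/-- A way to write the graph down: a list of all vertices; every vertex `v` is written as the list
`(ρ₁ … ρᵣ) … (τ₁ … τₜ)` of its cycles; every cycle is written as the list `x, σ x, …, σʳ⁻¹ x` of its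
flags, from some first flag `x` on. -/
structure Presentation (G : StableRibbonGraph) where
  list : List (List (List G.Flag))
  ne_nil : ∀ v ∈ list, v ≠ []
  cycle : ∀ v ∈ list, ∀ c ∈ v, ∃ x, c = List.iterate G.σ x (Function.minimalPeriod G.σ x)
  vertex : ∀ v ∈ list, ∀ x ∈ v.flatten, ∀ y, y ∈ v.flatten ↔ G.lam x y
  nodup : list.flatten.flatten.Nodup
  mem : ∀ x, x ∈ list.flatten.flatten

theorem minimalPeriod_pos {α : Type*} [Finite α] (σ : Perm α) (x : α) :
    0 < Function.minimalPeriod σ x := by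
  refine Function.IsPeriodicPt.minimalPeriod_pos (orderOf_pos σ) ?_
  rw [Function.IsPeriodicPt, Function.IsFixedPt, Perm.iterate_eq_pow, pow_orderOf_eq_one,
    Perm.one_apply]

theorem mem_cycleList {α : Type*} [Finite α] (σ : Perm α) (x y : α) :
    y ∈ List.iterate σ x (Function.minimalPeriod σ x) ↔ σ.SameCycle x y := by
  rw [List.mem_iterate]
  constructor
  · rintro ⟨m, _, rfl⟩
    exact ⟨m, by rw [zpow_natCast, Perm.iterate_eq_pow]⟩
  · intro h
    obtain ⟨n, rfl⟩ := h.exists_nat_pow_eq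
    refine ⟨n % Function.minimalPeriod σ x, Nat.mod_lt _ (minimalPeriod_pos σ x), ?_⟩
    rw [Function.iterate_mod_minimalPeriod_eq, Perm.iterate_eq_pow]

theorem head?_cycleList {α : Type*} [Finite α] (σ : Perm α) (x : α) :
    (List.iterate σ x (Function.minimalPeriod σ x)).head? = some x := by
  obtain ⟨n, hn⟩ := Nat.exists_eq_succ_of_ne_zero (minimalPeriod_pos σ x).ne'
  rw [hn]; rfl

theorem nodup_cycleList {α : Type*} (σ : Perm α) (x : α) :
    (List.iterate σ x (Function.minimalPeriod σ x)).Nodup := by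
  rw [← List.range_map_iterate]
  refine List.Nodup.map_on (fun a ha b hb h => ?_) List.nodup_range
  exact Function.iterate_injOn_Iio_minimalPeriod (Set.mem_Iio.2 (List.mem_range.1 ha))
    (Set.mem_Iio.2 (List.mem_range.1 hb)) h

/-- The ordered basis of `k^Flag(v) ⊕ k^Cycle(v)` for a vertex that is written as the list
`c₁ … c_b` of its cycles: the flags `ρ₁, …, τₜ` in the given order, then the cycles `c_b, …, c₁`. -/
def vertexOrder {α : Type*} (σ : Perm α) (v : List (List α)) : List (α ⊕ Cyc σ) :=
  v.flatten.map .inl ++ (v.reverse.filterMap List.head?).map (fun x => .inr (cyc σ x))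

theorem flatMap_vertexOrder_perm {α : Type*} (σ : Perm α) (L : List (List (List α))) :
    (L.flatMap (vertexOrder σ)).Perm
      (L.flatten.flatten.map .inl ++
        (L.flatten.filterMap List.head?).map (fun x => .inr (cyc σ x))) := by
  induction L with
  | nil => simp
  | cons v L ih =>
    simp only [List.flatMap_cons, List.flatten_cons, List.flatten_append, List.map_append,
      List.filterMap_append, vertexOrder, List.append_assoc]
    refine List.Perm.append_left _ ?_
    refine (List.Perm.append_left _ ih).trans ?_
    refine (List.perm_append_comm_assoc _ _ _).trans ?_
    refine List.Perm.append_left _ (List.Perm.append_right _ ?_)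
    exact ((List.reverse_perm v).filterMap _).map _

namespace Presentation

variable {G : StableRibbonGraph}

/-- The ordered basis of `k^Flag ⊕ k^Cycle` defined by a presentation: the ordered bases of the
vertices one after another. -/
def order (P : Presentation G) : BasisOrder G.Basis where
  list := P.list.flatMap (vertexOrder G.σ)
  nodup := by
    have hc : ∀ c ∈ P.list.flatten,
        ∃ x, c = List.iterate G.σ x (Function.minimalPeriod G.σ x) := by
      intro c hc
      obtain ⟨v, hv, hcv⟩ := List.mem_flatten.1 hc
      exact P.cycle v hv c hcv
    rw [(flatMap_vertexOrder_perm G.σ P.list).nodup_iff]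
    refine List.nodup_append.2 ⟨P.nodup.map Sum.inl_injective, ?_, ?_⟩
    · rw [List.Nodup, List.pairwise_map, List.pairwise_filterMap]
      refine ((List.nodup_flatten.1 P.nodup).2).imp_of_mem ?_
      intro c c' hcm hcm' hd x hx x' hx' hxx
      obtain ⟨y, rfl⟩ := hc c hcm
      obtain ⟨y', rfl⟩ := hc c' hcm'
      rw [head?_cycleList, Option.some.injEq] at hx hx'
      subst hx hx'
      have h1 := (cyc_eq_iff G.σ).1 (Sum.inr.inj hxx)
      exact hd ((mem_cycleList G.σ y y').2 h1) ((mem_cycleList G.σ y' y').2 (SameCycle.refl _ _))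
    · rintro a ha b hb rfl
      obtain ⟨x, _, rfl⟩ := List.mem_map.1 ha
      obtain ⟨y, _, hy⟩ := List.mem_map.1 hb
      cases hy
  mem z := by
    rw [(flatMap_vertexOrder_perm G.σ P.list).mem_iff, List.mem_append]
    rcases z with x | q
    · exact Or.inl (List.mem_map_of_mem (P.mem x))
    · induction q using Quotient.inductionOn with | h x => ?_
      refine Or.inr (List.mem_map.2 ?_)
      obtain ⟨c, hc, hx⟩ := List.mem_flatten.1 (P.mem x)
      obtain ⟨v, hv, hcv⟩ := List.mem_flatten.1 hc
      obtain ⟨y, rfl⟩ := P.cycle v hv c hcv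
      refine ⟨y, List.mem_filterMap.2 ⟨_, hc, head?_cycleList _ _⟩, ?_⟩
      exact congrArg Sum.inr ((cyc_eq_iff G.σ).2 ((mem_cycleList _ _ _).1 hx))

/-- Every stable ribbon graph has a presentation. -/
theorem exists_presentation (G : StableRibbonGraph) : Nonempty (Presentation G) := by
  classical
  have : Fintype (Quotient G.lam) := Fintype.ofFinite _
  let cl : G.Cycle → List G.Flag := fun q =>
    List.iterate G.σ q.out (Function.minimalPeriod G.σ q.out)
  let cs : Quotient G.lam → List G.Cycle := fun v =>
    (Finset.univ.filter fun q : G.Cycle => (Quotient.mk G.lam q.out) = v).toList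
  have hcl : ∀ q x, x ∈ cl q ↔ cyc G.σ x = q := by
    intro q x
    rw [mem_cycleList, ← cyc_eq_iff]
    change Quotient.mk _ q.out = _ ↔ _
    rw [Quotient.out_eq]
    exact eq_comm
  have hcs : ∀ v q, q ∈ cs v ↔ Quotient.mk G.lam q.out = v := by
    intro v q; simp [cs]
  have hlam : ∀ x : G.Flag, Quotient.mk G.lam (cyc G.σ x).out = Quotient.mk G.lam x := fun x =>
    Quotient.sound (StableRibbonGraph.lam_of_sameCycle
      ((cyc_eq_iff G.σ).1 (Quotient.out_eq (cyc G.σ x))))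
  have hv : ∀ v x, x ∈ ((cs v).map cl).flatten ↔ Quotient.mk G.lam x = v := by
    intro v x
    simp only [List.mem_flatten, List.mem_map]
    constructor
    · rintro ⟨_, ⟨q, hq, rfl⟩, hx⟩
      rw [hcl] at hx
      subst hx
      rw [← hlam]
      exact (hcs _ _).1 hq
    · rintro rfl
      exact ⟨_, ⟨cyc G.σ x, (hcs _ _).2 (hlam x), rfl⟩, (hcl _ _).2 rfl⟩
  have hd : ∀ q q', q ≠ q' → (cl q).Disjoint (cl q') := by
    intro q q' hne x hx hx'
    exact hne (((hcl _ _).1 hx).symm.trans ((hcl _ _).1 hx'))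
  refine ⟨⟨(Finset.univ : Finset (Quotient G.lam)).toList.map fun v => (cs v).map cl,
    ?_, ?_, ?_, ?_, ?_⟩⟩
  · intro v hvm
    obtain ⟨v, _, rfl⟩ := List.mem_map.1 hvm
    induction v using Quotient.inductionOn with | h x => ?_
    intro h
    have := (hv (Quotient.mk G.lam x) x).2 rfl
    simp [h] at this
  · intro v hvm c hc
    obtain ⟨v, _, rfl⟩ := List.mem_map.1 hvm
    obtain ⟨q, _, rfl⟩ := List.mem_map.1 hc
    exact ⟨_, rfl⟩
  · intro v hvm x hx y
    obtain ⟨v, _, rfl⟩ := List.mem_map.1 hvm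
    rw [hv] at hx ⊢
    subst hx
    rw [Quotient.eq]
    exact ⟨G.lam.symm, G.lam.symm⟩
  · rw [List.nodup_flatten]
    constructor
    · intro c hc
      obtain ⟨v, hvm, hcv⟩ := List.mem_flatten.1 hc
      obtain ⟨v, _, rfl⟩ := List.mem_map.1 hvm
      obtain ⟨q, _, rfl⟩ := List.mem_map.1 hcv
      exact nodup_cycleList _ _
    · rw [List.pairwise_flatten]
      constructor
      · intro v hvm
        obtain ⟨v, _, rfl⟩ := List.mem_map.1 hvm
        rw [List.pairwise_map]
        exact (Finset.nodup_toList _).imp fun h => hd _ _ h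
      · rw [List.pairwise_map]
        refine (Finset.nodup_toList _).imp fun {v v'} h c hc c' hc' => ?_
        obtain ⟨q, hq, rfl⟩ := List.mem_map.1 hc
        obtain ⟨q', hq', rfl⟩ := List.mem_map.1 hc'
        refine hd _ _ ?_
        rintro rfl
        exact h (((hcs _ _).1 hq).symm.trans ((hcs _ _).1 hq'))
  · intro x
    have := (hv (Quotient.mk G.lam x) x).2 rfl
    obtain ⟨c, hc, hx⟩ := List.mem_flatten.1 this
    exact List.mem_flatten.2 ⟨c, List.mem_flatten.2 ⟨_, List.mem_map.2 ⟨Quotient.mk G.lam x,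
      Finset.mem_toList.2 (Finset.mem_univ _), rfl⟩, hc⟩, hx⟩

end Presentation

/-! ### Algebras with odd scalar product -/

section Algebra

variable {k A : Type*} [Field k] [NonUnitalRing A] [Module k A]

/-- The sign `(-1)^s`. -/
def sgn (k : Type*) [Field k] (s : ZMod 2) : k := (-1) ^ s.val

/-- `𝒜` is a `ℤ/2`-grading of the algebra `A`. -/
structure IsSuperGrading (𝒜 : ZMod 2 → Submodule k A) : Prop where
  internal : DirectSum.IsInternal 𝒜
  mul_mem : ∀ i j, ∀ a ∈ 𝒜 i, ∀ b ∈ 𝒜 j, a * b ∈ 𝒜 (i + j)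

/-- An odd invariant non-degenerate (super)symmetric scalar product. -/
structure IsOddScalarProduct (𝒜 : ZMod 2 → Submodule k A) (g : A →ₗ[k] A →ₗ[k] k) : Prop where
  odd : ∀ i j, ∀ a ∈ 𝒜 i, ∀ b ∈ 𝒜 j, i + j ≠ 1 → g a b = 0
  symm : ∀ i j, ∀ a ∈ 𝒜 i, ∀ b ∈ 𝒜 j, g a b = sgn k (i * j) * g b a
  invariant : ∀ a b c, g (a * b) c = g a (b * c)
  nondegenerate : ∀ a, (∀ b, g a b = 0) → a = 0

/-- An odd operator. -/
def IsOddOperator (𝒜 : ZMod 2 → Submodule k A) (T : A →ₗ[k] A) : Prop :=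
  ∀ i, ∀ a ∈ 𝒜 i, T a ∈ 𝒜 (i + 1)

/-- An odd derivation of the algebra that is anti-self-adjoint for the scalar product. -/
structure IsOddDerivation (𝒜 : ZMod 2 → Submodule k A) (g : A →ₗ[k] A →ₗ[k] k)
    (I : A →ₗ[k] A) : Prop where
  odd : IsOddOperator 𝒜 I
  leibniz : ∀ i, ∀ a ∈ 𝒜 i, ∀ b, I (a * b) = I a * b + sgn k i • (a * I b)
  antiSelfAdjoint : ∀ i, ∀ a ∈ 𝒜 i, ∀ b, g (I a) b + sgn k i * g a (I b) = 0

/-- An odd self-adjoint operator `J` with `[I, J] = 1`; the commutator of odd operators is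
`I J + J I`. -/
structure IsHomotopyInverse (𝒜 : ZMod 2 → Submodule k A) (g : A →ₗ[k] A →ₗ[k] k)
    (I J : A →ₗ[k] A) : Prop where
  odd : IsOddOperator 𝒜 J
  selfAdjoint : ∀ i, ∀ a ∈ 𝒜 i, ∀ b, g (J a) b = sgn k i * g a (J b)
  commutator : ∀ a, I (J a) + J (I a) = a

/-- A basis `e_μ` of homogeneous elements, with the dual basis `e^μ`, `g(e^μ, e_ν) = δ`. -/
structure DualBases (𝒜 : ZMod 2 → Submodule k A) (g : A →ₗ[k] A →ₗ[k] k) (ι : Type*)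
    [DecidableEq ι] where
  e : Module.Basis ι k A
  dual : ι → A
  parity : ι → ZMod 2
  e_mem : ∀ μ, e μ ∈ 𝒜 (parity μ)
  pairing : ∀ μ ν, g (dual μ) (e ν) = if μ = ν then 1 else 0

/-- The product of a nonempty list of elements. -/
def wordProd : List A → A
  | [] => 0
  | a :: l => l.foldl (· * ·) a

/-- The odd functional `l(a₁ a₂ … aₙ) = g(a₁, a₂ ⋯ aₙ)` on words with `n ≥ 2` letters. By invariance
it is also equal to `g(a₁ ⋯ aᵢ, aᵢ₊₁ ⋯ aₙ)`. -/
def oddTrace (g : A →ₗ[k] A →ₗ[k] k) : List A → k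
  | [] => 0
  | a :: l => g a (wordProd l)

/-- The exponent of the sign that arises when all the shifts `π` in `πa₁ ⊗ … ⊗ πaₙ` are passed to
the left, from the parities of `a₁, …, aₙ`. -/
def piExponent : List (ZMod 2) → ZMod 2
  | [] => 0
  | s :: l => l.length * s + piExponent l

/-- For words `A₁, …, A_b` with the given parities: the exponent `∑_{i < j} |Aⱼ|` of the sign that
arises when `A₁, …, A_b` pass the odd pairs `e^{μ₁} e_{μ₁}, …, e^{μ_{b-1}} e_{μ_{b-1}}`. -/
def insertionExponent : List (ZMod 2) → ZMod 2
  | [] => 0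
  | _ :: l => l.sum + insertionExponent l

/-- The exponent of the Koszul sign for bringing the list of elements of parity `q` into the order
of the list `target`. -/
def reorderExponent {X : Type*} [DecidableEq X] (q : X → ZMod 2) (target : List X) :
    List X → ZMod 2
  | [] => 0
  | x :: l => q x * ((l.filter fun y => target.idxOf y < target.idxOf x).map q).sum +
      reorderExponent q target l

namespace DualBases

variable {𝒜 : ZMod 2 → Submodule k A} {g : A →ₗ[k] A →ₗ[k] k} {ι : Type*} [DecidableEq ι]
  [Fintype ι] (B : DualBases 𝒜 g ι)

/-- The supertrace `∑ (-1)^{|e_μ|} g(e^μ, T e_μ)` of an operator. -/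
noncomputable def superTrace (T : A →ₗ[k] A) : k := ∑ μ, sgn k (B.parity μ) * g (B.dual μ) (T (B.e μ))

/-- `∑_μ (-1)^{|e^μ| (|a| + 1)} e^μ a e_μ` for `a` of parity `s`; `e^μ` has parity `|e_μ| + 1`. -/
noncomputable def insertion (s : ZMod 2) (a : A) : A :=
  ∑ μ, sgn k ((B.parity μ + 1) * (s + 1)) • (B.dual μ * a * B.e μ)

/-- `∑_{ξ, ζ} (-1)^{|e^ξ| |e^ζ|} e^ξ e^ζ e_ξ e_ζ`. -/
noncomputable def handle : A :=
  ∑ ξ, ∑ ζ, sgn k ((B.parity ξ + 1) * (B.parity ζ + 1)) •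
    (B.dual ξ * B.dual ζ * B.e ξ * B.e ζ)

/-- The value of the tensor `α_{σ_v, γ}` of a vertex `v`, written as the list
`(ρ₁ … ρᵣ) … (τ₁ … τₜ)` of its cycles, on `πa_{ρ₁} ⊗ … ⊗ πa_{τₜ}`, where `a_x = e_{m x}`:
the scalar product of
`∑ ± e^{μ₁} a_{ρ₁} … a_{ρᵣ} e_{μ₁} e^{μ₂} … e_{μ_{b-1}} a_{τ₁} … a_{τₜ}` with the `γ`-th power of
`∑ ± e^ξ e^ζ e_ξ e_ζ`. -/
noncomputable def vertexTensor {F : Type*} (γ : ℕ) (v : List (List F)) (m : F → ι) : k :=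
  sgn k (piExponent (v.flatten.map fun x => B.parity (m x)) +
      insertionExponent (v.map fun c => (c.map fun x => B.parity (m x)).sum)) *
    oddTrace g
      ((v.dropLast.map fun c =>
          B.insertion (c.map fun x => B.parity (m x)).sum (wordProd (c.map fun x => B.e (m x)))) ++
        (v.getLast?.getD []).map (fun x => B.e (m x)) ++
        List.replicate γ B.handle)

/-- The coefficient at `πe_μ ⊗ πe_ν` of the even symmetric tensor in `ΠA ⊗ ΠA` that is given by the
pairing `g⁻¹(J* φ, ψ)` on `Π Hom(A, k)`. On the coordinate functionals of the basis `e` this pairing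
is `g(J e^μ, e^ν)`, and `πe_ν` has parity `|e_ν| + 1`. -/
noncomputable def propagator (J : A →ₗ[k] A) (μ ν : ι) : k :=
  sgn k (B.parity ν + 1) * g (J (B.dual μ)) (B.dual ν)

end DualBases

namespace Presentation

variable {G : StableRibbonGraph} (P : Presentation G)

/-- All flags, in the order of the presentation. -/
def flags : List G.Flag := P.list.flatten.flatten

/-- For every edge the flag of it that comes first. -/
def edgeFlags : List G.Flag := P.flags.filter fun x => P.flags.idxOf x < P.flags.idxOf (G.η x)

variable {𝒜 : ZMod 2 → Submodule k A} {g : A →ₗ[k] A →ₗ[k] k} {ι : Type*} [DecidableEq ι]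
  [Fintype ι] (B : DualBases 𝒜 g ι) (J : A →ₗ[k] A)

/-- The contraction of the tensors of the vertices with the propagators of the edges. The tensor
product over the edges is an element of `(ΠA)^{⊗ Flag}`; its factors are brought into the order of
the presentation by the Koszul rule, and then the tensors of the vertices are evaluated. -/
noncomputable def weight : k :=
  ∑ m : G.Flag → ι,
    sgn k (reorderExponent (fun x => B.parity (m x) + 1) P.flags
      (P.edgeFlags.flatMap fun x => [x, G.η x])) *
    (P.edgeFlags.map fun x => B.propagator J (m x) (m (G.η x))).prod *
    (P.list.map fun v => B.vertexTensor (v.flatten.head?.elim 0 G.genus) v m).prod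

end Presentation

variable {𝒜 : ZMod 2 → Submodule k A} {g : A →ₗ[k] A →ₗ[k] k} {ι : Type*} [DecidableEq ι]
  [Fintype ι]

/-- The cochain `Ẑ`. Its value on a graph with an orientation is the contraction of tensors for a
presentation of the graph, with a minus sign if the ordered basis of the presentation is negative
for the given orientation. -/
noncomputable def partitionCochain (B : DualBases 𝒜 g ι) (J : A →ₗ[k] A) (Γ : OrientedGraph) : k :=
  ((Γ.orient.sign (Classical.choice (Presentation.exists_presentation Γ.graph)).order : ℤ) : k) *
    (Classical.choice (Presentation.exists_presentation Γ.graph)).weight B J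

end Algebra

end StableRibbon

/-!
A *presentation* writes a stable ribbon graph as a list of vertices, each of which is a list of
cycles, each of which is a list of flags. A presentation gives a contraction of tensors and an
ordered basis of `k^F ⊕ k^Cycle`, and the value of the cochain is the contraction with the sign of
the basis.

*Independence of the choices.* Any two presentations of a graph are connected by exchanges of
neighbouring vertices, exchanges of neighbouring cycles of a vertex, and rotations of cycles
(`IsPresentation.reflTransGen_move`). Each of these moves changes the Koszul sign, the sign of the
vertices and the sign of the ordered basis, and the three changes cancel
(`colouringValue_independent`). For the vertices this rests on three facts: the form `l` is
cyclic, the elements `T(a)` commute with all elements up to the sign of the Koszul rule, and the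
handle element `Γ` is central. Since the operator `I~` is odd and self-adjoint, the element
attached to an edge is even and symmetric (`isEvenSymmetric_propagator`), so that the edges may be
written in any order (`edgeFactor_eq`).

*The sign in the handle element.* The sign `(-1)^{|e^ξ||e^ζ|}` in `Γ` differs from the sign in the
element `∑ T'(e^ζ) e_ζ`, where `T'` is a Casimir operator with the sign of the Koszul rule; for
the latter it is clear that it is central, that derivations annihilate it and that loops produce
it. The two elements are equal nevertheless (`handle_eq_naturalHandle`). Up to sign each of them
is the sum of four parts, according to the parities of `e_ξ` and `e_ζ`, and these four parts
coincide: some of the relations follow from rotations and from the vanishing of a Casimir operator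
on odd elements, the remaining one from the vanishing of the traces of operators with square zero
(`handlePart_odd`).

*Contraction of an edge.* Let the element of an edge be replaced by the inverse of the scalar
product `g`. Contraction with this tensor joins the traces of two vertices into one, turns a loop
between two cycles of a vertex into a handle element, and turns a loop within a cycle into a
product with one more factor `T` (`vertexTrace_join`, `vertexTrace_join_loop`, `vertexTrace_cut`).
The result is the value of the cochain on the contracted graph with the induced orientation
(`edgeSum_eq_contractionValue`). If the edge cannot be contracted, one of the cycles becomes
empty, and the
value is zero: the trace contains either `T` of an empty word, which is zero, or the sum
`∑ ± e^μ e_μ`, which vanishes because the supertraces of all left multiplications do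
(`vertexTrace_concat_nil`). So `d Z` is the sum over the edges of the contractions in which one
propagator is replaced by the inverse of the scalar product.

*The differential.* By `[I, I~] = 1` the inverse of the scalar product is the result of the action
of the derivation `I` on the propagator (`pairing_dual_eq_sum`). As `I` is anti-self-adjoint, it
can be moved to the two flags of the edge at the vertices (`sum_pairing_edge`), and `d Z` becomes
the sum over all flags of the contractions in which `I` acts on the argument of one flag. This sum
is the action of `I` on the product of the tensors of the vertices, and it vanishes because these
tensors are `I`-invariant (`derivation_prod_vertexValue`): `l(I(a)) = 0`, the derivation commutes
with `T`, and it annihilates `Γ`.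
-/

set_option linter.unusedSectionVars false

namespace StableRibbon

open Equiv Equiv.Perm

/-! ### Signs -/

section Signs

variable (k : Type*) [Field k]

theorem zmod_two_mul_self (a : ZMod 2) : a * a = a := by
  revert a; decide

theorem zmod_two_cases (a : ZMod 2) : a = 0 ∨ a = 1 := by
  revert a; decide

@[simp] theorem sgn_zero : sgn k 0 = 1 := by simp [sgn]

@[simp] theorem sgn_one : sgn k 1 = -1 := by simp [sgn, ZMod.val_one]

theorem sgn_add (a b : ZMod 2) : sgn k (a + b) = sgn k a * sgn k b := by
  rcases zmod_two_cases a with rfl | rfl <;> rcases zmod_two_cases b with rfl | rfl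
  · simp
  · simp
  · simp
  · rw [show (1 : ZMod 2) + 1 = 0 by decide]; simp

theorem sgn_mul_self (a : ZMod 2) : sgn k a * sgn k a = 1 := by
  rw [← sgn_add, CharTwo.add_self_eq_zero, sgn_zero]

theorem sgn_mul_sgn_mul (a : ZMod 2) (x : k) : sgn k a * (sgn k a * x) = x := by
  rw [← mul_assoc, sgn_mul_self, one_mul]

theorem eq_sgn_mul_comm {a : ZMod 2} {x y : k} (h : x = sgn k a * y) : y = sgn k a * x := by
  rw [h, sgn_mul_sgn_mul]

end Signs

/-! ### Koszul exponents -/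

section Koszul

variable {X : Type*}

/-- One list arises from the other by an exchange of two neighbours. -/
def AdjSwap (l l' : List X) : Prop :=
  ∃ a x y b, l = a ++ x :: y :: b ∧ l' = a ++ y :: x :: b

theorem adjSwap_reflTransGen {l l' : List X} (h : l.Perm l') :
    Relation.ReflTransGen AdjSwap l l' := by
  induction h with
  | nil => exact .refl
  | cons z _ ih =>
    refine Relation.ReflTransGen.lift (r := AdjSwap) (p := AdjSwap) (List.cons z) ?_ _ _ ih
    rintro _ _ ⟨a, x, y, b, rfl, rfl⟩
    exact ⟨z :: a, x, y, b, rfl, rfl⟩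
  | swap x y l => exact .single ⟨[], y, x, l, rfl, rfl⟩
  | trans _ _ ih1 ih2 => exact ih1.trans ih2

theorem AdjSwap.perm {l l' : List X} (h : AdjSwap l l') : l.Perm l' := by
  obtain ⟨a, x, y, b, rfl, rfl⟩ := h
  exact (List.Perm.swap _ _ _).append_left a

variable [DecidableEq X] (q : X → ZMod 2)

theorem idxOf_map_of_injective {Y : Type*} [DecidableEq Y] {φ : X → Y}
    (hφ : Function.Injective φ) (l : List X) (x : X) : (l.map φ).idxOf (φ x) = l.idxOf x := by
  induction l with
  | nil => rfl
  | cons a l ih =>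
    by_cases h : a = x
    · subst h; simp
    · rw [List.map_cons, List.idxOf_cons_ne _ (fun k => h (hφ k)), List.idxOf_cons_ne _ h, ih]

/-- The sum of the parities of those members of `l` that precede `x` in the list `t`. -/
def precedingSum (t l : List X) (x : X) : ZMod 2 :=
  ((l.filter fun y => t.idxOf y < t.idxOf x).map q).sum

theorem reorderExponent_cons (t : List X) (x : X) (l : List X) :
    reorderExponent q t (x :: l) = q x * precedingSum q t l x + reorderExponent q t l := rfl

theorem precedingSum_cons (t : List X) (y : X) (l : List X) (x : X) :
    precedingSum q t (y :: l) x =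
      (if t.idxOf y < t.idxOf x then q y else 0) + precedingSum q t l x := by
  unfold precedingSum
  rw [List.filter_cons]
  split_ifs with h h' h' <;> simp_all

theorem precedingSum_perm (t : List X) {l l' : List X} (h : l.Perm l') (x : X) :
    precedingSum q t l x = precedingSum q t l' x :=
  ((h.filter _).map q).sum_eq

theorem precedingSum_append (t l l' : List X) (x : X) :
    precedingSum q t (l ++ l') x = precedingSum q t l x + precedingSum q t l' x := by
  simp [precedingSum]

theorem reorderExponent_swap (t a : List X) {x y : X} (b : List X) (hxy : x ≠ y) (hx : x ∈ t) :
    reorderExponent q t (a ++ x :: y :: b) =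
      reorderExponent q t (a ++ y :: x :: b) + q x * q y := by
  induction a with
  | nil =>
    simp only [List.nil_append, reorderExponent_cons, precedingSum_cons]
    have hne : t.idxOf x ≠ t.idxOf y := fun h => hxy ((List.idxOf_inj hx).1 h)
    rcases lt_or_gt_of_ne hne with h | h
    · rw [if_neg (by omega), if_pos h]
      have := CharTwo.add_self_eq_zero (q x * q y)
      linear_combination -this
    · rw [if_pos h, if_neg (by omega)]
      ring
  | cons z a ih =>
    simp only [List.cons_append, reorderExponent_cons, ih]
    rw [precedingSum_perm q t ((List.Perm.swap y x b).append_left a)]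
    ring

theorem reorderExponent_move (t a : List X) (x : X) (Y b : List X) (hn : x ∉ Y) (hx : x ∈ t) :
    reorderExponent q t (a ++ x :: (Y ++ b)) =
      reorderExponent q t (a ++ (Y ++ x :: b)) + q x * (Y.map q).sum := by
  induction Y generalizing a with
  | nil => simp
  | cons y Y ih =>
    rw [List.cons_append, reorderExponent_swap q t a _ (fun h => hn (by simp [h])) hx]
    have := ih (a ++ [y]) (fun h => hn (List.mem_cons_of_mem _ h))
    simp only [List.append_assoc, List.cons_append, List.nil_append] at this
    rw [this]
    simp only [List.cons_append, List.map_cons, List.sum_cons]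
    ring

/-- The exchange of two neighbouring blocks changes the Koszul sign by the product of their
parities. -/
theorem reorderExponent_block (t a : List X) (Y Z b : List X) (hn : Y.Disjoint Z)
    (hx : ∀ y ∈ Y, y ∈ t) :
    reorderExponent q t (a ++ (Y ++ (Z ++ b))) =
      reorderExponent q t (a ++ (Z ++ (Y ++ b))) + (Y.map q).sum * (Z.map q).sum := by
  induction Y generalizing a with
  | nil => simp
  | cons y Y ih =>
    have := ih (a ++ [y]) (List.disjoint_of_disjoint_cons_left hn)
      (fun z hz => hx z (List.mem_cons_of_mem _ hz))
    simp only [List.append_assoc, List.cons_append, List.nil_append] at this ⊢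
    rw [this, reorderExponent_move q t a y Z _ (hn (by simp)) (hx y (by simp))]
    simp only [List.map_cons, List.sum_cons]
    ring

theorem reorderExponent_congr_target {t t' l : List X}
    (h : ∀ x ∈ l, ∀ y ∈ l, (t.idxOf y < t.idxOf x ↔ t'.idxOf y < t'.idxOf x)) :
    reorderExponent q t l = reorderExponent q t' l := by
  induction l with
  | nil => rfl
  | cons x l ih =>
    rw [reorderExponent_cons, reorderExponent_cons,
      ih fun a ha b hb => h a (List.mem_cons_of_mem _ ha) b (List.mem_cons_of_mem _ hb)]
    congr 2
    unfold precedingSum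
    congr 2
    refine List.filter_congr fun y hy => ?_
    simp [h x (by simp) y (List.mem_cons_of_mem _ hy)]

theorem reorderExponent_congr {q q' : X → ZMod 2} (t : List X) {l : List X}
    (h : ∀ x ∈ l, q x = q' x) : reorderExponent q t l = reorderExponent q' t l := by
  induction l with
  | nil => rfl
  | cons x l ih =>
    rw [reorderExponent_cons, reorderExponent_cons, h x (by simp),
      ih fun a ha => h a (List.mem_cons_of_mem _ ha)]
    congr 2
    unfold precedingSum
    congr 1
    refine List.map_congr_left fun y hy => h y ?_
    exact List.mem_cons_of_mem _ (List.mem_filter.1 hy).1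

theorem reorderExponent_self {l : List X} (hl : l.Nodup) : reorderExponent q l l = 0 := by
  induction l with
  | nil => rfl
  | cons x l ih =>
    have hl' := List.nodup_cons.1 hl
    rw [reorderExponent_cons, reorderExponent_congr_target q (t' := l), ih hl'.2]
    · simp [precedingSum]
    · intro a ha b hb
      rw [List.idxOf_cons_ne _ (ne_of_mem_of_not_mem ha hl'.1).symm,
        List.idxOf_cons_ne _ (ne_of_mem_of_not_mem hb hl'.1).symm]
      omega

theorem reorderExponent_append_left (Y : List X) {t l : List X} (h : (Y ++ l).Nodup) :
    reorderExponent q (Y ++ t) (Y ++ l) = reorderExponent q t l := by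
  induction Y with
  | nil => rfl
  | cons x Y ih =>
    have hl' := List.nodup_cons.1 h
    rw [List.cons_append, List.cons_append, reorderExponent_cons,
      reorderExponent_congr_target q (t' := Y ++ t), ih hl'.2]
    · simp [precedingSum]
    · intro a ha b hb
      rw [List.idxOf_cons_ne _ (ne_of_mem_of_not_mem ha hl'.1).symm,
        List.idxOf_cons_ne _ (ne_of_mem_of_not_mem hb hl'.1).symm]
      omega

theorem reorderExponent_map {Y : Type*} [DecidableEq Y] {φ : X → Y}
    (hφ : Function.Injective φ) (q : Y → ZMod 2) (t l : List X) :
    reorderExponent q (t.map φ) (l.map φ) = reorderExponent (q ∘ φ) t l := by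
  induction l with
  | nil => rfl
  | cons x l ih =>
    rw [List.map_cons, reorderExponent_cons, reorderExponent_cons, ih]
    congr 2
    simp only [precedingSum, List.filter_map, List.map_map]
    congr 3
    funext y
    simp [idxOf_map_of_injective hφ]

/-- The Koszul exponent as a sum over all inverted pairs. -/
theorem reorderExponent_eq_sum (t : List X) {l : List X} (hl : l.Nodup) :
    reorderExponent q t l = ∑ x ∈ l.toFinset, ∑ y ∈ l.toFinset,
      if l.idxOf x < l.idxOf y ∧ t.idxOf y < t.idxOf x then q x * q y else 0 := by
  induction l with
  | nil => simp [reorderExponent]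
  | cons a l ih =>
    have hl' := List.nodup_cons.1 hl
    have hne : ∀ x ∈ l, a ≠ x := fun x hx h => hl'.1 (h ▸ hx)
    rw [reorderExponent_cons, ih hl'.2, List.toFinset_cons,
      Finset.sum_insert (by simpa using hl'.1)]
    congr 1
    · rw [Finset.sum_insert (by simpa using hl'.1), precedingSum, ← List.sum_toFinset _
        (hl'.2.filter _), Finset.mul_sum, List.toFinset_filter, Finset.sum_filter]
      simp only [lt_self_iff_false, false_and, if_false, zero_add]
      refine Finset.sum_congr rfl fun y hy => ?_
      rw [List.idxOf_cons_self, List.idxOf_cons_ne _ (hne y (by simpa using hy))]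
      simp
    · refine Finset.sum_congr rfl fun x hx => ?_
      rw [Finset.sum_insert (by simpa using hl'.1), List.idxOf_cons_self]
      simp only [not_lt_zero, false_and, if_false, zero_add]
      refine Finset.sum_congr rfl fun y hy => ?_
      rw [List.idxOf_cons_ne _ (hne x (by simpa using hx)),
        List.idxOf_cons_ne _ (hne y (by simpa using hy))]
      simp

theorem reorderExponent_symm {t l : List X} (hl : l.Nodup) (h : t.Perm l) :
    reorderExponent q t l = reorderExponent q l t := by
  rw [reorderExponent_eq_sum q t hl, reorderExponent_eq_sum q l (h.nodup_iff.2 hl),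
    List.toFinset_eq_of_perm _ _ h, Finset.sum_comm]
  refine Finset.sum_congr rfl fun x _ => Finset.sum_congr rfl fun y _ => ?_
  rw [mul_comm (q y) (q x)]
  exact if_congr and_comm rfl rfl

/-- The change of the Koszul sign when the parity of one element is reversed. -/
theorem reorderExponent_update_of_mem {t l : List X} (hl : l.Nodup) (ht : ∀ y ∈ l, y ∈ t)
    {x : X} (hx : x ∈ l) {q' : X → ZMod 2} (hq : q' x = q x + 1) (hq' : ∀ y, y ≠ x → q' y = q y) :
    reorderExponent q' t l =
      reorderExponent q t l + precedingSum q t l x + precedingSum q l l x := by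
  have hcongr : ∀ m : List X, x ∉ m → ∀ z, precedingSum q' t m z = precedingSum q t m z := by
    intro m hm z
    unfold precedingSum
    congr 1
    exact List.map_congr_left fun y hy => hq' y fun h => hm (h ▸ (List.mem_filter.1 hy).1)
  have hshift : ∀ (a : X) (m : List X) (z : X), a ∉ m → z ∈ m →
      precedingSum q (a :: m) (a :: m) z = q a + precedingSum q m m z := by
    intro a m z ha hz
    rw [precedingSum_cons, if_pos]
    · congr 1
      unfold precedingSum
      congr 2
      refine List.filter_congr fun y hy => ?_
      rw [List.idxOf_cons_ne _ (ne_of_mem_of_not_mem hz ha).symm,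
        List.idxOf_cons_ne _ (ne_of_mem_of_not_mem hy ha).symm]
      simp
    · rw [List.idxOf_cons_self, List.idxOf_cons_ne _ (ne_of_mem_of_not_mem hz ha).symm]
      omega
  induction l with
  | nil => simp at hx
  | cons a l ih =>
    have hl' := List.nodup_cons.1 hl
    rw [reorderExponent_cons, reorderExponent_cons, precedingSum_cons q t a l x]
    by_cases hax : a = x
    · subst hax
      rw [hcongr l hl'.1, hq, reorderExponent_congr (q' := q) t (fun y hy => hq' y
        fun h => hl'.1 (h ▸ hy))]
      have : precedingSum q (a :: l) (a :: l) a = 0 := by simp [precedingSum]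
      rw [this]
      simp
      ring
    · have hxl : x ∈ l := (List.mem_cons.1 hx).resolve_left (fun h => hax h.symm)
      rw [ih hl'.2 (fun y hy => ht y (List.mem_cons_of_mem _ hy)) hxl, hshift a l x hl'.1 hxl,
        hq' a hax]
      have hne : t.idxOf a ≠ t.idxOf x := fun h => hax ((List.idxOf_inj (ht a (by simp))).1 h)
      have hpre : precedingSum q' t l a =
          precedingSum q t l a + if t.idxOf x < t.idxOf a then 1 else 0 := by
        rw [precedingSum_perm q' t (List.perm_cons_erase hxl),
          precedingSum_perm q t (List.perm_cons_erase hxl), precedingSum_cons, precedingSum_cons,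
          hcongr _ (hl'.2.not_mem_erase), hq]
        split_ifs <;> ring
      rw [hpre]
      have h2 := CharTwo.add_self_eq_zero (q a)
      rcases lt_or_gt_of_ne hne with h | h
      · rw [if_pos h, if_neg (by omega)]
        linear_combination -h2
      · rw [if_pos h, if_neg (by omega)]
        ring

theorem reorderExponent_update {t l : List X} (hl : l.Nodup) (h : t.Perm l)
    {x : X} (hx : x ∈ l) {q' : X → ZMod 2} (hq : q' x = q x + 1) (hq' : ∀ y, y ≠ x → q' y = q y) :
    reorderExponent q' t l =
      reorderExponent q t l + precedingSum q t t x + precedingSum q l l x := by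
  rw [reorderExponent_update_of_mem q hl (fun y hy => h.mem_iff.2 hy) hx hq hq',
    precedingSum_perm q t h]

theorem precedingSum_append_left {l l' : List X} (h : (l ++ l').Nodup) {x : X} (hx : x ∈ l) :
    precedingSum q (l ++ l') (l ++ l') x = precedingSum q l l x := by
  obtain ⟨_, _, hd⟩ := List.nodup_append'.1 h
  have h2 : precedingSum q (l ++ l') l' x = 0 := by
    unfold precedingSum
    rw [List.filter_eq_nil_iff.2]
    · rfl
    · intro y hy
      rw [List.idxOf_append_of_mem hx, List.idxOf_append_of_notMem (fun k => hd k hy)]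
      have := List.idxOf_lt_length_of_mem hx
      simp; omega
  rw [precedingSum_append, h2, add_zero]
  unfold precedingSum
  congr 2
  refine List.filter_congr fun y hy => ?_
  rw [List.idxOf_append_of_mem hx, List.idxOf_append_of_mem hy]

theorem precedingSum_append_right {l l' : List X} (h : (l ++ l').Nodup) {x : X} (hx : x ∈ l') :
    precedingSum q (l ++ l') (l ++ l') x = (l.map q).sum + precedingSum q l' l' x := by
  obtain ⟨_, _, hd⟩ := List.nodup_append'.1 h
  have hxl : x ∉ l := fun k => hd k hx
  rw [precedingSum_append]
  congr 1
  · unfold precedingSum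
    rw [List.filter_eq_self.2]
    intro y hy
    rw [List.idxOf_append_of_mem hy, List.idxOf_append_of_notMem hxl]
    have := List.idxOf_lt_length_of_mem hy
    simp; omega
  · unfold precedingSum
    congr 2
    refine List.filter_congr fun y hy => ?_
    rw [List.idxOf_append_of_notMem hxl, List.idxOf_append_of_notMem (fun k => hd k hy)]
    simp

theorem precedingSum_cons_self (x : X) (l : List X) :
    precedingSum q (x :: l) (x :: l) x = 0 := by
  simp [precedingSum]

end Koszul

/-! ### Comparison of ordered bases -/

section Orientation

variable {X : Type*}

theorem BasisOrder.perm (o o' : BasisOrder X) : o.list.Perm o'.list :=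
  (List.perm_ext_iff_of_nodup o.nodup o'.nodup).2 fun x => ⟨fun _ => o'.mem x, fun _ => o.mem x⟩

theorem BasisOrder.ext_list {o o' : BasisOrder X} (h : o.list = o'.list) : o = o' := by
  cases o; cases o'; cases h; rfl

variable [Fintype X] [DecidableEq X]

theorem BasisOrientation.sign_adjSwap (w : BasisOrientation X) {o o' : BasisOrder X}
    (h : AdjSwap o.list o'.list) : w.sign o' = - w.sign o := by
  obtain ⟨a, x, y, b, h1, h2⟩ := h
  have hn := o.nodup
  rw [h1] at hn
  have hxy : x ≠ y := by
    rintro rfl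
    simp [List.nodup_append] at hn
  have key : o' = o.map (swap x y) := by
    apply BasisOrder.ext_list
    have hfix : ∀ l : List X, x ∉ l → y ∉ l → l.map (swap x y) = l := by
      intro l hx hy
      conv_rhs => rw [← List.map_id l]
      exact List.map_congr_left fun z hz => swap_apply_of_ne_of_ne
        (fun h => hx (h ▸ hz)) (fun h => hy (h ▸ hz))
    have hdis := List.nodup_append'.1 hn
    have hd := List.disjoint_right.1 hdis.2.2
    have hn2 := hdis.2.1
    simp only [List.nodup_cons, List.mem_cons, not_or] at hn2
    change o'.list = o.list.map (swap x y)
    rw [h2, h1, List.map_append, List.map_cons, List.map_cons, swap_apply_left,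
      swap_apply_right, hfix a (hd (by simp)) (hd (by simp)), hfix b hn2.1.2 hn2.2.1]
  rw [key, w.alternating, sign_swap hxy, neg_one_mul]

/-- The orientation of one ordered basis is that of another one times the sign of the
permutation. -/
theorem BasisOrientation.sign_eq (k : Type*) [Field k] (w : BasisOrientation X)
    (o o' : BasisOrder X) :
    ((w.sign o' : ℤ) : k) =
      sgn k (reorderExponent (fun _ => 1) o.list o'.list) * ((w.sign o : ℤ) : k) := by
  have key : ∀ l, Relation.ReflTransGen AdjSwap o.list l → ∀ o' : BasisOrder X, o'.list = l →
      ((w.sign o' : ℤ) : k) =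
        sgn k (reorderExponent (fun _ => 1) o.list l) * ((w.sign o : ℤ) : k) := by
    intro l hl
    induction hl with
    | refl =>
      intro o' ho'
      rw [BasisOrder.ext_list ho', reorderExponent_self _ o.nodup, sgn_zero, one_mul]
    | @tail l₁ l₂ h1 h2 ih =>
      intro o' ho'
      have hp : l₁.Perm l₂ := h2.perm
      let o₁ : BasisOrder X := ⟨l₁, hp.nodup_iff.2 (ho' ▸ o'.nodup), fun x =>
        hp.mem_iff.2 (ho' ▸ o'.mem x)⟩
      have hs : AdjSwap o₁.list o'.list := by rw [ho']; exact h2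
      rw [w.sign_adjSwap hs]
      have := ih o₁ rfl
      obtain ⟨a, x, y, b, rfl, rfl⟩ := h2
      have hxy : x ≠ y := by
        have := o₁.nodup
        rintro rfl
        simp [o₁, List.nodup_append] at this
      rw [reorderExponent_swap _ _ _ _ hxy (o.mem x), mul_one, sgn_add, sgn_one] at this
      push_cast
      rw [this]
      ring
  exact key _ (adjSwap_reflTransGen (o.perm o')) o' rfl

end Orientation

/-! ### Dual bases of an odd scalar product -/

section DualBasesBasic

variable {k A : Type*} [Field k] [NonUnitalRing A] [Module k A]
  {𝒜 : ZMod 2 → Submodule k A} {g : A →ₗ[k] A →ₗ[k] k} {ι : Type*} [DecidableEq ι]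

namespace DualBases

/-- An odd supersymmetric form is symmetric in the plain sense, since two homogeneous elements that
pair nontrivially cannot both be odd. -/
theorem pairing_comm (B : DualBases 𝒜 g ι) (hg : IsOddScalarProduct 𝒜 g) (a b : A) :
    g a b = g b a := by
  have : g = g.flip := by
    refine B.e.ext fun μ => B.e.ext fun ν => ?_
    rw [LinearMap.flip_apply]
    by_cases h : B.parity μ + B.parity ν = 1
    · rw [hg.symm _ _ _ (B.e_mem μ) _ (B.e_mem ν)]
      have : ∀ a b : ZMod 2, a + b = 1 → a * b = 0 := by decide
      rw [this _ _ h, sgn_zero, one_mul]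
    · rw [hg.odd _ _ _ (B.e_mem μ) _ (B.e_mem ν) h,
        hg.odd _ _ _ (B.e_mem ν) _ (B.e_mem μ) (by rwa [add_comm])]
  conv_lhs => rw [this]
  rfl

theorem pairing_mul_left (B : DualBases 𝒜 g ι) (hg : IsOddScalarProduct 𝒜 g) (a b c : A) :
    g (a * b) c = g b (c * a) := by
  rw [pairing_comm B hg, ← hg.invariant, pairing_comm B hg]

variable [Fintype ι] (B : DualBases 𝒜 g ι)

theorem repr_eq_pairing (a : A) (μ : ι) : B.e.repr a μ = g (B.dual μ) a := by
  conv_rhs => rw [← B.e.sum_repr a]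
  simp only [map_sum, map_smul, B.pairing, smul_eq_mul, mul_ite, mul_one, mul_zero,
    Finset.sum_ite_eq, Finset.mem_univ, if_true]

theorem sum_pairing_smul_e (a : A) : ∑ μ, g (B.dual μ) a • B.e μ = a := by
  conv_rhs => rw [← B.e.sum_repr a]
  simp only [repr_eq_pairing]

theorem sum_pairing_smul_dual (hg : IsOddScalarProduct 𝒜 g) (a : A) :
    ∑ μ, g a (B.e μ) • B.dual μ = a := by
  rw [← sub_eq_zero]
  refine hg.nondegenerate _ fun b => ?_
  have : g (∑ μ, g a (B.e μ) • B.dual μ - a) = 0 := by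
    refine B.e.ext fun ν => ?_
    simp [B.pairing, LinearMap.sum_apply]
  rw [this]; rfl

theorem exists_homogeneous_add (B : DualBases 𝒜 g ι) (i : ZMod 2) (a : A) :
    ∃ b ∈ 𝒜 i, ∃ c ∈ 𝒜 (i + 1), a = b + c := by
  refine ⟨∑ μ with B.parity μ = i, B.e.repr a μ • B.e μ, ?_,
    ∑ μ with ¬ B.parity μ = i, B.e.repr a μ • B.e μ, ?_, ?_⟩
  · refine Submodule.sum_mem _ fun μ hμ => Submodule.smul_mem _ _ ?_
    rw [← (Finset.mem_filter.1 hμ).2]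
    exact B.e_mem μ
  · refine Submodule.sum_mem _ fun μ hμ => Submodule.smul_mem _ _ ?_
    have h := (Finset.mem_filter.1 hμ).2
    have h2 : ∀ a b : ZMod 2, ¬ a = b → b + 1 = a := by decide
    rw [h2 _ _ h]
    exact B.e_mem μ
  · rw [Finset.sum_filter_add_sum_filter_not, B.e.sum_repr]

/-- The dual basis consists of homogeneous elements of the opposite parities. -/
theorem dual_mem (hg : IsOddScalarProduct 𝒜 g) (μ : ι) : B.dual μ ∈ 𝒜 (B.parity μ + 1) := by
  obtain ⟨b, hb, c, hc, h⟩ := B.exists_homogeneous_add (B.parity μ) (B.dual μ)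
  have hb0 : b = 0 := by
    refine hg.nondegenerate _ fun x => ?_
    have : g b = 0 := by
      refine B.e.ext fun ν => ?_
      rw [LinearMap.zero_apply]
      by_cases hp : B.parity μ + B.parity ν = 1
      · have h1 := B.pairing μ ν
        have hne : μ ≠ ν := by
          rintro rfl
          rw [CharTwo.add_self_eq_zero] at hp
          exact zero_ne_one hp
        rw [if_neg hne, h, map_add, LinearMap.add_apply,
          hg.odd _ _ _ hc _ (B.e_mem ν), add_zero] at h1
        · exact h1
        · rw [add_right_comm, hp]; decide
      · exact hg.odd _ _ _ hb _ (B.e_mem ν) hp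
    rw [this]; rfl
  rw [h, hb0, zero_add]
  exact hc

theorem trace_eq_sum (f : A →ₗ[k] A) :
    LinearMap.trace k A f = ∑ μ, g (B.dual μ) (f (B.e μ)) := by
  rw [LinearMap.trace_eq_matrix_trace k B.e, Matrix.trace]
  refine Finset.sum_congr rfl fun μ _ => ?_
  rw [Matrix.diag_apply, LinearMap.toMatrix_apply, repr_eq_pairing]

variable {V : Type*} [AddCommGroup V] [Module k V] (F : A →ₗ[k] A →ₗ[k] V)

/-- An operator of parity `s` is moved from one tensor factor of `∑ ± e^μ ⊗ e_μ` to the other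
one, where it becomes the adjoint operator. -/
theorem sum_adjoint (hg : IsOddScalarProduct 𝒜 g) (φ σ : ZMod 2 → k) {s : ZMod 2}
    {X X' : A →ₗ[k] A} (hX : ∀ ν, X (B.e ν) ∈ 𝒜 (B.parity ν + s))
    (hadj : ∀ μ ν, B.parity μ = B.parity ν + s →
      g (X' (B.dual μ)) (B.e ν) = σ (B.parity ν) * g (B.dual μ) (X (B.e ν)))
    (hpar : ∀ μ ν, B.parity μ ≠ B.parity ν + s → g (X' (B.dual μ)) (B.e ν) = 0) :
    ∑ μ, φ (B.parity μ) • F (X' (B.dual μ)) (B.e μ) =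
      ∑ μ, (φ (B.parity μ + s) * σ (B.parity μ)) • F (B.dual μ) (X (B.e μ)) := by
  have h1 : ∀ μ, F (X' (B.dual μ)) (B.e μ) =
      ∑ ν, g (X' (B.dual μ)) (B.e ν) • F (B.dual ν) (B.e μ) := by
    intro μ
    conv_lhs => rw [← B.sum_pairing_smul_dual hg (X' (B.dual μ))]
    simp only [map_sum, map_smul, LinearMap.sum_apply, LinearMap.smul_apply]
  have h2 : ∀ μ, F (B.dual μ) (X (B.e μ)) =
      ∑ ν, g (B.dual ν) (X (B.e μ)) • F (B.dual μ) (B.e ν) := by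
    intro μ
    conv_lhs => rw [← B.sum_pairing_smul_e (X (B.e μ))]
    simp only [map_sum, map_smul]
  simp only [h1, h2, Finset.smul_sum]
  rw [Finset.sum_comm]
  refine Finset.sum_congr rfl fun ν _ => Finset.sum_congr rfl fun μ _ => ?_
  rw [smul_smul, smul_smul]
  congr 1
  by_cases h : B.parity μ = B.parity ν + s
  · rw [hadj _ _ h, h]; ring
  · rw [hpar _ _ h, hg.odd _ _ _ (B.dual_mem hg μ) _ (hX ν), mul_zero, mul_zero]
    grind

/-- The tensor `∑ ± e^μ ⊗ e_μ` is symmetric; the exchange of its factors reverses the parity of the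
summation index. -/
theorem sum_swap (hg : IsOddScalarProduct 𝒜 g) (φ : ZMod 2 → k) :
    ∑ μ, φ (B.parity μ) • F (B.dual μ) (B.e μ) =
      ∑ μ, φ (B.parity μ + 1) • F (B.e μ) (B.dual μ) := by
  have h1 : ∀ μ, F (B.dual μ) (B.e μ) =
      ∑ ν, g (B.dual ν) (B.dual μ) • F (B.e ν) (B.e μ) := by
    intro μ
    conv_lhs => rw [← B.sum_pairing_smul_e (B.dual μ)]
    simp only [map_sum, map_smul, LinearMap.sum_apply, LinearMap.smul_apply]
  have h2 : ∀ μ, F (B.e μ) (B.dual μ) =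
      ∑ ν, g (B.dual ν) (B.dual μ) • F (B.e μ) (B.e ν) := by
    intro μ
    conv_lhs => rw [← B.sum_pairing_smul_e (B.dual μ)]
    simp only [map_sum, map_smul]
  simp only [h1, h2, Finset.smul_sum]
  rw [Finset.sum_comm]
  refine Finset.sum_congr rfl fun ν _ => Finset.sum_congr rfl fun μ _ => ?_
  rw [smul_smul, smul_smul, pairing_comm B hg (B.dual ν) (B.dual μ)]
  congr 1
  by_cases h : B.parity μ = B.parity ν + 1
  · rw [h]
  · rw [hg.odd _ _ _ (B.dual_mem hg μ) _ (B.dual_mem hg ν), mul_zero, mul_zero]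
    revert h
    generalize B.parity μ = a
    generalize B.parity ν = b
    revert a b
    decide

end DualBases

end DualBasesBasic

section DualBasesMul

variable {k A : Type*} [Field k] [NonUnitalRing A] [Module k A]
  [IsScalarTower k A A] [SMulCommClass k A A]
  {𝒜 : ZMod 2 → Submodule k A} {g : A →ₗ[k] A →ₗ[k] k} {ι : Type*} [DecidableEq ι] [Fintype ι]

namespace DualBases

variable (B : DualBases 𝒜 g ι)
  {V : Type*} [AddCommGroup V] [Module k V] (F : A →ₗ[k] A →ₗ[k] V)

theorem sum_mul_right (h𝒜 : IsSuperGrading 𝒜) (hg : IsOddScalarProduct 𝒜 g) (φ : ZMod 2 → k)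
    {s : ZMod 2} {x : A} (hx : x ∈ 𝒜 s) :
    ∑ μ, φ (B.parity μ) • F (B.dual μ * x) (B.e μ) =
      ∑ μ, φ (B.parity μ + s) • F (B.dual μ) (x * B.e μ) := by
  have := B.sum_adjoint F hg φ (fun _ => 1) (s := s) (X := LinearMap.mulLeft k x)
    (X' := LinearMap.mulRight k x) (fun ν => by
      rw [add_comm]; exact h𝒜.mul_mem _ _ _ hx _ (B.e_mem ν))
    (fun μ ν _ => by simp [hg.invariant])
    (fun μ ν h => hg.odd _ _ _ (h𝒜.mul_mem _ _ _ (B.dual_mem hg μ) _ hx) _ (B.e_mem ν) (by grind))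
  simpa using this

theorem sum_mul_left (h𝒜 : IsSuperGrading 𝒜) (hg : IsOddScalarProduct 𝒜 g) (φ : ZMod 2 → k)
    {s : ZMod 2} {x : A} (hx : x ∈ 𝒜 s) :
    ∑ μ, φ (B.parity μ) • F (x * B.dual μ) (B.e μ) =
      ∑ μ, φ (B.parity μ + s) • F (B.dual μ) (B.e μ * x) := by
  have := B.sum_adjoint F hg φ (fun _ => 1) (s := s) (X := LinearMap.mulRight k x)
    (X' := LinearMap.mulLeft k x) (fun ν => h𝒜.mul_mem _ _ _ (B.e_mem ν) _ hx)
    (fun μ ν _ => by simp [pairing_mul_left B hg])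
    (fun μ ν h => hg.odd _ _ _ (h𝒜.mul_mem _ _ _ hx _ (B.dual_mem hg μ)) _ (B.e_mem ν) (by grind))
  simpa using this

theorem sum_derivation (hg : IsOddScalarProduct 𝒜 g) {I : A →ₗ[k] A} (hI : IsOddDerivation 𝒜 g I)
    (φ : ZMod 2 → k) :
    ∑ μ, φ (B.parity μ) • F (I (B.dual μ)) (B.e μ) =
      ∑ μ, (φ (B.parity μ + 1) * sgn k (B.parity μ + 1)) • F (B.dual μ) (I (B.e μ)) := by
  refine B.sum_adjoint F hg φ (fun p => sgn k (p + 1)) (s := 1) (X := I) (X' := I)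
    (fun ν => hI.odd _ _ (B.e_mem ν)) (fun μ ν h => ?_) (fun μ ν h => ?_)
  · have := hI.antiSelfAdjoint _ _ (B.dual_mem hg μ) (B.e ν)
    rw [h, add_assoc, CharTwo.add_self_eq_zero, add_zero] at this
    rw [sgn_add, sgn_one]
    linear_combination this
  · refine hg.odd _ _ _ (hI.odd _ _ (B.dual_mem hg μ)) _ (B.e_mem ν) ?_
    revert h
    generalize B.parity μ = a
    generalize B.parity ν = b
    revert a b
    decide

/-- The operator `a ↦ ∑ (-1)^{j |e^μ|} e^μ a e_μ`. -/
noncomputable def casimir (j : ZMod 2) : A →ₗ[k] A :=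
  ∑ μ, sgn k ((B.parity μ + 1) * j) •
    (LinearMap.mulRight k (B.e μ) ∘ₗ LinearMap.mulLeft k (B.dual μ))

theorem casimir_apply (j : ZMod 2) (a : A) :
    B.casimir j a = ∑ μ, sgn k ((B.parity μ + 1) * j) • (B.dual μ * a * B.e μ) := by
  simp [casimir, LinearMap.sum_apply]

theorem insertion_eq_casimir (s : ZMod 2) (a : A) : B.insertion s a = B.casimir (s + 1) a := by
  rw [casimir_apply, insertion]

theorem casimir_mem (h𝒜 : IsSuperGrading 𝒜) (hg : IsOddScalarProduct 𝒜 g) (j : ZMod 2)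
    {s : ZMod 2} {a : A} (ha : a ∈ 𝒜 s) : B.casimir j a ∈ 𝒜 (s + 1) := by
  rw [casimir_apply]
  refine Submodule.sum_mem _ fun μ _ => Submodule.smul_mem _ _ ?_
  have := h𝒜.mul_mem _ _ _ (h𝒜.mul_mem _ _ _ (B.dual_mem hg μ) _ ha) _ (B.e_mem μ)
  convert this using 2
  grind

/-- The values of the Casimir operators commute with all elements up to sign. -/
theorem mul_casimir (h𝒜 : IsSuperGrading 𝒜) (hg : IsOddScalarProduct 𝒜 g) (j : ZMod 2) (a : A)
    {t : ZMod 2} {x : A} (hx : x ∈ 𝒜 t) :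
    x * B.casimir j a = sgn k (t * j) • (B.casimir j a * x) := by
  have := B.sum_mul_left (LinearMap.mk₂ k (fun u w => u * a * w)
    (by intros; simp [add_mul]) (by intros; simp [smul_mul_assoc])
    (by intros; simp [mul_add]) (by intros; simp [mul_smul_comm])) h𝒜 hg
    (fun p => sgn k ((p + 1) * j)) hx
  simp only [LinearMap.mk₂_apply] at this
  simp only [casimir_apply, Finset.mul_sum, Finset.sum_mul, mul_smul_comm, smul_mul_assoc,
    Finset.smul_sum, smul_smul, ← sgn_add, ← mul_assoc] at this ⊢
  rw [this]
  refine Finset.sum_congr rfl fun μ _ => ?_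
  congr 2
  ring

theorem casimir_mul_comm (h𝒜 : IsSuperGrading 𝒜) (hg : IsOddScalarProduct 𝒜 g) (j : ZMod 2)
    (c : A) {t : ZMod 2} {x : A} (hx : x ∈ 𝒜 t) :
    B.casimir j (x * c) = sgn k (t * j) • B.casimir j (c * x) := by
  have := B.sum_mul_right (LinearMap.mk₂ k (fun u w => u * c * w)
    (by intros; simp [add_mul]) (by intros; simp [smul_mul_assoc])
    (by intros; simp [mul_add]) (by intros; simp [mul_smul_comm])) h𝒜 hg
    (fun p => sgn k ((p + 1) * j)) hx
  simp only [LinearMap.mk₂_apply] at this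
  simp only [casimir_apply, Finset.smul_sum, smul_smul, ← sgn_add, ← mul_assoc] at this ⊢
  rw [this]
  refine Finset.sum_congr rfl fun μ _ => ?_
  congr 2
  ring

theorem pairing_casimir (hg : IsOddScalarProduct 𝒜 g) (j : ZMod 2) (a b : A) :
    g (B.casimir j a) b = sgn k j * g a (B.casimir j b) := by
  have := B.sum_swap (LinearMap.mk₂ k (fun u w => g a (w * b * u))
    (by intros; simp [mul_add]) (by intros; simp [mul_smul_comm])
    (by intros; simp [add_mul]) (by intros; simp [smul_mul_assoc])) hg
    (fun p => sgn k ((p + 1) * j))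
  simp only [LinearMap.mk₂_apply] at this
  simp only [casimir_apply, map_sum, map_smul, LinearMap.sum_apply, LinearMap.smul_apply,
    smul_eq_mul, Finset.mul_sum, ← mul_assoc, ← sgn_add] at this ⊢
  refine Eq.trans (Finset.sum_congr rfl fun μ _ => ?_) (this.trans
    (Finset.sum_congr rfl fun μ _ => ?_))
  · rw [mul_assoc (B.dual μ), pairing_mul_left B hg, ← hg.invariant, ← hg.invariant,
      mul_assoc a]
  · congr 2
    ring

/-- On odd elements the Casimir operator with alternating signs vanishes. -/
theorem casimir_one_of_odd [CharZero k] (h𝒜 : IsSuperGrading 𝒜) (hg : IsOddScalarProduct 𝒜 g)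
    {a : A} (ha : a ∈ 𝒜 1) : B.casimir 1 a = 0 := by
  have := B.sum_mul_right (LinearMap.mul k A) h𝒜 hg (fun p => sgn k ((p + 1) * 1)) ha
  have h2 : B.casimir 1 a = - B.casimir 1 a := by
    conv_lhs => rw [casimir_apply]
    simp only [LinearMap.mul_apply'] at this
    rw [this, casimir_apply, ← Finset.sum_neg_distrib]
    refine Finset.sum_congr rfl fun μ _ => ?_
    rw [mul_assoc, ← neg_smul]
    congr 1
    rw [add_right_comm, add_mul _ 1, sgn_add]
    simp
  have h3 : (2 : k) • B.casimir 1 a = 0 := by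
    rw [two_smul]
    nth_rewrite 2 [h2]
    exact add_neg_cancel _
  exact (smul_eq_zero.1 h3).resolve_left two_ne_zero

/-- The derivation commutes with the insertion of the Casimir element. -/
theorem derivation_casimir (hg : IsOddScalarProduct 𝒜 g) {I : A →ₗ[k] A}
    (hI : IsOddDerivation 𝒜 g I) {s : ZMod 2} {a : A} (ha : a ∈ 𝒜 s)
    (h𝒜 : IsSuperGrading 𝒜) :
    I (B.casimir (s + 1) a) = B.casimir s (I a) := by
  have := B.sum_derivation (LinearMap.mk₂ k (fun u w => u * a * w)
    (by intros; simp [add_mul]) (by intros; simp [smul_mul_assoc])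
    (by intros; simp [mul_add]) (by intros; simp [mul_smul_comm])) hg hI
    (fun p => sgn k ((p + 1) * (s + 1)))
  simp only [LinearMap.mk₂_apply] at this
  have hd : ∀ μ, I (B.dual μ * a * B.e μ) = I (B.dual μ) * a * B.e μ +
      sgn k (B.parity μ + 1) • (B.dual μ * I a * B.e μ) +
      sgn k (B.parity μ + 1 + s) • (B.dual μ * a * I (B.e μ)) := by
    intro μ
    rw [hI.leibniz _ _ (h𝒜.mul_mem _ _ _ (B.dual_mem hg μ) _ ha), hI.leibniz _ _ (B.dual_mem hg μ),
      add_mul, smul_mul_assoc]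
  simp only [casimir_apply, map_sum, map_smul, hd, smul_add, Finset.sum_add_distrib, this,
    smul_smul, ← sgn_add]
  rw [add_right_comm, ← Finset.sum_add_distrib, Finset.sum_eq_zero, zero_add]
  · refine Finset.sum_congr rfl fun μ _ => ?_
    congr 2
    have := CharTwo.add_self_eq_zero (B.parity μ + 1)
    linear_combination this
  · intro μ _
    rw [← add_smul]
    convert zero_smul k _
    generalize B.parity μ = p
    rcases zmod_two_cases p with rfl | rfl <;> rcases zmod_two_cases s with rfl | rfl <;>
      simp [show (1 : ZMod 2) + 1 = 0 by decide]

/-! ### The handle element -/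

/-- `∑ e^ξ e^ζ e_ξ e_ζ` over the indices with `|e_ξ| = i` and `|e_ζ| = j`. -/
noncomputable def handlePart (i j : ZMod 2) : A :=
  ∑ ξ, ∑ ζ, (if B.parity ξ = i ∧ B.parity ζ = j then (1 : k) else 0) •
    (B.dual ξ * B.dual ζ * B.e ξ * B.e ζ)

/-- A sum over the terms of the handle element whose signs depend only on the parities of the indices
splits into four parts. -/
theorem sum_sum_eq_handlePart (f : ZMod 2 → ZMod 2 → k) :
    ∑ ξ, ∑ ζ, f (B.parity ξ) (B.parity ζ) • (B.dual ξ * B.dual ζ * B.e ξ * B.e ζ) =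
      f 0 0 • B.handlePart 0 0 + f 0 1 • B.handlePart 0 1 + f 1 0 • B.handlePart 1 0 +
        f 1 1 • B.handlePart 1 1 := by
  simp only [handlePart, Finset.smul_sum, ← Finset.sum_add_distrib, smul_smul, ← add_smul]
  refine Finset.sum_congr rfl fun ξ _ => Finset.sum_congr rfl fun ζ _ => ?_
  congr 1
  rcases zmod_two_cases (B.parity ξ) with h | h <;> rcases zmod_two_cases (B.parity ζ) with h' | h' <;>
    simp [h, h']

/-- The handle element in terms of the Casimir operator. -/
noncomputable def naturalHandle : A := ∑ ζ, B.casimir (B.parity ζ) (B.dual ζ) * B.e ζ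

theorem naturalHandle_eq : B.naturalHandle = B.handlePart 0 0 - B.handlePart 0 1 +
    B.handlePart 1 0 + B.handlePart 1 1 := by
  have := B.sum_sum_eq_handlePart (fun i j => sgn k ((i + 1) * j))
  simp only [naturalHandle, casimir_apply, Finset.sum_mul, smul_mul_assoc]
  rw [Finset.sum_comm, this]
  simp [show (1 : ZMod 2) + 1 = 0 by decide]
  abel

theorem handle_eq : B.handle = - B.handlePart 0 0 + B.handlePart 0 1 +
    B.handlePart 1 0 + B.handlePart 1 1 := by
  rw [handle, B.sum_sum_eq_handlePart (fun i j => sgn k ((i + 1) * (j + 1)))]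
  simp [show (1 : ZMod 2) + 1 = 0 by decide]

variable [CharZero k]

/-- `casimir 1` vanishes on odd elements; hence so does the sum of `casimir 1 (e^ζ) e_ζ` over the odd
`e^ζ`. -/
theorem handlePart_swap (h𝒜 : IsSuperGrading 𝒜) (hg : IsOddScalarProduct 𝒜 g) :
    B.handlePart 0 0 = B.handlePart 1 0 := by
  have h : ∑ ξ, ∑ ζ, (if B.parity ζ = 0 then sgn k (B.parity ξ + 1) else 0) •
      (B.dual ξ * B.dual ζ * B.e ξ * B.e ζ) = 0 := by
    rw [Finset.sum_comm]
    refine Finset.sum_eq_zero fun ζ _ => ?_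
    by_cases hζ : B.parity ζ = 0
    · have h1 := B.casimir_one_of_odd h𝒜 hg (a := B.dual ζ)
        (by have := B.dual_mem hg ζ; rwa [hζ, zero_add] at this)
      rw [casimir_apply] at h1
      simp only [hζ, if_true]
      have h2 := congrArg (· * B.e ζ) h1
      simpa only [Finset.sum_mul, smul_mul_assoc, mul_one, zero_mul] using h2
    · simp [hζ]
  rw [B.sum_sum_eq_handlePart (fun i j => if j = 0 then sgn k (i + 1) else 0)] at h
  simp [show (1 : ZMod 2) + 1 = 0 by decide] at h
  exact (neg_add_eq_zero.1 h)

/-- A cyclic rotation of `e^ξ e^ζ e_ξ e_ζ` exchanges the two Casimir elements. -/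
theorem handlePart_rotate (h𝒜 : IsSuperGrading 𝒜) (hg : IsOddScalarProduct 𝒜 g) :
    B.handlePart 0 0 = B.handlePart 1 1 := by
  have h1 : B.handlePart 0 0 = ∑ ξ, ∑ ζ,
      (if B.parity ξ = 0 ∧ B.parity ζ = 1 then (1 : k) else 0) •
        (B.dual ζ * B.e ξ * B.e ζ * B.dual ξ) := by
    refine Finset.sum_congr rfl fun ξ _ => ?_
    have := B.sum_mul_left (LinearMap.mk₂ k (fun u w => u * B.e ξ * w)
      (by intros; simp [add_mul]) (by intros; simp [smul_mul_assoc])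
      (by intros; simp [mul_add]) (by intros; simp [mul_smul_comm])) h𝒜 hg
      (fun p => if B.parity ξ = 0 ∧ p = 0 then (1 : k) else 0) (B.dual_mem hg ξ)
    simp only [LinearMap.mk₂_apply, ← mul_assoc] at this
    rw [this]
    refine Finset.sum_congr rfl fun ζ _ => ?_
    congr 1
    refine if_congr ?_ rfl rfl
    grind
  rw [h1, Finset.sum_comm, handlePart]
  refine Finset.sum_congr rfl fun ζ _ => ?_
  have := B.sum_swap (LinearMap.mk₂ k (fun u w => B.dual ζ * u * B.e ζ * w)
      (by intros; simp [mul_add, add_mul]) (by intros; simp [mul_smul_comm, smul_mul_assoc])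
      (by intros; simp [mul_add]) (by intros; simp [mul_smul_comm])) hg
      (fun p => if B.parity ζ = 1 ∧ p = 1 then (1 : k) else 0)
  simp only [LinearMap.mk₂_apply] at this
  rw [this]
  refine Finset.sum_congr rfl fun ξ _ => ?_
  congr 1
  refine if_congr ?_ rfl rfl
  grind

/-- Left multiplication by `u` composed with right multiplication by `b` and with the parity
involution. -/
noncomputable def twistedMul (u b : A) : A →ₗ[k] A :=
  B.e.constr k fun μ => sgn k (B.parity μ + 1) • (u * B.e μ * b)

theorem twistedMul_apply (u b : A) {s : ZMod 2} {y : A} (hy : y ∈ 𝒜 s)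
    (hg : IsOddScalarProduct 𝒜 g) :
    B.twistedMul u b y = sgn k (s + 1) • (u * y * b) := by
  have hy' : y = ∑ μ, g (B.dual μ) y • B.e μ := (B.sum_pairing_smul_e y).symm
  rw [hy']
  simp only [map_sum, map_smul, Finset.mul_sum, Finset.sum_mul, Finset.smul_sum, mul_smul_comm,
    smul_mul_assoc]
  refine Finset.sum_congr rfl fun μ _ => ?_
  rw [twistedMul, Module.Basis.constr_basis, smul_smul, smul_smul]
  by_cases h : B.parity μ = s
  · rw [h, mul_comm]
  · rw [hg.odd _ _ _ (B.dual_mem hg μ) _ hy (by grind)]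
    simp

/-- For even `a` the odd element `casimir 1 a` commutes with everything in the sense of the sign rule;
in particular it anticommutes with itself. -/
theorem casimir_one_mul_self (h𝒜 : IsSuperGrading 𝒜) (hg : IsOddScalarProduct 𝒜 g)
    {a : A} (ha : a ∈ 𝒜 0) : B.casimir 1 a * B.casimir 1 a = 0 := by
  have h1 := B.casimir_mem h𝒜 hg 1 ha
  rw [zero_add] at h1
  have h2 := B.mul_casimir h𝒜 hg 1 a h1
  rw [mul_one, sgn_one, neg_one_smul] at h2
  have h3 : (2 : k) • (B.casimir 1 a * B.casimir 1 a) = 0 := by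
    rw [two_smul]
    nth_rewrite 2 [h2]
    exact add_neg_cancel _
  exact (smul_eq_zero.1 h3).resolve_left two_ne_zero

/-- The element `casimir 1 a` has square zero and is central up to sign, so that the left
multiplication by `z = casimir 1 a * x` has square zero. The values `g(casimir 1 z, b)` are traces of
operators `y ↦ ± z y b`, which have square zero as well. -/
theorem casimir_one_mul_casimir_one (h𝒜 : IsSuperGrading 𝒜) (hg : IsOddScalarProduct 𝒜 g)
    {a x : A} (ha : a ∈ 𝒜 0) (hx : x ∈ 𝒜 1) : B.casimir 1 (B.casimir 1 a * x) = 0 := by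
  set z := B.casimir 1 a with hz
  have hz1 : z ∈ 𝒜 1 := by simpa using B.casimir_mem h𝒜 hg 1 ha
  have hzx : z * x ∈ 𝒜 0 := by
    have := h𝒜.mul_mem _ _ _ hz1 _ hx
    rwa [show (1 : ZMod 2) + 1 = 0 by decide] at this
  refine hg.nondegenerate _ fun b => ?_
  have htr : ∀ s, ∀ b ∈ 𝒜 s, g (B.casimir 1 (z * x)) b = 0 := by
    intro s b hb
    have h1 : g (B.casimir 1 (z * x)) b = LinearMap.trace k A (B.twistedMul (z * x) b) := by
      rw [B.trace_eq_sum, casimir_apply, map_sum, LinearMap.sum_apply]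
      refine Finset.sum_congr rfl fun μ _ => ?_
      rw [twistedMul, Module.Basis.constr_basis, map_smul, map_smul, LinearMap.smul_apply, mul_one,
        mul_assoc (B.dual μ), hg.invariant]
    rw [h1]
    refine (LinearMap.isNilpotent_trace_of_isNilpotent ⟨2, ?_⟩).eq_zero
    refine B.e.ext fun μ => ?_
    rw [pow_two, Module.End.mul_apply, B.twistedMul_apply _ _ (B.e_mem μ) hg, map_smul,
      B.twistedMul_apply _ _ (h𝒜.mul_mem _ _ _ (h𝒜.mul_mem _ _ _ hzx _ (B.e_mem μ)) _ hb) hg]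
    have : z * x * (z * x * B.e μ * b) * b = 0 := by
      have h0 : ∀ w, z * x * (z * x * w) = 0 := by
        intro w
        obtain ⟨p, hp, q, hq, rfl⟩ := B.exists_homogeneous_add 0 w
        have h1 := B.mul_casimir h𝒜 hg 1 a hx
        rw [← hz] at h1
        calc z * x * (z * x * (p + q)) = z * (x * z) * x * (p + q) := by simp only [mul_assoc]
          _ = 0 := by
            rw [h1, mul_smul_comm, ← mul_assoc, hz, casimir_one_mul_self B h𝒜 hg ha]
            simp
      simp only [mul_assoc] at h0 ⊢
      exact h0 _
    rw [this]
    simp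
  obtain ⟨p, hp, q, hq, rfl⟩ := B.exists_homogeneous_add 0 b
  rw [map_add, htr _ _ hp, htr _ _ hq, add_zero]

/-- The sum of `casimir 1 (e^ζ) e_ζ` over the even `e^ζ` pairs with an odd element `x` to the negative
of the trace of `y ↦ casimir 1 (y x)` on the odd part of `A`; this operator has square zero by
`casimir_one_mul_casimir_one`. -/
theorem handlePart_odd (h𝒜 : IsSuperGrading 𝒜) (hg : IsOddScalarProduct 𝒜 g) :
    B.handlePart 0 1 = B.handlePart 1 1 := by
  have h : ∑ ξ, ∑ ζ, (if B.parity ζ = 1 then sgn k (B.parity ξ + 1) else 0) •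
      (B.dual ξ * B.dual ζ * B.e ξ * B.e ζ) = 0 := by
    have e1 : ∑ ξ, ∑ ζ, (if B.parity ζ = 1 then sgn k (B.parity ξ + 1) else 0) •
      (B.dual ξ * B.dual ζ * B.e ξ * B.e ζ) =
        ∑ ζ, (if B.parity ζ = 1 then (1 : k) else 0) • (B.casimir 1 (B.dual ζ) * B.e ζ) := by
      rw [Finset.sum_comm]
      refine Finset.sum_congr rfl fun ζ _ => ?_
      rw [casimir_apply, Finset.sum_mul, Finset.smul_sum]
      refine Finset.sum_congr rfl fun ξ _ => ?_
      rw [smul_mul_assoc, smul_smul, mul_one]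
      congr 1
      split_ifs <;> simp
    rw [e1]
    refine hg.nondegenerate _ fun x => ?_
    have key : ∀ s, ∀ x ∈ 𝒜 s, g (∑ ζ, (if B.parity ζ = 1 then (1 : k) else 0) •
        (B.casimir 1 (B.dual ζ) * B.e ζ)) x = 0 := by
      intro s x hx
      -- the projection onto the odd part of `A`
      let π : A →ₗ[k] A := B.e.constr k fun ζ =>
        (if B.parity ζ = 1 then (1 : k) else 0) • B.e ζ
      have hπ : ∀ y, π y ∈ 𝒜 1 := by
        intro y
        rw [← B.sum_pairing_smul_e y]
        simp only [π, map_sum, map_smul, Module.Basis.constr_basis]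
        refine Submodule.sum_mem _ fun μ _ => Submodule.smul_mem _ _ ?_
        split_ifs with h
        · rw [one_smul, ← h]; exact B.e_mem μ
        · rw [zero_smul]; exact Submodule.zero_mem _
      have hπ1 : ∀ y ∈ 𝒜 1, π y = y := by
        intro y hy
        have hy' : y = ∑ μ, g (B.dual μ) y • B.e μ := (B.sum_pairing_smul_e y).symm
        rw [hy']
        simp only [π, map_sum, map_smul, Module.Basis.constr_basis]
        refine Finset.sum_congr rfl fun μ _ => ?_
        split_ifs with h
        · rw [one_smul]
        · rw [hg.odd _ _ _ (B.dual_mem hg μ) _ hy (by grind), zero_smul, zero_smul]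
      rcases zmod_two_cases s with rfl | rfl
      · rw [map_sum, LinearMap.sum_apply]
        refine Finset.sum_eq_zero fun ζ _ => ?_
        split_ifs with h
        · have h1 := B.casimir_mem h𝒜 hg 1 (B.dual_mem hg ζ)
          rw [one_smul]
          exact hg.odd _ _ _ (h𝒜.mul_mem _ _ _ h1 _ (B.e_mem ζ)) _ hx (by rw [h]; decide)
        · rw [zero_smul, map_zero, LinearMap.zero_apply]
      · let Q : A →ₗ[k] A := B.casimir 1 ∘ₗ LinearMap.mulRight k x ∘ₗ π
        have hQ : Q ^ 2 = 0 := by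
          ext y
          have hy0 : π y * x ∈ 𝒜 0 := by
            have := h𝒜.mul_mem _ _ _ (hπ y) _ hx
            rwa [show (1 : ZMod 2) + 1 = 0 by decide] at this
          have h1 : Q y ∈ 𝒜 1 := by
            have := B.casimir_mem h𝒜 hg 1 hy0
            rwa [zero_add] at this
          rw [pow_two, Module.End.mul_apply]
          change B.casimir 1 (π (Q y) * x) = 0
          rw [hπ1 _ h1]
          exact B.casimir_one_mul_casimir_one h𝒜 hg hy0 hx
        have htr : LinearMap.trace k A Q = 0 :=
          (LinearMap.isNilpotent_trace_of_isNilpotent ⟨2, hQ⟩).eq_zero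
        rw [B.trace_eq_sum] at htr
        rw [map_sum, LinearMap.sum_apply, ← neg_eq_zero, ← Finset.sum_neg_distrib]
        refine Eq.trans ?_ htr
        refine Finset.sum_congr rfl fun ζ _ => ?_
        have : Q (B.e ζ) = B.casimir 1 (((if B.parity ζ = 1 then (1 : k) else 0) • B.e ζ) * x) := by
          change B.casimir 1 (π (B.e ζ) * x) = _
          rw [show π (B.e ζ) = _ from B.e.constr_basis k _ ζ]
        rw [this, smul_mul_assoc, map_smul, map_smul, map_smul, LinearMap.smul_apply,
          hg.invariant, pairing_casimir B hg, sgn_one, smul_eq_mul, smul_eq_mul, neg_one_mul,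
          mul_neg, neg_neg]
    obtain ⟨p, hp, q, hq, rfl⟩ := B.exists_homogeneous_add 0 x
    rw [map_add, key _ _ hp, key _ _ hq, add_zero]
  rw [B.sum_sum_eq_handlePart (fun i j => if j = 1 then sgn k (i + 1) else 0)] at h
  simp [show (1 : ZMod 2) + 1 = 0 by decide] at h
  exact (neg_add_eq_zero.1 h)

/-- The two sign conventions for the handle element agree. Their difference is a combination of the
four parts of given parities, and these parts are all equal. -/
theorem handle_eq_naturalHandle (h𝒜 : IsSuperGrading 𝒜) (hg : IsOddScalarProduct 𝒜 g) :
    B.handle = B.naturalHandle := by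
  rw [handle_eq, naturalHandle_eq, ← B.handlePart_swap h𝒜 hg, B.handlePart_odd h𝒜 hg,
    ← B.handlePart_rotate h𝒜 hg]
  abel

end DualBases

end DualBasesMul

/-! ### Traces of words -/

section Words

variable {k A : Type*} [Field k] [NonUnitalRing A] [Module k A]
  {𝒜 : ZMod 2 → Submodule k A} {g : A →ₗ[k] A →ₗ[k] k} {ι : Type*} [DecidableEq ι]

theorem wordProd_cons {l : List A} (a : A) (hl : l ≠ []) :
    wordProd (a :: l) = a * wordProd l := by
  have key : ∀ (l : List A) (a b : A), (l.foldl (· * ·) (a * b)) = a * l.foldl (· * ·) b := by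
    intro l
    induction l with
    | nil => intro a b; rfl
    | cons c l ih => intro a b; simp only [List.foldl_cons]; rw [mul_assoc, ih]
  cases l with
  | nil => exact absurd rfl hl
  | cons b l => exact key l a b

theorem wordProd_append {l l' : List A} (hl : l ≠ []) (hl' : l' ≠ []) :
    wordProd (l ++ l') = wordProd l * wordProd l' := by
  induction l with
  | nil => exact absurd rfl hl
  | cons a l ih =>
    rw [List.cons_append, wordProd_cons a (by simp [hl'])]
    cases l with
    | nil => rfl
    | cons b l => rw [ih (by simp), wordProd_cons a (l := b :: l) (by simp), mul_assoc]

theorem oddTrace_append (hg : IsOddScalarProduct 𝒜 g) {l l' : List A} (hl : l ≠ [])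
    (hl' : l' ≠ []) : oddTrace g (l ++ l') = g (wordProd l) (wordProd l') := by
  cases l with
  | nil => exact absurd rfl hl
  | cons a l =>
    cases l with
    | nil => rfl
    | cons b l =>
      change g a (wordProd ((b :: l) ++ l')) = _
      rw [wordProd_append (by simp) hl', wordProd_cons a (by simp), hg.invariant]

/-- A word of homogeneous elements: every letter is recorded together with its parity. -/
abbrev Word (A : Type*) := List (ZMod 2 × A)

namespace Word

/-- All letters are homogeneous of the recorded parities. -/
def Homogeneous (𝒜 : ZMod 2 → Submodule k A) (c : Word A) : Prop := ∀ x ∈ c, x.2 ∈ 𝒜 x.1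

/-- The product of the letters. -/
def prod (c : Word A) : A := wordProd (c.map Prod.snd)

/-- The parity of a word. -/
def parity (c : Word A) : ZMod 2 := (c.map Prod.fst).sum

/-- The odd trace of a word. -/
def trace (g : A →ₗ[k] A →ₗ[k] k) (c : Word A) : k := oddTrace g (c.map Prod.snd)

@[simp] theorem parity_nil : parity ([] : Word A) = 0 := rfl

@[simp] theorem parity_cons (x : ZMod 2 × A) (c : Word A) :
    parity (x :: c) = x.1 + parity c := by simp [parity]

@[simp] theorem parity_append (c c' : Word A) : parity (c ++ c') = parity c + parity c' := by
  simp [parity]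

@[simp] theorem prod_singleton (x : ZMod 2 × A) : prod [x] = x.2 := rfl

theorem prod_cons (x : ZMod 2 × A) {c : Word A} (h : c ≠ []) : prod (x :: c) = x.2 * prod c :=
  wordProd_cons _ (by simpa using h)

theorem prod_append {c c' : Word A} (h : c ≠ []) (h' : c' ≠ []) :
    prod (c ++ c') = prod c * prod c' := by
  unfold prod
  rw [List.map_append, wordProd_append (by simpa using h) (by simpa using h')]

theorem Homogeneous.append {c c' : Word A} (h : Homogeneous 𝒜 c) (h' : Homogeneous 𝒜 c') :
    Homogeneous 𝒜 (c ++ c') := fun x hx => (List.mem_append.1 hx).elim (h x) (h' x)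

theorem Homogeneous.head {x : ZMod 2 × A} {c : Word A} (h : Homogeneous 𝒜 (x :: c)) :
    x.2 ∈ 𝒜 x.1 := h x (by simp)

theorem Homogeneous.tail {x : ZMod 2 × A} {c : Word A} (h : Homogeneous 𝒜 (x :: c)) :
    Homogeneous 𝒜 c := fun y hy => h y (List.mem_cons_of_mem _ hy)

theorem homogeneous_cons {x : ZMod 2 × A} {c : Word A} (hx : x.2 ∈ 𝒜 x.1)
    (h : Homogeneous 𝒜 c) : Homogeneous 𝒜 (x :: c) := fun y hy =>
  (List.mem_cons.1 hy).elim (fun e => e ▸ hx) (h y)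

theorem homogeneous_nil : Homogeneous 𝒜 ([] : Word A) := fun x hx => by simp at hx

theorem prod_mem (h𝒜 : IsSuperGrading 𝒜) {c : Word A} (h : Homogeneous 𝒜 c) :
    prod c ∈ 𝒜 (parity c) := by
  induction c with
  | nil => exact Submodule.zero_mem _
  | cons x c ih =>
    by_cases hc : c = []
    · subst hc
      simpa using h.head
    · rw [prod_cons x hc, parity_cons]
      exact h𝒜.mul_mem _ _ _ h.head _ (ih h.tail)

theorem trace_cons (x : ZMod 2 × A) (c : Word A) : trace g (x :: c) = g x.2 (prod c) := rfl

theorem trace_append (hg : IsOddScalarProduct 𝒜 g) {c c' : Word A} (h : c ≠ []) (h' : c' ≠ []) :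
    trace g (c ++ c') = g (prod c) (prod c') := by
  unfold trace prod
  rw [List.map_append, oddTrace_append hg (by simpa using h) (by simpa using h')]

theorem trace_comm (B : DualBases 𝒜 g ι) (hg : IsOddScalarProduct 𝒜 g) (c c' : Word A) :
    trace g (c ++ c') = trace g (c' ++ c) := by
  by_cases h : c = []
  · simp [h]
  by_cases h' : c' = []
  · simp [h']
  rw [trace_append hg h h', trace_append hg h' h, B.pairing_comm hg]

theorem trace_middle_cons (B : DualBases 𝒜 g ι) (hg : IsOddScalarProduct 𝒜 g)
    (x : ZMod 2 × A) (l r : Word A) :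
    trace g (l ++ x :: r) = g x.2 (prod (r ++ l)) := by
  rw [trace_comm B hg, List.cons_append, trace_cons]

/-- The trace vanishes on words of even parity. -/
theorem trace_eq_zero (h𝒜 : IsSuperGrading 𝒜) (hg : IsOddScalarProduct 𝒜 g) {c : Word A}
    (h : Homogeneous 𝒜 c) (hc : parity c ≠ 1) : trace g c = 0 := by
  cases c with
  | nil => rfl
  | cons x c =>
    rw [trace_cons]
    exact hg.odd _ _ _ h.head _ (prod_mem h𝒜 h.tail) (by simpa using hc)

/-- A homogeneous element that commutes with all elements up to the Koszul sign. -/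
structure IsCentral (𝒜 : ZMod 2 → Submodule k A) (z : ZMod 2 × A) : Prop where
  mem : z.2 ∈ 𝒜 z.1
  comm : ∀ t, ∀ x ∈ 𝒜 t, z.2 * x = sgn k (z.1 * t) • (x * z.2)

theorem homogeneous_of_isCentral {c : Word A} (h : ∀ z ∈ c, IsCentral 𝒜 z) : Homogeneous 𝒜 c :=
  fun x hx => (h x hx).mem

theorem trace_swap_central (B : DualBases 𝒜 g ι)
    (hg : IsOddScalarProduct 𝒜 g) (l r : Word A)
    {z x : ZMod 2 × A} (hz : IsCentral 𝒜 z) (hx : x.2 ∈ 𝒜 x.1) :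
    trace g (l ++ z :: x :: r) = sgn k (z.1 * x.1) * trace g (l ++ x :: z :: r) := by
  rw [trace_comm B hg l, trace_comm B hg l]
  by_cases h : r ++ l = []
  · simp only [List.cons_append, h]
    simp only [trace_cons, prod_singleton]
    rw [B.pairing_comm hg]
    by_cases hp : x.1 + z.1 = 1
    · have : ∀ a b : ZMod 2, a + b = 1 → b * a = 0 := by decide
      rw [this _ _ hp, sgn_zero, one_mul]
    · rw [hg.odd _ _ _ hx _ hz.mem hp, mul_zero]
  · have e : ∀ y w : ZMod 2 × A, (y :: w :: r) ++ l = [y, w] ++ (r ++ l) := fun _ _ => rfl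
    rw [e, e, trace_append hg (by simp) h, trace_append hg (by simp) h,
      prod_cons z (c := [x]) (by simp), prod_cons x (c := [z]) (by simp), prod_singleton,
      prod_singleton,
      hz.comm _ _ hx, map_smul, LinearMap.smul_apply, smul_eq_mul]

theorem trace_move_central (B : DualBases 𝒜 g ι)
    (hg : IsOddScalarProduct 𝒜 g) (l : Word A) {c : Word A} (r : Word A)
    {z : ZMod 2 × A} (hz : IsCentral 𝒜 z) (hc : Homogeneous 𝒜 c) :
    trace g (l ++ z :: (c ++ r)) = sgn k (z.1 * parity c) * trace g (l ++ (c ++ z :: r)) := by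
  induction c generalizing l with
  | nil => simp
  | cons x c ih =>
    rw [List.cons_append, trace_swap_central B hg l _ hz hc.head]
    have := ih (l ++ [x]) hc.tail
    simp only [List.append_assoc, List.cons_append, List.nil_append] at this
    rw [this, parity_cons, mul_add, sgn_add, List.cons_append]
    ring

theorem trace_move_central_block (B : DualBases 𝒜 g ι)
    (hg : IsOddScalarProduct 𝒜 g) (l : Word A) {Z c : Word A} (r : Word A)
    (hZ : ∀ z ∈ Z, IsCentral 𝒜 z) (hc : Homogeneous 𝒜 c) :
    trace g (l ++ (Z ++ (c ++ r))) =
      sgn k (parity Z * parity c) * trace g (l ++ (c ++ (Z ++ r))) := by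
  induction Z generalizing l with
  | nil => simp
  | cons z Z ih =>
    have := ih (l ++ [z]) (fun y hy => hZ y (List.mem_cons_of_mem _ hy))
    simp only [List.append_assoc, List.cons_append, List.nil_append] at this
    rw [List.cons_append, this, trace_move_central B hg l _ (hZ z (by simp)) hc, parity_cons,
      add_mul, sgn_add, List.cons_append]
    ring

theorem prod_central [IsScalarTower k A A] [SMulCommClass k A A] (h𝒜 : IsSuperGrading 𝒜)
    {Z : Word A} (hZ : ∀ z ∈ Z, IsCentral 𝒜 z) : IsCentral 𝒜 (parity Z, prod Z) := by
  induction Z with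
  | nil =>
    refine ⟨Submodule.zero_mem _, fun t x _ => ?_⟩
    change 0 * x = _ • (x * 0)
    simp
  | cons z Z ih =>
    have ih := ih fun y hy => hZ y (List.mem_cons_of_mem _ hy)
    have hz := hZ z (by simp)
    refine ⟨prod_mem h𝒜 (homogeneous_of_isCentral hZ), fun t x hx => ?_⟩
    by_cases h : Z = []
    · subst h
      simpa using hz.comm t x hx
    · simp only [prod_cons z h, parity_cons]
      have h2 := ih.comm t x hx
      simp only at h2
      rw [mul_assoc, h2, mul_smul_comm, ← mul_assoc, hz.comm t x hx, smul_mul_assoc, smul_smul,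
        ← sgn_add, mul_assoc]
      congr 2
      ring

end Word

end Words

/-! ### The traces of vertices -/

section VertexTrace

variable {k A : Type*} [Field k] [NonUnitalRing A] [Module k A]
  [IsScalarTower k A A] [SMulCommClass k A A]
  {𝒜 : ZMod 2 → Submodule k A} {g : A →ₗ[k] A →ₗ[k] k} {ι : Type*} [DecidableEq ι] [Fintype ι]

namespace DualBases

open Word

variable (B : DualBases 𝒜 g ι)

/-- The element `T(A)` for a word `A`, with its parity. -/
noncomputable def insertionLetter (c : Word A) : ZMod 2 × A :=
  (c.parity + 1, B.insertion c.parity c.prod)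

/-- The `γ`-th power of the handle element, as a word of `γ` letters: a non-unital algebra has no
zeroth power. -/
noncomputable def handleWord (γ : ℕ) : Word A := List.replicate γ (0, B.handle)

/-- The word `T(A₁) … T(A_{b-1}) A_b Γ ⋯ Γ` of a vertex with the cycles `A₁, …, A_b`. -/
noncomputable def vertexWord (γ : ℕ) (v : List (Word A)) : Word A :=
  v.dropLast.map B.insertionLetter ++ ((v.getLast?.getD []) ++ B.handleWord γ)

/-- The trace of a vertex, without the sign. -/
noncomputable def vertexTrace (γ : ℕ) (v : List (Word A)) : k := (B.vertexWord γ v).trace g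

/-- The exponent of the sign of a vertex. -/
def _root_.StableRibbon.vertexExponent (v : List (Word A)) : ZMod 2 :=
  piExponent (v.flatten.map Prod.fst) + insertionExponent (v.map Word.parity)

theorem vertexTensor_eq {F : Type*} (γ : ℕ) (v : List (List F)) (m : F → ι) :
    B.vertexTensor γ v m =
      sgn k (vertexExponent (v.map (List.map fun x => (B.parity (m x), B.e (m x))))) *
        B.vertexTrace γ (v.map (List.map fun x => (B.parity (m x), B.e (m x)))) := by
  unfold vertexTensor vertexExponent vertexTrace vertexWord Word.trace handleWord
  congr 2
  · congr 2
    · rw [← List.map_flatten, List.map_map]; rfl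
    · rw [List.map_map]
      congr 1
      funext c
      simp [Word.parity, List.map_map, Function.comp_def]
  · rw [List.map_append, List.map_append, List.map_replicate, List.append_assoc]
    congr 2
    · rw [← List.map_dropLast, List.map_map, List.map_map]
      refine List.map_congr_left fun c _ => ?_
      simp [insertionLetter, Word.parity, Word.prod, List.map_map, Function.comp_def]
    · rw [List.getLast?_map]
      cases v.getLast? <;> simp [List.map_map, Function.comp_def]

theorem vertexTrace_concat (γ : ℕ) (v : List (Word A)) (c : Word A) :
    B.vertexTrace γ (v ++ [c]) =
      Word.trace g (v.map B.insertionLetter ++ (c ++ B.handleWord γ)) := by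
  simp [vertexTrace, vertexWord]

/-- The values of `T` commute with all elements in the sense of the sign rule. -/
theorem isCentral_insertionLetter (h𝒜 : IsSuperGrading 𝒜) (hg : IsOddScalarProduct 𝒜 g)
    {c : Word A} (hc : c.Homogeneous 𝒜) : IsCentral 𝒜 (B.insertionLetter c) := by
  constructor
  · simp only [insertionLetter, insertion_eq_casimir]
    exact B.casimir_mem h𝒜 hg _ (prod_mem h𝒜 hc)
  · intro t x hx
    simp only [insertionLetter, insertion_eq_casimir]
    rw [B.mul_casimir h𝒜 hg _ _ hx, smul_smul, ← sgn_add, mul_comm t, CharTwo.add_self_eq_zero,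
      sgn_zero, one_smul]

theorem isCentral_insertionLetters (h𝒜 : IsSuperGrading 𝒜) (hg : IsOddScalarProduct 𝒜 g)
    {v : List (Word A)} (hv : ∀ c ∈ v, c.Homogeneous 𝒜) :
    ∀ z ∈ v.map B.insertionLetter, IsCentral 𝒜 z := by
  intro z hz
  obtain ⟨c, hc, rfl⟩ := List.mem_map.1 hz
  exact B.isCentral_insertionLetter h𝒜 hg (hv c hc)

theorem handle_mem (h𝒜 : IsSuperGrading 𝒜) (hg : IsOddScalarProduct 𝒜 g) : B.handle ∈ 𝒜 0 := by
  rw [handle]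
  refine Submodule.sum_mem _ fun ξ _ => Submodule.sum_mem _ fun ζ _ => Submodule.smul_mem _ _ ?_
  have := h𝒜.mul_mem _ _ _ (h𝒜.mul_mem _ _ _ (h𝒜.mul_mem _ _ _ (B.dual_mem hg ξ) _
    (B.dual_mem hg ζ)) _ (B.e_mem ξ)) _ (B.e_mem ζ)
  convert this using 2
  grind

theorem mul_naturalHandle (h𝒜 : IsSuperGrading 𝒜) (hg : IsOddScalarProduct 𝒜 g) {s : ZMod 2}
    {x : A} (hx : x ∈ 𝒜 s) : x * B.naturalHandle = B.naturalHandle * x := by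
  rw [naturalHandle, Finset.mul_sum, Finset.sum_mul]
  have h1 : ∀ ζ, x * (B.casimir (B.parity ζ) (B.dual ζ) * B.e ζ) =
      sgn k (s * B.parity ζ) • (B.casimir (B.parity ζ) (B.dual ζ) * (x * B.e ζ)) := by
    intro ζ
    rw [← mul_assoc, B.mul_casimir h𝒜 hg _ _ hx, smul_mul_assoc, mul_assoc]
  have key : ∀ j, ∑ ζ, (if B.parity ζ = j then (1 : k) else 0) •
      (B.casimir j (B.dual ζ) * B.e ζ * x) =
      ∑ ζ, (if B.parity ζ + s = j then (1 : k) else 0) •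
        (B.casimir j (x * B.dual ζ) * B.e ζ) := by
    intro j
    have := B.sum_mul_left ((LinearMap.mul k A) ∘ₗ B.casimir j) h𝒜 hg
      (fun p => if p + s = j then (1 : k) else 0) hx
    simp only [LinearMap.comp_apply, LinearMap.mul_apply'] at this
    rw [this]
    refine Finset.sum_congr rfl fun ζ _ => ?_
    rw [add_assoc, CharTwo.add_self_eq_zero, add_zero, mul_assoc]
  have key2 : ∀ j, ∑ ζ, (if B.parity ζ + s = j then (1 : k) else 0) •
        (B.casimir j (B.dual ζ * x) * B.e ζ) =
      ∑ ζ, (if B.parity ζ = j then (1 : k) else 0) •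
      (B.casimir j (B.dual ζ) * (x * B.e ζ)) := by
    intro j
    have := B.sum_mul_right ((LinearMap.mul k A) ∘ₗ B.casimir j) h𝒜 hg
      (fun p => if p + s = j then (1 : k) else 0) hx
    simp only [LinearMap.comp_apply, LinearMap.mul_apply'] at this
    rw [this]
    refine Finset.sum_congr rfl fun ζ _ => ?_
    rw [add_assoc, CharTwo.add_self_eq_zero, add_zero]
  have split : ∀ (f : ι → ZMod 2 → A), ∑ ζ, f ζ (B.parity ζ) =
      ∑ j : ZMod 2, ∑ ζ, (if B.parity ζ = j then (1 : k) else 0) • f ζ j := by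
    intro f
    rw [Finset.sum_comm]
    refine Finset.sum_congr rfl fun ζ _ => ?_
    simp
  rw [Finset.sum_congr rfl fun ζ _ => h1 ζ,
    split (fun ζ j => sgn k (s * j) • (B.casimir j (B.dual ζ) * (x * B.e ζ))),
    split (fun ζ j => B.casimir j (B.dual ζ) * B.e ζ * x)]
  refine Finset.sum_congr rfl fun j _ => ?_
  rw [key]
  simp only [smul_comm _ (sgn k (s * j))]
  rw [← Finset.smul_sum, ← key2, Finset.smul_sum]
  refine Finset.sum_congr rfl fun ζ _ => ?_
  rw [smul_comm, B.casimir_mul_comm h𝒜 hg j (B.dual ζ) hx, smul_mul_assoc]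

variable [CharZero k]

/-- The handle element is central. This is clear for the sign convention of `naturalHandle`. -/
theorem isCentral_handle (h𝒜 : IsSuperGrading 𝒜) (hg : IsOddScalarProduct 𝒜 g) :
    IsCentral 𝒜 ((0 : ZMod 2), B.handle) := by
  refine ⟨B.handle_mem h𝒜 hg, fun t x hx => ?_⟩
  simp only [zero_mul, sgn_zero, one_smul, B.handle_eq_naturalHandle h𝒜 hg]
  exact (B.mul_naturalHandle h𝒜 hg hx).symm

theorem isCentral_handleWord (h𝒜 : IsSuperGrading 𝒜) (hg : IsOddScalarProduct 𝒜 g) (γ : ℕ) :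
    ∀ z ∈ B.handleWord γ, IsCentral 𝒜 z := by
  intro z hz
  rw [List.eq_of_mem_replicate hz]
  exact B.isCentral_handle h𝒜 hg

@[simp] theorem parity_handleWord (γ : ℕ) : (B.handleWord γ).parity = 0 := by
  simp [handleWord, Word.parity]

/-- Derivations annihilate the handle element. -/
theorem derivation_handle (h𝒜 : IsSuperGrading 𝒜) (hg : IsOddScalarProduct 𝒜 g) {I : A →ₗ[k] A}
    (hI : IsOddDerivation 𝒜 g I) : I B.handle = 0 := by
  rw [B.handle_eq_naturalHandle h𝒜 hg, naturalHandle, map_sum]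
  have h1 : ∀ ζ, I (B.casimir (B.parity ζ) (B.dual ζ) * B.e ζ) =
      B.casimir (B.parity ζ + 1) (I (B.dual ζ)) * B.e ζ +
        sgn k (B.parity ζ) • (B.casimir (B.parity ζ) (B.dual ζ) * I (B.e ζ)) := by
    intro ζ
    have h2 := B.casimir_mem h𝒜 hg (B.parity ζ) (B.dual_mem hg ζ)
    have e : B.parity ζ + 1 + 1 = B.parity ζ := by grind
    have h3 := B.derivation_casimir hg hI (B.dual_mem hg ζ) h𝒜
    rw [e] at h2 h3
    rw [hI.leibniz _ _ h2, h3]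
  have split : ∀ (f : ι → ZMod 2 → A), ∑ ζ, f ζ (B.parity ζ) =
      ∑ j : ZMod 2, ∑ ζ, (if B.parity ζ = j then (1 : k) else 0) • f ζ j := by
    intro f
    rw [Finset.sum_comm]
    refine Finset.sum_congr rfl fun ζ _ => ?_
    simp
  have key : ∀ j, ∑ ζ, (if B.parity ζ + 1 = j then (1 : k) else 0) •
      (B.casimir j (I (B.dual ζ)) * B.e ζ) =
      - ∑ ζ, (if B.parity ζ = j then (1 : k) else 0) • (sgn k j •
        (B.casimir j (B.dual ζ) * I (B.e ζ))) := by
    intro j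
    have := B.sum_derivation ((LinearMap.mul k A) ∘ₗ B.casimir j) hg hI
      (fun p => if p + 1 = j then (1 : k) else 0)
    simp only [LinearMap.comp_apply, LinearMap.mul_apply'] at this
    rw [this, ← Finset.sum_neg_distrib]
    refine Finset.sum_congr rfl fun ζ _ => ?_
    rw [add_assoc, CharTwo.add_self_eq_zero, add_zero, smul_smul, ← neg_smul]
    congr 1
    split_ifs with h
    · rw [h, sgn_add, sgn_one]; ring
    · simp
  rw [Finset.sum_congr rfl fun ζ _ => h1 ζ, Finset.sum_add_distrib,
    split (fun ζ j => sgn k j • (B.casimir j (B.dual ζ) * I (B.e ζ)))]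
  have h4 : ∑ ζ, B.casimir (B.parity ζ + 1) (I (B.dual ζ)) * B.e ζ =
      ∑ j : ZMod 2, ∑ ζ, (if B.parity ζ + 1 = j then (1 : k) else 0) •
        (B.casimir j (I (B.dual ζ)) * B.e ζ) := by
    rw [Finset.sum_comm]
    refine Finset.sum_congr rfl fun ζ _ => ?_
    simp
  rw [h4, Finset.sum_congr rfl fun j _ => key j, Finset.sum_neg_distrib]
  exact neg_add_cancel _

/-- The exchange of two neighbouring cycles of a vertex. -/
theorem vertexTrace_swap (h𝒜 : IsSuperGrading 𝒜) (hg : IsOddScalarProduct 𝒜 g) (γ : ℕ)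
    (v₁ v₂ : List (Word A)) {c c' : Word A} (hc : c.Homogeneous 𝒜) (hc' : c'.Homogeneous 𝒜)
    (hne : c ≠ []) (hne' : c' ≠ []) (hv₁ : ∀ c ∈ v₁, c.Homogeneous 𝒜) :
    B.vertexTrace γ (v₁ ++ c :: c' :: v₂) =
      sgn k ((c.parity + 1) * (c'.parity + 1)) * B.vertexTrace γ (v₁ ++ c' :: c :: v₂) := by
  rcases List.eq_nil_or_concat v₂ with rfl | ⟨v₂, d, rfl⟩
  · have e : ∀ c c' : Word A, v₁ ++ [c, c'] = (v₁ ++ [c]) ++ [c'] := by simp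
    rw [e, e, vertexTrace_concat, vertexTrace_concat]
    simp only [List.map_append, List.map_cons, List.map_nil, List.append_assoc]
    have e2 : ∀ c c' : Word A, Word.trace g (v₁.map B.insertionLetter ++ ([B.insertionLetter c] ++
        (c' ++ B.handleWord γ))) = Word.trace g ((B.insertionLetter c :: c') ++
          (B.handleWord γ ++ v₁.map B.insertionLetter)) := by
      intro c c'
      rw [trace_comm B hg]
      simp
    rw [e2, e2]
    have hZ : ∀ z ∈ B.handleWord γ ++ v₁.map B.insertionLetter, IsCentral 𝒜 z := by
      intro z hz
      rcases List.mem_append.1 hz with hz | hz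
      · exact B.isCentral_handleWord h𝒜 hg γ z hz
      · exact B.isCentral_insertionLetters h𝒜 hg hv₁ z hz
    generalize B.handleWord γ ++ v₁.map B.insertionLetter = Z at hZ
    have hcm := prod_mem h𝒜 hc
    have hcm' := prod_mem h𝒜 hc'
    by_cases hZn : Z = []
    · simp only [hZn, List.append_nil, trace_cons, insertionLetter, insertion_eq_casimir]
      rw [B.pairing_casimir hg]
      by_cases hp : c.parity = c'.parity
      · rw [hp, B.pairing_comm hg, zmod_two_mul_self]
      · rw [hg.odd _ _ _ hcm _ (B.casimir_mem h𝒜 hg _ hcm') (by grind),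
          hg.odd _ _ _ (B.casimir_mem h𝒜 hg _ hcm') _ hcm (by grind)]
        simp
    · rw [trace_append hg (by simp) hZn, trace_append hg (by simp) hZn, prod_cons _ hne,
        prod_cons _ hne']
      simp only [insertionLetter, insertion_eq_casimir]
      have hz := prod_central h𝒜 hZ
      generalize Z.prod = r at hz
      generalize Z.parity = t at hz
      have hr := hz.mem
      have hcomm := hz.comm
      simp only at hr hcomm
      generalize c.parity = a at *
      generalize c'.parity = b at *
      rw [hg.invariant, B.pairing_casimir hg]
      have h1 : ∀ j, B.casimir j (c'.prod * r) = sgn k t • (B.casimir (j + t) c'.prod * r) := by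
        intro j
        rw [casimir_apply, casimir_apply, Finset.sum_mul, Finset.smul_sum]
        refine Finset.sum_congr rfl fun μ _ => ?_
        simp only [mul_assoc, smul_mul_assoc]
        rw [hcomm _ _ (B.e_mem μ)]
        simp only [mul_smul_comm, smul_smul, ← sgn_add]
        congr 2
        · ring_nf
          have := CharTwo.add_self_eq_zero t
          linear_combination -this
      rw [h1, map_smul, smul_eq_mul]
      have hC := fun j => B.casimir_mem h𝒜 hg j hcm'
      by_cases hp : a = b + t
      · have hj : a + 1 + t = b + 1 := by grind
        have h2 := hcomm _ _ (hC (b + 1))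
        have h3 : B.casimir (b + 1) c'.prod * r =
            sgn k (t * (b + 1)) • (r * B.casimir (b + 1) c'.prod) := by
          rw [h2, smul_smul, ← sgn_add, CharTwo.add_self_eq_zero, sgn_zero, one_smul]
        rw [hj, h3, map_smul, smul_eq_mul, hg.invariant, ← mul_assoc, ← mul_assoc, ← sgn_add,
          ← sgn_add, B.pairing_comm hg (B.casimir _ _), hg.invariant]
        congr 2
        have := zmod_two_mul_self b
        have := zmod_two_mul_self t
        grind
      · have e1 := h𝒜.mul_mem _ _ _ (hC (a + 1 + t)) _ hr
        have e2 := h𝒜.mul_mem _ _ _ (hC (b + 1)) _ hcm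
        rw [hg.odd _ _ _ hcm _ e1 (by grind), hg.odd _ _ _ e2 _ hr (by grind)]
        simp
  · have e : ∀ c c' : Word A, v₁ ++ c :: c' :: v₂.concat d = (v₁ ++ c :: c' :: v₂) ++ [d] := by simp
    rw [e, e, vertexTrace_concat, vertexTrace_concat]
    simp only [List.map_append, List.map_cons, List.append_assoc, List.cons_append]
    rw [trace_swap_central B hg _ _ (B.isCentral_insertionLetter h𝒜 hg hc)
      (B.isCentral_insertionLetter h𝒜 hg hc').mem]
    rfl

/-- The rotation of a cycle of a vertex. -/
theorem vertexTrace_rotate (h𝒜 : IsSuperGrading 𝒜) (hg : IsOddScalarProduct 𝒜 g) (γ : ℕ)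
    (v₁ v₂ : List (Word A)) {c : Word A} {x : ZMod 2 × A} (hx : x.2 ∈ 𝒜 x.1)
    (hc : c.Homogeneous 𝒜) (hv₁ : ∀ c ∈ v₁, c.Homogeneous 𝒜) :
    B.vertexTrace γ (v₁ ++ (x :: c) :: v₂) =
      sgn k (x.1 * c.parity) * B.vertexTrace γ (v₁ ++ (c ++ [x]) :: v₂) := by
  by_cases hcn : c = []
  · subst hcn; simp
  rcases List.eq_nil_or_concat v₂ with rfl | ⟨v₂, d, rfl⟩
  · rw [vertexTrace_concat, vertexTrace_concat]
    have hZ : ∀ z ∈ B.handleWord γ ++ v₁.map B.insertionLetter, IsCentral 𝒜 z := by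
      intro z hz
      rcases List.mem_append.1 hz with hz | hz
      · exact B.isCentral_handleWord h𝒜 hg γ z hz
      · exact B.isCentral_insertionLetters h𝒜 hg hv₁ z hz
    rw [trace_comm B hg, trace_comm B hg (v₁.map _)]
    simp only [List.append_assoc]
    generalize B.handleWord γ ++ v₁.map B.insertionLetter = Z at hZ
    have hZh := homogeneous_of_isCentral hZ
    rw [List.cons_append, ← List.singleton_append, trace_comm B hg [x]]
    have := trace_move_central_block B hg c (Z := Z) (c := [x]) [] hZ
      (homogeneous_cons hx homogeneous_nil)
    simp only [List.append_assoc, List.append_nil] at this ⊢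
    rw [this]
    by_cases hp : Z.parity + x.1 + c.parity = 1
    · congr 2
      have := zmod_two_mul_self x.1
      simp only [parity_cons, parity_nil]
      grind
    · rw [trace_eq_zero h𝒜 hg]
      · simp
      · exact hc.append ((homogeneous_cons hx homogeneous_nil).append hZh)
      · simp only [parity_append, parity_cons, parity_nil]
        grind
  · have e : ∀ c : Word A, v₁ ++ c :: v₂.concat d = (v₁ ++ c :: v₂) ++ [d] := by simp
    rw [e, e, vertexTrace_concat, vertexTrace_concat]
    simp only [List.map_append, List.map_cons, List.append_assoc, List.cons_append]
    rw [trace_middle_cons B hg, trace_middle_cons B hg]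
    simp only [insertionLetter, insertion_eq_casimir]
    rw [prod_cons _ hcn, prod_append hcn (by simp), B.casimir_mul_comm h𝒜 hg _ _ hx, map_smul,
      LinearMap.smul_apply, smul_eq_mul, prod_singleton]
    simp only [parity_append, parity_cons, parity_nil, add_zero]
    rw [add_comm c.parity x.1]
    congr 2
    have := zmod_two_mul_self x.1
    grind

end DualBases

end VertexTrace

/-! ### Contraction of an edge in the traces of vertices -/

section VertexContraction

theorem piExponent_append (l l' : List (ZMod 2)) :
    piExponent (l ++ l') = piExponent l + l'.length * l.sum + piExponent l' := by
  induction l with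
  | nil => simp [piExponent]
  | cons a l ih =>
    simp only [List.cons_append, piExponent, ih, List.length_append, List.sum_cons]
    push_cast
    ring

theorem insertionExponent_append (l l' : List (ZMod 2)) :
    insertionExponent (l ++ l') = insertionExponent l + l.length * l'.sum +
      insertionExponent l' := by
  induction l with
  | nil => simp [insertionExponent]
  | cons a l ih =>
    simp only [List.cons_append, insertionExponent, ih, List.sum_append, List.length_cons]
    push_cast
    ring

variable {k A : Type*} [Field k] [NonUnitalRing A] [Module k A]
  [IsScalarTower k A A] [SMulCommClass k A A]
  {𝒜 : ZMod 2 → Submodule k A} {g : A →ₗ[k] A →ₗ[k] k} {ι : Type*} [DecidableEq ι] [Fintype ι]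

namespace DualBases

open Word

variable (B : DualBases 𝒜 g ι)

/-- A basis vector as a letter. -/
noncomputable def letter (μ : ι) : ZMod 2 × A := (B.parity μ, B.e μ)

theorem letter_mem (μ : ι) : (B.letter μ).2 ∈ 𝒜 (B.letter μ).1 := B.e_mem μ

theorem sum_dual_mul_pairing (ν : ι) (X : A) :
    ∑ μ, g (B.dual μ) (B.dual ν) * g (B.e μ) X = g (B.dual ν) X := by
  conv_rhs => rw [← B.sum_pairing_smul_e (B.dual ν)]
  simp [LinearMap.sum_apply]

theorem pairing_dual_eq_zero (hg : IsOddScalarProduct 𝒜 g) {μ ν : ι}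
    (h : B.parity μ ≠ B.parity ν + 1) : g (B.dual μ) (B.dual ν) = 0 :=
  hg.odd _ _ _ (B.dual_mem hg μ) _ (B.dual_mem hg ν) (by
    generalize B.parity μ = a at *
    generalize B.parity ν = b at *
    revert a b; decide)

/-- The vanishing of the supertraces of all left multiplications, in terms of the dual bases. -/
theorem sum_sgn_e_mul_dual (hg : IsOddScalarProduct 𝒜 g)
    (hTr : ∀ a : A, B.superTrace (LinearMap.mulLeft k a) = 0) :
    ∑ μ, sgn k (B.parity μ) • (B.e μ * B.dual μ) = 0 := by
  refine hg.nondegenerate _ fun b => ?_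
  rw [B.pairing_comm hg, map_sum, ← hTr b]
  refine Finset.sum_congr rfl fun μ _ => ?_
  rw [map_smul, smul_eq_mul, ← hg.invariant, B.pairing_comm hg]
  rfl

theorem sum_sgn_dual_mul_e (hg : IsOddScalarProduct 𝒜 g)
    (hTr : ∀ a : A, B.superTrace (LinearMap.mulLeft k a) = 0) :
    ∑ μ, sgn k (B.parity μ) • (B.dual μ * B.e μ) = 0 := by
  have := B.sum_swap (LinearMap.mul k A) hg (fun p => sgn k p)
  simp only [LinearMap.mul_apply'] at this
  rw [this]
  simp only [sgn_add, sgn_one, mul_neg, mul_one, neg_smul, Finset.sum_neg_distrib, neg_eq_zero]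
  exact B.sum_sgn_e_mul_dual hg hTr

variable [CharZero k]

/-- The product of the empty word is zero by convention. -/
theorem insertionLetter_nil : (B.insertionLetter []).2 = 0 := by
  simp [insertionLetter, insertion_eq_casimir, Word.prod, wordProd]

/-- If a cycle is empty, the trace of the vertex vanishes: a product of central elements with at
least one factor `T(c)` contains the sum `∑ ± e^μ e_μ`. -/
theorem vertexTrace_concat_nil (h𝒜 : IsSuperGrading 𝒜) (hg : IsOddScalarProduct 𝒜 g)
    (hTr : ∀ a : A, B.superTrace (LinearMap.mulLeft k a) = 0) (γ : ℕ) {cs : List (Word A)}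
    (hcs : ∀ c ∈ cs, c.Homogeneous 𝒜) : B.vertexTrace γ (cs ++ [[]]) = 0 := by
  rw [vertexTrace_concat, List.nil_append]
  cases cs with
  | nil =>
    rw [List.map_nil, List.nil_append]
    refine trace_eq_zero h𝒜 hg (homogeneous_of_isCentral (B.isCentral_handleWord h𝒜 hg γ)) ?_
    simp
  | cons c cs =>
    rw [List.map_cons, List.cons_append, trace_cons]
    have hZ : ∀ z ∈ cs.map B.insertionLetter ++ B.handleWord γ, IsCentral 𝒜 z := by
      intro z hz
      rcases List.mem_append.1 hz with hz | hz
      · exact B.isCentral_insertionLetters h𝒜 hg (fun c hc => hcs c (by simp [hc])) z hz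
      · exact B.isCentral_handleWord h𝒜 hg γ z hz
    have hz := prod_central h𝒜 hZ
    have hc := prod_mem h𝒜 (hcs c (by simp))
    generalize Word.prod (cs.map B.insertionLetter ++ B.handleWord γ) = r at hz
    generalize Word.parity (cs.map B.insertionLetter ++ B.handleWord γ) = t at hz
    simp only [insertionLetter]
    generalize c.prod = a at *
    generalize c.parity = s at *
    have hr := hz.mem
    have hcomm := hz.comm
    simp only at hr hcomm
    -- the pairing is `g(a, C(r))`, and `C(r)` is a multiple of `(∑ ± e^μ e_μ) r`
    rw [insertion_eq_casimir, B.pairing_casimir hg]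
    by_cases hp : s = t
    · subst hp
      have : B.casimir (s + 1) r = 0 := by
        have h0 : ∑ μ, sgn k (B.parity μ) • (B.dual μ * B.e μ * r) = 0 := by
          have := congrArg (· * r) (B.sum_sgn_dual_mul_e hg hTr)
          simpa [Finset.sum_mul, smul_mul_assoc] using this
        rw [casimir_apply]
        have h1 : ∀ μ, sgn k ((B.parity μ + 1) * (s + 1)) • (B.dual μ * r * B.e μ) =
            sgn k (s + 1) • sgn k (B.parity μ) • (B.dual μ * B.e μ * r) := by
          intro μ
          rw [mul_assoc, hcomm _ _ (B.e_mem μ), mul_smul_comm, smul_smul, smul_smul, ← sgn_add,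
            ← sgn_add, mul_assoc]
          congr 2
          grind
        rw [Finset.sum_congr rfl fun μ _ => h1 μ, ← Finset.smul_sum, h0, smul_zero]
      rw [this]; simp
    · rw [hg.odd _ _ _ hc _ (B.casimir_mem h𝒜 hg _ hr) (by grind), mul_zero]

/-- Contraction of an edge both of whose flags belong to the last cycle of a vertex: the two basis
vectors enclose the word `c` and give `T(c)`. By `hX` something follows the second flag in the trace,
so that the trace is a pairing with `T(c)`. -/
theorem vertexTrace_cut (hg : IsOddScalarProduct 𝒜 g)
    (hTr : ∀ a : A, B.superTrace (LinearMap.mulLeft k a) = 0) (γ : ℕ) (cs : List (Word A))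
    (c c' : Word A) (hX : c' ++ (B.handleWord γ ++ cs.map B.insertionLetter) ≠ []) :
    ∑ μ, ∑ ν, sgn k (B.parity ν * (c.parity + 1)) * (g (B.dual μ) (B.dual ν) *
        B.vertexTrace γ (cs ++ [B.letter μ :: (c ++ B.letter ν :: c')])) =
      sgn k (c.parity + 1) * B.vertexTrace γ (cs ++ [c, c']) := by
  set X := Word.prod (c' ++ (B.handleWord γ ++ cs.map B.insertionLetter)) with hXdef
  have hR : B.vertexTrace γ (cs ++ [c, c']) = g (B.insertion c.parity c.prod) X := by
    have e : cs ++ [c, c'] = (cs ++ [c]) ++ [c'] := by simp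
    rw [e, vertexTrace_concat, List.map_append, List.append_assoc, List.map_singleton,
      List.singleton_append, trace_middle_cons B hg, List.append_assoc]
    rfl
  have hL : ∀ μ ν, B.vertexTrace γ (cs ++ [B.letter μ :: (c ++ B.letter ν :: c')]) =
      g (B.e μ) (Word.prod (c ++ [B.letter ν]) * X) := by
    intro μ ν
    rw [vertexTrace_concat, List.cons_append, trace_middle_cons B hg]
    have e : c ++ B.letter ν :: c' ++ B.handleWord γ ++ cs.map B.insertionLetter =
        (c ++ [B.letter ν]) ++ (c' ++ (B.handleWord γ ++ cs.map B.insertionLetter)) := by simp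
    rw [e, prod_append (by simp) hX]
    rfl
  simp only [hL]
  rw [Finset.sum_comm]
  simp only [← Finset.mul_sum, sum_dual_mul_pairing]
  simp only [← hg.invariant]
  rw [hR]
  by_cases hc : c = []
  · subst hc
    have h0 : ∑ μ, sgn k (B.parity μ) * g (B.dual μ * B.e μ) X = 0 := by
      have := congrArg (fun y => g y X) (B.sum_sgn_dual_mul_e hg hTr)
      simpa [map_sum, LinearMap.sum_apply] using this
    have h1 := B.insertionLetter_nil
    simp only [insertionLetter] at h1
    rw [h1]
    simpa [letter] using h0
  · have h1 : ∀ ν, Word.prod (c ++ [B.letter ν]) = c.prod * B.e ν := fun ν => by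
      rw [prod_append hc (by simp), prod_singleton]; rfl
    simp only [h1, insertion, map_sum, LinearMap.sum_apply, Finset.mul_sum, map_smul,
      LinearMap.smul_apply, smul_eq_mul, ← mul_assoc, ← sgn_add]
    refine Finset.sum_congr rfl fun ν _ => ?_
    congr 2
    grind

/-- Contraction of a pair of basis vectors with `e_μ a` inserted into `e^ρ · e_ρ`; the result is the
handle element. -/
theorem sum_casimir_mul_e (h𝒜 : IsSuperGrading 𝒜) (hg : IsOddScalarProduct 𝒜 g) {s : ZMod 2}
    {a : A} (ha : a ∈ 𝒜 s) :
    ∑ ν, sgn k (B.parity ν * s) • (B.casimir (B.parity ν + s) (B.dual ν * a) * B.e ν) =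
      sgn k s • (a * B.handle) := by
  have split : ∀ (f : ι → ZMod 2 → A), ∑ ζ, f ζ (B.parity ζ) =
      ∑ j : ZMod 2, ∑ ζ, (if B.parity ζ + s = j then (1 : k) else 0) • f ζ (j + s) := by
    intro f
    rw [Finset.sum_comm]
    refine Finset.sum_congr rfl fun ζ _ => ?_
    have : B.parity ζ + s + s = B.parity ζ := by grind
    simp [this]
  have split' : ∀ (f : ι → ZMod 2 → A), ∑ ζ, f ζ (B.parity ζ) =
      ∑ j : ZMod 2, ∑ ζ, (if B.parity ζ = j then (1 : k) else 0) • f ζ j := by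
    intro f
    rw [Finset.sum_comm]
    refine Finset.sum_congr rfl fun ζ _ => ?_
    simp
  have h1 : ∀ ν, sgn k (B.parity ν * s) • (B.casimir (B.parity ν + s) (B.dual ν * a) * B.e ν) =
      sgn k s • (B.casimir (B.parity ν + s) (a * B.dual ν) * B.e ν) := by
    intro ν
    rw [B.casimir_mul_comm h𝒜 hg _ _ ha, smul_mul_assoc, smul_smul, ← sgn_add]
    have := zmod_two_mul_self s
    congr 2
    grind
  have key : ∀ j, ∑ ζ, (if B.parity ζ + s = j then (1 : k) else 0) •
      (B.casimir j (a * B.dual ζ) * B.e ζ) =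
      ∑ ζ, (if B.parity ζ = j then (1 : k) else 0) •
        (B.casimir j (B.dual ζ) * (B.e ζ * a)) := by
    intro j
    have := B.sum_mul_left ((LinearMap.mul k A) ∘ₗ B.casimir j) h𝒜 hg
      (fun p => if p + s = j then (1 : k) else 0) ha
    simp only [LinearMap.comp_apply, LinearMap.mul_apply'] at this
    rw [this]
    refine Finset.sum_congr rfl fun ζ _ => ?_
    rw [add_assoc, CharTwo.add_self_eq_zero, add_zero]
  rw [Finset.sum_congr rfl fun ν _ => h1 ν, ← Finset.smul_sum,
    B.handle_eq_naturalHandle h𝒜 hg, B.mul_naturalHandle h𝒜 hg ha,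
    split (fun ζ j => B.casimir (j + s) (a * B.dual ζ) * B.e ζ), naturalHandle, Finset.sum_mul,
    split' (fun ζ j => B.casimir j (B.dual ζ) * B.e ζ * a)]
  congr 1
  refine Finset.sum_congr rfl fun j _ => ?_
  rw [add_assoc, CharTwo.add_self_eq_zero, add_zero, key]
  simp only [mul_assoc]

/-- Contraction of a loop whose flags belong to the two last cycles of a vertex: the basis vector in
`T(e_μ c)` and the one in the last cycle produce a handle element between `c` and `c'`. -/
theorem vertexTrace_join_loop (h𝒜 : IsSuperGrading 𝒜) (hg : IsOddScalarProduct 𝒜 g) (γ : ℕ)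
    (cs : List (Word A)) (c c' : Word A) (hcs : ∀ c ∈ cs, c.Homogeneous 𝒜)
    (hc : c.Homogeneous 𝒜) (hc' : c'.Homogeneous 𝒜) :
    ∑ μ, ∑ ν, sgn k (B.parity ν * c.parity) * (g (B.dual μ) (B.dual ν) *
        B.vertexTrace γ (cs ++ [B.letter μ :: c, B.letter ν :: c'])) =
      sgn k c.parity * B.vertexTrace (γ + 1) (cs ++ [c ++ c']) := by
  have hT := B.isCentral_insertionLetters h𝒜 hg hcs
  have hTh := homogeneous_of_isCentral hT
  have hΓ := B.isCentral_handle h𝒜 hg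
  have hΓs := B.isCentral_handleWord h𝒜 hg γ
  have hR : B.vertexTrace (γ + 1) (cs ++ [c ++ c']) = Word.trace g
      (c ++ (0, B.handle) :: (c' ++ (B.handleWord γ ++ cs.map B.insertionLetter))) := by
    have e1 := trace_move_central B hg (cs.map B.insertionLetter ++ c)
      (c := c' ++ B.handleWord γ) [] hΓ (hc'.append (homogeneous_of_isCentral hΓs))
    have e2 : B.handleWord (γ + 1) = B.handleWord γ ++ [(0, B.handle)] := by
      rw [handleWord, List.replicate_succ']; rfl
    rw [vertexTrace_concat, e2]
    simp only [zero_mul, sgn_zero, one_mul, List.append_nil, List.append_assoc] at e1 ⊢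
    rw [← e1, trace_comm B hg]
    simp
  have hL : ∀ μ ν, B.vertexTrace γ (cs ++ [B.letter μ :: c, B.letter ν :: c']) =
      g (B.casimir (B.parity μ + c.parity + 1) (Word.prod (B.letter μ :: c)))
        (Word.prod (B.letter ν :: (c' ++ (B.handleWord γ ++ cs.map B.insertionLetter)))) := by
    intro μ ν
    have e : cs ++ [B.letter μ :: c, B.letter ν :: c'] =
      (cs ++ [B.letter μ :: c]) ++ [B.letter ν :: c'] := by simp
    rw [e, vertexTrace_concat, List.map_append, List.append_assoc, List.map_singleton,
      List.singleton_append, trace_middle_cons B hg, List.append_assoc, List.cons_append,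
      insertionLetter, insertion_eq_casimir]
    simp [letter]
  have hL2 : ∀ ν X, ∑ μ, g (B.dual μ) (B.dual ν) *
      g (B.casimir (B.parity μ + c.parity + 1) (Word.prod (B.letter μ :: c))) X =
      g (B.casimir (B.parity ν + c.parity) (Word.prod ((B.parity ν + 1, B.dual ν) :: c))) X := by
    intro ν X
    have key : ∀ F : A →ₗ[k] k, (∀ μ, F (B.e μ) = g (B.casimir (B.parity ν + c.parity)
        (Word.prod (B.letter μ :: c))) X) →
        F (B.dual ν) = g (B.casimir (B.parity ν + c.parity)
          (Word.prod ((B.parity ν + 1, B.dual ν) :: c))) X →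
        ∑ μ, g (B.dual μ) (B.dual ν) *
          g (B.casimir (B.parity μ + c.parity + 1) (Word.prod (B.letter μ :: c))) X =
        g (B.casimir (B.parity ν + c.parity) (Word.prod ((B.parity ν + 1, B.dual ν) :: c))) X := by
      intro F hF hF'
      rw [← hF']
      conv_rhs => rw [← B.sum_pairing_smul_e (B.dual ν)]
      rw [map_sum]
      refine Finset.sum_congr rfl fun μ _ => ?_
      rw [map_smul, smul_eq_mul, hF]
      by_cases hp : B.parity μ = B.parity ν + 1
      · have : B.parity μ + c.parity + 1 = B.parity ν + c.parity := by grind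
        rw [this]
      · rw [B.pairing_dual_eq_zero hg hp, zero_mul, zero_mul]
    by_cases hcn : c = []
    · subst hcn
      exact key ((g.flip X) ∘ₗ B.casimir _) (fun _ => rfl) rfl
    · exact key ((g.flip X) ∘ₗ B.casimir _ ∘ₗ LinearMap.mulRight k c.prod)
        (fun _ => by rw [prod_cons _ hcn]; rfl) (by rw [prod_cons _ hcn]; rfl)
  simp only [hL]
  rw [Finset.sum_comm]
  simp only [← Finset.mul_sum, hL2]
  rw [hR]
  by_cases hX : c' ++ (B.handleWord γ ++ cs.map B.insertionLetter) = []
  · rw [hX]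
    simp only [prod_singleton]
    change ∑ ν, _ * g _ (B.e ν) = _
    by_cases hcn : c = []
    · subst hcn
      rw [Finset.sum_eq_zero, List.nil_append, trace_cons]
      · simp [Word.prod, wordProd]
      · intro ν _
        simp only [prod_singleton]
        rw [hg.odd _ _ _ (B.casimir_mem h𝒜 hg _ (B.dual_mem hg ν)) _ (B.e_mem ν), mul_zero]
        generalize B.parity ν = p
        revert p; decide
    · have hcm := prod_mem h𝒜 hc
      have h1 : ∀ ν, g (B.casimir (B.parity ν + c.parity)
          (Word.prod ((B.parity ν + 1, B.dual ν) :: c))) (B.e ν) =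
          sgn k (B.parity ν + c.parity) * g c.prod
            (B.casimir (B.parity ν + c.parity) (B.e ν) * B.dual ν) := by
        intro ν
        rw [prod_cons _ hcn, B.pairing_casimir hg, B.pairing_mul_left hg]
      simp only [h1]
      rw [trace_append hg hcn (by simp), prod_singleton]
      generalize c.prod = a at *
      generalize c.parity = s at *
      have split : ∀ (f : ι → ZMod 2 → A), ∑ ζ, f ζ (B.parity ζ) =
          ∑ j : ZMod 2, ∑ ζ, (if B.parity ζ = j then (1 : k) else 0) • f ζ j := by
        intro f
        rw [Finset.sum_comm]
        refine Finset.sum_congr rfl fun ζ _ => ?_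
        simp
      have split' : ∀ (f : ι → ZMod 2 → A), ∑ ζ, f ζ (B.parity ζ) =
          ∑ j : ZMod 2, ∑ ζ, (if B.parity ζ + 1 = j then (1 : k) else 0) • f ζ (j + 1) := by
        intro f
        rw [Finset.sum_comm]
        refine Finset.sum_congr rfl fun ζ _ => ?_
        have : B.parity ζ + 1 + 1 = B.parity ζ := by grind
        simp [this]
      have h2 : ∀ j, ∑ ν, (if B.parity ν + 1 = j then (1 : k) else 0) •
          (B.casimir j (B.e ν) * B.dual ν) =
          ∑ ν, (if B.parity ν = j then (1 : k) else 0) • (B.casimir j (B.dual ν) * B.e ν) := by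
        intro j
        have := B.sum_swap ((LinearMap.mul k A) ∘ₗ B.casimir j) hg
          (fun p => if p = j then (1 : k) else 0)
        simp only [LinearMap.comp_apply, LinearMap.mul_apply'] at this
        exact this.symm
      have h3 : ∑ ν, B.casimir (B.parity ν + 1) (B.e ν) * B.dual ν = B.handle := by
        rw [B.handle_eq_naturalHandle h𝒜 hg, naturalHandle,
          split (fun ζ j => B.casimir j (B.dual ζ) * B.e ζ),
          split' (fun ζ j => B.casimir (j + 1) (B.e ζ) * B.dual ζ)]
        refine Finset.sum_congr rfl fun j _ => ?_
        rw [add_assoc, CharTwo.add_self_eq_zero, add_zero, h2]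
      by_cases hs : s = 1
      · subst hs
        rw [← h3, map_sum, Finset.mul_sum]
        refine Finset.sum_congr rfl fun ν _ => ?_
        rw [← mul_assoc, ← sgn_add]
        congr 2
        grind
      · rw [hg.odd _ _ _ hcm _ (B.handle_mem h𝒜 hg) (by simpa using hs), mul_zero]
        refine Finset.sum_eq_zero fun ν _ => ?_
        have := h𝒜.mul_mem _ _ _ (B.casimir_mem h𝒜 hg (B.parity ν + s) (B.e_mem ν)) _
          (B.dual_mem hg ν)
        rw [hg.odd _ _ _ hcm _ this (by grind)]
        simp
  · set X := Word.prod (c' ++ (B.handleWord γ ++ cs.map B.insertionLetter)) with hXdef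
    have h1 : ∀ ν, Word.prod (B.letter ν :: (c' ++ (B.handleWord γ ++
        cs.map B.insertionLetter))) = B.e ν * X := fun ν => prod_cons _ hX
    simp only [h1, ← hg.invariant]
    by_cases hcn : c = []
    · subst hcn
      rw [List.nil_append, trace_cons, B.handle_eq_naturalHandle h𝒜 hg, naturalHandle]
      simp [map_sum, LinearMap.sum_apply, hXdef]
    · have h2 : Word.trace g (c ++ (0, B.handle) :: (c' ++ (B.handleWord γ ++
          cs.map B.insertionLetter))) = g (c.prod * B.handle) X := by
        rw [trace_append hg hcn (by simp), prod_cons _ hX, hg.invariant]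
      rw [h2]
      have := congrArg (fun y => g y X) (B.sum_casimir_mul_e h𝒜 hg (prod_mem h𝒜 hc))
      simp only [map_sum, LinearMap.sum_apply, map_smul, LinearMap.smul_apply, smul_eq_mul] at this
      rw [← this]
      refine Finset.sum_congr rfl fun ν _ => ?_
      rw [prod_cons _ hcn]

/-- Contraction of an edge that joins the last cycles of two vertices. -/
theorem vertexTrace_join (h𝒜 : IsSuperGrading 𝒜) (hg : IsOddScalarProduct 𝒜 g) (γ γ' : ℕ)
    (cs cs' : List (Word A)) (c c' : Word A) (hcs : ∀ c ∈ cs, c.Homogeneous 𝒜)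
    (hcs' : ∀ c ∈ cs', c.Homogeneous 𝒜)
    (hc : c.Homogeneous 𝒜) (hc' : c'.Homogeneous 𝒜)
    (hX : c ++ (B.handleWord γ ++ cs.map B.insertionLetter) ≠ [])
    (hX' : c' ++ (B.handleWord γ' ++ cs'.map B.insertionLetter) ≠ []) :
    ∑ μ, ∑ ν, g (B.dual μ) (B.dual ν) * (B.vertexTrace γ (cs ++ [B.letter μ :: c]) *
        B.vertexTrace γ' (cs' ++ [B.letter ν :: c'])) =
      sgn k ((Word.parity (cs.map B.insertionLetter)) *
        (c.parity + Word.parity (cs'.map B.insertionLetter))) *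
        B.vertexTrace (γ + γ') (cs ++ cs' ++ [c ++ c']) := by
  have hT := B.isCentral_insertionLetters h𝒜 hg hcs
  have hT' := B.isCentral_insertionLetters h𝒜 hg hcs'
  have hΓ := B.isCentral_handleWord h𝒜 hg γ
  have hΓ' := B.isCentral_handleWord h𝒜 hg γ'
  have hL : ∀ γ (cs : List (Word A)) c μ, B.vertexTrace γ (cs ++ [B.letter μ :: c]) =
      g (B.e μ) (Word.prod (c ++ (B.handleWord γ ++ cs.map B.insertionLetter))) := by
    intro γ cs c μ
    rw [vertexTrace_concat, List.cons_append, trace_middle_cons B hg, List.append_assoc]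
    rfl
  simp only [hL]
  rw [Finset.sum_comm]
  simp only [← mul_assoc, ← Finset.sum_mul, sum_dual_mul_pairing]
  have h1 : ∀ X X', ∑ ν, g (B.dual ν) X * g (B.e ν) X' = g X X' := by
    intro X X'
    conv_rhs => rw [← B.sum_pairing_smul_e X]
    simp [LinearMap.sum_apply]
  rw [h1, ← trace_append hg hX hX', vertexTrace_concat]
  have e2 : B.handleWord (γ + γ') = B.handleWord γ ++ B.handleWord γ' := by
    rw [handleWord, List.replicate_add]; rfl
  rw [e2, List.map_append]
  have pΓ := B.parity_handleWord γ
  have pΓ' := B.parity_handleWord γ'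
  generalize B.handleWord γ = G at *
  generalize B.handleWord γ' = G' at *
  generalize cs.map B.insertionLetter = T at *
  generalize cs'.map B.insertionLetter = T' at *
  have hG := homogeneous_of_isCentral hΓ
  have hTh' := homogeneous_of_isCentral hT'
  have m1 := trace_move_central_block B hg T' (Z := T) (c := c ++ G) (c' ++ G') hT
    (hc.append hG)
  have m2 := trace_move_central_block B hg [] (Z := T) (c := T') (c ++ (G ++ (c' ++ G'))) hT hTh'
  have m3 := trace_move_central_block B hg (T ++ (T' ++ c)) (Z := G) (c := c') G' hΓ hc'
  have m4 := trace_comm B hg (c ++ (G ++ (T ++ (c' ++ G')))) T'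
  simp only [List.append_assoc, List.nil_append, parity_append, pΓ, zero_mul, sgn_zero, one_mul,
    add_zero] at m1 m2 m3 m4 ⊢
  rw [m4, ← m3, m2, ← mul_assoc, ← sgn_add, eq_sgn_mul_comm k m1]
  congr 2
  grind

theorem _root_.StableRibbon.Word.parity_flatten (cs : List (Word A)) :
    Word.parity cs.flatten = (cs.map Word.parity).sum := by
  induction cs with
  | nil => rfl
  | cons c cs ih => simp [ih]

theorem parity_insertionLetters (cs : List (Word A)) : Word.parity (cs.map B.insertionLetter) =
    Word.parity cs.flatten + cs.length := by
  induction cs with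
  | nil => simp
  | cons d cs ih =>
    simp only [List.map_cons, parity_cons, ih, List.flatten_cons, parity_append,
      List.length_cons, insertionLetter]
    push_cast; ring

/-- The trace of a vertex vanishes unless its total parity is the number of cycles. -/
theorem vertexTrace_eq_zero (h𝒜 : IsSuperGrading 𝒜) (hg : IsOddScalarProduct 𝒜 g) (γ : ℕ)
    {v : List (Word A)} (hv : ∀ c ∈ v, c.Homogeneous 𝒜)
    (h : Word.parity v.flatten ≠ v.length) : B.vertexTrace γ v = 0 := by
  rcases List.eq_nil_or_concat v with rfl | ⟨cs, c, rfl⟩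
  · simp at h
  rw [List.concat_eq_append] at h hv ⊢
  have hcs : ∀ c ∈ cs, c.Homogeneous 𝒜 := fun c hc => hv c (by simp [hc])
  have hc : c.Homogeneous 𝒜 := hv c (by simp)
  rw [vertexTrace_concat]
  refine trace_eq_zero h𝒜 hg ?_ ?_
  · exact (homogeneous_of_isCentral (B.isCentral_insertionLetters h𝒜 hg hcs)).append
      (hc.append (homogeneous_of_isCentral (B.isCentral_handleWord h𝒜 hg γ)))
  · simp only [parity_append, parity_insertionLetters, parity_handleWord]
    simp only [List.flatten_append, List.flatten_cons, List.flatten_nil, List.append_nil,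
      parity_append, List.length_append, List.length_cons, List.length_nil] at h
    push_cast at h
    grind

theorem _root_.StableRibbon.vertexExponent_append (v v' : List (Word A)) :
    vertexExponent (v ++ v') = vertexExponent v + vertexExponent v' +
      v'.flatten.length * Word.parity v.flatten + v.length * Word.parity v'.flatten := by
  simp only [vertexExponent, List.flatten_append, List.map_append, piExponent_append,
    insertionExponent_append, List.length_map, parity_flatten]
  have : (v.flatten.map Prod.fst).sum = (v.map Word.parity).sum := parity_flatten v
  rw [this]
  ring

theorem _root_.StableRibbon.vertexExponent_singleton (c : Word A) :
    vertexExponent [c] = piExponent (c.map Prod.fst) := by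
  simp [vertexExponent, insertionExponent]

theorem _root_.StableRibbon.Word.piExponent_append (c c' : Word A) :
    piExponent ((c ++ c').map Prod.fst) = piExponent (c.map Prod.fst) +
      c'.length * c.parity + piExponent (c'.map Prod.fst) := by
  rw [List.map_append, StableRibbon.piExponent_append, List.length_map]
  rfl

theorem _root_.StableRibbon.Word.piExponent_cons (x : ZMod 2 × A) (c : Word A) :
    piExponent ((x :: c).map Prod.fst) = c.length * x.1 + piExponent (c.map Prod.fst) := by
  rw [List.map_cons, piExponent, List.length_map]

/-- The value of the tensor of a vertex on homogeneous elements. -/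
noncomputable def vertexValue (γ : ℕ) (v : List (Word A)) : k :=
  sgn k (vertexExponent v) * B.vertexTrace γ v

/-- A sign that depends on the total parity of a vertex is invisible where the vertex does not vanish.
-/
theorem vertexValue_eq_sgn_mul (h𝒜 : IsSuperGrading 𝒜) (hg : IsOddScalarProduct 𝒜 g) (γ : ℕ)
    {v : List (Word A)} (hv : ∀ c ∈ v, c.Homogeneous 𝒜) (t : ZMod 2) :
    B.vertexValue γ v = sgn k (t * (Word.parity v.flatten + v.length)) * B.vertexValue γ v := by
  by_cases h : Word.parity v.flatten = v.length
  · rw [h, CharTwo.add_self_eq_zero, mul_zero, sgn_zero, one_mul]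
  · rw [vertexValue, vertexTrace_eq_zero B h𝒜 hg γ hv h]
    simp

/-- The sign consists of two parts: the Koszul sign of the removal of the two flags of the edge, and
the sign of the comparison of the two ordered bases (`orientation_cut`). -/
theorem vertexValue_cut (h𝒜 : IsSuperGrading 𝒜) (hg : IsOddScalarProduct 𝒜 g)
    (hTr : ∀ a : A, B.superTrace (LinearMap.mulLeft k a) = 0) (γ : ℕ) (cs : List (Word A))
    (c c' : Word A) (hcs : ∀ c ∈ cs, c.Homogeneous 𝒜)
    (hc : c.Homogeneous 𝒜) (hc' : c'.Homogeneous 𝒜)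
    (hX : c' ++ (B.handleWord γ ++ cs.map B.insertionLetter) ≠ []) :
    ∑ μ, ∑ ν, sgn k (Word.parity cs.flatten + cs.flatten.length +
          (B.parity ν + 1) * (c.parity + c.length) + (cs.flatten.length + c'.length)) *
        (g (B.dual μ) (B.dual ν) *
          B.vertexValue γ (cs ++ [B.letter μ :: (c ++ B.letter ν :: c')])) =
      B.vertexValue γ (cs ++ [c, c']) := by
  rw [B.vertexValue_eq_sgn_mul h𝒜 hg γ (v := cs ++ [c, c']) (t := 1), vertexValue,
    eq_sgn_mul_comm k (B.vertexTrace_cut hg hTr γ cs c c' hX)]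
  · simp only [Finset.mul_sum, vertexValue]
    refine Finset.sum_congr rfl fun μ _ => Finset.sum_congr rfl fun ν _ => ?_
    by_cases hp : B.parity μ = B.parity ν + 1
    · simp only [mul_left_comm _ (g _ _)]
      congr 1
      simp only [← mul_assoc, ← sgn_add]
      congr 2
      have e : cs ++ [c, c'] = cs ++ [c] ++ [c'] := by simp
      rw [e]
      simp only [vertexExponent_append, vertexExponent_singleton, Word.piExponent_append,
        Word.piExponent_cons, List.flatten_append, List.flatten_cons, List.flatten_nil,
        List.append_nil, List.length_append, List.length_cons, List.length_nil, parity_append,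
        parity_cons, letter, hp]
      push_cast
      generalize (cs.flatten.length : ZMod 2) = a1
      generalize (cs.length : ZMod 2) = a2
      generalize (c.length : ZMod 2) = a3
      generalize (c'.length : ZMod 2) = a4
      grind
    · rw [B.pairing_dual_eq_zero hg hp]; simp
  · simp only [List.mem_append, List.mem_cons, List.not_mem_nil, or_false]
    rintro d (hd | rfl | rfl)
    exacts [hcs d hd, hc, hc']

/-- As in `vertexValue_cut`, the sign is the Koszul sign of the removal of the edge together with that of
the comparison of the ordered bases (`orientation_join_loop`). -/
theorem vertexValue_join_loop (h𝒜 : IsSuperGrading 𝒜) (hg : IsOddScalarProduct 𝒜 g) (γ : ℕ)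
    (cs : List (Word A)) (c c' : Word A) (hcs : ∀ c ∈ cs, c.Homogeneous 𝒜)
    (hc : c.Homogeneous 𝒜) (hc' : c'.Homogeneous 𝒜) :
    ∑ μ, ∑ ν, sgn k (Word.parity cs.flatten + cs.flatten.length +
          (B.parity ν + 1) * (c.parity + c.length) + (cs.flatten.length + c'.length)) *
        (g (B.dual μ) (B.dual ν) *
          B.vertexValue γ (cs ++ [B.letter μ :: c, B.letter ν :: c'])) =
      B.vertexValue (γ + 1) (cs ++ [c ++ c']) := by
  rw [B.vertexValue_eq_sgn_mul h𝒜 hg (γ + 1) (v := cs ++ [c ++ c']) (t := 1), vertexValue,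
    eq_sgn_mul_comm k (B.vertexTrace_join_loop h𝒜 hg γ cs c c' hcs hc hc')]
  · simp only [Finset.mul_sum, vertexValue]
    refine Finset.sum_congr rfl fun μ _ => Finset.sum_congr rfl fun ν _ => ?_
    by_cases hp : B.parity μ = B.parity ν + 1
    · simp only [mul_left_comm _ (g _ _)]
      congr 1
      simp only [← mul_assoc, ← sgn_add]
      congr 2
      have e : ∀ c c' : Word A, cs ++ [c, c'] = cs ++ [c] ++ [c'] := by simp
      rw [e]
      simp only [vertexExponent_append, vertexExponent_singleton, Word.piExponent_append,
        Word.piExponent_cons, List.flatten_append, List.flatten_cons, List.flatten_nil,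
        List.append_nil, List.length_append, List.length_cons, List.length_nil, parity_append,
        parity_cons, letter, hp]
      push_cast
      generalize (cs.flatten.length : ZMod 2) = a1
      generalize (cs.length : ZMod 2) = a2
      generalize (c.length : ZMod 2) = a3
      generalize (c'.length : ZMod 2) = a4
      grind
    · rw [B.pairing_dual_eq_zero hg hp]; simp
  · simp only [List.mem_append, List.mem_cons, List.not_mem_nil, or_false]
    rintro d (hd | rfl)
    exacts [hcs d hd, hc.append hc']

/-- As in `vertexValue_cut`, the sign is the Koszul sign of the removal of the edge, here also with a
transposition of the blocks of `c` and `cs'`, together with that of the comparison of the ordered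
bases (`orientation_join`). -/
theorem vertexValue_join (h𝒜 : IsSuperGrading 𝒜) (hg : IsOddScalarProduct 𝒜 g) (γ γ' : ℕ)
    (cs cs' : List (Word A)) (c c' : Word A) (hcs : ∀ c ∈ cs, c.Homogeneous 𝒜)
    (hcs' : ∀ c ∈ cs', c.Homogeneous 𝒜)
    (hc : c.Homogeneous 𝒜) (hc' : c'.Homogeneous 𝒜)
    (hX : c ++ (B.handleWord γ ++ cs.map B.insertionLetter) ≠ [])
    (hX' : c' ++ (B.handleWord γ' ++ cs'.map B.insertionLetter) ≠ []) :
    ∑ μ, ∑ ν, sgn k ((Word.parity cs.flatten + cs.flatten.length +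
          (B.parity ν + 1) * (c.parity + c.length + Word.parity cs'.flatten + cs'.flatten.length) +
          (c.parity + c.length) * (Word.parity cs'.flatten + cs'.flatten.length)) +
          (cs.flatten.length + cs'.flatten.length +
          cs.length * (cs'.flatten.length + c'.length + cs'.length) +
          c.length * cs'.flatten.length)) *
        (g (B.dual μ) (B.dual ν) * (B.vertexValue γ (cs ++ [B.letter μ :: c]) *
          B.vertexValue γ' (cs' ++ [B.letter ν :: c']))) =
      B.vertexValue (γ + γ') (cs ++ cs' ++ [c ++ c']) := by
  rw [vertexValue, eq_sgn_mul_comm k (B.vertexTrace_join h𝒜 hg γ γ' cs cs' c c' hcs hcs' hc hc'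
    hX hX')]
  · simp only [Finset.mul_sum]
    refine Finset.sum_congr rfl fun μ _ => Finset.sum_congr rfl fun ν _ => ?_
    by_cases hp : B.parity μ = B.parity ν + 1
    · rw [B.vertexValue_eq_sgn_mul h𝒜 hg γ (v := cs ++ [B.letter μ :: c])
          (t := Word.parity cs'.flatten + c'.length + cs'.length + c.parity + cs'.flatten.length),
        B.vertexValue_eq_sgn_mul h𝒜 hg γ' (v := cs' ++ [B.letter ν :: c']) (t := cs.length)]
      simp only [vertexValue]
      simp only [mul_left_comm _ (g _ _)]
      congr 1
      have aux : ∀ (a b c b' c' e f : ZMod 2) (x y : k), a + (b + c + (b' + c')) = e + f →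
          sgn k a * (sgn k b * (sgn k c * x) * (sgn k b' * (sgn k c' * y))) =
            sgn k e * (sgn k f * (x * y)) := by
        intro a b c b' c' e f x y h
        have := congrArg (sgn k) h
        simp only [sgn_add] at this
        linear_combination x * y * this
      apply aux
      simp only [vertexExponent_append, vertexExponent_singleton, Word.piExponent_append,
        Word.piExponent_cons, List.flatten_append, List.flatten_cons, List.flatten_nil,
        List.append_nil, List.length_append, List.length_cons, List.length_nil, parity_append,
        parity_cons, letter, hp, parity_insertionLetters]
      push_cast
      generalize (cs.flatten.length : ZMod 2) = a1
      generalize (cs.length : ZMod 2) = a2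
      generalize (c.length : ZMod 2) = a3
      generalize (c'.length : ZMod 2) = a4
      generalize (cs'.flatten.length : ZMod 2) = a5
      generalize (cs'.length : ZMod 2) = a6
      have := zmod_two_mul_self a2
      have := zmod_two_mul_self c.parity
      have := zmod_two_mul_self (Word.parity cs'.flatten)
      have := zmod_two_mul_self (B.parity ν)
      clear aux
      grind
      · simp only [List.mem_append, List.mem_cons, List.not_mem_nil, or_false]
        rintro d (hd | rfl)
        exacts [hcs' d hd, homogeneous_cons (B.letter_mem ν) hc']
      · simp only [List.mem_append, List.mem_cons, List.not_mem_nil, or_false]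
        rintro d (hd | rfl)
        exacts [hcs d hd, homogeneous_cons (B.letter_mem μ) hc]
    · rw [B.pairing_dual_eq_zero hg hp]; simp

end DualBases

end VertexContraction

/-! ### Invariance of the vertices under the derivation -/

section Invariance

variable {k A : Type*} [Field k] [NonUnitalRing A] [Module k A]
  [IsScalarTower k A A] [SMulCommClass k A A]
  {𝒜 : ZMod 2 → Submodule k A} {g : A →ₗ[k] A →ₗ[k] k} {ι : Type*} [DecidableEq ι] [Fintype ι]
  {F : Type*} [DecidableEq F]

/-- The assignment of letters to the elements of `F` in which the operator `I` is applied to the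
letter of `x`. -/
def applyAt (I : A →ₗ[k] A) (a : F → ZMod 2 × A) (x : F) : F → ZMod 2 × A :=
  Function.update a x ((a x).1 + 1, I (a x).2)

theorem applyAt_self (I : A →ₗ[k] A) (a : F → ZMod 2 × A) (x : F) :
    applyAt I a x x = ((a x).1 + 1, I (a x).2) := by simp [applyAt]

theorem applyAt_of_ne (I : A →ₗ[k] A) (a : F → ZMod 2 × A) {x y : F} (h : y ≠ x) :
    applyAt I a x y = a y := by simp [applyAt, h]

theorem map_applyAt (I : A →ₗ[k] A) (a : F → ZMod 2 × A) {x : F} {c : List F} (h : x ∉ c) :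
    c.map (applyAt I a x) = c.map a :=
  List.map_congr_left fun _ hy => applyAt_of_ne I a (ne_of_mem_of_not_mem hy h)

theorem map_map_applyAt (I : A →ₗ[k] A) (a : F → ZMod 2 × A) {x : F} {v : List (List F)}
    (h : x ∉ v.flatten) : v.map (List.map (applyAt I a x)) = v.map (List.map a) :=
  List.map_congr_left fun _ hc =>
    map_applyAt I a fun hx => h (List.mem_flatten.2 ⟨_, hc, hx⟩)

theorem homogeneous_map {a : F → ZMod 2 × A} (ha : ∀ x, (a x).2 ∈ 𝒜 (a x).1) (c : List F) :
    Word.Homogeneous 𝒜 (c.map a) := by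
  intro y hy
  obtain ⟨x, _, rfl⟩ := List.mem_map.1 hy
  exact ha x

theorem precedingSum_cons_of_ne (q : F → ZMod 2) {c : List F} {x y : F}
    (hn : (y :: c).Nodup) (hx : x ∈ c) :
    precedingSum q (y :: c) (y :: c) x = q y + precedingSum q c c x := by
  have := precedingSum_append_right q (l := [y]) (l' := c) hn hx
  simpa using this

theorem parity_map_applyAt (I : A →ₗ[k] A) (a : F → ZMod 2 × A) {x : F} {c : List F}
    (hx : x ∈ c) (hn : c.Nodup) :
    Word.parity (c.map (applyAt I a x)) = Word.parity (c.map a) + 1 := by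
  induction c with
  | nil => simp at hx
  | cons y c ih =>
    have hn' := List.nodup_cons.1 hn
    rw [List.map_cons, List.map_cons, Word.parity_cons, Word.parity_cons]
    by_cases h : x = y
    · subst h
      rw [map_applyAt I a hn'.1, applyAt_self]
      ring
    · rw [applyAt_of_ne I a (Ne.symm h), ih ((List.mem_cons.1 hx).resolve_left h) hn'.2]
      ring

theorem sum_map_cons_congr {M : Type*} [AddCommMonoid M] {f f' : F → M} {c : List F}
    (h : ∀ x ∈ c, f x = f' x) : (c.map f).sum = (c.map f').sum := by
  rw [List.map_congr_left h]

theorem list_sum_map_smul {V : Type*} [AddCommGroup V] [Module k V] (r : k) (f : F → V)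
    (c : List F) : (c.map fun x => r • f x).sum = r • (c.map f).sum := by
  induction c with
  | nil => simp
  | cons y c ih => simp [ih, smul_add]

/-- The Leibniz rule for a product of several factors. -/
theorem derivation_prod {I : A →ₗ[k] A} (hI : IsOddDerivation 𝒜 g I)
    {a : F → ZMod 2 × A} (ha : ∀ x, (a x).2 ∈ 𝒜 (a x).1) {c : List F} (hn : c.Nodup) :
    (c.map fun x => sgn k (precedingSum (fun y => (a y).1) c c x) •
      Word.prod (c.map (applyAt I a x))).sum = I (Word.prod (c.map a)) := by
  induction c with
  | nil => simp [Word.prod, wordProd]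
  | cons y c ih =>
    have hn' := List.nodup_cons.1 hn
    by_cases hc : c = []
    · subst hc
      simp [precedingSum_cons_self, applyAt_self]
    have h1 : ∀ x ∈ c, sgn k (precedingSum (fun y => (a y).1) (y :: c) (y :: c) x) •
        Word.prod ((y :: c).map (applyAt I a x)) =
        sgn k (a y).1 • (LinearMap.mulLeft k (a y).2 (sgn k (precedingSum (fun y => (a y).1) c c x) •
          Word.prod (c.map (applyAt I a x)))) := by
      intro x hx
      have hxy : x ≠ y := ne_of_mem_of_not_mem hx hn'.1
      rw [precedingSum_cons_of_ne _ hn hx, List.map_cons, Word.prod_cons _ (by simpa using hc),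
        applyAt_of_ne I a hxy.symm, map_smul, smul_smul, ← sgn_add]
      rfl
    rw [List.map_cons, List.sum_cons, precedingSum_cons_self, sgn_zero, one_smul,
      sum_map_cons_congr h1, list_sum_map_smul, List.map_cons, List.map_cons,
      Word.prod_cons _ (by simpa using hc), Word.prod_cons _ (by simpa using hc), applyAt_self,
      map_applyAt I a hn'.1, hI.leibniz _ _ (ha y), ← ih hn'.2, ← LinearMap.mulLeft_apply k (a y).2,
      map_list_sum, List.map_map]
    rfl

/-- The parity of what precedes `x` in the word `T(c₁) … T(c_{b-1}) c_b`. -/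
def wordExponent (p : F → ZMod 2) : List (List F) → F → ZMod 2
  | [], _ => 0
  | c :: v, x => if x ∈ c then precedingSum p c c x else (c.map p).sum + 1 + wordExponent p v x

namespace DualBases

open Word

variable (B : DualBases 𝒜 g ι) [CharZero k]

theorem derivation_insertion (h𝒜 : IsSuperGrading 𝒜) (hg : IsOddScalarProduct 𝒜 g)
    {I : A →ₗ[k] A} (hI : IsOddDerivation 𝒜 g I) {a : F → ZMod 2 × A}
    (ha : ∀ x, (a x).2 ∈ 𝒜 (a x).1) {c : List F} (hn : c.Nodup) :
    (c.map fun x => sgn k (precedingSum (fun y => (a y).1) c c x) •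
      (B.insertionLetter (c.map (applyAt I a x))).2).sum = I (B.insertionLetter (c.map a)).2 := by
  have h1 : ∀ x ∈ c, sgn k (precedingSum (fun y => (a y).1) c c x) •
      (B.insertionLetter (c.map (applyAt I a x))).2 = B.casimir (Word.parity (c.map a))
      (sgn k (precedingSum (fun y => (a y).1) c c x) • Word.prod (c.map (applyAt I a x))) := by
    intro x hx
    rw [map_smul, insertionLetter, insertion_eq_casimir, parity_map_applyAt I a hx hn, add_assoc,
      CharTwo.add_self_eq_zero, add_zero]
  rw [sum_map_cons_congr h1, insertionLetter, insertion_eq_casimir,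
    B.derivation_casimir hg hI (prod_mem h𝒜 (homogeneous_map ha c)) h𝒜,
    ← derivation_prod hI ha hn, map_list_sum, List.map_map]
  rfl

theorem derivation_prod_handleWord (h𝒜 : IsSuperGrading 𝒜) (hg : IsOddScalarProduct 𝒜 g)
    {I : A →ₗ[k] A} (hI : IsOddDerivation 𝒜 g I) (γ : ℕ) : I (B.handleWord γ).prod = 0 := by
  induction γ with
  | zero => simp [handleWord, Word.prod, wordProd]
  | succ γ ih =>
    have e : B.handleWord (γ + 1) = (0, B.handle) :: B.handleWord γ := List.replicate_succ
    rw [e]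
    by_cases h : B.handleWord γ = []
    · rw [h, prod_singleton, B.derivation_handle h𝒜 hg hI]
    · rw [prod_cons _ h, hI.leibniz _ _ (B.handle_mem h𝒜 hg), ih, B.derivation_handle h𝒜 hg hI]
      simp

/-- The derivation acts on the product of the word of a vertex letter by letter: it commutes with `T`
and annihilates the handle element. -/
theorem derivation_vertexWord (h𝒜 : IsSuperGrading 𝒜) (hg : IsOddScalarProduct 𝒜 g)
    {I : A →ₗ[k] A} (hI : IsOddDerivation 𝒜 g I) {a : F → ZMod 2 × A}
    (ha : ∀ x, (a x).2 ∈ 𝒜 (a x).1) (γ : ℕ) {v : List (List F)} (hv : v ≠ [])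
    (hne : ∀ c ∈ v, c ≠ []) (hn : v.flatten.Nodup) :
    (v.flatten.map fun x => sgn k (wordExponent (fun y => (a y).1) v x) •
      Word.prod (B.vertexWord γ (v.map (List.map (applyAt I a x))))).sum =
      I (Word.prod (B.vertexWord γ (v.map (List.map a)))) := by
  induction v with
  | nil => exact absurd rfl hv
  | cons c v ih =>
    rw [List.flatten_cons] at hn
    have hn' := List.nodup_append.1 hn
    have hcne : c ≠ [] := hne c (by simp)
    have hx1 : ∀ x ∈ c, x ∉ v.flatten := fun x hx hx' => hn'.2.2 x hx x hx' rfl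
    have hx2 : ∀ x ∈ v.flatten, x ∉ c := fun x hx hx' => hx1 x hx' hx
    by_cases hvn : v = []
    · subst hvn
      have e : ∀ a : F → ZMod 2 × A, B.vertexWord γ ([c].map (List.map a)) =
          c.map a ++ B.handleWord γ := fun a => by simp [vertexWord]
      have h1 : ∀ x ∈ c, sgn k (wordExponent (fun y => (a y).1) [c] x) •
          Word.prod (B.vertexWord γ ([c].map (List.map (applyAt I a x)))) =
          sgn k (precedingSum (fun y => (a y).1) c c x) •
            Word.prod (c.map (applyAt I a x) ++ B.handleWord γ) := by
        intro x hx
        rw [e, wordExponent, if_pos hx]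
      simp only [List.flatten_cons, List.flatten_nil, List.append_nil]
      rw [sum_map_cons_congr h1, e]
      by_cases hγ : B.handleWord γ = []
      · simp only [hγ, List.append_nil]
        exact derivation_prod hI ha hn'.1
      · have h2 : ∀ x ∈ c, sgn k (precedingSum (fun y => (a y).1) c c x) •
            Word.prod (c.map (applyAt I a x) ++ B.handleWord γ) =
            LinearMap.mulRight k (B.handleWord γ).prod
              (sgn k (precedingSum (fun y => (a y).1) c c x) •
                Word.prod (c.map (applyAt I a x))) := by
          intro x hx
          rw [prod_append (by simpa using hcne) hγ, map_smul]
          rfl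
        rw [sum_map_cons_congr h2, prod_append (by simpa using hcne) hγ,
          hI.leibniz _ _ (prod_mem h𝒜 (homogeneous_map ha c)), B.derivation_prod_handleWord h𝒜 hg hI,
          mul_zero, smul_zero, add_zero, ← derivation_prod hI ha hn'.1,
          ← LinearMap.mulRight_apply k, map_list_sum, List.map_map]
        rfl
    · have e : ∀ a : F → ZMod 2 × A, B.vertexWord γ ((c :: v).map (List.map a)) =
          B.insertionLetter (c.map a) :: B.vertexWord γ (v.map (List.map a)) := by
        intro a
        obtain ⟨cs, d, rfl⟩ := (List.eq_nil_or_concat v).resolve_left hvn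
        have h : ∀ l y, B.vertexWord γ (l ++ [y]) =
            l.map B.insertionLetter ++ (y ++ B.handleWord γ) := by simp [vertexWord]
        simp only [List.concat_eq_append, List.map_cons, List.map_append, List.map_nil]
        rw [← List.cons_append, h, h]
        rfl
      have hvne : ∀ a : F → ZMod 2 × A, B.vertexWord γ (v.map (List.map a)) ≠ [] := by
        intro a
        obtain ⟨cs, d, rfl⟩ := (List.eq_nil_or_concat v).resolve_left hvn
        have : d ≠ [] := hne d (by simp)
        simp [vertexWord, this]
      have h1 : ∀ x ∈ c, sgn k (wordExponent (fun y => (a y).1) (c :: v) x) •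
          Word.prod (B.vertexWord γ ((c :: v).map (List.map (applyAt I a x)))) =
          LinearMap.mulRight k (Word.prod (B.vertexWord γ (v.map (List.map a))))
            (sgn k (precedingSum (fun y => (a y).1) c c x) •
              (B.insertionLetter (c.map (applyAt I a x))).2) := by
        intro x hx
        rw [e, wordExponent, if_pos hx, prod_cons _ (hvne _), map_map_applyAt I a (hx1 x hx),
          map_smul]
        rfl
      have h2 : ∀ x ∈ v.flatten, sgn k (wordExponent (fun y => (a y).1) (c :: v) x) •
          Word.prod (B.vertexWord γ ((c :: v).map (List.map (applyAt I a x)))) =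
          sgn k (Word.parity (c.map a) + 1) •
          LinearMap.mulLeft k (B.insertionLetter (c.map a)).2
            (sgn k (wordExponent (fun y => (a y).1) v x) •
              Word.prod (B.vertexWord γ (v.map (List.map (applyAt I a x))))) := by
        intro x hx
        rw [e, wordExponent, if_neg (hx2 x hx), prod_cons _ (hvne _), map_applyAt I a (hx2 x hx),
          map_smul, smul_smul, ← sgn_add]
        simp only [Word.parity, List.map_map]
        rfl
      have hm := (B.isCentral_insertionLetter h𝒜 hg (homogeneous_map ha c)).mem
      rw [List.flatten_cons, List.map_append, List.sum_append, sum_map_cons_congr h1,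
        sum_map_cons_congr h2, list_sum_map_smul, e, prod_cons _ (hvne _), hI.leibniz _ _ hm,
        ← ih hvn (fun c hc => hne c (by simp [hc])) hn'.2.1,
        ← B.derivation_insertion h𝒜 hg hI ha hn'.1, ← LinearMap.mulRight_apply k,
        ← LinearMap.mulLeft_apply k, map_list_sum, map_list_sum, List.map_map, List.map_map]
      rfl

/-- The traces of vertices are annihilated by the derivation. -/
theorem derivation_vertexTrace (h𝒜 : IsSuperGrading 𝒜) (hg : IsOddScalarProduct 𝒜 g)
    {I : A →ₗ[k] A} (hI : IsOddDerivation 𝒜 g I) {a : F → ZMod 2 × A}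
    (ha : ∀ x, (a x).2 ∈ 𝒜 (a x).1) (γ : ℕ) {v : List (List F)}
    (hne : ∀ c ∈ v, c ≠ []) (hn : v.flatten.Nodup) :
    (v.flatten.map fun x => sgn k (wordExponent (fun y => (a y).1) v x) *
      B.vertexTrace γ (v.map (List.map (applyAt I a x)))).sum = 0 := by
  cases v with
  | nil => simp
  | cons c v =>
    rw [List.flatten_cons] at hn
    have hn' := List.nodup_append.1 hn
    have hcne : c ≠ [] := hne c (by simp)
    have hx1 : ∀ x ∈ c, x ∉ v.flatten := fun x hx hx' => hn'.2.2 x hx x hx' rfl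
    have hx2 : ∀ x ∈ v.flatten, x ∉ c := fun x hx hx' => hx1 x hx' hx
    -- pass from `g (I u) w ± g u (I w) = 0` to the sum over the letters
    have key : ∀ {t : ZMod 2} {u : A} (w : A), u ∈ 𝒜 t → g (I u) w + sgn k t * g u (I w) = 0 :=
      fun w hu => hI.antiSelfAdjoint _ _ hu w
    by_cases hvn : v = []
    · subst hvn
      have e : ∀ a : F → ZMod 2 × A, B.vertexTrace γ ([c].map (List.map a)) =
          Word.trace g (c.map a ++ B.handleWord γ) := fun a => by simp [vertexTrace, vertexWord]
      have h1 : ∀ x ∈ c, sgn k (wordExponent (fun y => (a y).1) [c] x) *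
          B.vertexTrace γ ([c].map (List.map (applyAt I a x))) =
          sgn k (precedingSum (fun y => (a y).1) c c x) *
            Word.trace g (c.map (applyAt I a x) ++ B.handleWord γ) := by
        intro x hx
        rw [e, wordExponent, if_pos hx]
      simp only [List.flatten_cons, List.flatten_nil, List.append_nil]
      rw [sum_map_cons_congr h1]
      by_cases hγ : B.handleWord γ = []
      · simp only [hγ, List.append_nil]
        cases c with
        | nil => exact absurd rfl hcne
        | cons y c =>
          have hnc := List.nodup_cons.1 hn'.1
          have h2 : ∀ x ∈ c, sgn k (precedingSum (fun y => (a y).1) (y :: c) (y :: c) x) *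
              Word.trace g ((y :: c).map (applyAt I a x)) =
              sgn k (a y).1 • g (a y).2 (sgn k (precedingSum (fun y => (a y).1) c c x) •
                Word.prod (c.map (applyAt I a x))) := by
            intro x hx
            have hxy : x ≠ y := ne_of_mem_of_not_mem hx hnc.1
            rw [precedingSum_cons_of_ne _ hn'.1 hx, List.map_cons, Word.trace_cons,
              applyAt_of_ne I a hxy.symm, map_smul, smul_eq_mul, smul_eq_mul, ← mul_assoc,
              ← sgn_add]
          rw [List.map_cons, List.sum_cons, precedingSum_cons_self, sgn_zero, one_mul,
            sum_map_cons_congr h2, list_sum_map_smul, List.map_cons, Word.trace_cons, applyAt_self,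
            map_applyAt I a hnc.1]
          have := key (Word.prod (c.map a)) (ha y)
          rw [← derivation_prod hI ha hnc.2, map_list_sum, List.map_map] at this
          exact this
      · have h2 : ∀ x ∈ c, sgn k (precedingSum (fun y => (a y).1) c c x) *
            Word.trace g (c.map (applyAt I a x) ++ B.handleWord γ) =
            g.flip (B.handleWord γ).prod
              (sgn k (precedingSum (fun y => (a y).1) c c x) •
                Word.prod (c.map (applyAt I a x))) := by
          intro x hx
          rw [trace_append hg (by simpa using hcne) hγ, map_smul]
          rfl
        have := key (B.handleWord γ).prod (prod_mem h𝒜 (homogeneous_map ha c))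
        rw [B.derivation_prod_handleWord h𝒜 hg hI, map_zero, mul_zero, add_zero,
          ← derivation_prod hI ha hn'.1, ← LinearMap.flip_apply, map_list_sum, List.map_map] at this
        rw [sum_map_cons_congr h2]
        exact this
    · have e : ∀ a : F → ZMod 2 × A, B.vertexTrace γ ((c :: v).map (List.map a)) =
          g (B.insertionLetter (c.map a)).2 (Word.prod (B.vertexWord γ (v.map (List.map a)))) := by
        intro a
        obtain ⟨cs, d, rfl⟩ := (List.eq_nil_or_concat v).resolve_left hvn
        have h : ∀ l y, B.vertexWord γ (l ++ [y]) =
            l.map B.insertionLetter ++ (y ++ B.handleWord γ) := by simp [vertexWord]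
        simp only [List.concat_eq_append, List.map_cons, List.map_append, List.map_nil]
        rw [← List.cons_append, vertexTrace, h, h]
        rfl
      have h1 : ∀ x ∈ c, sgn k (wordExponent (fun y => (a y).1) (c :: v) x) *
          B.vertexTrace γ ((c :: v).map (List.map (applyAt I a x))) =
          g.flip (Word.prod (B.vertexWord γ (v.map (List.map a))))
            (sgn k (precedingSum (fun y => (a y).1) c c x) •
              (B.insertionLetter (c.map (applyAt I a x))).2) := by
        intro x hx
        rw [e, wordExponent, if_pos hx, map_map_applyAt I a (hx1 x hx), map_smul]
        rfl
      have h2 : ∀ x ∈ v.flatten, sgn k (wordExponent (fun y => (a y).1) (c :: v) x) *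
          B.vertexTrace γ ((c :: v).map (List.map (applyAt I a x))) =
          sgn k (Word.parity (c.map a) + 1) • g (B.insertionLetter (c.map a)).2
            (sgn k (wordExponent (fun y => (a y).1) v x) •
              Word.prod (B.vertexWord γ (v.map (List.map (applyAt I a x))))) := by
        intro x hx
        rw [e, wordExponent, if_neg (hx2 x hx), map_applyAt I a (hx2 x hx), map_smul, smul_eq_mul,
          smul_eq_mul, ← mul_assoc, ← sgn_add]
        simp only [Word.parity, List.map_map]
        rfl
      have hm := (B.isCentral_insertionLetter h𝒜 hg (homogeneous_map ha c)).mem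
      have := key (Word.prod (B.vertexWord γ (v.map (List.map a)))) hm
      rw [← B.derivation_vertexWord h𝒜 hg hI ha γ hvn (fun c hc => hne c (by simp [hc])) hn'.2.1,
        ← B.derivation_insertion h𝒜 hg hI ha hn'.1, ← LinearMap.flip_apply, map_list_sum,
        map_list_sum, List.map_map, List.map_map] at this
      rw [List.flatten_cons, List.map_append, List.sum_append, sum_map_cons_congr h1,
        sum_map_cons_congr h2, list_sum_map_smul]
      exact this

theorem piExponent_map_applyAt (I : A →ₗ[k] A) (a : F → ZMod 2 × A) {x : F} {c : List F}
    (hx : x ∈ c) (hn : c.Nodup) :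
    precedingSum (fun y => (a y).1 + 1) c c x + piExponent ((c.map (applyAt I a x)).map Prod.fst) =
      precedingSum (fun y => (a y).1) c c x + (c.length + 1) +
        piExponent ((c.map a).map Prod.fst) := by
  induction c with
  | nil => simp at hx
  | cons y c ih =>
    have hn' := List.nodup_cons.1 hn
    by_cases h : x = y
    · subst h
      simp only [precedingSum_cons_self, List.map_cons, piExponent, map_applyAt I a hn'.1,
        applyAt_self, List.length_map, List.length_cons]
      push_cast
      grind
    · have hxc := (List.mem_cons.1 hx).resolve_left h
      rw [precedingSum_cons_of_ne _ hn hxc, precedingSum_cons_of_ne _ hn hxc]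
      simp only [List.map_cons, piExponent, applyAt_of_ne I a (Ne.symm h), List.length_map,
        List.length_cons] at ih ⊢
      have := ih hxc hn'.2
      push_cast
      grind

theorem vertexExponent_applyAt (I : A →ₗ[k] A) (a : F → ZMod 2 × A) {x : F} {v : List (List F)}
    (hx : x ∈ v.flatten) (hn : v.flatten.Nodup) :
    precedingSum (fun y => (a y).1 + 1) v.flatten v.flatten x +
        vertexExponent (v.map (List.map (applyAt I a x))) =
      wordExponent (fun y => (a y).1) v x + (v.flatten.length + 1) +
        vertexExponent (v.map (List.map a)) := by
  induction v with
  | nil => simp at hx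
  | cons c v ih =>
    rw [List.flatten_cons] at hn hx
    have hn' := List.nodup_append.1 hn
    have hx1 : ∀ x ∈ c, x ∉ v.flatten := fun x hx hx' => hn'.2.2 x hx x hx' rfl
    have e : ∀ a : F → ZMod 2 × A, vertexExponent ((c :: v).map (List.map a)) =
        piExponent ((c.map a).map Prod.fst) + vertexExponent (v.map (List.map a)) +
        v.flatten.length * Word.parity (c.map a) + Word.parity (v.flatten.map a) := by
      intro a
      have := vertexExponent_append [c.map a] (v.map (List.map a))
      rw [vertexExponent_singleton, ← List.map_flatten, List.length_map] at this
      rw [List.map_cons, ← List.singleton_append, this]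
      simp only [List.flatten_cons, List.flatten_nil, List.append_nil, List.length_cons,
        List.length_nil]
      simp
    have hq : ((c.map fun y => (a y).1 + 1).sum : ZMod 2) = Word.parity (c.map a) + c.length := by
      clear hn hn' hx hx1 ih e
      induction c with
      | nil => simp
      | cons y c ih =>
        simp only [List.map_cons, List.sum_cons, Word.parity_cons, ih, List.length_cons]
        push_cast; ring
    rw [e, e, List.flatten_cons]
    by_cases hxc : x ∈ c
    · have h1 := piExponent_map_applyAt I a hxc hn'.1
      rw [precedingSum_append_left _ hn hxc, wordExponent, if_pos hxc, map_applyAt I a (hx1 x hxc),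
        map_map_applyAt I a (hx1 x hxc), parity_map_applyAt I a hxc hn'.1, List.length_append]
      push_cast
      grind
    · have hxv := (List.mem_append.1 hx).resolve_left hxc
      have := ih hxv hn'.2.1
      rw [precedingSum_append_right _ hn hxv, wordExponent, if_neg hxc, map_applyAt I a hxc,
        parity_map_applyAt I a hxv hn'.2.1, List.length_append, hq]
      have h2 : (c.map fun y => (a y).1).sum = Word.parity (c.map a) := by
        rw [Word.parity, List.map_map]; rfl
      rw [h2]
      push_cast
      grind

theorem derivation_vertexValue (h𝒜 : IsSuperGrading 𝒜) (hg : IsOddScalarProduct 𝒜 g)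
    {I : A →ₗ[k] A} (hI : IsOddDerivation 𝒜 g I) {a : F → ZMod 2 × A}
    (ha : ∀ x, (a x).2 ∈ 𝒜 (a x).1) (γ : ℕ) {v : List (List F)}
    (hne : ∀ c ∈ v, c ≠ []) (hn : v.flatten.Nodup) :
    (v.flatten.map fun x => sgn k (precedingSum (fun y => (a y).1 + 1) v.flatten v.flatten x) *
      B.vertexValue γ (v.map (List.map (applyAt I a x)))).sum = 0 := by
  have h1 : ∀ x ∈ v.flatten,
      sgn k (precedingSum (fun y => (a y).1 + 1) v.flatten v.flatten x) *
        B.vertexValue γ (v.map (List.map (applyAt I a x))) =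
      sgn k (v.flatten.length + 1 + vertexExponent (v.map (List.map a))) •
        (sgn k (wordExponent (fun y => (a y).1) v x) *
          B.vertexTrace γ (v.map (List.map (applyAt I a x)))) := by
    intro x hx
    rw [vertexValue, smul_eq_mul, ← mul_assoc, ← mul_assoc, ← sgn_add, ← sgn_add,
      vertexExponent_applyAt I a hx hn]
    congr 2
    ring
  rw [sum_map_cons_congr h1, list_sum_map_smul, B.derivation_vertexTrace h𝒜 hg hI ha γ hne hn,
    smul_zero]

/-- The product of the tensors of all vertices is invariant under the derivation. -/
theorem derivation_prod_vertexValue (h𝒜 : IsSuperGrading 𝒜) (hg : IsOddScalarProduct 𝒜 g)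
    {I : A →ₗ[k] A} (hI : IsOddDerivation 𝒜 g I) {a : F → ZMod 2 × A}
    (ha : ∀ x, (a x).2 ∈ 𝒜 (a x).1) (γ : List (List F) → ℕ) {L : List (List (List F))}
    (hne : ∀ v ∈ L, ∀ c ∈ v, c ≠ []) (hn : L.flatten.flatten.Nodup) :
    (L.flatten.flatten.map fun x =>
      sgn k (precedingSum (fun y => (a y).1 + 1) L.flatten.flatten L.flatten.flatten x) *
      (L.map fun v => B.vertexValue (γ v) (v.map (List.map (applyAt I a x)))).prod).sum = 0 := by
  induction L with
  | nil => simp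
  | cons v L ih =>
    rw [List.flatten_cons, List.flatten_append] at hn
    have hn' := List.nodup_append.1 hn
    have hx1 : ∀ x ∈ v.flatten, x ∉ L.flatten.flatten := fun x hx hx' => hn'.2.2 x hx x hx' rfl
    have hx2 : ∀ x ∈ L.flatten.flatten, x ∉ v.flatten := fun x hx hx' => hx1 x hx' hx
    have h1 : ∀ x ∈ v.flatten, sgn k (precedingSum (fun y => (a y).1 + 1)
          (v.flatten ++ L.flatten.flatten) (v.flatten ++ L.flatten.flatten) x) *
        ((v :: L).map fun v => B.vertexValue (γ v) (v.map (List.map (applyAt I a x)))).prod =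
        (L.map fun v => B.vertexValue (γ v) (v.map (List.map a))).prod •
        (sgn k (precedingSum (fun y => (a y).1 + 1) v.flatten v.flatten x) *
          B.vertexValue (γ v) (v.map (List.map (applyAt I a x)))) := by
      intro x hx
      have : L.map (fun v => B.vertexValue (γ v) (v.map (List.map (applyAt I a x)))) =
          L.map fun v => B.vertexValue (γ v) (v.map (List.map a)) := by
        refine List.map_congr_left fun w hw => ?_
        rw [map_map_applyAt I a]
        intro hxw
        obtain ⟨c, hc, hxc⟩ := List.mem_flatten.1 hxw
        exact hx1 x hx (List.mem_flatten.2 ⟨c, List.mem_flatten.2 ⟨w, hw, hc⟩, hxc⟩)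
      rw [precedingSum_append_left _ hn hx, List.map_cons, List.prod_cons, this, smul_eq_mul]
      ring
    have h2 : ∀ x ∈ L.flatten.flatten, sgn k (precedingSum (fun y => (a y).1 + 1)
          (v.flatten ++ L.flatten.flatten) (v.flatten ++ L.flatten.flatten) x) *
        ((v :: L).map fun v => B.vertexValue (γ v) (v.map (List.map (applyAt I a x)))).prod =
        (sgn k (v.flatten.map fun y => (a y).1 + 1).sum *
          B.vertexValue (γ v) (v.map (List.map a))) •
        (sgn k (precedingSum (fun y => (a y).1 + 1) L.flatten.flatten L.flatten.flatten x) *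
          (L.map fun v => B.vertexValue (γ v) (v.map (List.map (applyAt I a x)))).prod) := by
      intro x hx
      rw [precedingSum_append_right _ hn hx, List.map_cons, List.prod_cons,
        map_map_applyAt I a (hx2 x hx), smul_eq_mul, sgn_add]
      ring
    rw [List.flatten_cons, List.flatten_append, List.map_append, List.sum_append,
      sum_map_cons_congr h1, sum_map_cons_congr h2, list_sum_map_smul, list_sum_map_smul,
      B.derivation_vertexValue h𝒜 hg hI ha (γ v) (hne v (by simp)) hn'.1,
      ih (fun v hv => hne v (by simp [hv])) hn'.2.1, smul_zero, smul_zero, add_zero]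

end DualBases

end Invariance

/-! ### Lists of the flags of a cycle -/

section CycleLists

variable {α : Type*}

/-- The list `c` runs once through a cycle of `σ`: each member is followed by its image, in the cyclic
sense. -/
structure IsCycleList (σ : Perm α) (c : List α) : Prop where
  ne_nil : c ≠ []
  nodup : c.Nodup
  map_eq : c.map σ = c.rotate 1

theorem IsCycleList.rotate {σ : Perm α} {c : List α} (h : IsCycleList σ c) (n : ℕ) :
    IsCycleList σ (c.rotate n) where
  ne_nil := by simpa using h.ne_nil
  nodup := by simpa using h.nodup
  map_eq := by rw [List.map_rotate, h.map_eq, List.rotate_rotate, List.rotate_rotate, add_comm]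

theorem IsCycleList.apply_mem {σ : Perm α} {c : List α} (h : IsCycleList σ c) {x : α}
    (hx : x ∈ c) : σ x ∈ c := by
  have : σ x ∈ c.map σ := List.mem_map_of_mem hx
  rwa [h.map_eq, List.mem_rotate] at this

theorem isCycleList_iterate [Finite α] (σ : Perm α) (x : α) :
    IsCycleList σ (List.iterate σ x (Function.minimalPeriod σ x)) where
  ne_nil h := by
    have := head?_cycleList σ x
    simp [h] at this
  nodup := nodup_cycleList σ x
  map_eq := by
    refine List.ext_getElem (by simp) fun i h1 h2 => ?_
    rw [List.getElem_map, List.getElem_rotate]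
    simp only [List.getElem_iterate, List.length_iterate]
    rw [Function.iterate_mod_minimalPeriod_eq, Function.iterate_succ_apply']

theorem IsCycleList.eq_iterate {σ : Perm α} {x : α} {c : List α} (h : IsCycleList σ (x :: c)) :
    x :: c = List.iterate σ x (Function.minimalPeriod σ x) := by
  have key : ∀ i (hi : i < (x :: c).length), (x :: c)[i] = σ^[i] x := by
    intro i
    induction i with
    | zero => intro _; rfl
    | succ i ih =>
      intro hi
      have := List.getElem_of_eq h.map_eq (i := i) (by rw [List.length_map]; omega)
      rw [List.getElem_map, List.getElem_rotate, ih (by omega)] at this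
      rw [Function.iterate_succ_apply', this]
      congr 1
      rw [Nat.mod_eq_of_lt hi]
  have hper : Function.IsPeriodicPt σ (x :: c).length x := by
    have := List.getElem_of_eq h.map_eq (i := c.length) (by simp)
    rw [List.getElem_map, List.getElem_rotate, key _ (by simp)] at this
    rw [Function.IsPeriodicPt, Function.IsFixedPt, List.length_cons, Function.iterate_succ_apply',
      this]
    simp
  have hle : Function.minimalPeriod σ x = (x :: c).length := by
    refine le_antisymm (hper.minimalPeriod_le (by simp)) ?_
    by_contra hlt
    push Not at hlt
    have h1 := key _ hlt
    rw [Function.iterate_minimalPeriod] at h1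
    have h2 : (x :: c)[Function.minimalPeriod σ x] = (x :: c)[0] := h1
    have h3 := (h.nodup.getElem_inj_iff).1 h2
    have := hper.minimalPeriod_pos (by simp)
    omega
  rw [hle]
  refine List.ext_getElem (by simp) fun i h1 h2 => ?_
  rw [key, List.getElem_iterate]

theorem isCycleList_iff [Finite α] (σ : Perm α) (c : List α) :
    IsCycleList σ c ↔ ∃ x, c = List.iterate σ x (Function.minimalPeriod σ x) := by
  constructor
  · intro h
    cases c with
    | nil => exact absurd rfl h.ne_nil
    | cons x c => exact ⟨x, h.eq_iterate⟩
  · rintro ⟨x, rfl⟩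
    exact isCycleList_iterate σ x

theorem IsCycleList.exists_rotate {σ : Perm α} {c : List α} (h : IsCycleList σ c) {x : α}
    (hx : x ∈ c) : c ~r List.iterate σ x (Function.minimalPeriod σ x) := by
  obtain ⟨l, r, rfl⟩ := List.append_of_mem hx
  have h1 : (l ++ x :: r).rotate l.length = x :: r ++ l := List.rotate_append_length_eq _ _
  have h2 := h.rotate l.length
  rw [h1, List.cons_append] at h2
  rw [← h2.eq_iterate, ← List.cons_append, ← h1]
  exact (List.IsRotated.forall _ _).symm

theorem IsCycleList.mem_iff [Finite α] {σ : Perm α} {c : List α} (h : IsCycleList σ c) {x y : α}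
    (hx : x ∈ c) : y ∈ c ↔ σ.SameCycle x y := by
  rw [(h.exists_rotate hx).mem_iff, mem_cycleList]

end CycleLists

/-! ### Elementary moves between presentations -/

section Moves

/-- The conditions on a list of lists of lists to be a presentation. -/
structure IsPresentation (G : StableRibbonGraph) (L : List (List (List G.Flag))) : Prop where
  ne_nil : ∀ v ∈ L, v ≠ []
  cycle : ∀ v ∈ L, ∀ c ∈ v, IsCycleList G.σ c
  vertex : ∀ v ∈ L, ∀ x ∈ v.flatten, ∀ y, y ∈ v.flatten ↔ G.lam x y
  nodup : L.flatten.flatten.Nodup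
  mem : ∀ x, x ∈ L.flatten.flatten

variable {G : StableRibbonGraph}

theorem Presentation.isPresentation (P : Presentation G) : IsPresentation G P.list where
  ne_nil := P.ne_nil
  cycle v hv c hc := (isCycleList_iff _ _).2 (P.cycle v hv c hc)
  vertex := P.vertex
  nodup := P.nodup
  mem := P.mem

/-- The presentation given by a list. -/
def IsPresentation.presentation {L : List (List (List G.Flag))} (h : IsPresentation G L) :
    Presentation G where
  list := L
  ne_nil := h.ne_nil
  cycle v hv c hc := (isCycleList_iff _ _).1 (h.cycle v hv c hc)
  vertex := h.vertex
  nodup := h.nodup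
  mem := h.mem

/-- An elementary change of a list of vertices: two neighbouring vertices or two neighbouring
cycles of a vertex are exchanged, or a cycle is rotated by one step. -/
inductive PresentationMove {F : Type*} : List (List (List F)) → List (List (List F)) → Prop
  | vertex (l₁ l₂ v v') : PresentationMove (l₁ ++ v :: v' :: l₂) (l₁ ++ v' :: v :: l₂)
  | cycle (l₁ l₂ v₁ v₂ c c') :
    PresentationMove (l₁ ++ (v₁ ++ c :: c' :: v₂) :: l₂) (l₁ ++ (v₁ ++ c' :: c :: v₂) :: l₂)
  | rotate (l₁ l₂ v₁ v₂ x c) :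
    PresentationMove (l₁ ++ (v₁ ++ (x :: c) :: v₂) :: l₂) (l₁ ++ (v₁ ++ (c ++ [x]) :: v₂) :: l₂)

open Relation

theorem PresentationMove.perm {F : Type*} {L L' : List (List (List F))}
    (h : PresentationMove L L') : L.flatten.flatten.Perm L'.flatten.flatten := by
  cases h with
  | vertex l₁ l₂ v v' => exact ((List.Perm.append_left l₁ (List.Perm.swap v' v l₂)).flatten).flatten
  | cycle l₁ l₂ v₁ v₂ c c' =>
    have := ((List.Perm.swap c' c v₂).append_left v₁).flatten
    simp only [List.flatten_append, List.flatten_cons] at this ⊢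
    exact (this.append_right _).append_left _
  | rotate l₁ l₂ v₁ v₂ x c =>
    simp only [List.flatten_append, List.flatten_cons]
    refine List.Perm.append_left _ (List.Perm.append_right _ (List.Perm.append_left _
      (List.Perm.append_right _ ?_)))
    exact (List.perm_append_singleton x c).symm

theorem IsPresentation.of_vertices {L L' : List (List (List G.Flag))} (h : IsPresentation G L)
    (hp : L.flatten.flatten.Perm L'.flatten.flatten)
    (hv : ∀ v' ∈ L', v' ≠ [] ∧ (∀ c ∈ v', IsCycleList G.σ c) ∧
      ∃ v ∈ L, ∀ x, x ∈ v'.flatten ↔ x ∈ v.flatten) : IsPresentation G L' where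
  ne_nil v hv' := (hv v hv').1
  cycle v hv' := (hv v hv').2.1
  vertex v hv' x hx y := by
    obtain ⟨w, hw, hvw⟩ := (hv v hv').2.2
    rw [hvw] at hx ⊢
    exact h.vertex w hw x hx y
  nodup := hp.nodup_iff.1 h.nodup
  mem x := hp.mem_iff.1 (h.mem x)

theorem IsPresentation.move {L L' : List (List (List G.Flag))} (h : IsPresentation G L)
    (hm : PresentationMove L L') : IsPresentation G L' := by
  refine h.of_vertices hm.perm ?_
  cases hm with
  | vertex l₁ l₂ v v' =>
    intro u hu
    have hu : u ∈ l₁ ++ v :: v' :: l₂ :=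
      ((List.Perm.swap v' v l₂).append_left l₁).mem_iff.2 hu
    exact ⟨h.ne_nil u hu, h.cycle u hu, u, hu, fun _ => Iff.rfl⟩
  | cycle l₁ l₂ v₁ v₂ c c' =>
    intro u hu
    by_cases he : u = v₁ ++ c' :: c :: v₂
    · subst he
      have hm : v₁ ++ c :: c' :: v₂ ∈ l₁ ++ (v₁ ++ c :: c' :: v₂) :: l₂ := by simp
      have hp : (v₁ ++ c :: c' :: v₂).Perm (v₁ ++ c' :: c :: v₂) :=
        (List.Perm.swap c' c v₂).append_left v₁
      exact ⟨by simp, fun d hd => h.cycle _ hm d (hp.mem_iff.2 hd), _, hm,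
        fun x => hp.flatten.mem_iff.symm⟩
    · have hu : u ∈ l₁ ++ (v₁ ++ c :: c' :: v₂) :: l₂ := by
        simp only [List.mem_append, List.mem_cons] at hu ⊢
        tauto
      exact ⟨h.ne_nil u hu, h.cycle u hu, u, hu, fun _ => Iff.rfl⟩
  | rotate l₁ l₂ v₁ v₂ x c =>
    intro u hu
    by_cases he : u = v₁ ++ (c ++ [x]) :: v₂
    · subst he
      have hm : v₁ ++ (x :: c) :: v₂ ∈ l₁ ++ (v₁ ++ (x :: c) :: v₂) :: l₂ := by simp
      refine ⟨by simp, fun d hd => ?_, _, hm, fun y => ?_⟩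
      · by_cases hdc : d = c ++ [x]
        · subst hdc
          have := (h.cycle _ hm (x :: c) (by simp)).rotate 1
          simpa using this
        · refine h.cycle _ hm d ?_
          simp only [List.mem_append, List.mem_cons] at hd ⊢
          tauto
      · simp only [List.flatten_append, List.flatten_cons, List.mem_append, List.mem_cons,
          List.not_mem_nil, or_false]
        tauto
    · have hu : u ∈ l₁ ++ (v₁ ++ (x :: c) :: v₂) :: l₂ := by
        simp only [List.mem_append, List.mem_cons] at hu ⊢
        tauto
      exact ⟨h.ne_nil u hu, h.cycle u hu, u, hu, fun _ => Iff.rfl⟩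

/-- If a relation between the members of two lists without repetitions is a bijection, then the
second list can be permuted so that the lists are related member by member. -/
theorem exists_perm_forall₂ {α β : Type*} {R : α → β → Prop} {l : List α} {l' : List β}
    (hl : l.Nodup) (hl' : l'.Nodup) (h1 : ∀ x ∈ l, ∃ y ∈ l', R x y) (h2 : ∀ y ∈ l', ∃ x ∈ l, R x y)
    (h3 : ∀ x ∈ l, ∀ x' ∈ l, ∀ y ∈ l', R x y → R x' y → x = x')
    (h4 : ∀ x ∈ l, ∀ y ∈ l', ∀ y' ∈ l', R x y → R x y' → y = y') :
    ∃ l'' : List β, l''.Perm l' ∧ List.Forall₂ R l l'' := by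
  have hf : ∀ x : {x // x ∈ l}, ∃ y, y ∈ l' ∧ R x y := fun x => h1 x x.2
  choose f hf using hf
  refine ⟨l.attach.map f, ?_, ?_⟩
  · refine (List.perm_ext_iff_of_nodup ?_ hl').2 fun y => ⟨?_, fun hy => ?_⟩
    · refine (List.nodup_attach.2 hl).map fun x x' hx => Subtype.ext ?_
      exact h3 x x.2 x' x'.2 (f x) (hf x).1 (hf x).2 (hx ▸ (hf x').2)
    · rw [List.mem_map]
      rintro ⟨x, _, rfl⟩
      exact (hf x).1
    · obtain ⟨x, hx, hxy⟩ := h2 y hy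
      refine List.mem_map.2 ⟨⟨x, hx⟩, by simp, ?_⟩
      exact h4 x hx _ (hf ⟨x, hx⟩).1 _ hy (hf ⟨x, hx⟩).2 hxy
  · rw [List.forall₂_map_right_iff]
    conv => arg 2; rw [← List.attach_map_subtype_val l]
    rw [List.forall₂_map_left_iff, List.forall₂_same]
    exact fun x _ => (hf x).2

theorem reflTransGen_move_of_perm {F : Type*} {L L' : List (List (List F))} (h : L.Perm L') :
    ReflTransGen PresentationMove L L' := by
  refine ReflTransGen.mono (r := AdjSwap) ?_ _ _ (adjSwap_reflTransGen h)
  rintro _ _ ⟨a, x, y, b, rfl, rfl⟩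
  exact .vertex _ _ _ _

theorem reflTransGen_move_of_perm_vertex {F : Type*} (l₁ l₂ : List (List (List F)))
    {v v' : List (List F)} (h : v.Perm v') :
    ReflTransGen PresentationMove (l₁ ++ v :: l₂) (l₁ ++ v' :: l₂) := by
  refine ReflTransGen.lift (fun v => l₁ ++ v :: l₂) ?_ _ _ (adjSwap_reflTransGen h)
  rintro _ _ ⟨a, x, y, b, rfl, rfl⟩
  exact .cycle _ _ _ _ _ _

theorem reflTransGen_move_of_isRotated {F : Type*} (l₁ l₂ : List (List (List F)))
    (v₁ v₂ : List (List F)) {c c' : List F} (h : c ~r c') :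
    ReflTransGen PresentationMove (l₁ ++ (v₁ ++ c :: v₂) :: l₂) (l₁ ++ (v₁ ++ c' :: v₂) :: l₂) := by
  obtain ⟨n, rfl⟩ := h
  induction n with
  | zero => rw [List.rotate_zero]
  | succ n ih =>
    refine ih.trans ?_
    rw [← List.rotate_rotate]
    cases c.rotate n with
    | nil => rw [List.rotate_nil]
    | cons x c =>
      rw [List.rotate_cons_succ, List.rotate_zero]
      exact .single (.rotate _ _ _ _ _ _)

theorem reflTransGen_move_of_forall₂_isRotated {F : Type*} (l₁ l₂ : List (List (List F)))
    (v₁ : List (List F)) {v v' : List (List F)} (h : List.Forall₂ List.IsRotated v v') :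
    ReflTransGen PresentationMove (l₁ ++ (v₁ ++ v) :: l₂) (l₁ ++ (v₁ ++ v') :: l₂) := by
  induction h generalizing v₁ with
  | nil => exact .refl
  | @cons c c' v v' hc _ ih =>
    refine (reflTransGen_move_of_isRotated l₁ l₂ v₁ v hc).trans ?_
    have := ih (v₁ ++ [c'])
    simpa using this

theorem reflTransGen_move_of_forall₂ {F : Type*} (l₁ : List (List (List F)))
    {L L' : List (List (List F))}
    (h : List.Forall₂ (fun v v' => ∃ w, w.Perm v' ∧ List.Forall₂ List.IsRotated v w) L L') :
    ReflTransGen PresentationMove (l₁ ++ L) (l₁ ++ L') := by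
  induction h generalizing l₁ with
  | nil => exact .refl
  | @cons v v' L L' hv _ ih =>
    obtain ⟨w, hw, hvw⟩ := hv
    refine (reflTransGen_move_of_forall₂_isRotated l₁ L [] hvw).trans
      ((reflTransGen_move_of_perm_vertex l₁ L hw).trans ?_)
    have := ih (l₁ ++ [v'])
    simpa using this

theorem eq_of_mem_of_nodup_flatten {F : Type*} {v : List (List F)} (h : v.flatten.Nodup)
    {c c' : List F} (hc : c ∈ v) (hc' : c' ∈ v) {x : F} (hx : x ∈ c) (hx' : x ∈ c') : c = c' := by
  by_contra hne
  have hd := (List.nodup_flatten.1 h).2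
  have : Std.Symm (List.Disjoint (α := F)) := ⟨fun _ _ h => h.symm⟩
  exact hd.forall hc hc' hne hx hx'

theorem nodup_of_nodup_flatten {F : Type*} {v : List (List F)} (h : v.flatten.Nodup)
    (hne : ∀ c ∈ v, c ≠ []) : v.Nodup := by
  refine ((List.nodup_flatten.1 h).2).imp_of_mem ?_
  rintro c c' hc hc' hd rfl
  obtain ⟨x, hx⟩ := List.exists_mem_of_ne_nil c (hne c hc)
  exact hd hx hx

theorem IsPresentation.nodup_flatten {L : List (List (List G.Flag))} (h : IsPresentation G L)
    {v : List (List G.Flag)} (hv : v ∈ L) : v.flatten.Nodup := by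
  refine h.nodup.sublist ?_
  exact (List.sublist_flatten_of_mem hv).flatten

theorem IsPresentation.exists_mem {L : List (List (List G.Flag))} (h : IsPresentation G L)
    {v : List (List G.Flag)} (hv : v ∈ L) : ∃ x, x ∈ v.flatten := by
  obtain ⟨c, hc⟩ := List.exists_mem_of_ne_nil v (h.ne_nil v hv)
  obtain ⟨x, hx⟩ := List.exists_mem_of_ne_nil c (h.cycle v hv c hc).ne_nil
  exact ⟨x, List.mem_flatten.2 ⟨c, hc, hx⟩⟩

/-- Any two presentations are connected by elementary moves. -/
theorem IsPresentation.reflTransGen_move {L L' : List (List (List G.Flag))}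
    (h : IsPresentation G L) (h' : IsPresentation G L') : ReflTransGen PresentationMove L L' := by
  have hvertex : ∀ {L}, IsPresentation G L → ∀ v ∈ L, ∀ w ∈ L, ∀ x, x ∈ v.flatten →
      x ∈ w.flatten → v = w := by
    intro L h v hv w hw x hx hx'
    obtain ⟨c, hc, hxc⟩ := List.mem_flatten.1 hx
    obtain ⟨d, hd, hxd⟩ := List.mem_flatten.1 hx'
    have hcd : c = d := eq_of_mem_of_nodup_flatten h.nodup (List.mem_flatten.2 ⟨v, hv, hc⟩)
      (List.mem_flatten.2 ⟨w, hw, hd⟩) hxc hxd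
    subst hcd
    refine eq_of_mem_of_nodup_flatten ?_ hv hw hc hd
    exact nodup_of_nodup_flatten h.nodup fun c hc => by
      obtain ⟨v, hv, hcv⟩ := List.mem_flatten.1 hc
      exact (h.cycle v hv c hcv).ne_nil
  have hlist : ∀ {L}, IsPresentation G L → L.Nodup := by
    intro L h
    refine nodup_of_nodup_flatten ?_ h.ne_nil
    exact nodup_of_nodup_flatten h.nodup fun c hc => by
      obtain ⟨v, hv, hcv⟩ := List.mem_flatten.1 hc
      exact (h.cycle v hv c hcv).ne_nil
  have hex : ∀ {L}, IsPresentation G L → ∀ x, ∃ v ∈ L, x ∈ v.flatten := by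
    intro L h x
    obtain ⟨c, hc, hx⟩ := List.mem_flatten.1 (h.mem x)
    obtain ⟨v, hv, hcv⟩ := List.mem_flatten.1 hc
    exact ⟨v, hv, List.mem_flatten.2 ⟨c, hcv, hx⟩⟩
  -- vertices with the same flags agree up to the order of the cycles and rotations
  have hcycles : ∀ v ∈ L, ∀ v' ∈ L', (∀ x, x ∈ v.flatten ↔ x ∈ v'.flatten) →
      ∃ w, w.Perm v' ∧ List.Forall₂ List.IsRotated v w := by
    intro v hv v' hv' hvv
    have hn := h.nodup_flatten hv
    have hn' := h'.nodup_flatten hv'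
    have hmeet : ∀ {c c' : List G.Flag}, c ~r c' → c ≠ [] → ∃ x, x ∈ c ∧ x ∈ c' := by
      intro c c' hr hc
      obtain ⟨x, hx⟩ := List.exists_mem_of_ne_nil c hc
      exact ⟨x, hx, hr.mem_iff.1 hx⟩
    have hrot : ∀ c ∈ v, ∀ c' ∈ v', ∀ x, x ∈ c → x ∈ c' → c ~r c' := fun c hc c' hc' x hx hx' =>
      ((h.cycle v hv c hc).exists_rotate hx).trans
        ((h'.cycle v' hv' c' hc').exists_rotate hx').symm
    refine exists_perm_forall₂ (nodup_of_nodup_flatten hn fun c hc => (h.cycle v hv c hc).ne_nil)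
      (nodup_of_nodup_flatten hn' fun c hc => (h'.cycle v' hv' c hc).ne_nil) ?_ ?_ ?_ ?_
    · intro c hc
      obtain ⟨x, hx⟩ := List.exists_mem_of_ne_nil c (h.cycle v hv c hc).ne_nil
      obtain ⟨c', hc', hx'⟩ := List.mem_flatten.1 ((hvv x).1 (List.mem_flatten.2 ⟨c, hc, hx⟩))
      exact ⟨c', hc', hrot c hc c' hc' x hx hx'⟩
    · intro c' hc'
      obtain ⟨x, hx'⟩ := List.exists_mem_of_ne_nil c' (h'.cycle v' hv' c' hc').ne_nil
      obtain ⟨c, hc, hx⟩ := List.mem_flatten.1 ((hvv x).2 (List.mem_flatten.2 ⟨c', hc', hx'⟩))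
      exact ⟨c, hc, hrot c hc c' hc' x hx hx'⟩
    · intro c hc d hd c' hc' h1 h2
      obtain ⟨x, hx, hx'⟩ := hmeet (h1.trans h2.symm) (h.cycle v hv c hc).ne_nil
      exact eq_of_mem_of_nodup_flatten hn hc hd hx hx'
    · intro c hc c' hc' d' hd' h1 h2
      obtain ⟨x, hx, hx'⟩ := hmeet (h1.symm.trans h2) (h'.cycle v' hv' c' hc').ne_nil
      exact eq_of_mem_of_nodup_flatten hn' hc' hd' hx hx'
  have hflags : ∀ v ∈ L, ∀ v' ∈ L', ∀ x, x ∈ v.flatten → x ∈ v'.flatten →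
      ∀ y, y ∈ v.flatten ↔ y ∈ v'.flatten := fun v hv v' hv' x hx hx' y =>
    (h.vertex v hv x hx y).trans (h'.vertex v' hv' x hx' y).symm
  have hM : ∃ M : List (List (List G.Flag)), M.Perm L' ∧
      List.Forall₂ (fun v v' : List (List G.Flag) => ∀ x, x ∈ v.flatten ↔ x ∈ v'.flatten) L M := by
    refine exists_perm_forall₂ (hlist h) (hlist h') ?_ ?_ ?_ ?_
    · intro v hv
      obtain ⟨x, hx⟩ := h.exists_mem hv
      obtain ⟨v', hv', hx'⟩ := hex h' x
      exact ⟨v', hv', hflags v hv v' hv' x hx hx'⟩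
    · intro v' hv'
      obtain ⟨x, hx'⟩ := h'.exists_mem hv'
      obtain ⟨v, hv, hx⟩ := hex h x
      exact ⟨v, hv, hflags v hv v' hv' x hx hx'⟩
    · intro v hv w hw v' hv' h1 h2
      obtain ⟨x, hx⟩ := h.exists_mem hv
      exact hvertex h v hv w hw x hx ((h2 x).2 ((h1 x).1 hx))
    · intro v hv v' hv' w' hw' h1 h2
      obtain ⟨x, hx⟩ := h.exists_mem hv
      exact hvertex h' v' hv' w' hw' x ((h1 x).1 hx) ((h2 x).1 hx)
  obtain ⟨M, hM, hLM⟩ := hM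
  refine ReflTransGen.trans ?_ (reflTransGen_move_of_perm hM)
  refine reflTransGen_move_of_forall₂ [] ?_
  rw [List.forall₂_iff_get] at hLM ⊢
  refine ⟨hLM.1, fun i h1 h2 => ?_⟩
  exact hcycles _ (List.get_mem _ _) _ (hM.mem_iff.1 (List.get_mem _ _)) (hLM.2 i h1 h2)

end Moves

/-! ### Independence of the presentation -/

section Independence

theorem reorderExponent_block_self {X : Type*} [DecidableEq X] (q : X → ZMod 2) (a Y Z b : List X)
    (h : (a ++ (Y ++ (Z ++ b))).Nodup) :
    reorderExponent q (a ++ (Y ++ (Z ++ b))) (a ++ (Z ++ (Y ++ b))) =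
      (Y.map q).sum * (Z.map q).sum := by
  have h1 := reorderExponent_block q (a ++ (Y ++ (Z ++ b))) a Y Z b
    (fun x hy hz => by
      have := (List.nodup_append.1 (List.nodup_append.1 h).2.1).2.2 x hy x (by simp [hz])
      exact this rfl) (fun y hy => by simp [hy])
  rw [reorderExponent_self q h] at h1
  exact ((CharTwo.add_eq_zero).1 h1.symm)

theorem prod_map_append_cons {M X : Type*} [CommMonoid M] (φ : X → M) (l₁ l₂ : List X) (v : X) :
    ((l₁ ++ v :: l₂).map φ).prod = (l₁.map φ).prod * φ v * (l₂.map φ).prod := by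
  simp [mul_assoc]

theorem sum_map_one {X : Type*} (l : List X) : (l.map fun _ => (1 : ZMod 2)).sum = l.length := by
  simp

variable {k A : Type*} [Field k] [NonUnitalRing A] [Module k A]
  [IsScalarTower k A A] [SMulCommClass k A A]
  {𝒜 : ZMod 2 → Submodule k A} {g : A →ₗ[k] A →ₗ[k] k} {ι : Type*} [DecidableEq ι] [Fintype ι]

theorem sum_map_parity_add_one {F : Type*} (a : F → ZMod 2 × A) (c : List F) :
    (c.map fun y => (a y).1 + 1).sum = Word.parity (c.map a) + c.length := by
  induction c with
  | nil => simp
  | cons y c ih =>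
    simp only [List.map_cons, List.sum_cons, Word.parity_cons, ih, List.length_cons]
    push_cast; ring

namespace DualBases

open Word

variable (B : DualBases 𝒜 g ι) [CharZero k]

theorem vertexValue_swap (h𝒜 : IsSuperGrading 𝒜) (hg : IsOddScalarProduct 𝒜 g) (γ : ℕ)
    (v₁ v₂ : List (Word A)) {c c' : Word A} (hc : c.Homogeneous 𝒜) (hc' : c'.Homogeneous 𝒜)
    (hne : c ≠ []) (hne' : c' ≠ []) (hv₁ : ∀ c ∈ v₁, c.Homogeneous 𝒜) :
    B.vertexValue γ (v₁ ++ c :: c' :: v₂) =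
      sgn k (c.length * c'.length + 1 + (c.parity + c.length) * (c'.parity + c'.length)) *
        B.vertexValue γ (v₁ ++ c' :: c :: v₂) := by
  rw [vertexValue, vertexValue, B.vertexTrace_swap h𝒜 hg γ v₁ v₂ hc hc' hne hne' hv₁, ← mul_assoc,
    ← mul_assoc, ← sgn_add, ← sgn_add]
  congr 2
  have e : ∀ c c' : Word A, v₁ ++ c :: c' :: v₂ = v₁ ++ ([c] ++ ([c'] ++ v₂)) := fun _ _ => rfl
  rw [e, e]
  simp only [vertexExponent_append, vertexExponent_singleton, List.flatten_append,
    List.flatten_cons, List.flatten_nil, List.append_nil, List.length_append, List.length_cons,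
    List.length_nil, parity_append]
  push_cast
  generalize (v₁.flatten.length : ZMod 2) = a1
  generalize (v₂.flatten.length : ZMod 2) = a2
  generalize (c.length : ZMod 2) = a3
  generalize (c'.length : ZMod 2) = a4
  generalize (v₁.length : ZMod 2) = a5
  grind

theorem vertexValue_rotate (h𝒜 : IsSuperGrading 𝒜) (hg : IsOddScalarProduct 𝒜 g) (γ : ℕ)
    (v₁ v₂ : List (Word A)) {c : Word A} {x : ZMod 2 × A} (hx : x.2 ∈ 𝒜 x.1)
    (hc : c.Homogeneous 𝒜) (hv₁ : ∀ c ∈ v₁, c.Homogeneous 𝒜) :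
    B.vertexValue γ (v₁ ++ (x :: c) :: v₂) =
      sgn k (c.length + (x.1 + 1) * (c.parity + c.length)) *
        B.vertexValue γ (v₁ ++ (c ++ [x]) :: v₂) := by
  rw [vertexValue, vertexValue, B.vertexTrace_rotate h𝒜 hg γ v₁ v₂ hx hc hv₁, ← mul_assoc,
    ← mul_assoc, ← sgn_add, ← sgn_add]
  congr 2
  have e : ∀ c : Word A, v₁ ++ c :: v₂ = v₁ ++ ([c] ++ v₂) := fun _ => rfl
  rw [e, e]
  simp only [vertexExponent_append, vertexExponent_singleton, List.flatten_append,
    List.flatten_cons, List.flatten_nil, List.append_nil, List.length_append, List.length_cons,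
    List.length_nil, parity_append, parity_cons, parity_nil, Word.piExponent_append,
    Word.piExponent_cons]
  push_cast
  generalize (v₁.flatten.length : ZMod 2) = a1
  generalize (v₂.flatten.length : ZMod 2) = a2
  generalize (c.length : ZMod 2) = a3
  generalize (v₁.length : ZMod 2) = a5
  simp only [List.map_nil, piExponent]
  grind

end DualBases

variable {G : StableRibbonGraph}

/-- The integer of the vertex with the list `v` of cycles. -/
def vertexGenus (G : StableRibbonGraph) (v : List (List G.Flag)) : ℕ :=
  v.flatten.head?.elim 0 G.genus

theorem IsPresentation.vertexGenus_eq {L : List (List (List G.Flag))} (h : IsPresentation G L)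
    {v : List (List G.Flag)} (hv : v ∈ L) {x : G.Flag} (hx : x ∈ v.flatten) :
    vertexGenus G v = G.genus x := by
  unfold vertexGenus
  cases hf : v.flatten with
  | nil => simp [hf] at hx
  | cons y l =>
    have hy : y ∈ v.flatten := by simp [hf]
    exact G.genus_eq _ _ ((h.vertex v hv y hy x).1 hx)

/-- The parities of the factors of a coloured product of edge tensors. -/
def shiftedParity (B : DualBases 𝒜 g ι) {F : Type*} (m : F → ι) (x : F) : ZMod 2 :=
  B.parity (m x) + 1

theorem sum_shiftedParity (B : DualBases 𝒜 g ι) {F : Type*} (m : F → ι) (c : List F) :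
    (c.map (shiftedParity B m)).sum =
      Word.parity (c.map fun x => B.letter (m x)) + c.length :=
  sum_map_parity_add_one (fun x => B.letter (m x)) c

namespace Presentation

variable (B : DualBases 𝒜 g ι) (w : G.Orient) (P : Presentation G) (E : List G.Flag)
  (m : G.Flag → ι)

/-- The product of the values of the vertices for a colouring of the flags by basis vectors. -/
noncomputable def vertexProduct : k :=
  (P.list.map fun v => B.vertexTensor (vertexGenus G v) v m).prod

/-- The contribution of a colouring of the flags to the contraction of tensors, without the edges:
the flags come in the order `E`. -/
noncomputable def colouringValue : k :=
  ((w.sign P.order : ℤ) : k) * (sgn k (reorderExponent (shiftedParity B m) P.flags E) *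
    P.vertexProduct B m)

theorem flags_perm (hE : E.Nodup) (hm : ∀ x, x ∈ E) : P.flags.Perm E :=
  (List.perm_ext_iff_of_nodup P.nodup hE).2 fun x => ⟨fun _ => hm x, fun _ => P.mem x⟩

theorem colouringValue_eq {P P' : Presentation G} (hE : E.Nodup) (hm : ∀ x, x ∈ E) (s : ZMod 2)
    (h1 : reorderExponent (fun _ => 1) P.order.list P'.order.list = s)
    {t : ZMod 2} (h2 : reorderExponent (shiftedParity B m) E P.flags =
      reorderExponent (shiftedParity B m) E P'.flags + t)
    (h3 : P.vertexProduct B m = sgn k (s + t) * P'.vertexProduct B m) :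
    P.colouringValue B w E m = P'.colouringValue B w E m := by
  unfold colouringValue
  rw [w.sign_eq k P.order P'.order, h1, h3, reorderExponent_symm _ hE (P.flags_perm E hE hm),
    reorderExponent_symm _ hE (P'.flags_perm E hE hm), h2]
  simp only [sgn_add]
  have e1 := sgn_mul_self (k := k) s
  have e2 := sgn_mul_self (k := k) t
  linear_combination (sgn k s * ((w.sign P.order : ℤ) : k) *
    sgn k (reorderExponent (shiftedParity B m) E P'.flags) * P'.vertexProduct B m) * e2

end Presentation

theorem length_vertexOrder (σ : Perm G.Flag) {v : List (List G.Flag)} (h : ∀ c ∈ v, c ≠ []) :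
    (vertexOrder σ v).length = v.flatten.length + v.length := by
  have : ∀ v : List (List G.Flag), (∀ c ∈ v, c ≠ []) →
      (v.filterMap List.head?).length = v.length := by
    intro v hv
    induction v with
    | nil => rfl
    | cons c v ih =>
      obtain ⟨x, c, rfl⟩ := List.exists_cons_of_ne_nil (hv c (by simp))
      simp [ih fun c hc => hv c (by simp [hc])]
  rw [vertexOrder, List.length_append, List.length_map, List.length_map, this]
  · simp
  · simpa using h

variable [CharZero k]

theorem homogeneous_letters (B : DualBases 𝒜 g ι) {F : Type*} (m : F → ι) (c : List F) :
    Word.Homogeneous 𝒜 (c.map fun x => B.letter (m x)) := by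
  intro y hy
  obtain ⟨x, _, rfl⟩ := List.mem_map.1 hy
  exact B.letter_mem _

theorem homogeneous_letters' (B : DualBases 𝒜 g ι) {F : Type*} (m : F → ι) (v : List (List F)) :
    ∀ c ∈ v.map (List.map fun x => B.letter (m x)), Word.Homogeneous 𝒜 c := by
  intro c hc
  obtain ⟨d, _, rfl⟩ := List.mem_map.1 hc
  exact homogeneous_letters B m d

theorem vertexTensor_eq_vertexValue (B : DualBases 𝒜 g ι) {F : Type*} (γ : ℕ) (v : List (List F))
    (m : F → ι) : B.vertexTensor γ v m =
      B.vertexValue γ (v.map (List.map fun x => B.letter (m x))) :=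
  B.vertexTensor_eq γ v m

open Presentation

theorem colouringValue_move (h𝒜 : IsSuperGrading 𝒜) (hg : IsOddScalarProduct 𝒜 g)
    (B : DualBases 𝒜 g ι) (w : G.Orient) {E : List G.Flag} (hE : E.Nodup) (hEm : ∀ x, x ∈ E)
    (m : G.Flag → ι) {L L' : List (List (List G.Flag))} (h : IsPresentation G L)
    (h' : IsPresentation G L') (hm : PresentationMove L L') :
    h.presentation.colouringValue B w E m = h'.presentation.colouringValue B w E m := by
  have hon := h.presentation.order.nodup
  have hfn := h.nodup
  cases hm with
  | vertex l₁ l₂ v v' =>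
    have hd : ∀ y ∈ v.flatten, y ∉ v'.flatten := by
      simp only [List.flatten_append, List.flatten_cons] at hfn
      have := (List.nodup_append.1 (List.nodup_append.1 hfn).2.1).2.2
      intro y hy hy'
      exact this y hy y (by simp only [List.mem_append]; exact Or.inl hy') rfl
    have e1 : h.presentation.order.list = l₁.flatMap (vertexOrder G.σ) ++ (vertexOrder G.σ v ++
        (vertexOrder G.σ v' ++ l₂.flatMap (vertexOrder G.σ))) := by
      simp [IsPresentation.presentation, Presentation.order]
    have e2 : h'.presentation.order.list = l₁.flatMap (vertexOrder G.σ) ++ (vertexOrder G.σ v' ++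
        (vertexOrder G.σ v ++ l₂.flatMap (vertexOrder G.σ))) := by
      simp [IsPresentation.presentation, Presentation.order]
    have h1 := reorderExponent_block_self (fun _ => 1) _ _ _ _ (e1 ▸ hon)
    rw [← e1, ← e2, sum_map_one, sum_map_one,
      length_vertexOrder G.σ fun c hc => (h.cycle v (by simp) c hc).ne_nil,
      length_vertexOrder G.σ fun c hc => (h.cycle v' (by simp) c hc).ne_nil] at h1
    have h2 := reorderExponent_block (shiftedParity B m) E l₁.flatten.flatten v.flatten v'.flatten
      l₂.flatten.flatten (fun y hy hy' => hd y hy hy') (fun y _ => hEm y)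
    refine colouringValue_eq B w E m hE hEm _ h1 (t := (v.flatten.map (shiftedParity B m)).sum *
        (v'.flatten.map (shiftedParity B m)).sum) ?_ ?_
    · simpa [Presentation.flags, IsPresentation.presentation] using h2
    · simp only [vertexProduct, IsPresentation.presentation, List.map_append, List.map_cons,
        List.prod_append, List.prod_cons]
      rw [sum_shiftedParity, sum_shiftedParity, vertexTensor_eq_vertexValue,
        vertexTensor_eq_vertexValue]
      set a := fun x => B.letter (m x) with ha
      have hV := B.vertexValue_eq_sgn_mul h𝒜 hg (vertexGenus G v) (homogeneous_letters' B m v)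
          (v'.flatten.length + Word.parity (v'.flatten.map a))
      have hV' := B.vertexValue_eq_sgn_mul h𝒜 hg (vertexGenus G v') (homogeneous_letters' B m v')
          (v.flatten.length + v.length)
      rw [← List.map_flatten, List.length_map] at hV hV'
      have aux : ∀ (a b c : ZMod 2) (l x y r : k), x = sgn k a * x → y = sgn k b * y → a + b = c →
          l * (x * (y * r)) = sgn k c * (l * (y * (x * r))) := by
        rintro a b _ l x y r h1 h2 rfl
        rw [sgn_add]
        linear_combination l * y * r * h1 + l * r * (sgn k a * x) * h2
      refine aux _ _ _ _ _ _ _ hV hV' ?_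
      push_cast
      generalize (v.flatten.length : ZMod 2) = a1
      generalize (v'.flatten.length : ZMod 2) = a2
      generalize (v.length : ZMod 2) = a3
      generalize (v'.length : ZMod 2) = a4
      generalize Word.parity _ = a5
      generalize Word.parity _ = a6
      grind
  | cycle l₁ l₂ v₁ v₂ c c' =>
    have hv : v₁ ++ c :: c' :: v₂ ∈ l₁ ++ (v₁ ++ c :: c' :: v₂) :: l₂ := by simp
    have hv' : v₁ ++ c' :: c :: v₂ ∈ l₁ ++ (v₁ ++ c' :: c :: v₂) :: l₂ := by simp
    have hc := (h.cycle _ hv c (by simp)).ne_nil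
    have hc' := (h.cycle _ hv c' (by simp)).ne_nil
    obtain ⟨x, d, rfl⟩ := List.exists_cons_of_ne_nil hc
    obtain ⟨x', d', rfl⟩ := List.exists_cons_of_ne_nil hc'
    have hd : ∀ y ∈ x :: d, y ∉ x' :: d' := by
      simp only [List.flatten_append, List.flatten_cons, List.append_assoc] at hfn
      have := (List.nodup_append.1 (List.nodup_append.1 (List.nodup_append.1 hfn).2.1).2.1).2.2
      intro y hy hy'
      exact this y hy y (List.mem_append_left _ hy') rfl
    set hs := fun v : List (List G.Flag) =>
      (v.reverse.filterMap List.head?).map (fun x => (Sum.inr (cyc G.σ x) : G.Basis)) with hhs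
    have e1 : h.presentation.order.list = (l₁.flatMap (vertexOrder G.σ) ++ v₁.flatten.map Sum.inl) ++
        ((x :: d).map Sum.inl ++ ((x' :: d').map Sum.inl ++ (v₂.flatten.map Sum.inl ++ (hs v₂ ++
          ([Sum.inr (cyc G.σ x')] ++ ([Sum.inr (cyc G.σ x)] ++
            (hs v₁ ++ l₂.flatMap (vertexOrder G.σ)))))))) := by
      simp [IsPresentation.presentation, Presentation.order, vertexOrder, hhs]
    have e2 : h'.presentation.order.list = (l₁.flatMap (vertexOrder G.σ) ++ v₁.flatten.map Sum.inl) ++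
        ((x' :: d').map Sum.inl ++ ((x :: d).map Sum.inl ++ (v₂.flatten.map Sum.inl ++ (hs v₂ ++
          ([Sum.inr (cyc G.σ x)] ++ ([Sum.inr (cyc G.σ x')] ++
            (hs v₁ ++ l₂.flatMap (vertexOrder G.σ)))))))) := by
      simp [IsPresentation.presentation, Presentation.order, vertexOrder, hhs]
    have hcc : cyc G.σ x ≠ cyc G.σ x' := by
      intro hxx
      rw [cyc_eq_iff] at hxx
      exact hd x' (((h.cycle _ hv _ (by simp)).mem_iff (by simp)).2 hxx) (by simp)
    have h1 : reorderExponent (fun _ => 1) h.presentation.order.list h'.presentation.order.list =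
        (x :: d).length * (x' :: d').length + 1 := by
      have k0 := reorderExponent_block_self (fun _ => 1) _ _ _ _ (e1 ▸ hon)
      have k1 := reorderExponent_block (fun _ => 1) h.presentation.order.list
        ((l₁.flatMap (vertexOrder G.σ) ++ v₁.flatten.map Sum.inl) ++
        ((x' :: d').map Sum.inl ++ ((x :: d).map Sum.inl ++ (v₂.flatten.map Sum.inl ++ hs v₂))))
        [Sum.inr (cyc G.σ x)] [Sum.inr (cyc G.σ x')] (hs v₁ ++ l₂.flatMap (vertexOrder G.σ))
        (by simpa using fun h => hcc h.symm) (fun y _ => h.presentation.order.mem y)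
      rw [← e1] at k0
      simp only [List.append_assoc] at k0 k1 e2
      rw [e2, k1, k0, sum_map_one, sum_map_one]
      simp
    have h2 := reorderExponent_block (shiftedParity B m) E (l₁.flatten.flatten ++ v₁.flatten)
      (x :: d) (x' :: d') (v₂.flatten ++ l₂.flatten.flatten) (fun y hy hy' => hd y hy hy')
      (fun y _ => hEm y)
    refine colouringValue_eq B w E m hE hEm _ h1 (t := ((x :: d).map (shiftedParity B m)).sum *
        ((x' :: d').map (shiftedParity B m)).sum) ?_ ?_
    · simpa [Presentation.flags, IsPresentation.presentation] using h2
    · have hgen : vertexGenus G (v₁ ++ (x :: d) :: (x' :: d') :: v₂) =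
          vertexGenus G (v₁ ++ (x' :: d') :: (x :: d) :: v₂) :=
        (h.vertexGenus_eq hv (x := x) (by simp)).trans
          (h'.vertexGenus_eq hv' (x := x) (by simp)).symm
      have hsw := B.vertexValue_swap h𝒜 hg
        (vertexGenus G (v₁ ++ (x' :: d') :: (x :: d) :: v₂)) _
        (v₂.map (List.map fun x => B.letter (m x))) (homogeneous_letters B m (x :: d))
        (homogeneous_letters B m (x' :: d')) (by simp) (by simp) (homogeneous_letters' B m v₁)
      rw [sum_shiftedParity, sum_shiftedParity]
      rw [List.length_map, List.length_map] at hsw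
      have hmap : ∀ c c' : List G.Flag, (v₁ ++ c :: c' :: v₂).map
          (List.map fun x => B.letter (m x)) = v₁.map (List.map fun x => B.letter (m x)) ++
          c.map (fun x => B.letter (m x)) :: c'.map (fun x => B.letter (m x)) ::
            v₂.map (List.map fun x => B.letter (m x)) := by simp
      unfold vertexProduct IsPresentation.presentation
      rw [prod_map_append_cons, prod_map_append_cons, vertexTensor_eq_vertexValue,
        vertexTensor_eq_vertexValue, hgen, hmap, hmap, hsw]
      ring
  | rotate l₁ l₂ v₁ v₂ x c =>
    by_cases hc : c = []
    · subst hc; rfl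
    have hv : v₁ ++ (x :: c) :: v₂ ∈ l₁ ++ (v₁ ++ (x :: c) :: v₂) :: l₂ := by simp
    have hv' : v₁ ++ (c ++ [x]) :: v₂ ∈ l₁ ++ (v₁ ++ (c ++ [x]) :: v₂) :: l₂ := by simp
    obtain ⟨y, d, rfl⟩ := List.exists_cons_of_ne_nil hc
    have hd : x ∉ y :: d := (List.nodup_cons.1 (h.cycle _ hv _ (by simp)).nodup).1
    have hcyc : cyc G.σ x = cyc G.σ y :=
      (cyc_eq_iff _).2 (((h.cycle _ hv (x :: y :: d) (by simp)).mem_iff (by simp)).1 (by simp))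
    set hs := fun v : List (List G.Flag) =>
      (v.reverse.filterMap List.head?).map (fun x => (Sum.inr (cyc G.σ x) : G.Basis)) with hhs
    have e1 : h.presentation.order.list = (l₁.flatMap (vertexOrder G.σ) ++ v₁.flatten.map Sum.inl) ++
        ([Sum.inl x] ++ ((y :: d).map Sum.inl ++ (v₂.flatten.map Sum.inl ++ (hs v₂ ++
          ([Sum.inr (cyc G.σ x)] ++ (hs v₁ ++ l₂.flatMap (vertexOrder G.σ))))))) := by
      simp [IsPresentation.presentation, Presentation.order, vertexOrder, hhs]
    have e2 : h'.presentation.order.list = (l₁.flatMap (vertexOrder G.σ) ++ v₁.flatten.map Sum.inl) ++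
        ((y :: d).map Sum.inl ++ ([Sum.inl x] ++ (v₂.flatten.map Sum.inl ++ (hs v₂ ++
          ([Sum.inr (cyc G.σ x)] ++ (hs v₁ ++ l₂.flatMap (vertexOrder G.σ))))))) := by
      simp [IsPresentation.presentation, Presentation.order, vertexOrder, hhs, hcyc]
    have h1 := reorderExponent_block_self (fun _ => 1) _ _ _ _ (e1 ▸ hon)
    rw [← e1, ← e2, sum_map_one, sum_map_one] at h1
    have h2 := reorderExponent_block (shiftedParity B m) E (l₁.flatten.flatten ++ v₁.flatten)
      [x] (y :: d) (v₂.flatten ++ l₂.flatten.flatten) (by simpa using hd) (fun y _ => hEm y)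
    refine colouringValue_eq B w E m hE hEm _ h1 (t := ([x].map (shiftedParity B m)).sum *
        ((y :: d).map (shiftedParity B m)).sum) ?_ ?_
    · simpa [Presentation.flags, IsPresentation.presentation] using h2
    · have hgen : vertexGenus G (v₁ ++ (x :: (y :: d)) :: v₂) =
          vertexGenus G (v₁ ++ ((y :: d) ++ [x]) :: v₂) :=
        (h.vertexGenus_eq hv (x := x) (by simp)).trans
          (h'.vertexGenus_eq hv' (x := x) (by simp)).symm
      have hsw := B.vertexValue_rotate h𝒜 hg
        (vertexGenus G (v₁ ++ ((y :: d) ++ [x]) :: v₂)) _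
        (v₂.map (List.map fun x => B.letter (m x))) (B.letter_mem (m x))
        (homogeneous_letters B m (y :: d)) (homogeneous_letters' B m v₁)
      have hx : Word.parity ([x].map fun x => B.letter (m x)) = (B.letter (m x)).1 := by simp
      rw [sum_shiftedParity, sum_shiftedParity, hx]
      rw [List.length_map] at hsw
      have hmap : ∀ c : List G.Flag, (v₁ ++ c :: v₂).map
          (List.map fun x => B.letter (m x)) = v₁.map (List.map fun x => B.letter (m x)) ++
          c.map (fun x => B.letter (m x)) :: v₂.map (List.map fun x => B.letter (m x)) := by simp
      unfold vertexProduct IsPresentation.presentation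
      rw [prod_map_append_cons, prod_map_append_cons, vertexTensor_eq_vertexValue,
        vertexTensor_eq_vertexValue, hgen, hmap, hmap, List.map_cons (l := y :: d),
        List.map_append, List.map_singleton, hsw, List.length_singleton, List.length_singleton,
        List.length_map]
      push_cast
      ring_nf

theorem colouringValue_independent (h𝒜 : IsSuperGrading 𝒜) (hg : IsOddScalarProduct 𝒜 g)
    (B : DualBases 𝒜 g ι) (w : G.Orient) {E : List G.Flag} (hE : E.Nodup) (hEm : ∀ x, x ∈ E)
    (m : G.Flag → ι) (P P' : Presentation G) :
    P.colouringValue B w E m = P'.colouringValue B w E m := by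
  have key : ∀ {L L'}, Relation.ReflTransGen PresentationMove L L' → ∀ (h : IsPresentation G L)
      (h' : IsPresentation G L'), h.presentation.colouringValue B w E m =
        h'.presentation.colouringValue B w E m := by
    intro L L' hr h
    induction hr with
    | refl => intro _; rfl
    | @tail M N hLM hMN ih =>
      intro h'
      have hM : IsPresentation G M := by
        clear ih hMN h'
        induction hLM with
        | refl => exact h
        | tail _ hm ih => exact ih.move hm
      exact (ih hM).trans (colouringValue_move h𝒜 hg B w hE hEm m hM h' hMN)
  exact key (P.isPresentation.reflTransGen_move P'.isPresentation) P.isPresentation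
    P'.isPresentation

end Independence

/-! ### The product over the edges -/

section Edges

/-- The flags of the edges with the first flags `R`: each first flag is followed by its partner. -/
def edgeList {F : Type*} (η : Perm F) (R : List F) : List F := R.flatMap fun x => [x, η x]

/-- `R` contains exactly one flag of every edge. -/
structure IsEdgeSystem {F : Type*} (η : Perm F) (R : List F) : Prop where
  nodup : (edgeList η R).Nodup
  mem : ∀ x, x ∈ edgeList η R

variable {F : Type*} {η : Perm F}

theorem mem_edgeList {R : List F} {y : F} :
    y ∈ edgeList η R ↔ ∃ x ∈ R, y = x ∨ y = η x := by
  simp [edgeList]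

theorem edgeList_cons (x : F) (R : List F) : edgeList η (x :: R) = x :: η x :: edgeList η R := rfl

theorem edgeList_append (R R' : List F) :
    edgeList η (R ++ R') = edgeList η R ++ edgeList η R' := by
  simp [edgeList]

theorem edgeList_perm {R R' : List F} (h : R.Perm R') : (edgeList η R).Perm (edgeList η R') :=
  h.flatMap_right _

theorem nodup_of_edgeList {R : List F} (h : (edgeList η R).Nodup) : R.Nodup := by
  induction R with
  | nil => simp
  | cons x R ih =>
    rw [edgeList_cons, List.nodup_cons, List.nodup_cons] at h
    refine List.nodup_cons.2 ⟨fun hx => h.1 ?_, ih h.2.2⟩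
    exact List.mem_cons_of_mem _ (mem_edgeList.2 ⟨x, hx, Or.inl rfl⟩)

theorem IsEdgeSystem.perm {R R' : List F} (h : IsEdgeSystem η R) (hR : R.Perm R') :
    IsEdgeSystem η R' :=
  ⟨(edgeList_perm hR).nodup_iff.1 h.nodup, fun x => (edgeList_perm hR).mem_iff.1 (h.mem x)⟩

theorem IsEdgeSystem.apply_notMem (hne : ∀ x, η x ≠ x) {R : List F}
    (h : IsEdgeSystem η R) {x : F} (hx : x ∈ R) : η x ∉ R := by
  intro hy
  obtain ⟨S, T, rfl⟩ := List.append_of_mem hx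
  have hn := (edgeList_perm (η := η) (List.perm_middle (a := x) (l₁ := S) (l₂ := T))).nodup_iff.1
    h.nodup
  rw [edgeList_cons, List.nodup_cons, List.nodup_cons] at hn
  have : η x ∈ S ++ T := by
    simp only [List.mem_append, List.mem_cons] at hy ⊢
    rcases hy with hy | hy | hy
    · exact Or.inl hy
    · exact absurd hy (hne x)
    · exact Or.inr hy
  exact hn.2.1 (mem_edgeList.2 ⟨_, this, Or.inl rfl⟩)

variable [DecidableEq F]

/-- Two systems of first flags differ by a permutation and by exchanging the two flags of edges. -/
theorem IsEdgeSystem.map_perm (hη : ∀ x, η (η x) = x) (hne : ∀ x, η x ≠ x) {R R' : List F}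
    (h : IsEdgeSystem η R) (h' : IsEdgeSystem η R') :
    (R.map fun x => if x ∈ R' then x else η x).Perm R' := by
  have hn : (R.map fun x => if x ∈ R' then x else η x).Nodup := by
    refine List.Nodup.map_on (fun x hx y hy hxy => ?_) (nodup_of_edgeList h.nodup)
    split_ifs at hxy with h1 h2 h2
    · exact hxy
    · exact absurd (hxy ▸ hx) (h.apply_notMem hne hy)
    · exact absurd (hxy ▸ hy) (h.apply_notMem hne hx)
    · exact η.injective hxy
  refine (List.perm_ext_iff_of_nodup hn (nodup_of_edgeList h'.nodup)).2 fun y => ?_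
  rw [List.mem_map]
  constructor
  · rintro ⟨x, hx, rfl⟩
    split_ifs with h1
    · exact h1
    · obtain ⟨z, hz, rfl | rfl⟩ := mem_edgeList.1 (h'.mem x)
      · exact absurd hz h1
      · rwa [hη]
  · intro hy
    obtain ⟨z, hz, rfl | rfl⟩ := mem_edgeList.1 (h.mem y)
    · exact ⟨_, hz, if_pos hy⟩
    · refine ⟨z, hz, if_neg fun hz' => h'.apply_notMem hne hz' hy⟩

variable {k A : Type*} [Field k] [NonUnitalRing A] [Module k A]
  {𝒜 : ZMod 2 → Submodule k A} {g : A →ₗ[k] A →ₗ[k] k} {ι : Type*} [DecidableEq ι] [Fintype ι]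

/-- The coefficient of the product of the edge tensors at a colouring of the flags, with the Koszul
sign for the order `t` of the flags. -/
noncomputable def edgeFactor (B : DualBases 𝒜 g ι) (J : A →ₗ[k] A) (η : Perm F) (t R : List F)
    (m : F → ι) : k :=
  sgn k (reorderExponent (shiftedParity B m) t (edgeList η R)) *
    (R.map fun x => B.propagator J (m x) (m (η x))).prod

variable (B : DualBases 𝒜 g ι) {J : A →ₗ[k] A}

/-- The edge tensor is even and symmetric in the sense of the Koszul rule. -/
structure IsEvenSymmetric (K : ι → ι → k) : Prop where
  even : ∀ μ ν, K μ ν ≠ 0 → B.parity μ = B.parity ν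
  symm : ∀ μ ν, K ν μ = sgn k ((B.parity μ + 1) * (B.parity ν + 1)) * K μ ν

variable {B}

/-- The elements of the edges are even, so that the order of the edges does not matter. -/
theorem edgeFactor_swap (hK : IsEvenSymmetric B (B.propagator J)) {t : List F} (ht : ∀ x, x ∈ t)
    (a b : List F) (x y : F) (hn : (edgeList η (a ++ x :: y :: b)).Nodup) (m : F → ι) :
    edgeFactor B J η t (a ++ x :: y :: b) m = edgeFactor B J η t (a ++ y :: x :: b) m := by
  have e : ∀ x y, edgeList η (a ++ x :: y :: b) =
      edgeList η a ++ ([x, η x] ++ ([y, η y] ++ edgeList η b)) := fun x y => by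
    rw [edgeList_append]; rfl
  have hd : [x, η x].Disjoint [y, η y] := by
    rw [e] at hn
    have := (List.nodup_append'.1 (List.nodup_append'.1 hn).2.1).2.2
    exact fun z hz hz' => this hz (List.mem_append_left _ hz')
  have hprod : ((a ++ x :: y :: b).map fun x => B.propagator J (m x) (m (η x))).prod =
      ((a ++ y :: x :: b).map fun x => B.propagator J (m x) (m (η x))).prod :=
    (((List.Perm.swap y x b).append_left a).map _).prod_eq
  unfold edgeFactor
  rw [hprod, e, e, reorderExponent_block _ t _ _ _ _ hd fun y _ => ht y]
  by_cases h0 : B.propagator J (m x) (m (η x)) = 0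
  · simp [h0]
  · have h1 : ([x, η x].map (shiftedParity B m)).sum = 0 := by
      simp only [List.map_cons, List.map_nil, List.sum_cons, List.sum_nil, shiftedParity,
        hK.even _ _ h0, add_zero]
      exact CharTwo.add_self_eq_zero _
    rw [h1, zero_mul, add_zero]

theorem edgeFactor_perm (hK : IsEvenSymmetric B (B.propagator J)) {t : List F} (ht : ∀ x, x ∈ t)
    {R R' : List F} (h : R.Perm R') (hn : (edgeList η R).Nodup) (m : F → ι) :
    edgeFactor B J η t R m = edgeFactor B J η t R' m := by
  have hr := adjSwap_reflTransGen h
  clear h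
  induction hr with
  | refl => rfl
  | @tail M N hM hMN ih =>
    rw [ih]
    have hp : R.Perm M := by
      clear ih hMN
      induction hM with
      | refl => rfl
      | tail _ h ih => exact ih.trans h.perm
    obtain ⟨a, x, y, b, rfl, rfl⟩ := hMN
    exact edgeFactor_swap hK ht a b x y ((edgeList_perm hp).nodup_iff.1 hn) m

/-- The elements of the edges are symmetric, so that the order of the two flags of an edge does not
matter. -/
theorem edgeFactor_flip (hη : ∀ x, η (η x) = x) (hne : ∀ x, η x ≠ x)
    (hK : IsEvenSymmetric B (B.propagator J)) {t : List F} (ht : ∀ x, x ∈ t)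
    (a b : List F) (x : F) (m : F → ι) :
    edgeFactor B J η t (a ++ x :: b) m = edgeFactor B J η t (a ++ η x :: b) m := by
  unfold edgeFactor
  rw [edgeList_append, edgeList_append, edgeList_cons, edgeList_cons, hη,
    reorderExponent_swap _ t _ _ (hne x).symm (ht x), sgn_add]
  simp only [List.map_append, List.map_cons, List.prod_append, List.prod_cons, hη]
  rw [hK.symm (m x) (m (η x))]
  simp only [shiftedParity]
  ring

theorem edgeFactor_map (hη : ∀ x, η (η x) = x) (hne : ∀ x, η x ≠ x)
    (hK : IsEvenSymmetric B (B.propagator J)) {t : List F} (ht : ∀ x, x ∈ t)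
    (a b : List F) (p : F → Prop) [DecidablePred p] (m : F → ι) :
    edgeFactor B J η t (a ++ b) m =
      edgeFactor B J η t (a ++ b.map fun x => if p x then x else η x) m := by
  induction b generalizing a with
  | nil => rfl
  | cons x b ih =>
    have h := ih (a ++ [if p x then x else η x])
    simp only [List.append_assoc, List.singleton_append] at h
    rw [List.map_cons, ← h]
    split_ifs
    · rfl
    · exact edgeFactor_flip hη hne hK ht a b x m

/-- The product of the edge tensors does not depend on the order of the edges and on the order of
the two flags of an edge. -/
theorem edgeFactor_eq (hη : ∀ x, η (η x) = x) (hne : ∀ x, η x ≠ x)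
    (hK : IsEvenSymmetric B (B.propagator J)) {t : List F} (ht : ∀ x, x ∈ t) {R R' : List F}
    (h : IsEdgeSystem η R) (h' : IsEdgeSystem η R') (m : F → ι) :
    edgeFactor B J η t R m = edgeFactor B J η t R' m := by
  have h1 := edgeFactor_map hη hne hK ht [] R (· ∈ R') m
  simp only [List.nil_append] at h1
  rw [h1]
  symm
  exact edgeFactor_perm hK ht (h.map_perm hη hne h').symm h'.nodup m

end Edges

section Weight

variable {k A : Type*} [Field k] [NonUnitalRing A] [Module k A]
  [IsScalarTower k A A] [SMulCommClass k A A]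
  {𝒜 : ZMod 2 → Submodule k A} {g : A →ₗ[k] A →ₗ[k] k} {ι : Type*} [DecidableEq ι] [Fintype ι]

/-- The symmetry of the propagator amounts to the self-adjointness of `J`. -/
theorem isEvenSymmetric_propagator [CharZero k]
    (hg : IsOddScalarProduct 𝒜 g)
    (B : DualBases 𝒜 g ι) {I J : A →ₗ[k] A} (hJ : IsHomotopyInverse 𝒜 g I J) :
    IsEvenSymmetric B (B.propagator J) := by
  have even : ∀ μ ν, B.propagator J μ ν ≠ 0 → B.parity μ = B.parity ν := by
    intro μ ν h
    by_contra hne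
    refine h ?_
    rw [DualBases.propagator, hg.odd _ _ _ (hJ.odd _ _ (B.dual_mem hg μ)) _ (B.dual_mem hg ν),
      mul_zero]
    intro hh
    apply hne
    generalize B.parity μ = a at *
    generalize B.parity ν = b at *
    grind
  refine ⟨even, fun μ ν => ?_⟩
  have h1 : B.propagator J ν μ = sgn k (B.parity μ + 1) * B.propagator J μ ν := by
    unfold DualBases.propagator
    rw [hJ.selfAdjoint _ _ (B.dual_mem hg ν), B.pairing_comm hg (B.dual ν)]
  rw [h1]
  by_cases h0 : B.propagator J μ ν = 0
  · simp [h0]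
  · rw [even μ ν h0, zmod_two_mul_self]

variable {G : StableRibbonGraph}

theorem Presentation.isEdgeSystem (P : Presentation G) : IsEdgeSystem G.η P.edgeFlags := by
  have hlt : ∀ x, x ∈ P.edgeFlags ↔ P.flags.idxOf x < P.flags.idxOf (G.η x) := fun x => by
    unfold Presentation.edgeFlags
    rw [List.mem_filter, decide_eq_true_iff]
    exact and_iff_right (P.mem x)
  constructor
  · rw [edgeList, List.nodup_flatMap]
    refine ⟨fun x _ => by simpa using (G.η_ne x).symm, ?_⟩
    have hn : P.edgeFlags.Nodup := P.nodup.filter _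
    refine List.Pairwise.imp_of_mem ?_ hn
    intro x y hx hy hxy
    rw [hlt] at hx hy
    rw [Function.onFun]
    intro z hz hz'
    simp only [List.mem_cons, List.not_mem_nil, or_false] at hz hz'
    rcases hz with rfl | rfl <;> rcases hz' with h | h
    · exact hxy h
    · rw [h, G.η_η] at hx; omega
    · rw [← h, G.η_η] at hy; omega
    · exact hxy (G.η.injective h)
  · intro x
    have hne : P.flags.idxOf x ≠ P.flags.idxOf (G.η x) := fun h =>
      G.η_ne x ((List.idxOf_inj (P.mem x)).1 h).symm
    rcases lt_or_gt_of_ne hne with h | h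
    · exact mem_edgeList.2 ⟨x, (hlt x).2 h, Or.inl rfl⟩
    · refine mem_edgeList.2 ⟨G.η x, (hlt _).2 (by rwa [G.η_η]), Or.inr (G.η_η x).symm⟩

theorem Presentation.weight_eq (P : Presentation G) (B : DualBases 𝒜 g ι) (J : A →ₗ[k] A) :
    P.weight B J = ∑ m, edgeFactor B J G.η P.flags P.edgeFlags m * P.vertexProduct B m := rfl

/-- The contraction of tensors can be computed with any order of the edges and of their flags. -/
theorem Presentation.sign_mul_weight [CharZero k] (P : Presentation G) (B : DualBases 𝒜 g ι)
    {J : A →ₗ[k] A} (hK : IsEvenSymmetric B (B.propagator J)) (w : G.Orient)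
    {R : List G.Flag} (hR : IsEdgeSystem G.η R) :
    ((w.sign P.order : ℤ) : k) * P.weight B J =
      ∑ m, (R.map fun x => B.propagator J (m x) (m (G.η x))).prod *
        P.colouringValue B w (edgeList G.η R) m := by
  rw [P.weight_eq, Finset.mul_sum]
  refine Finset.sum_congr rfl fun m _ => ?_
  rw [edgeFactor_eq G.η_η G.η_ne hK (t := P.flags) P.mem P.isEdgeSystem hR, edgeFactor,
    Presentation.colouringValue]
  ring

theorem partitionCochain_eq [CharZero k] (h𝒜 : IsSuperGrading 𝒜) (hg : IsOddScalarProduct 𝒜 g)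
    (B : DualBases 𝒜 g ι) {J : A →ₗ[k] A} (hK : IsEvenSymmetric B (B.propagator J))
    (w : G.Orient) (P : Presentation G) :
    partitionCochain B J ⟨G, w⟩ = ((w.sign P.order : ℤ) : k) * P.weight B J := by
  have hR := P.isEdgeSystem
  rw [partitionCochain, Presentation.sign_mul_weight _ B hK w hR, P.sign_mul_weight B hK w hR]
  refine Finset.sum_congr rfl fun m _ => ?_
  rw [colouringValue_independent h𝒜 hg B w hR.nodup hR.mem m _ P]

theorem partitionCochain_neg [CharZero k] (B : DualBases 𝒜 g ι) {J : A →ₗ[k] A} (w : G.Orient) :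
    partitionCochain B J ⟨G, -w⟩ = - partitionCochain B J ⟨G, w⟩ := by
  have h : ∀ o, (-w).sign o = - w.sign o := fun _ => rfl
  simp [partitionCochain, h]

end Weight

section Isomorphism

variable {G H : StableRibbonGraph}

theorem GraphIso.isCycleList (i : GraphIso G H) {c : List G.Flag} (h : IsCycleList G.σ c) :
    IsCycleList H.σ (c.map i.toEquiv) where
  ne_nil := by simpa using h.ne_nil
  nodup := h.nodup.map i.toEquiv.injective
  map_eq := by
    rw [← List.map_rotate, ← h.map_eq, List.map_map, List.map_map]
    exact List.map_congr_left fun x _ => (i.map_σ x).symm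

theorem flatten_map_map {X Y : Type*} (φ : X → Y) (L : List (List X)) :
    (L.map (List.map φ)).flatten = L.flatten.map φ := by
  rw [List.map_flatten]

theorem flatten_flatten_map {X Y : Type*} (φ : X → Y) (L : List (List (List X))) :
    (L.map (List.map (List.map φ))).flatten.flatten = L.flatten.flatten.map φ := by
  rw [← List.map_flatten, ← List.map_flatten]

theorem GraphIso.isPresentation (i : GraphIso G H) {L : List (List (List G.Flag))}
    (h : IsPresentation G L) :
    IsPresentation H (L.map (List.map (List.map i.toEquiv))) where
  ne_nil := by
    intro v hv
    obtain ⟨u, hu, rfl⟩ := List.mem_map.1 hv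
    simpa using h.ne_nil u hu
  cycle := by
    intro v hv c hc
    obtain ⟨u, hu, rfl⟩ := List.mem_map.1 hv
    obtain ⟨d, hd, rfl⟩ := List.mem_map.1 hc
    exact i.isCycleList (h.cycle u hu d hd)
  vertex := by
    intro v hv x hx y
    obtain ⟨u, hu, rfl⟩ := List.mem_map.1 hv
    rw [flatten_map_map] at hx ⊢
    obtain ⟨x, hx', rfl⟩ := List.mem_map.1 hx
    obtain ⟨y, rfl⟩ := i.toEquiv.surjective y
    rw [← i.map_lam, ← h.vertex u hu x hx' y, List.mem_map_of_injective i.toEquiv.injective]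
  nodup := by
    rw [flatten_flatten_map]
    exact h.nodup.map i.toEquiv.injective
  mem := by
    intro y
    obtain ⟨y, rfl⟩ := i.toEquiv.surjective y
    rw [flatten_flatten_map]
    exact List.mem_map_of_mem (h.mem y)

theorem GraphIso.vertexOrder_map (i : GraphIso G H) (v : List (List G.Flag)) :
    vertexOrder H.σ (v.map (List.map i.toEquiv)) = (vertexOrder G.σ v).map i.basisEquiv := by
  simp only [vertexOrder, flatten_map_map, List.map_append, List.map_map, ← List.map_reverse,
    List.filterMap_map]
  congr 1
  have : (List.head? ∘ List.map i.toEquiv) = fun c => (List.head? c).map i.toEquiv := by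
    funext c; cases c <;> rfl
  rw [this, ← List.map_filterMap, List.map_map]
  rfl

variable {k A : Type*} [Field k] [NonUnitalRing A] [Module k A]
  [IsScalarTower k A A] [SMulCommClass k A A]
  {𝒜 : ZMod 2 → Submodule k A} {g : A →ₗ[k] A →ₗ[k] k} {ι : Type*} [DecidableEq ι] [Fintype ι]

theorem DualBases.vertexTensor_map (B : DualBases 𝒜 g ι) {F F' : Type*} (φ : F → F') (γ : ℕ)
    (v : List (List F)) (m : F' → ι) :
    B.vertexTensor γ (v.map (List.map φ)) m = B.vertexTensor γ v (m ∘ φ) := by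
  unfold DualBases.vertexTensor
  rw [flatten_map_map, ← List.map_dropLast, List.getLast?_map]
  have : ((v.getLast?.map (List.map φ)).getD []) = (v.getLast?.getD []).map φ := by
    cases v.getLast? <;> rfl
  rw [this]
  simp only [List.map_map, Function.comp_def]

theorem partitionCochain_iso [CharZero k] (h𝒜 : IsSuperGrading 𝒜) (hg : IsOddScalarProduct 𝒜 g)
    (B : DualBases 𝒜 g ι) {J : A →ₗ[k] A} (hK : IsEvenSymmetric B (B.propagator J))
    (i : GraphIso G H) (w : G.Orient) :
    partitionCochain B J ⟨H, w.map i.basisEquiv⟩ = partitionCochain B J ⟨G, w⟩ := by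
  obtain ⟨P⟩ := Presentation.exists_presentation G
  have hP := i.isPresentation P.isPresentation
  rw [partitionCochain_eq h𝒜 hg B hK _ hP.presentation, partitionCochain_eq h𝒜 hg B hK _ P]
  have ho : (w.map i.basisEquiv).sign hP.presentation.order = w.sign P.order := by
    refine congrArg w.sign (BasisOrder.ext_list ?_)
    change ((P.list.map (List.map (List.map i.toEquiv))).flatMap (vertexOrder H.σ)).map
      i.basisEquiv.symm = P.list.flatMap (vertexOrder G.σ)
    rw [List.flatMap_map, List.map_flatMap]
    congr 1
    funext v
    rw [i.vertexOrder_map, List.map_map, Equiv.symm_comp_self, List.map_id]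
  rw [ho]
  congr 1
  have hfl : hP.presentation.flags = P.flags.map i.toEquiv := flatten_flatten_map _ _
  have hef : hP.presentation.edgeFlags = P.edgeFlags.map i.toEquiv := by
    unfold Presentation.edgeFlags
    rw [hfl, List.filter_map]
    congr 1
    refine List.filter_congr fun x _ => ?_
    simp only [Function.comp, ← i.map_η, idxOf_map_of_injective i.toEquiv.injective]
  rw [Presentation.weight_eq, Presentation.weight_eq]
  refine Fintype.sum_equiv (Equiv.arrowCongr i.toEquiv (Equiv.refl ι)).symm _ _ fun m => ?_
  have hm : (Equiv.arrowCongr i.toEquiv (Equiv.refl ι)).symm m = m ∘ i.toEquiv := rfl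
  rw [hm]
  congr 1
  · unfold edgeFactor
    rw [hfl, hef]
    have he : edgeList H.η (P.edgeFlags.map i.toEquiv) =
        (edgeList G.η P.edgeFlags).map i.toEquiv := by
      simp only [edgeList, List.flatMap_map, List.map_flatMap, List.map_cons, List.map_nil,
        i.map_η]
    rw [he, reorderExponent_map i.toEquiv.injective, List.map_map]
    congr 2
    refine List.map_congr_left fun x _ => ?_
    simp [i.map_η]
  · unfold Presentation.vertexProduct
    change ((P.list.map (List.map (List.map i.toEquiv))).map _).prod = _
    rw [List.map_map]
    congr 1
    refine List.map_congr_left fun v _ => ?_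
    simp only [Function.comp, B.vertexTensor_map]
    have : vertexGenus H (v.map (List.map i.toEquiv)) = vertexGenus G v := by
      unfold vertexGenus
      rw [flatten_map_map]
      cases v.flatten with
      | nil => rfl
      | cons x l => exact i.map_genus x
    rw [this]

end Isomorphism

/-! ### Linearity of the vertices in the letters -/

section Linearity

variable {k A : Type*} [Field k] [NonUnitalRing A] [Module k A]
  [IsScalarTower k A A] [SMulCommClass k A A]
  {𝒜 : ZMod 2 → Submodule k A} {g : A →ₗ[k] A →ₗ[k] k} {ι : Type*} [DecidableEq ι] [Fintype ι]

/-- The function agrees with a linear map. -/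
def IsLinearFunction {V W : Type*} [AddCommGroup V] [Module k V] [AddCommGroup W] [Module k W]
    (φ : V → W) : Prop := ∃ ψ : V →ₗ[k] W, ∀ y, φ y = ψ y

theorem isLinearFunction_wordProd (u u' : List A) :
    IsLinearFunction (k := k) fun y : A => wordProd (u ++ y :: u') := by
  have key : ∀ u' : List A, IsLinearFunction (k := k) fun y : A => u'.foldl (· * ·) y := by
    intro u'
    induction u' with
    | nil => exact ⟨LinearMap.id, fun _ => rfl⟩
    | cons b u' ih =>
      obtain ⟨ψ, hψ⟩ := ih
      exact ⟨ψ ∘ₗ LinearMap.mulRight k b, fun y => hψ (y * b)⟩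
  obtain ⟨ψ, hψ⟩ := key u'
  cases u with
  | nil => exact ⟨ψ, hψ⟩
  | cons a u =>
    refine ⟨ψ ∘ₗ LinearMap.mulLeft k (u.foldl (· * ·) a), fun y => ?_⟩
    simp only [List.cons_append, wordProd, List.foldl_append, List.foldl_cons]
    exact hψ _

theorem isLinearFunction_oddTrace (u u' : List A) :
    IsLinearFunction (k := k) fun y : A => oddTrace g (u ++ y :: u') := by
  cases u with
  | nil => exact ⟨g.flip (wordProd u'), fun _ => rfl⟩
  | cons a u =>
    obtain ⟨ψ, hψ⟩ := isLinearFunction_wordProd (k := k) u u'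
    exact ⟨g a ∘ₗ ψ, fun y => congrArg (g a) (hψ y)⟩

theorem isLinearFunction_trace (s : ZMod 2) (u u' : Word A) :
    IsLinearFunction (k := k) fun y : A => Word.trace g (u ++ (s, y) :: u') := by
  obtain ⟨ψ, hψ⟩ := isLinearFunction_oddTrace (g := g) (u.map Prod.snd) (u'.map Prod.snd)
  exact ⟨ψ, fun y => by simpa [Word.trace] using hψ y⟩

theorem IsLinearFunction.const_mul {φ : A → k} (h : IsLinearFunction (k := k) φ) (r : k) :
    IsLinearFunction (k := k) fun y => r * φ y := by
  obtain ⟨ψ, hψ⟩ := h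
  exact ⟨r • ψ, fun y => by simp [hψ]⟩

namespace DualBases

open Word

variable (B : DualBases 𝒜 g ι)

theorem isLinearFunction_vertexTrace (γ : ℕ) (w w' : List (Word A)) (c c' : Word A) (s : ZMod 2) :
    IsLinearFunction (k := k) fun y : A =>
      B.vertexTrace γ (w ++ (c ++ (s, y) :: c') :: w') := by
  rcases List.eq_nil_or_concat w' with rfl | ⟨w', d, rfl⟩
  · obtain ⟨ψ, hψ⟩ := isLinearFunction_trace (g := g) s (w.map B.insertionLetter ++ c)
      (c' ++ B.handleWord γ)
    refine ⟨ψ, fun y => ?_⟩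
    beta_reduce
    rw [vertexTrace_concat, ← hψ]
    simp
  · obtain ⟨χ, hχ⟩ := isLinearFunction_wordProd (k := k) (c.map Prod.snd) (c'.map Prod.snd)
    obtain ⟨ψ, hψ⟩ := isLinearFunction_trace (g := g) (c.parity + (s + c'.parity) + 1)
      (w.map B.insertionLetter) (w'.map B.insertionLetter ++ (d ++ B.handleWord γ))
    refine ⟨ψ ∘ₗ B.casimir (c.parity + (s + c'.parity) + 1) ∘ₗ χ, fun y => ?_⟩
    have e : w ++ (c ++ (s, y) :: c') :: w'.concat d =
        (w ++ (c ++ (s, y) :: c') :: w') ++ [d] := by simp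
    beta_reduce
    rw [e, vertexTrace_concat, LinearMap.comp_apply, LinearMap.comp_apply, ← hχ, ← hψ]
    have e2 : B.insertionLetter (c ++ (s, y) :: c') = (c.parity + (s + c'.parity) + 1,
        B.casimir (c.parity + (s + c'.parity) + 1)
          (wordProd (c.map Prod.snd ++ y :: c'.map Prod.snd))) := by
      simp [insertionLetter, insertion_eq_casimir, Word.prod]
    simp [e2]

theorem isLinearFunction_vertexValue (γ : ℕ) (w w' : List (Word A)) (c c' : Word A) (s : ZMod 2) :
    IsLinearFunction (k := k) fun y : A =>
      B.vertexValue γ (w ++ (c ++ (s, y) :: c') :: w') := by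
  have h := B.isLinearFunction_vertexTrace γ w w' c c' s
  have e : ∀ y, vertexExponent (w ++ (c ++ (s, y) :: c') :: w') =
      vertexExponent (w ++ (c ++ (s, (0 : A)) :: c') :: w') := fun y => by
    simp [vertexExponent]
  simp only [vertexValue, e]
  exact h.const_mul _

variable {F : Type*} [DecidableEq F]

theorem isLinearFunction_vertexValue_update (γ : ℕ) {v : List (List F)} (hn : v.flatten.Nodup)
    {x : F} (hx : x ∈ v.flatten) (a : F → ZMod 2 × A) (s : ZMod 2) :
    IsLinearFunction (k := k) fun y : A =>
      B.vertexValue γ (v.map (List.map (Function.update a x (s, y)))) := by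
  obtain ⟨d, hd, hxd⟩ := List.mem_flatten.1 hx
  obtain ⟨w, w', rfl⟩ := List.append_of_mem hd
  obtain ⟨c, c', rfl⟩ := List.append_of_mem hxd
  have hcount : x ∉ w.flatten ∧ x ∉ c ∧ x ∉ c' ∧ x ∉ w'.flatten := by
    have h : (w.flatten ++ (c ++ x :: (c' ++ w'.flatten))).Nodup := by simpa using hn
    have h1 := ((List.perm_middle.append_left w.flatten).trans List.perm_middle).nodup_iff.1 h
    have h2 := (List.nodup_cons.1 h1).1
    simp only [List.mem_append, not_or] at h2
    exact ⟨h2.1, h2.2.1, h2.2.2.1, h2.2.2.2⟩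
  obtain ⟨ψ, hψ⟩ := B.isLinearFunction_vertexValue γ (w.map (List.map a)) (w'.map (List.map a))
    (c.map a) (c'.map a) s
  refine ⟨ψ, fun y => ?_⟩
  rw [← hψ]
  have e1 : ∀ c : List F, x ∉ c → c.map (Function.update a x (s, y)) = c.map a := fun c hc =>
    List.map_congr_left fun z hz => Function.update_of_ne (ne_of_mem_of_not_mem hz hc) _ _
  have e2 : ∀ w : List (List F), x ∉ w.flatten →
      w.map (List.map (Function.update a x (s, y))) = w.map (List.map a) := fun w hw =>
    List.map_congr_left fun c hc => e1 c fun hx => hw (List.mem_flatten.2 ⟨c, hc, hx⟩)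
  simp only [List.map_append, List.map_cons, e1 c hcount.2.1, e1 c' hcount.2.2.1, e2 w hcount.1,
    e2 w' hcount.2.2.2, Function.update_self]

/-- The product of the values of the vertices for an assignment of letters to the flags. -/
noncomputable def graphValue (γ : List (List F) → ℕ) (L : List (List (List F)))
    (a : F → ZMod 2 × A) : k := (L.map fun v => B.vertexValue (γ v) (v.map (List.map a))).prod

theorem isLinearFunction_graphValue_update (γ : List (List F) → ℕ) {L : List (List (List F))}
    (hn : L.flatten.flatten.Nodup) {x : F} (hx : x ∈ L.flatten.flatten) (a : F → ZMod 2 × A)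
    (s : ZMod 2) :
    IsLinearFunction (k := k) fun y : A => B.graphValue γ L (Function.update a x (s, y)) := by
  induction L with
  | nil => simp at hx
  | cons v L ih =>
    simp only [List.flatten_cons, List.flatten_append] at hn hx
    obtain ⟨h1, h2, h3⟩ := List.nodup_append'.1 hn
    have e2 : ∀ v : List (List F), x ∉ v.flatten → ∀ y,
        v.map (List.map (Function.update a x (s, y))) = v.map (List.map a) := fun v hv y =>
      List.map_congr_left fun c hc => List.map_congr_left fun z hz =>
        Function.update_of_ne (fun h => hv (List.mem_flatten.2 ⟨c, hc, by rwa [← h]⟩)) _ _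
    have e3 : ∀ y, B.graphValue γ (v :: L) (Function.update a x (s, y)) =
        B.vertexValue (γ v) (v.map (List.map (Function.update a x (s, y)))) *
          B.graphValue γ L (Function.update a x (s, y)) := fun _ => rfl
    simp only [e3]
    by_cases hv : x ∈ v.flatten
    · have e4 : ∀ y, B.graphValue γ L (Function.update a x (s, y)) = B.graphValue γ L a := by
        intro y
        unfold graphValue
        congr 1
        refine List.map_congr_left fun u hu => ?_
        rw [e2 u fun h => h3 hv ?_]
        obtain ⟨c, hc, hxc⟩ := List.mem_flatten.1 h
        exact List.mem_flatten.2 ⟨c, List.mem_flatten.2 ⟨u, hu, hc⟩, hxc⟩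
      simp only [e4, mul_comm _ (B.graphValue γ L a)]
      exact (B.isLinearFunction_vertexValue_update _ h1 hv a s).const_mul _
    · simp only [e2 v hv]
      exact (ih h2 ((List.mem_append.1 hx).resolve_left hv)).const_mul _

theorem sum_pairing_mul_graphValue (γ : List (List F) → ℕ) {L : List (List (List F))}
    (hn : L.flatten.flatten.Nodup) {x : F} (hx : x ∈ L.flatten.flatten) (a : F → ZMod 2 × A)
    (s : ZMod 2) (y : A) :
    ∑ μ, g (B.dual μ) y * B.graphValue γ L (Function.update a x (s, B.e μ)) =
      B.graphValue γ L (Function.update a x (s, y)) := by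
  obtain ⟨ψ, hψ⟩ := B.isLinearFunction_graphValue_update γ hn hx a s
  simp only [hψ]
  conv_rhs => rw [← B.sum_pairing_smul_e y]
  simp

end DualBases

end Linearity

/-! ### The differential of the edges -/

section Homotopy

variable {k A : Type*} [Field k] [NonUnitalRing A] [Module k A]
  [IsScalarTower k A A] [SMulCommClass k A A] [CharZero k]
  {𝒜 : ZMod 2 → Submodule k A} {g : A →ₗ[k] A →ₗ[k] k} {ι : Type*} [DecidableEq ι] [Fintype ι]
  {F : Type*} [DecidableEq F] [Fintype F]

theorem sum_sum_update {M : Type*} [AddCommMonoid M] (x : F) (φ : (F → ι) → ι → M) :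
    ∑ m, ∑ μ, φ m μ = ∑ m, ∑ μ, φ (Function.update m x μ) (m x) := by
  rw [← Fintype.sum_prod_type', ← Fintype.sum_prod_type']
  let e : ((F → ι) × ι) → ((F → ι) × ι) := fun p => (Function.update p.1 x p.2, p.1 x)
  have he : Function.Involutive e := fun p => by simp [e]
  exact (Fintype.sum_equiv he.toPerm (fun p => φ (e p).1 (e p).2) (fun p => φ p.1 p.2)
    fun p => rfl).symm

namespace DualBases

variable (B : DualBases 𝒜 g ι)

/-- The operator `I` moves from one basis to the other because it is anti-self-adjoint. -/
theorem sum_pairing_derivation_smul_dual (hg : IsOddScalarProduct 𝒜 g) {I : A →ₗ[k] A}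
    (hI : IsOddDerivation 𝒜 g I) (μ : ι) :
    ∑ l, g (B.dual μ) (I (B.e l)) • B.dual l = - (sgn k (B.parity μ + 1) • I (B.dual μ)) := by
  have h1 : ∀ x, g (B.dual μ) (I x) = - (sgn k (B.parity μ + 1) * g (I (B.dual μ)) x) := by
    intro x
    have h := hI.antiSelfAdjoint _ _ (B.dual_mem hg μ) x
    have h2 := sgn_mul_self k (B.parity μ + 1)
    linear_combination sgn k (B.parity μ + 1) * h - g (B.dual μ) (I x) * h2
  simp only [h1, neg_smul, mul_smul, Finset.sum_neg_distrib, ← Finset.smul_sum]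
  rw [B.sum_pairing_smul_dual hg]

/-- The commutator of the derivation with the homotopy turns the propagator into the inverse of the
scalar product. -/
theorem pairing_dual_eq_sum (hg : IsOddScalarProduct 𝒜 g) {I J : A →ₗ[k] A}
    (hI : IsOddDerivation 𝒜 g I) (hJ : IsHomotopyInverse 𝒜 g I J) (μ ν : ι) :
    g (B.dual μ) (B.dual ν) = (∑ l, g (B.dual μ) (I (B.e l)) * B.propagator J l ν) +
      sgn k (B.parity μ + 1) * ∑ l, g (B.dual ν) (I (B.e l)) * B.propagator J μ l := by
  have hμ := B.dual_mem hg μ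
  have hν := B.dual_mem hg ν
  have h1 : ∑ l, g (B.dual μ) (I (B.e l)) * B.propagator J l ν =
      g (J (I (B.dual μ))) (B.dual ν) := by
    have : ∀ l, g (B.dual μ) (I (B.e l)) * B.propagator J l ν = sgn k (B.parity ν + 1) *
        g (J (g (B.dual μ) (I (B.e l)) • B.dual l)) (B.dual ν) := by
      intro l
      simp only [propagator, map_smul, LinearMap.smul_apply, smul_eq_mul]
      ring
    simp only [this]
    rw [← Finset.mul_sum, ← LinearMap.sum_apply, ← map_sum, ← map_sum,
      B.sum_pairing_derivation_smul_dual hg hI]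
    simp only [map_neg, map_smul, LinearMap.neg_apply, LinearMap.smul_apply, smul_eq_mul]
    by_cases hp : B.parity μ = B.parity ν + 1
    · rw [hp, sgn_add _ (B.parity ν + 1)]
      have h2 := sgn_mul_self k (B.parity ν + 1)
      rw [sgn_one]
      linear_combination g (J (I (B.dual μ))) (B.dual ν) * h2
    · rw [hg.odd _ _ _ (hJ.odd _ _ (hI.odd _ _ hμ)) _ hν]
      · simp
      · generalize B.parity μ = a at *
        generalize B.parity ν = b at *
        grind
  have h2 : sgn k (B.parity μ + 1) * ∑ l, g (B.dual ν) (I (B.e l)) * B.propagator J μ l =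
      g (I (J (B.dual μ))) (B.dual ν) := by
    have : ∀ l, sgn k (B.parity μ + 1) * (g (B.dual ν) (I (B.e l)) * B.propagator J μ l) =
        g (J (B.dual μ)) (g (B.dual ν) (I (B.e l)) • B.dual l) := by
      intro l
      rw [map_smul, smul_eq_mul, propagator]
      by_cases hp : B.parity μ = B.parity l
      · rw [hp]
        have h2 := sgn_mul_self k (B.parity l + 1)
        linear_combination (g (B.dual ν) (I (B.e l)) * g (J (B.dual μ)) (B.dual l)) * h2
      · rw [hg.odd _ _ _ (hJ.odd _ _ hμ) _ (B.dual_mem hg l)]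
        · simp
        · generalize B.parity μ = a at *
          generalize B.parity l = b at *
          grind
    rw [Finset.mul_sum]
    simp only [this]
    rw [← map_sum, B.sum_pairing_derivation_smul_dual hg hI]
    have h3 := hI.antiSelfAdjoint _ _ (hJ.odd _ _ hμ) (B.dual ν)
    simp only [map_neg, map_smul, smul_eq_mul]
    by_cases hp : B.parity μ = B.parity ν + 1
    · have e : B.parity μ + 1 + 1 = B.parity ν + 1 := by rw [hp]; grind
      rw [e] at h3
      linear_combination - h3
    · rw [hg.odd _ _ _ (hI.odd _ _ (hJ.odd _ _ hμ)) _ hν]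
      · rw [hg.odd _ _ _ (hJ.odd _ _ hμ) _ (hI.odd _ _ hν)]
        · simp
        · generalize B.parity μ = a at *
          generalize B.parity ν = b at *
          grind
      · generalize B.parity μ = a at *
        generalize B.parity ν = b at *
        grind
  rw [h1, h2, ← LinearMap.add_apply, ← map_add, add_comm, hJ.commutator]

/-- An operator at an end of an edge can be moved to the vertex. -/
theorem sum_pairing_derivation_mul (hg : IsOddScalarProduct 𝒜 g) {I : A →ₗ[k] A}
    (hI : IsOddDerivation 𝒜 g I) (γ : List (List F) → ℕ) {L : List (List (List F))}
    (hn : L.flatten.flatten.Nodup) (hL : ∀ x, x ∈ L.flatten.flatten) {E : List F} (hE : E.Nodup)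
    (hEm : ∀ x, x ∈ E) (m : F → ι) (x : F) :
    ∑ μ, g (B.dual μ) (I (B.e (m x))) *
        (sgn k (reorderExponent (shiftedParity B (Function.update m x μ)) L.flatten.flatten E) *
          B.graphValue γ L fun y => B.letter (Function.update m x μ y)) =
      sgn k (reorderExponent (shiftedParity B m) L.flatten.flatten E) *
        sgn k (precedingSum (shiftedParity B m) E E x) *
        (sgn k (precedingSum (shiftedParity B m) L.flatten.flatten L.flatten.flatten x) *
          B.graphValue γ L (applyAt I (fun y => B.letter (m y)) x)) := by
  have hperm : L.flatten.flatten.Perm E :=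
    (List.perm_ext_iff_of_nodup hn hE).2 fun x => ⟨fun _ => hEm x, fun _ => hL x⟩
  have hy : I (B.e (m x)) ∈ 𝒜 (B.parity (m x) + 1) := hI.odd _ _ (B.e_mem _)
  have key := B.sum_pairing_mul_graphValue γ hn (hL x) (fun y => B.letter (m y))
    (B.parity (m x) + 1) (I (B.e (m x)))
  have e1 : applyAt I (fun y => B.letter (m y)) x =
      Function.update (fun y => B.letter (m y)) x (B.parity (m x) + 1, I (B.e (m x))) := rfl
  rw [e1, ← key, Finset.mul_sum, Finset.mul_sum]
  refine Finset.sum_congr rfl fun μ _ => ?_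
  by_cases hp : B.parity μ = B.parity (m x) + 1
  · have e2 : (fun y => B.letter (Function.update m x μ y)) =
        Function.update (fun y => B.letter (m y)) x (B.parity (m x) + 1, B.e μ) := by
      funext y
      by_cases hxy : y = x
      · subst hxy; simp [letter, hp]
      · simp [hxy]
    have e3 : reorderExponent (shiftedParity B (Function.update m x μ)) L.flatten.flatten E =
        reorderExponent (shiftedParity B m) L.flatten.flatten E +
          precedingSum (shiftedParity B m) L.flatten.flatten L.flatten.flatten x +
          precedingSum (shiftedParity B m) E E x := by
      refine reorderExponent_update _ hE hperm (hEm x) ?_ ?_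
      · simp [shiftedParity, hp]
      · intro y hxy
        simp [shiftedParity, hxy]
    rw [e2, e3, sgn_add, sgn_add]
    ring
  · rw [hg.odd _ _ _ (B.dual_mem hg μ) _ hy]
    · simp
    · generalize B.parity μ = a at *
      generalize B.parity (m x) = b at *
      grind

/-- The sum over the colourings with the inverse of the scalar product at the edge `{f, η f}`. -/
theorem sum_pairing_edge (hg : IsOddScalarProduct 𝒜 g) {I J : A →ₗ[k] A}
    (hI : IsOddDerivation 𝒜 g I) (hJ : IsHomotopyInverse 𝒜 g I J) {η : Perm F}
    (hne : ∀ x, η x ≠ x) (γ : List (List F) → ℕ)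
    {L : List (List (List F))} (hn : L.flatten.flatten.Nodup) (hL : ∀ x, x ∈ L.flatten.flatten)
    {f : F} {R : List F} (hR : IsEdgeSystem η (f :: R)) :
    ∑ m : F → ι, g (B.dual (m f)) (B.dual (m (η f))) *
        (R.map fun x => B.propagator J (m x) (m (η x))).prod *
        (sgn k (reorderExponent (shiftedParity B m) L.flatten.flatten (edgeList η (f :: R))) *
          B.graphValue γ L fun y => B.letter (m y)) =
      ∑ m : F → ι, edgeFactor B J η L.flatten.flatten (f :: R) m *
        (sgn k (precedingSum (shiftedParity B m) L.flatten.flatten L.flatten.flatten f) *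
            B.graphValue γ L (applyAt I (fun y => B.letter (m y)) f) +
          sgn k (precedingSum (shiftedParity B m) L.flatten.flatten L.flatten.flatten (η f)) *
            B.graphValue γ L (applyAt I (fun y => B.letter (m y)) (η f))) := by
  have hEn := hR.nodup
  rw [edgeList_cons, List.nodup_cons, List.nodup_cons] at hEn
  have hf : ∀ x ∈ R, x ≠ f ∧ η x ≠ f := fun x hx =>
    ⟨fun h => hEn.1 (List.mem_cons_of_mem _ (mem_edgeList.2 ⟨x, hx, Or.inl h.symm⟩)),
      fun h => hEn.1 (List.mem_cons_of_mem _ (mem_edgeList.2 ⟨x, hx, Or.inr h.symm⟩))⟩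
  have hf' : ∀ x ∈ R, x ≠ η f ∧ η x ≠ η f := fun x hx =>
    ⟨fun h => hEn.2.1 (mem_edgeList.2 ⟨x, hx, Or.inl h.symm⟩),
      fun h => hEn.2.1 (mem_edgeList.2 ⟨x, hx, Or.inr h.symm⟩)⟩
  have hprod : ∀ (m : F → ι) (μ : ι),
      (R.map fun x => B.propagator J (Function.update m f μ x) (Function.update m f μ (η x))) =
        R.map fun x => B.propagator J (m x) (m (η x)) := fun m μ =>
    List.map_congr_left fun x hx => by
      rw [Function.update_of_ne (hf x hx).1, Function.update_of_ne (hf x hx).2]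
  have hprod' : ∀ (m : F → ι) (μ : ι),
      (R.map fun x => B.propagator J (Function.update m (η f) μ x)
        (Function.update m (η f) μ (η x))) =
        R.map fun x => B.propagator J (m x) (m (η x)) := fun m μ =>
    List.map_congr_left fun x hx => by
      rw [Function.update_of_ne (hf' x hx).1, Function.update_of_ne (hf' x hx).2]
  simp only [B.pairing_dual_eq_sum hg hI hJ, add_mul, Finset.sum_add_distrib, mul_add]
  congr 1
  · simp only [Finset.sum_mul]
    rw [sum_sum_update f]
    refine Finset.sum_congr rfl fun m _ => ?_
    have key := B.sum_pairing_derivation_mul hg hI γ hn hL hR.nodup hR.mem m f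
    rw [edgeList_cons, precedingSum_cons_self, sgn_zero, mul_one] at key
    rw [edgeFactor, edgeList_cons, List.map_cons, List.prod_cons]
    have : ∀ P Q a b c : k, a * (P * Q) * (b * c) = (P * Q) * (a * (b * c)) := by intros; ring
    simp only [hprod, Function.update_self, Function.update_of_ne (hne f)]
    calc _ = (B.propagator J (m f) (m (η f)) *
            (R.map fun x => B.propagator J (m x) (m (η x))).prod) * ∑ μ, _ := by
          rw [Finset.mul_sum]
          refine Finset.sum_congr rfl fun μ _ => ?_
          rw [mul_assoc (g _ _), this]
      _ = _ := by rw [key]; ring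
  · simp only [Finset.sum_mul, Finset.mul_sum]
    rw [sum_sum_update (η f)]
    refine Finset.sum_congr rfl fun m _ => ?_
    have key := B.sum_pairing_derivation_mul hg hI γ hn hL hR.nodup hR.mem m (η f)
    have hprec : precedingSum (shiftedParity B m) (edgeList η (f :: R)) (edgeList η (f :: R))
        (η f) = B.parity (m f) + 1 := by
      rw [edgeList_cons, precedingSum_cons_of_ne _ ?_ (by simp), precedingSum_cons_self, add_zero]
      · rfl
      · exact hR.nodup
    rw [hprec] at key
    rw [edgeFactor, List.map_cons, List.prod_cons]
    have hsq := sgn_mul_self k (B.parity (m f) + 1)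
    have : ∀ s a P Q b c : k, s * (a * P) * Q * (b * c) = (s * (P * Q)) * (a * (b * c)) := by
      intros; ring
    simp only [hprod', Function.update_self, Function.update_of_ne (hne f).symm]
    calc _ = (sgn k (B.parity (m f) + 1) * (B.propagator J (m f) (m (η f)) *
            (R.map fun x => B.propagator J (m x) (m (η x))).prod)) * ∑ μ, _ := by
          rw [Finset.mul_sum]
          refine Finset.sum_congr rfl fun μ _ => ?_
          rw [this]
      _ = _ := by
          rw [key]
          linear_combination (sgn k (reorderExponent (shiftedParity B m) L.flatten.flatten
            (edgeList η (f :: R))) * (B.propagator J (m f) (m (η f)) *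
            (R.map fun x => B.propagator J (m x) (m (η x))).prod) *
            sgn k (precedingSum (shiftedParity B m) L.flatten.flatten L.flatten.flatten (η f)) *
            B.graphValue γ L (applyAt I (fun y => B.letter (m y)) (η f))) * hsq

end DualBases

end Homotopy

/-! ### Cycle lists of a contraction -/

section ContractCycles

variable {α : Type*} [DecidableEq α] {σ : Perm α} {f f' : α}

theorem map_swap_of_notMem {c : List α} (h : f ∉ c) (h' : f' ∉ c) : c.map (swap f f') = c := by
  conv_rhs => rw [← List.map_id c]
  exact List.map_congr_left fun x hx => swap_apply_of_ne_of_ne (ne_of_mem_of_not_mem hx h)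
    (ne_of_mem_of_not_mem hx h')

theorem map_glue (c : List α) : c.map (glue σ f f') = (c.map σ).map (swap f f') := by
  rw [List.map_map]; rfl

theorem IsCycleList.glue_of_notMem {c : List α} (h : IsCycleList σ c) (hf : f ∉ c) (hf' : f' ∉ c) :
    IsCycleList (glue σ f f') c where
  ne_nil := h.ne_nil
  nodup := h.nodup
  map_eq := by
    rw [map_glue, h.map_eq, map_swap_of_notMem] <;> simpa

theorem IsCycleList.cut {A A' : List α} (h : IsCycleList σ (f :: (A ++ f' :: A'))) :
    IsCycleList (glue σ f f') (f :: A) ∧ IsCycleList (glue σ f f') (f' :: A') := by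
  have hn := h.nodup
  have hn2 : (f' :: A').Nodup ∧ (f :: A).Nodup ∧ f ∉ A ∧ f' ∉ A ∧ f ∉ A' ∧ f' ∉ A' := by
    simp only [List.nodup_cons, List.nodup_append, List.mem_append, List.mem_cons, not_or] at hn ⊢
    grind
  obtain ⟨h1, h2, h3, h4, h5, h6⟩ := hn2
  have hm := map_glue (σ := σ) (f := f) (f' := f') (f :: (A ++ f' :: A'))
  rw [h.map_eq] at hm
  have e : (f :: (A ++ f' :: A')).rotate 1 = A ++ f' :: (A' ++ [f]) := by simp
  rw [e, List.map_append (f := swap f f'), List.map_cons (f := swap f f'),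
    List.map_append (f := swap f f'), List.map_singleton,
    map_swap_of_notMem h3 h4, map_swap_of_notMem h5 h6, swap_apply_left, swap_apply_right] at hm
  have e2 : (f :: (A ++ f' :: A')) = (f :: A) ++ (f' :: A') := rfl
  have e3 : A ++ f :: (A' ++ [f']) = (A ++ [f]) ++ (A' ++ [f']) := by simp
  rw [e2, e3, List.map_append] at hm
  obtain ⟨k1, k2⟩ := List.append_inj hm (by simp)
  exact ⟨⟨by simp, h2, by rw [k1]; simp⟩, ⟨by simp, h1, by rw [k2]; simp⟩⟩

theorem IsCycleList.join {A A' : List α} (h : IsCycleList σ (f :: A))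
    (h' : IsCycleList σ (f' :: A')) (hd : (f :: A).Disjoint (f' :: A')) :
    IsCycleList (glue σ f f') (f :: (A ++ f' :: A')) where
  ne_nil := by simp
  nodup := List.nodup_append'.2 ⟨h.nodup, h'.nodup, hd⟩
  map_eq := by
    have e2 : (f :: (A ++ f' :: A')) = (f :: A) ++ (f' :: A') := rfl
    have hA : f ∉ A ∧ f' ∉ A := ⟨(List.nodup_cons.1 h.nodup).1, fun k =>
      hd (List.mem_cons_of_mem _ k) (by simp)⟩
    have hA' : f ∉ A' ∧ f' ∉ A' := ⟨fun k => hd (by simp) (List.mem_cons_of_mem _ k),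
      (List.nodup_cons.1 h'.nodup).1⟩
    rw [map_glue, e2, List.map_append, h.map_eq, h'.map_eq]
    simp [map_swap_of_notMem hA.1 hA.2, map_swap_of_notMem hA'.1 hA'.2]

theorem IsCycleList.skip_of_notMem {π : Perm α} {c : List α} (h : IsCycleList π c) {a : α}
    (ha : a ∉ c) : IsCycleList (skip π a) c where
  ne_nil := h.ne_nil
  nodup := h.nodup
  map_eq := by
    rw [← h.map_eq]
    exact List.map_congr_left fun x hx => skip_of_ne π (ne_of_mem_of_not_mem hx ha)
      (ne_of_mem_of_not_mem (h.apply_mem hx) ha)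

theorem IsCycleList.skip_cons {π : Perm α} {a : α} {C : List α} (h : IsCycleList π (a :: C))
    (hC : C ≠ []) : IsCycleList (skip π a) C := by
  obtain ⟨b, C, rfl⟩ := List.exists_cons_of_ne_nil hC
  have hm := h.map_eq
  have hn := h.nodup
  rw [List.rotate_cons_succ, List.rotate_zero, List.map_cons, List.cons_append,
    List.cons.injEq] at hm
  refine ⟨by simp, (List.nodup_cons.1 hn).2, ?_⟩
  have e : (b :: C).map (skip π a) = ((b :: C).map π).map (swap a (π a)) := by
    rw [List.map_map]; rfl
  have ha : a ∉ C := fun k => (List.nodup_cons.1 hn).1 (List.mem_cons_of_mem _ k)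
  have hb : b ∉ C := (List.nodup_cons.1 (List.nodup_cons.1 hn).2).1
  rw [e, hm.1, hm.2, List.map_append, map_swap_of_notMem ha hb]
  simp

theorem IsCycleList.skip_append {π : Perm α} {a : α} {C D : List α}
    (h : IsCycleList π (C ++ a :: D)) (hC : C ++ D ≠ []) : IsCycleList (skip π a) (C ++ D) := by
  have h1 := h.rotate C.length
  rw [List.rotate_append_length_eq, List.cons_append] at h1
  have h2 := (h1.skip_cons (by
    intro k; apply hC; simp only [List.append_eq_nil_iff] at k ⊢; exact k.symm)).rotate D.length
  rwa [List.rotate_append_length_eq] at h2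

theorem IsCycleList.of_map_val {π : Perm α} {p : α → Prop} (hp : ∀ x, p (π x) ↔ p x)
    {c : List {x // p x}} (h : IsCycleList π (c.map Subtype.val)) :
    IsCycleList (π.subtypePerm hp) c where
  ne_nil := fun k => h.ne_nil (List.map_eq_nil_iff.2 k)
  nodup := List.Nodup.of_map _ h.nodup
  map_eq := by
    apply List.map_injective_iff.2 Subtype.val_injective
    rw [List.map_rotate, ← h.map_eq, List.map_map, List.map_map]
    rfl

theorem IsCycleList.contractPerm_of_glue (hne : f' ≠ f) {c : List {x : α // x ≠ f ∧ x ≠ f'}}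
    (h : IsCycleList (skip (skip (glue σ f f') f) f') (c.map Subtype.val)) :
    IsCycleList (contractPerm σ f f' hne) c :=
  IsCycleList.of_map_val _ h

theorem notMem_map_val_left {c : List {x : α // x ≠ f ∧ x ≠ f'}} : f ∉ c.map Subtype.val := by
  intro h
  obtain ⟨x, _, hx⟩ := List.mem_map.1 h
  exact x.2.1 hx

theorem notMem_map_val_right {c : List {x : α // x ≠ f ∧ x ≠ f'}} :
    f' ∉ c.map Subtype.val := by
  intro h
  obtain ⟨x, _, hx⟩ := List.mem_map.1 h
  exact x.2.2 hx

theorem IsCycleList.contract (hne : f' ≠ f) {c : List {x : α // x ≠ f ∧ x ≠ f'}}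
    (h : IsCycleList σ (c.map Subtype.val)) : IsCycleList (contractPerm σ f f' hne) c :=
  .contractPerm_of_glue hne (((h.glue_of_notMem notMem_map_val_left
    notMem_map_val_right).skip_of_notMem notMem_map_val_left).skip_of_notMem notMem_map_val_right)

variable {A A' : List {x : α // x ≠ f ∧ x ≠ f'}}

theorem IsCycleList.contract_cut_left (hne : f' ≠ f)
    (h : IsCycleList σ (f :: (A.map Subtype.val ++ f' :: A'.map Subtype.val))) (hA : A ≠ []) :
    IsCycleList (contractPerm σ f f' hne) A :=
  .contractPerm_of_glue hne
    ((h.cut.1.skip_cons (mt List.map_eq_nil_iff.1 hA)).skip_of_notMem notMem_map_val_right)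

theorem IsCycleList.contract_cut_right (hne : f' ≠ f)
    (h : IsCycleList σ (f :: (A.map Subtype.val ++ f' :: A'.map Subtype.val))) (hA : A' ≠ []) :
    IsCycleList (contractPerm σ f f' hne) A' :=
  .contractPerm_of_glue hne ((h.cut.2.skip_of_notMem (by
    rw [List.mem_cons, not_or]; exact ⟨hne.symm, notMem_map_val_left⟩)).skip_cons
      (mt List.map_eq_nil_iff.1 hA))

theorem IsCycleList.contract_join (hne : f' ≠ f) (h : IsCycleList σ (f :: A.map Subtype.val))
    (h' : IsCycleList σ (f' :: A'.map Subtype.val))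
    (hd : (f :: A.map Subtype.val).Disjoint (f' :: A'.map Subtype.val)) (hA : A ++ A' ≠ []) :
    IsCycleList (contractPerm σ f f' hne) (A ++ A') := by
  refine .contractPerm_of_glue hne ?_
  have := ((h.join h' hd).skip_cons (by simp)).skip_append
    (by rwa [← List.map_append, ne_eq, List.map_eq_nil_iff])
  rwa [← List.map_append] at this

/-- Cycles that avoid the edge are unchanged in the contraction. -/
theorem contractBasis_of_isCycleList [Finite α] (hne : f' ≠ f)
    {c : List {x : α // x ≠ f ∧ x ≠ f'}} (h : IsCycleList σ (c.map Subtype.val))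
    {x : {x : α // x ≠ f ∧ x ≠ f'}} (hx : x ∈ c) :
    contractBasis σ f f' hne (.inr (cyc _ x)) = .inr (cyc σ x) := by
  classical
  have hg := h.glue_of_notMem (notMem_map_val_left (f := f) (f' := f')) notMem_map_val_right
  have hx' : (x : α) ∈ c.map Subtype.val := List.mem_map_of_mem hx
  have h1 : ¬ (glue σ f f').SameCycle f x := fun k =>
    notMem_map_val_left ((hg.mem_iff hx').2 k.symm)
  have h2 : ¬ (glue σ f f').SameCycle f' x := fun k =>
    notMem_map_val_right ((hg.mem_iff hx').2 k.symm)
  by_cases hs : σ.SameCycle f f'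
  · rw [contractBasis_cut σ f f' hne hs, if_neg h1, if_neg h2]
  · rw [contractBasis_join σ f f' hne hs, if_neg h1]

theorem contractBasis_cut_left [Finite α] (hne : f' ≠ f)
    (h : IsCycleList σ (f :: (A.map Subtype.val ++ f' :: A'.map Subtype.val)))
    {x : {x : α // x ≠ f ∧ x ≠ f'}} (hx : x ∈ A) :
    contractBasis σ f f' hne (.inr (cyc _ x)) = .inl f' := by
  have hs : σ.SameCycle f f' := (h.mem_iff (by simp)).1 (by simp)
  have h1 : (glue σ f f').SameCycle f x :=
    (h.cut.1.mem_iff (by simp)).1 (List.mem_cons_of_mem _ (List.mem_map_of_mem hx))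
  rw [contractBasis_cut σ f f' hne hs, if_pos h1]

theorem contractBasis_cut_right [Finite α] (hne : f' ≠ f)
    (h : IsCycleList σ (f :: (A.map Subtype.val ++ f' :: A'.map Subtype.val)))
    {x : {x : α // x ≠ f ∧ x ≠ f'}} (hx : x ∈ A') :
    contractBasis σ f f' hne (.inr (cyc _ x)) = .inl f := by
  have hs : σ.SameCycle f f' := (h.mem_iff (by simp)).1 (by simp)
  have h2 : (glue σ f f').SameCycle f' x :=
    (h.cut.2.mem_iff (by simp)).1 (List.mem_cons_of_mem _ (List.mem_map_of_mem hx))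
  have h1 : ¬ (glue σ f f').SameCycle f x := fun k =>
    glue_not_sameCycle_of σ f f' hne hs (k.trans h2.symm)
  rw [contractBasis_cut σ f f' hne hs, if_neg h1, if_pos h2]

theorem contractBasis_join_eq [Finite α] (hne : f' ≠ f) (h : IsCycleList σ (f :: A.map Subtype.val))
    (h' : IsCycleList σ (f' :: A'.map Subtype.val))
    (hd : (f :: A.map Subtype.val).Disjoint (f' :: A'.map Subtype.val))
    {x : {x : α // x ≠ f ∧ x ≠ f'}} (hx : x ∈ A ++ A') :
    contractBasis σ f f' hne (.inr (cyc _ x)) = .inr (cyc σ f') := by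
  have hs : ¬ σ.SameCycle f f' := fun k =>
    hd ((h.mem_iff (by simp)).2 k) (by simp)
  have h1 : (glue σ f f').SameCycle f x := by
    refine ((h.join h' hd).mem_iff (by simp)).1 (List.mem_cons_of_mem _ ?_)
    rcases List.mem_append.1 hx with hx | hx
    · exact List.mem_append_left _ (List.mem_map_of_mem hx)
    · exact List.mem_append_right _ (List.mem_cons_of_mem _ (List.mem_map_of_mem hx))
  rw [contractBasis_join σ f f' hne hs, if_pos h1]

end ContractCycles

/-! ### Presentations adapted to an edge -/

section Adapted

variable {G : StableRibbonGraph}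

theorem IsPresentation.of_reflTransGen {L L' : List (List (List G.Flag))}
    (h : IsPresentation G L) (hm : Relation.ReflTransGen PresentationMove L L') :
    IsPresentation G L' := by
  induction hm with
  | refl => exact h
  | tail _ hm ih => exact ih.move hm

theorem IsPresentation.exists_cons {L : List (List (List G.Flag))} (h : IsPresentation G L)
    (f : G.Flag) : ∃ cs A rest, IsPresentation G ((cs ++ [f :: A]) :: rest) := by
  obtain ⟨c, hc, hf⟩ := List.mem_flatten.1 (h.mem f)
  obtain ⟨v, hv, hcv⟩ := List.mem_flatten.1 hc
  obtain ⟨l₁, l₂, rfl⟩ := List.append_of_mem hv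
  obtain ⟨v₁, v₂, rfl⟩ := List.append_of_mem hcv
  obtain ⟨c₁, c₂, rfl⟩ := List.append_of_mem hf
  refine ⟨v₁ ++ v₂, c₂ ++ c₁, l₁ ++ l₂, h.of_reflTransGen ?_⟩
  refine (reflTransGen_move_of_perm List.perm_middle).trans ?_
  refine (reflTransGen_move_of_perm_vertex [] (l₁ ++ l₂)
    (v' := (v₁ ++ v₂) ++ [c₁ ++ f :: c₂]) ?_).trans ?_
  · rw [List.append_assoc]
    exact (List.perm_append_singleton _ _).symm.append_left v₁
  · refine reflTransGen_move_of_isRotated [] (l₁ ++ l₂) (v₁ ++ v₂) [] ?_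
    exact ⟨c₁.length, by rw [List.rotate_append_length_eq]; rfl⟩

/-- A presentation in which the flags `f` and `f'` come as late as possible in the first vertices.
Either they belong to one cycle, or to two cycles of one vertex, or to two vertices. -/
theorem IsPresentation.exists_adapted {L : List (List (List G.Flag))} (h : IsPresentation G L)
    {f f' : G.Flag} (hne : f' ≠ f) :
    (∃ cs A A' rest, IsPresentation G ((cs ++ [f :: (A ++ f' :: A')]) :: rest)) ∨
    (∃ cs A A' rest, IsPresentation G ((cs ++ [f :: A, f' :: A']) :: rest)) ∨
    (∃ cs A cs' A' rest,
      IsPresentation G ((cs ++ [f :: A]) :: (cs' ++ [f' :: A']) :: rest)) := by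
  obtain ⟨cs, A, rest, h⟩ := h.exists_cons f
  have hf' := h.mem f'
  simp only [List.flatten_cons, List.flatten_append, List.flatten_nil, List.append_nil,
    List.mem_append, List.mem_cons, hne, false_or] at hf'
  rcases hf' with (hf' | hf') | hf'
  · obtain ⟨d, hd, hfd⟩ := List.mem_flatten.1 hf'
    obtain ⟨u, u', rfl⟩ := List.append_of_mem hd
    obtain ⟨l, r, rfl⟩ := List.append_of_mem hfd
    refine Or.inr (Or.inl ⟨u ++ u', A, r ++ l, rest, h.of_reflTransGen ?_⟩)
    refine (reflTransGen_move_of_perm_vertex [] rest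
      (v' := ((u ++ u') ++ [f :: A]) ++ [l ++ f' :: r]) ?_).trans ?_
    · rw [List.append_assoc, List.append_assoc, List.append_assoc, List.cons_append]
      refine List.Perm.append_left u ?_
      rw [← List.append_assoc]
      exact (List.perm_append_singleton _ _).symm
    · have e : (u ++ u') ++ [f :: A, f' :: (r ++ l)] =
          ((u ++ u') ++ [f :: A]) ++ [f' :: (r ++ l)] := by simp
      rw [e]
      refine reflTransGen_move_of_isRotated [] rest ((u ++ u') ++ [f :: A]) [] ?_
      exact ⟨l.length, by rw [List.rotate_append_length_eq]; rfl⟩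
  · obtain ⟨l, r, rfl⟩ := List.append_of_mem hf'
    exact Or.inl ⟨cs, l, r, rest, h⟩
  · obtain ⟨d, hd, hfd⟩ := List.mem_flatten.1 hf'
    obtain ⟨w, hw, hdw⟩ := List.mem_flatten.1 hd
    obtain ⟨l₁, l₂, rfl⟩ := List.append_of_mem hw
    obtain ⟨u, u', rfl⟩ := List.append_of_mem hdw
    obtain ⟨l, r, rfl⟩ := List.append_of_mem hfd
    refine Or.inr (Or.inr ⟨cs, A, u ++ u', r ++ l, l₁ ++ l₂, h.of_reflTransGen ?_⟩)
    refine (reflTransGen_move_of_perm (List.Perm.cons _ List.perm_middle)).trans ?_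
    refine (reflTransGen_move_of_perm_vertex [cs ++ [f :: A]] (l₁ ++ l₂)
      (v' := (u ++ u') ++ [l ++ f' :: r]) ?_).trans ?_
    · rw [List.append_assoc]
      exact (List.perm_append_singleton _ _).symm.append_left u
    · refine reflTransGen_move_of_isRotated [cs ++ [f :: A]] (l₁ ++ l₂) (u ++ u') [] ?_
      exact ⟨l.length, by rw [List.rotate_append_length_eq]; rfl⟩

/-- The first vertices of a presentation, if all of them contain `f` or `f'`, consist of the flags of
the vertices of `f` and of `f'`. -/
theorem IsPresentation.mem_iff_lam {f f' : G.Flag} {H L : List (List (List G.Flag))}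
    (h : IsPresentation G (H ++ L)) (hH : ∀ u ∈ H, f ∈ u.flatten ∨ f' ∈ u.flatten)
    (hf : f ∈ H.flatten.flatten) (hf' : f' ∈ H.flatten.flatten) (y : G.Flag) :
    y ∈ H.flatten.flatten ↔ G.lam f y ∨ G.lam f' y := by
  have aux : ∀ x ∈ H.flatten.flatten, ∀ y, G.lam x y → y ∈ H.flatten.flatten := by
    intro x hx y hxy
    obtain ⟨c, hc, hxc⟩ := List.mem_flatten.1 hx
    obtain ⟨u, hu, hcu⟩ := List.mem_flatten.1 hc
    have := (h.vertex u (List.mem_append_left _ hu) x (List.mem_flatten.2 ⟨c, hcu, hxc⟩) y).2 hxy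
    obtain ⟨d, hd, hyd⟩ := List.mem_flatten.1 this
    exact List.mem_flatten.2 ⟨d, List.mem_flatten.2 ⟨u, hu, hd⟩, hyd⟩
  constructor
  · intro hy
    obtain ⟨c, hc, hyc⟩ := List.mem_flatten.1 hy
    obtain ⟨u, hu, hcu⟩ := List.mem_flatten.1 hc
    have hyu : y ∈ u.flatten := List.mem_flatten.2 ⟨c, hcu, hyc⟩
    have hu' := List.mem_append_left L hu
    exact (hH u hu).imp (fun k => (h.vertex u hu' _ k y).1 hyu)
      (fun k => (h.vertex u hu' _ k y).1 hyu)
  · rintro (k | k)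
    · exact aux f hf y k
    · exact aux _ hf' y k

/-- The vertices of a presentation, of which exactly the members of `H` contain `f` or `η f`, give a
presentation of the contraction, in which `H` is replaced by the united vertex `v`. -/
theorem IsPresentation.contract {f : G.Flag} (hc : G.Contractible f)
    {H : List (List (List G.Flag))}
    {rest : List (List (List {x : G.Flag // x ≠ f ∧ x ≠ G.η f}))}
    {v : List (List {x : G.Flag // x ≠ f ∧ x ≠ G.η f})}
    (h : IsPresentation G (H ++ rest.map (List.map (List.map Subtype.val))))
    (hH : ∀ u ∈ H, f ∈ u.flatten ∨ G.η f ∈ u.flatten) (hv : v ≠ [])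
    (hcyc : ∀ c ∈ v, IsCycleList (contractPerm G.σ f (G.η f) (G.η_ne f)) c)
    (hperm : H.flatten.flatten.Perm (f :: G.η f :: v.flatten.map Subtype.val)) :
    IsPresentation (G.contract f hc) (v :: rest) := by
  have hn := h.nodup
  simp only [List.flatten_append] at hn
  obtain ⟨n1, n2, n3⟩ := List.nodup_append'.1 hn
  rw [hperm.nodup_iff, List.nodup_cons, List.nodup_cons] at n1
  rw [flatten_flatten_map] at n2 n3
  have hf : f ∈ H.flatten.flatten := hperm.mem_iff.2 (by simp)
  have hf' : G.η f ∈ H.flatten.flatten := hperm.mem_iff.2 (by simp)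
  have hlam := h.mem_iff_lam hH hf hf'
  have hmem : ∀ y : {x : G.Flag // x ≠ f ∧ x ≠ G.η f}, y ∈ v.flatten ↔
      (y : G.Flag) ∈ H.flatten.flatten := by
    intro y
    rw [hperm.mem_iff, List.mem_cons, List.mem_cons,
      List.mem_map_of_injective Subtype.val_injective]
    simp [y.2.1, y.2.2]
  have k1 : ∀ u ∈ v :: rest, u ≠ [] := by
    intro u hu
    rcases List.mem_cons.1 hu with rfl | hu
    · exact hv
    · have := h.ne_nil (u.map (List.map Subtype.val))
        (List.mem_append_right _ (List.mem_map_of_mem hu))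
      exact fun k => this (List.map_eq_nil_iff.2 k)
  have k2 : ∀ u ∈ v :: rest, ∀ c ∈ u,
      IsCycleList (contractPerm G.σ f (G.η f) (G.η_ne f)) c := by
    intro u hu c hcu
    rcases List.mem_cons.1 hu with rfl | hu
    · exact hcyc c hcu
    · exact (h.cycle (u.map (List.map Subtype.val))
        (List.mem_append_right _ (List.mem_map_of_mem hu)) (c.map Subtype.val)
        (List.mem_map_of_mem hcu)).contract _
  have k3 : ∀ u ∈ v :: rest, ∀ x ∈ u.flatten, ∀ y,
      y ∈ u.flatten ↔ mergeSetoid G.lam f (G.η f) x y := by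
    intro u hu x hx y
    rw [mergeSetoid_iff]
    rcases List.mem_cons.1 hu with rfl | hu
    · rw [hmem] at hx ⊢
      rw [hlam] at hx ⊢
      constructor
      · exact fun hy => Or.inr ⟨hx, hy⟩
      · rintro (k | k)
        · exact hx.imp (fun l => G.lam.trans l k) (fun l => G.lam.trans l k)
        · exact k.2
    · have hxr : (x : G.Flag) ∈ rest.flatten.flatten.map Subtype.val := by
        obtain ⟨c, hc, hxc⟩ := List.mem_flatten.1 hx
        exact List.mem_map_of_mem
          (List.mem_flatten.2 ⟨c, List.mem_flatten.2 ⟨u, hu, hc⟩, hxc⟩)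
      have hxH : ¬ (G.lam f x ∨ G.lam (G.η f) x) := fun k => n3 ((hlam x).2 k) hxr
      have := h.vertex (u.map (List.map Subtype.val))
        (List.mem_append_right _ (List.mem_map_of_mem hu)) x
        (by rw [flatten_map_map]; exact List.mem_map_of_mem hx) y
      rw [flatten_map_map, List.mem_map_of_injective Subtype.val_injective] at this
      rw [this]
      exact ⟨Or.inl, fun k => k.resolve_right fun k => hxH k.1⟩
  have k4 : (v :: rest).flatten.flatten.Nodup := by
    rw [List.flatten_cons, List.flatten_append]
    refine List.nodup_append'.2 ⟨List.Nodup.of_map _ n1.2.2, List.Nodup.of_map _ n2, ?_⟩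
    intro x hx hx'
    exact n3 ((hmem x).1 hx) (List.mem_map_of_mem hx')
  have k5 : ∀ x, x ∈ (v :: rest).flatten.flatten := by
    intro x
    rw [List.flatten_cons, List.flatten_append, List.mem_append]
    have := h.mem x
    rw [List.flatten_append, List.flatten_append, List.mem_append, flatten_flatten_map] at this
    refine this.imp (hmem x).2 fun k => ?_
    rwa [List.mem_map_of_injective Subtype.val_injective] at k
  exact ⟨k1, k2, k3, k4, k5⟩

end Adapted

/-! ### Summation over the colourings of an edge -/

section EdgeSums

/-- Removal of the flags `f`, `f'` of the first edge from a Koszul sign. -/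
theorem reorderExponent_remove {X : Type*} [DecidableEq X] (q : X → ZMod 2) {f f' : X}
    {U V Z E : List X} (hE : (f :: f' :: E).Nodup)
    (hp : (U ++ f :: (V ++ f' :: Z)).Perm (f :: f' :: E)) :
    reorderExponent q (U ++ f :: (V ++ f' :: Z)) (f :: f' :: E) =
      reorderExponent q E (U ++ (V ++ Z)) +
        ((q f + q f') * (U.map q).sum + q f' * (V.map q).sum) := by
  have hn := hp.nodup_iff.2 hE
  have hd : f ∉ U ∧ f' ∉ U ∧ f' ∉ V ∧ f ≠ f' := by
    simp only [List.nodup_append, List.nodup_cons, List.mem_append, List.mem_cons] at hn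
    grind
  rw [reorderExponent_symm q hE hp]
  have h1 := reorderExponent_move q (f :: f' :: E) [] f U (V ++ f' :: Z) hd.1 (by simp)
  have h2 := reorderExponent_move q (f :: f' :: E) [f] f' (U ++ V) Z
    (by simp [hd.2.1, hd.2.2.1]) (by simp)
  have hn' : ([f, f'] ++ (U ++ (V ++ Z))).Nodup := by
    refine (List.Perm.nodup_iff ?_).1 hn
    refine List.perm_middle.trans (List.Perm.cons _ ?_)
    rw [← List.append_assoc, ← List.append_assoc]
    exact List.perm_middle
  have h3 := reorderExponent_append_left q [f, f'] (t := E) hn'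
  simp only [List.nil_append, List.cons_append, List.append_assoc, List.map_append,
    List.sum_append] at h1 h2 h3
  rw [h3] at h2
  generalize reorderExponent q (f :: f' :: E) (U ++ f :: (V ++ f' :: Z)) = e₁ at *
  generalize reorderExponent q (f :: f' :: E) (f :: (U ++ (V ++ f' :: Z))) = e₂ at *
  generalize reorderExponent q E _ = e at *
  generalize (U.map q).sum = u at *
  generalize (V.map q).sum = v at *
  generalize q f = a at *
  generalize q f' = b at *
  grind

variable {F : Type*} [DecidableEq F] {f f' : F} {ι : Type*} [DecidableEq ι] [Fintype ι]

/-- The colouring of all elements that extends a colouring of the complement of `{f, f'}`. -/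
def extendColouring (m : {x : F // x ≠ f ∧ x ≠ f'} → ι) (μ ν : ι) (x : F) : ι :=
  if h : x ≠ f ∧ x ≠ f' then m ⟨x, h⟩ else if x = f then μ else ν

theorem extendColouring_val (m : {x : F // x ≠ f ∧ x ≠ f'} → ι) (μ ν : ι)
    (x : {x : F // x ≠ f ∧ x ≠ f'}) : extendColouring m μ ν x = m x := by
  simp [extendColouring, x.2.1, x.2.2]

theorem extendColouring_left (m : {x : F // x ≠ f ∧ x ≠ f'} → ι) (μ ν : ι) :
    extendColouring m μ ν f = μ := by simp [extendColouring]

theorem extendColouring_right (hne : f' ≠ f) (m : {x : F // x ≠ f ∧ x ≠ f'} → ι) (μ ν : ι) :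
    extendColouring m μ ν f' = ν := by simp [extendColouring, hne]

theorem sum_extendColouring [Fintype F] (hne : f' ≠ f) {M : Type*} [AddCommMonoid M]
    (φ : (F → ι) → M) :
    ∑ m, φ m = ∑ m : {x : F // x ≠ f ∧ x ≠ f'} → ι, ∑ μ, ∑ ν, φ (extendColouring m μ ν) := by
  let e : (F → ι) ≃ ({x : F // x ≠ f ∧ x ≠ f'} → ι) × ι × ι :=
    { toFun := fun m => (fun x => m x, m f, m f')
      invFun := fun p => extendColouring p.1 p.2.1 p.2.2
      left_inv := fun m => by
        funext x
        by_cases h : x ≠ f ∧ x ≠ f'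
        · exact extendColouring_val _ _ _ ⟨x, h⟩
        · by_cases hx : x = f
          · subst hx; exact extendColouring_left _ _ _
          · have : x = f' := by tauto
            subst this; exact extendColouring_right hne _ _ _
      right_inv := fun p => by
        simp only [extendColouring_val, extendColouring_left, extendColouring_right hne] }
  rw [← e.symm.sum_comp φ, Fintype.sum_prod_type]
  refine Finset.sum_congr rfl fun m _ => ?_
  rw [Fintype.sum_prod_type]
  rfl

variable {k A : Type*} [Field k] [NonUnitalRing A] [Module k A]
  [IsScalarTower k A A] [SMulCommClass k A A] [CharZero k]
  {𝒜 : ZMod 2 → Submodule k A} {g : A →ₗ[k] A →ₗ[k] k} (B : DualBases 𝒜 g ι)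

/-- Summation over the colours of the two flags of an edge, which are joined by the inverse scalar
product. The hypothesis `hκ` separates off the Koszul sign of the removal of these flags, and `hV`
evaluates the contraction of the vertices that contain them; `Q` is the product of the propagators of
the other edges and `ε` compares the orientations. -/
theorem sum_colourings_contract [Fintype F] (hg : IsOddScalarProduct 𝒜 g) (hne : f' ≠ f)
    {old : List F} {new E : List {x : F // x ≠ f ∧ x ≠ f'}}
    (V : (F → ι) → k) (V' Q : ({x : F // x ≠ f ∧ x ≠ f'} → ι) → k)
    (s : ({x : F // x ≠ f ∧ x ≠ f'} → ι) → ι → ZMod 2) (ε : ZMod 2)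
    (hκ : ∀ m μ ν, B.parity μ = B.parity ν + 1 →
      reorderExponent (shiftedParity B (extendColouring m μ ν)) old
        (f :: f' :: E.map Subtype.val) = reorderExponent (shiftedParity B m) new E + s m ν)
    (hV : ∀ m, ∑ μ, ∑ ν, sgn k (s m ν + ε) *
      (g (B.dual μ) (B.dual ν) * V (extendColouring m μ ν)) = V' m) :
    ∑ m : F → ι, g (B.dual (m f)) (B.dual (m f')) * Q (fun x => m x) *
        (sgn k (reorderExponent (shiftedParity B m) old (f :: f' :: E.map Subtype.val)) * V m) =
      sgn k ε * ∑ m, Q m * (sgn k (reorderExponent (shiftedParity B m) new E) * V' m) := by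
  rw [sum_extendColouring hne, Finset.mul_sum]
  refine Finset.sum_congr rfl fun m _ => ?_
  rw [← hV m]
  simp only [Finset.mul_sum]
  refine Finset.sum_congr rfl fun μ _ => Finset.sum_congr rfl fun ν _ => ?_
  simp only [extendColouring_val, extendColouring_left, extendColouring_right hne]
  by_cases hp : B.parity μ = B.parity ν + 1
  · rw [hκ m μ ν hp, sgn_add, sgn_add]
    have h2 := sgn_mul_self k ε
    linear_combination - (g (B.dual μ) (B.dual ν) * Q m *
      sgn k (reorderExponent (shiftedParity B m) new E) * sgn k (s m ν) *
      V (extendColouring m μ ν)) * h2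
  · rw [B.pairing_dual_eq_zero hg hp]; simp

theorem sum_shiftedParity_extend (m : {x : F // x ≠ f ∧ x ≠ f'} → ι) (μ ν : ι)
    (c : List {x : F // x ≠ f ∧ x ≠ f'}) :
    ((c.map Subtype.val).map (shiftedParity B (extendColouring m μ ν))).sum =
      Word.parity (c.map fun x => B.letter (m x)) + c.length := by
  rw [List.map_map, ← sum_shiftedParity]
  congr 1
  exact List.map_congr_left fun x _ => by simp [shiftedParity, extendColouring_val]

/-- The Koszul sign of flags other than `f` and `f'` does not see the colours of `f` and `f'`. -/
theorem reorderExponent_extend (m : {x : F // x ≠ f ∧ x ≠ f'} → ι) (μ ν : ι)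
    {E c : List {x : F // x ≠ f ∧ x ≠ f'}} (hE : E.Nodup) (hp : c.Perm E) :
    reorderExponent (shiftedParity B (extendColouring m μ ν)) (E.map Subtype.val)
      (c.map Subtype.val) = reorderExponent (shiftedParity B m) c E := by
  rw [reorderExponent_map Subtype.val_injective, reorderExponent_symm _ hE hp]
  congr 1
  funext x
  simp [shiftedParity, extendColouring_val]

theorem map_letter_extend (m : {x : F // x ≠ f ∧ x ≠ f'} → ι) (μ ν : ι)
    (c : List {x : F // x ≠ f ∧ x ≠ f'}) :
    (c.map Subtype.val).map (fun x => B.letter (extendColouring m μ ν x)) =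
      c.map fun x => B.letter (m x) := by
  rw [List.map_map]
  simp only [Function.comp_def, extendColouring_val]

theorem map_map_letter_extend (m : {x : F // x ≠ f ∧ x ≠ f'} → ι) (μ ν : ι)
    (v : List (List {x : F // x ≠ f ∧ x ≠ f'})) :
    (v.map (List.map Subtype.val)).map (List.map fun x => B.letter (extendColouring m μ ν x)) =
      v.map (List.map fun x => B.letter (m x)) := by
  rw [List.map_map]
  exact List.map_congr_left fun c _ => map_letter_extend B m μ ν c

theorem parity_flatten_letters {S : Type*} (m : S → ι) (v : List (List S)) :
    Word.parity ((v.map (List.map fun x => B.letter (m x))).flatten) =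
      Word.parity (v.flatten.map fun x => B.letter (m x)) := by
  rw [flatten_map_map]

theorem length_flatten_letters {S : Type*} (m : S → ι) (v : List (List S)) :
    ((v.map (List.map fun x => B.letter (m x))).flatten).length = v.flatten.length := by
  rw [flatten_map_map, List.length_map]

variable [Fintype F]

theorem nodup_cons_cons_map_val (hne : f' ≠ f) {E : List {x : F // x ≠ f ∧ x ≠ f'}}
    (hE : E.Nodup) : (f :: f' :: E.map Subtype.val).Nodup := by
  rw [List.nodup_cons, List.nodup_cons, List.mem_cons, not_or]
  exact ⟨⟨hne.symm, notMem_map_val_left⟩, notMem_map_val_right, hE.map Subtype.val_injective⟩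

theorem perm_cons_cons_of_perm {X : Type*} {f f' : X} {U V Z E : List X}
    (h : (U ++ (V ++ Z)).Perm E) : (U ++ f :: (V ++ f' :: Z)).Perm (f :: f' :: E) := by
  refine List.perm_middle.trans (List.Perm.cons _ ?_)
  rw [← List.append_assoc]
  refine List.perm_middle.trans (List.Perm.cons _ ?_)
  rwa [List.append_assoc]

/-- Summation over the colourings of an edge whose flags lie in one cycle. Here `T` contains the flags
of the other vertices, and `E` is the order of flags given by the other edges. -/
theorem sum_colourings_cut (hne : f' ≠ f)
    (h𝒜 : IsSuperGrading 𝒜) (hg : IsOddScalarProduct 𝒜 g)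
    (hTr : ∀ a : A, B.superTrace (LinearMap.mulLeft k a) = 0) (γ : ℕ)
    (cs : List (List {x : F // x ≠ f ∧ x ≠ f'})) (c c' T E : List {x : F // x ≠ f ∧ x ≠ f'})
    (hE : E.Nodup) (hp : (cs.flatten ++ (c ++ (c' ++ T))).Perm E)
    (hX : c' ≠ [] ∨ γ ≠ 0 ∨ cs ≠ []) (Q : ({x : F // x ≠ f ∧ x ≠ f'} → ι) → k) :
    ∑ m : F → ι, g (B.dual (m f)) (B.dual (m f')) * Q (fun x => m x) *
        (sgn k (reorderExponent (shiftedParity B m) (cs.flatten.map Subtype.val ++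
            f :: (c.map Subtype.val ++ f' :: (c'.map Subtype.val ++ T.map Subtype.val)))
          (f :: f' :: E.map Subtype.val)) *
        B.vertexTensor γ (cs.map (List.map Subtype.val) ++
          [f :: (c.map Subtype.val ++ f' :: c'.map Subtype.val)]) m) =
      sgn k (cs.flatten.length + c'.length) * ∑ m, Q m *
        (sgn k (reorderExponent (shiftedParity B m) (cs.flatten ++ (c ++ (c' ++ T))) E) *
          B.vertexTensor γ (cs ++ [c, c']) m) := by
  refine sum_colourings_contract B hg hne _ _ Q (fun m ν =>
    (Word.parity (cs.flatten.map fun x => B.letter (m x)) + cs.flatten.length) +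
      (B.parity ν + 1) * (Word.parity (c.map fun x => B.letter (m x)) + c.length)) _ ?_ ?_
  · intro m μ ν hμν
    rw [reorderExponent_remove]
    · rw [sum_shiftedParity_extend, sum_shiftedParity_extend, ← reorderExponent_extend B m μ ν hE hp]
      simp only [List.map_append, shiftedParity, extendColouring_left,
        extendColouring_right hne, hμν]
      generalize B.parity ν = b at *
      grind
    · exact nodup_cons_cons_map_val hne hE
    · have := (hp.map Subtype.val)
      simp only [List.map_append] at this
      exact perm_cons_cons_of_perm this
  · intro m
    have h := B.vertexValue_cut h𝒜 hg hTr γ (cs.map (List.map fun x => B.letter (m x)))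
      (c.map fun x => B.letter (m x)) (c'.map fun x => B.letter (m x))
      (homogeneous_letters' B m cs) (homogeneous_letters B m c) (homogeneous_letters B m c') (by
        rcases hX with h | h | h <;> simp [h, DualBases.handleWord])
    rw [vertexTensor_eq_vertexValue]
    simp only [vertexTensor_eq_vertexValue, List.map_append (f := List.map _), List.map_cons,
      List.map_nil, List.map_append, map_map_letter_extend, map_letter_extend,
      extendColouring_left, extendColouring_right hne]
    simp only [parity_flatten_letters, length_flatten_letters, List.length_map] at h
    exact h

end EdgeSums

section EdgeSums

variable {F : Type*} [DecidableEq F] {f f' : F} {ι : Type*} [DecidableEq ι] [Fintype ι]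
  {k A : Type*} [Field k] [NonUnitalRing A] [Module k A]
  [IsScalarTower k A A] [SMulCommClass k A A] [CharZero k]
  {𝒜 : ZMod 2 → Submodule k A} {g : A →ₗ[k] A →ₗ[k] k} (B : DualBases 𝒜 g ι) [Fintype F]

/-- Summation over the colourings of a loop whose flags lie in two cycles. -/
theorem sum_colourings_join_loop (hne : f' ≠ f)
    (h𝒜 : IsSuperGrading 𝒜) (hg : IsOddScalarProduct 𝒜 g) (γ : ℕ)
    (cs : List (List {x : F // x ≠ f ∧ x ≠ f'})) (c c' T E : List {x : F // x ≠ f ∧ x ≠ f'})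
    (hE : E.Nodup) (hp : (cs.flatten ++ (c ++ (c' ++ T))).Perm E)
    (Q : ({x : F // x ≠ f ∧ x ≠ f'} → ι) → k) :
    ∑ m : F → ι, g (B.dual (m f)) (B.dual (m f')) * Q (fun x => m x) *
        (sgn k (reorderExponent (shiftedParity B m) (cs.flatten.map Subtype.val ++
            f :: (c.map Subtype.val ++ f' :: (c'.map Subtype.val ++ T.map Subtype.val)))
          (f :: f' :: E.map Subtype.val)) *
        B.vertexTensor γ (cs.map (List.map Subtype.val) ++
          [f :: c.map Subtype.val, f' :: c'.map Subtype.val]) m) =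
      sgn k (cs.flatten.length + c'.length) * ∑ m, Q m *
        (sgn k (reorderExponent (shiftedParity B m) (cs.flatten ++ (c ++ (c' ++ T))) E) *
          B.vertexTensor (γ + 1) (cs ++ [c ++ c']) m) := by
  refine sum_colourings_contract B hg hne _ _ Q (fun m ν =>
    (Word.parity (cs.flatten.map fun x => B.letter (m x)) + cs.flatten.length) +
      (B.parity ν + 1) * (Word.parity (c.map fun x => B.letter (m x)) + c.length)) _ ?_ ?_
  · intro m μ ν hμν
    rw [reorderExponent_remove]
    · rw [sum_shiftedParity_extend, sum_shiftedParity_extend, ← reorderExponent_extend B m μ ν hE hp]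
      simp only [List.map_append, shiftedParity, extendColouring_left,
        extendColouring_right hne, hμν]
      generalize B.parity ν = b at *
      grind
    · exact nodup_cons_cons_map_val hne hE
    · have := (hp.map Subtype.val)
      simp only [List.map_append] at this
      exact perm_cons_cons_of_perm this
  · intro m
    have h := B.vertexValue_join_loop h𝒜 hg γ (cs.map (List.map fun x => B.letter (m x)))
      (c.map fun x => B.letter (m x)) (c'.map fun x => B.letter (m x))
      (homogeneous_letters' B m cs) (homogeneous_letters B m c) (homogeneous_letters B m c')
    rw [vertexTensor_eq_vertexValue]
    simp only [vertexTensor_eq_vertexValue, List.map_append (f := List.map _), List.map_cons,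
      List.map_nil, List.map_append, map_map_letter_extend, map_letter_extend,
      extendColouring_left, extendColouring_right hne]
    simp only [parity_flatten_letters, length_flatten_letters, List.length_map] at h
    exact h

/-- Summation over the colourings of an edge that joins two vertices. -/
theorem sum_colourings_join (hne : f' ≠ f)
    (h𝒜 : IsSuperGrading 𝒜) (hg : IsOddScalarProduct 𝒜 g) (γ γ' : ℕ)
    (cs cs' : List (List {x : F // x ≠ f ∧ x ≠ f'}))
    (c c' T E : List {x : F // x ≠ f ∧ x ≠ f'})
    (hE : E.Nodup) (hp : (cs.flatten ++ (cs'.flatten ++ (c ++ (c' ++ T)))).Perm E)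
    (hX : c ≠ [] ∨ γ ≠ 0 ∨ cs ≠ []) (hX' : c' ≠ [] ∨ γ' ≠ 0 ∨ cs' ≠ [])
    (Q : ({x : F // x ≠ f ∧ x ≠ f'} → ι) → k) :
    ∑ m : F → ι, g (B.dual (m f)) (B.dual (m f')) * Q (fun x => m x) *
        (sgn k (reorderExponent (shiftedParity B m) (cs.flatten.map Subtype.val ++
            f :: (c.map Subtype.val ++ (cs'.flatten.map Subtype.val ++
              f' :: (c'.map Subtype.val ++ T.map Subtype.val))))
          (f :: f' :: E.map Subtype.val)) *
        (B.vertexTensor γ (cs.map (List.map Subtype.val) ++ [f :: c.map Subtype.val]) m *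
        B.vertexTensor γ' (cs'.map (List.map Subtype.val) ++ [f' :: c'.map Subtype.val]) m)) =
      sgn k (cs.flatten.length + cs'.flatten.length +
          cs.length * (cs'.flatten.length + c'.length + cs'.length) +
          c.length * cs'.flatten.length) * ∑ m, Q m *
        (sgn k (reorderExponent (shiftedParity B m)
            (cs.flatten ++ (cs'.flatten ++ (c ++ (c' ++ T)))) E) *
          B.vertexTensor (γ + γ') (cs ++ cs' ++ [c ++ c']) m) := by
  refine sum_colourings_contract B hg hne _ _ Q (fun m ν =>
    (Word.parity (cs.flatten.map fun x => B.letter (m x)) + cs.flatten.length) +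
      (B.parity ν + 1) * (Word.parity (c.map fun x => B.letter (m x)) + c.length +
        Word.parity (cs'.flatten.map fun x => B.letter (m x)) + cs'.flatten.length) +
      (Word.parity (c.map fun x => B.letter (m x)) + c.length) *
        (Word.parity (cs'.flatten.map fun x => B.letter (m x)) + cs'.flatten.length)) _ ?_ ?_
  · intro m μ ν hμν
    have hp' : (cs.flatten ++ (c ++ (cs'.flatten ++ (c' ++ T)))).Perm E :=
      (List.Perm.append_left _ (List.perm_append_comm_assoc _ _ _)).trans hp
    have hd : (c.map Subtype.val).Disjoint (cs'.flatten.map Subtype.val) := by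
      have := (List.nodup_append'.1 (hp'.nodup_iff.2 hE)).2.1
      intro x hx hx'
      obtain ⟨y, hy, rfl⟩ := List.mem_map.1 hx
      rw [List.mem_map_of_injective Subtype.val_injective] at hx'
      exact (List.nodup_append'.1 this).2.2 hy (List.mem_append_left _ hx')
    have hr := reorderExponent_remove (shiftedParity B (extendColouring m μ ν))
      (U := cs.flatten.map Subtype.val) (V := c.map Subtype.val ++ cs'.flatten.map Subtype.val)
      (Z := c'.map Subtype.val ++ T.map Subtype.val) (nodup_cons_cons_map_val hne hE) (by
        have := (hp'.map Subtype.val)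
        simp only [List.map_append] at this
        refine perm_cons_cons_of_perm ?_
        rwa [List.append_assoc])
    simp only [List.append_assoc] at hr
    rw [hr, reorderExponent_block _ _ _ _ _ _ hd]
    · rw [List.map_append, List.sum_append, sum_shiftedParity_extend, sum_shiftedParity_extend,
        sum_shiftedParity_extend, ← reorderExponent_extend B m μ ν hE hp]
      simp only [List.map_append, shiftedParity, extendColouring_left,
        extendColouring_right hne, hμν]
      generalize B.parity ν = b at *
      clear hr hd
      grind
    · intro y hy
      obtain ⟨z, hz, rfl⟩ := List.mem_map.1 hy
      exact List.mem_map_of_mem (hp.mem_iff.1 (by simp [hz]))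
  · intro m
    have h := B.vertexValue_join h𝒜 hg γ γ' (cs.map (List.map fun x => B.letter (m x)))
      (cs'.map (List.map fun x => B.letter (m x)))
      (c.map fun x => B.letter (m x)) (c'.map fun x => B.letter (m x))
      (homogeneous_letters' B m cs) (homogeneous_letters' B m cs') (homogeneous_letters B m c)
      (homogeneous_letters B m c')
      (by rcases hX with h | h | h <;> simp [h, DualBases.handleWord])
      (by rcases hX' with h | h | h <;> simp [h, DualBases.handleWord])
    rw [vertexTensor_eq_vertexValue]
    simp only [vertexTensor_eq_vertexValue, List.map_append (f := List.map _), List.map_cons,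
      List.map_nil, List.map_append, map_map_letter_extend, map_letter_extend,
      extendColouring_left, extendColouring_right hne]
    simp only [parity_flatten_letters, length_flatten_letters, List.length_map] at h
    exact h

end EdgeSums

/-! ### The induced orientation -/

section InducedOrientation

variable {X : Type*} [DecidableEq X]

theorem reorderExponent_one_move (t a : List X) (x : X) (Y b : List X) (hn : x ∉ Y) (hx : x ∈ t) :
    reorderExponent (fun _ => 1) t (a ++ x :: (Y ++ b)) =
      reorderExponent (fun _ => 1) t (a ++ (Y ++ x :: b)) + Y.length := by
  rw [reorderExponent_move _ t a x Y b hn hx, sum_map_one, one_mul]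

/-- The comparison of the ordered bases if one cycle is cut. The letters `φ` and `φ'` stand for the
flags of the edge, `a` and `a'` for the other flags of their cycle `z`, `U` for the flags of the
earlier cycles of the vertex, `H` for these cycles, and `R` for the other vertices. -/
theorem orientation_cut {φ φ' z : X} {U a a' H R : List X}
    (hn : (U ++ φ :: (a ++ φ' :: (a' ++ z :: (H ++ R)))).Nodup) :
    reorderExponent (fun _ => 1) (U ++ φ :: (a ++ φ' :: (a' ++ z :: (H ++ R))))
      (z :: (U ++ (a ++ (a' ++ φ :: φ' :: (H ++ R))))) = U.length + a'.length := by
  have h0 := reorderExponent_self (fun _ => 1) hn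
  have hmem : ∀ x, x ∈ [φ, φ', z] → x ∈ U ++ φ :: (a ++ φ' :: (a' ++ z :: (H ++ R))) := by
    simp only [List.mem_append, List.mem_cons, List.not_mem_nil, or_false]
    tauto
  generalize ht : U ++ φ :: (a ++ φ' :: (a' ++ z :: (H ++ R))) = t at h0 hmem ⊢
  have hd : φ ∉ a ∧ φ ∉ a' ∧ φ' ∉ a' ∧ z ∉ U ∧ z ∉ a ∧ z ∉ a' ∧ z ≠ φ ∧ z ≠ φ' := by
    rw [ht] at hn
    subst ht
    simp only [List.nodup_append, List.nodup_cons, List.mem_append, List.mem_cons] at hn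
    grind
  have h1 := reorderExponent_one_move t [] z (U ++ (a ++ (a' ++ [φ, φ']))) (H ++ R)
    (by simp [hd]) (hmem z (by simp))
  have h2 := reorderExponent_one_move t U φ (a ++ a') (φ' :: z :: (H ++ R))
    (by simp [hd]) (hmem φ (by simp))
  have h3 := reorderExponent_one_move t (U ++ φ :: a) φ' a' (z :: (H ++ R))
    (by simp [hd]) (hmem φ' (by simp))
  simp only [List.nil_append, List.append_assoc, List.cons_append, List.length_append,
    List.length_cons, List.length_nil] at h1 h2 h3
  push_cast at h1 h2 h3
  rw [ht, h0] at h3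
  rw [h1]
  clear h1 hd hmem h0 ht hn
  grind

/-- The comparison of the ordered bases if two cycles `z`, `z'` of a vertex are joined; the place of
`z'` is taken by the new cycle. The other letters are as in `orientation_cut`. -/
theorem orientation_join_loop {φ φ' z z' : X} {U a a' H R : List X}
    (hn : (U ++ φ :: (a ++ φ' :: (a' ++ z' :: z :: (H ++ R)))).Nodup) :
    reorderExponent (fun _ => 1) (U ++ φ :: (a ++ φ' :: (a' ++ z' :: z :: (H ++ R))))
      (φ :: z :: φ' :: (U ++ (a ++ (a' ++ z' :: (H ++ R))))) = U.length + a'.length := by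
  have h0 := reorderExponent_self (fun _ => 1) hn
  have hmem : ∀ x, x ∈ [φ, φ', z] →
      x ∈ U ++ φ :: (a ++ φ' :: (a' ++ z' :: z :: (H ++ R))) := by
    simp only [List.mem_append, List.mem_cons, List.not_mem_nil, or_false]
    tauto
  generalize ht : U ++ φ :: (a ++ φ' :: (a' ++ z' :: z :: (H ++ R))) = t at h0 hmem ⊢
  have hd : φ ∉ U ∧ φ' ∉ U ∧ φ' ∉ a ∧ z ∉ U ∧ z ∉ a ∧ z ∉ a' ∧ z ≠ φ' ∧ z ≠ z' := by
    rw [ht] at hn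
    subst ht
    simp only [List.nodup_append, List.nodup_cons, List.mem_append, List.mem_cons] at hn
    grind
  have h1 := reorderExponent_one_move t [φ] z (φ' :: (U ++ (a ++ (a' ++ [z'])))) (H ++ R)
    (by simp [hd]) (hmem z (by simp))
  have h2 := reorderExponent_one_move t [φ] φ' (U ++ a) (a' ++ z' :: z :: (H ++ R))
    (by simp [hd]) (hmem φ' (by simp))
  have h3 := reorderExponent_one_move t [] φ U (a ++ φ' :: (a' ++ z' :: z :: (H ++ R)))
    (by simp [hd]) (hmem φ (by simp))
  simp only [List.nil_append, List.append_assoc, List.cons_append, List.length_append,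
    List.length_cons, List.length_nil] at h1 h2 h3
  push_cast at h1 h2 h3
  rw [ht, h0] at h3
  rw [h1]
  clear h1 hd hmem h0 ht hn
  grind

/-- The comparison of the ordered bases if two vertices are united. The vertices consist of `U`, `a`,
`H`, `z` and of `U'`, `a'`, `H'`, `z'`, where the letters are as in `orientation_join_loop`. -/
theorem orientation_join {φ φ' z z' : X} {U a H U' a' H' R : List X}
    (hn : (U ++ φ :: (a ++ z :: (H ++ (U' ++ φ' :: (a' ++ z' :: (H' ++ R)))))).Nodup) :
    reorderExponent (fun _ => 1)
      (U ++ φ :: (a ++ z :: (H ++ (U' ++ φ' :: (a' ++ z' :: (H' ++ R))))))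
      (φ :: z :: φ' :: (U ++ (U' ++ (a ++ (a' ++ z' :: (H' ++ (H ++ R))))))) =
      U.length + U'.length + H.length * (U'.length + a'.length + H'.length) +
        a.length * U'.length := by
  have h0 := reorderExponent_self (fun _ => 1) hn
  have hmem : ∀ x, x ∈ φ :: φ' :: z :: z' :: (U ++ a ++ H ++ U' ++ a' ++ H') →
      x ∈ U ++ φ :: (a ++ z :: (H ++ (U' ++ φ' :: (a' ++ z' :: (H' ++ R))))) := by
    simp only [List.mem_append, List.mem_cons]
    tauto
  generalize ht : U ++ φ :: (a ++ z :: (H ++ (U' ++ φ' :: (a' ++ z' :: (H' ++ R))))) = t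
    at h0 hmem ⊢
  have hd : φ ∉ U ∧ φ' ∉ U ∧ φ' ∉ a ∧ φ' ∉ U' ∧ z ∉ U ∧ z ∉ U' ∧ z ∉ a ∧ z ≠ φ' ∧
      a.Disjoint U' ∧ H.Disjoint (U' ++ φ' :: (a' ++ z' :: H')) := by
    rw [ht] at hn
    subst ht
    simp only [List.nodup_append, List.nodup_cons, List.mem_append, List.mem_cons,
      List.Disjoint] at hn ⊢
    grind
  have h1 := reorderExponent_one_move t [φ] z (φ' :: (U ++ (U' ++ a)))
    (a' ++ z' :: (H' ++ (H ++ R))) (by simp [hd]) (hmem z (by simp))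
  have h2 := reorderExponent_one_move t [φ] φ' (U ++ (U' ++ a))
    (z :: (a' ++ z' :: (H' ++ (H ++ R)))) (by simp [hd]) (hmem φ' (by simp))
  have h3 := reorderExponent_one_move t [] φ U
    (U' ++ (a ++ φ' :: z :: (a' ++ z' :: (H' ++ (H ++ R))))) (by simp [hd]) (hmem φ (by simp))
  have h4 := reorderExponent_block (fun _ => 1) t (U ++ [φ]) a U'
    (φ' :: z :: (a' ++ z' :: (H' ++ (H ++ R)))) hd.2.2.2.2.2.2.2.2.1
    fun y hy => hmem y (by simp [hy])
  have h5 := reorderExponent_one_move t (U ++ φ :: a) z (U' ++ [φ'])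
    (a' ++ z' :: (H' ++ (H ++ R))) (by simp [hd]) (hmem z (by simp))
  have h6 := reorderExponent_block (fun _ => 1) t (U ++ φ :: (a ++ [z])) H
    (U' ++ φ' :: (a' ++ z' :: H')) R hd.2.2.2.2.2.2.2.2.2
    fun y hy => hmem y (by simp [hy])
  simp only [List.nil_append, List.append_assoc, List.cons_append, List.length_append,
    List.length_cons, List.length_nil, sum_map_one] at h1 h2 h3 h4 h5 h6
  push_cast at h1 h2 h3 h4 h5 h6
  rw [ht, h0] at h6
  have h7 := reorderExponent_one_move t (U ++ φ :: (a ++ U')) φ' [z]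
    (a' ++ z' :: (H' ++ (H ++ R))) (by simp [hd.2.2.2.2.2.2.2.1.symm]) (hmem φ' (by simp))
  simp only [List.nil_append, List.append_assoc, List.cons_append,
    List.length_cons, List.length_nil] at h7
  push_cast at h7
  rw [h1]
  clear h1 hd hmem h0 ht hn
  grind

end InducedOrientation

/-! ### Contraction of an edge -/

section CycleHeads

variable {α : Type*}

/-- The cycles of a vertex in the reverse order. -/
def cycleHeads (σ : Perm α) (v : List (List α)) : List (α ⊕ Cyc σ) :=
  (v.reverse.filterMap List.head?).map (fun x => .inr (cyc σ x))

theorem vertexOrder_eq (σ : Perm α) (v : List (List α)) :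
    vertexOrder σ v = v.flatten.map .inl ++ cycleHeads σ v := rfl

theorem cycleHeads_append (σ : Perm α) (v v' : List (List α)) :
    cycleHeads σ (v ++ v') = cycleHeads σ v' ++ cycleHeads σ v := by
  simp [cycleHeads]

@[simp] theorem cycleHeads_singleton (σ : Perm α) (x : α) (c : List α) :
    cycleHeads σ [x :: c] = [.inr (cyc σ x)] := rfl

theorem length_cycleHeads (σ : Perm α) {v : List (List α)} (h : ∀ c ∈ v, c ≠ []) :
    (cycleHeads σ v).length = v.length := by
  have h1 : ∀ c : List α, c ∈ v → (cycleHeads σ [c]).length = 1 := by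
    intro c hc
    obtain ⟨x, c, rfl⟩ := List.exists_cons_of_ne_nil (h c hc)
    rfl
  induction v with
  | nil => rfl
  | cons c v ih =>
    rw [← List.singleton_append, cycleHeads_append, List.length_append, List.length_append,
      h1 c (by simp), ih (fun c hc => h c (by simp [hc])) (fun c hc => h1 c (by simp [hc]))]
    simp [add_comm]

variable [DecidableEq α] [Finite α] {σ : Perm α} {f f' : α}

theorem map_cycleHeads_contract (hne : f' ≠ f) {v : List (List {x : α // x ≠ f ∧ x ≠ f'})}
    (h : ∀ c ∈ v, IsCycleList σ (c.map Subtype.val)) :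
    (cycleHeads (contractPerm σ f f' hne) v).map (contractBasis σ f f' hne) =
      cycleHeads σ (v.map (List.map Subtype.val)) := by
  induction v with
  | nil => rfl
  | cons c v ih =>
    rw [← List.singleton_append, cycleHeads_append, List.map_append, List.map_append,
      cycleHeads_append, ih fun c hc => h c (by simp [hc])]
    congr 1
    have hc := h c (by simp)
    cases c with
    | nil => rfl
    | cons x c =>
      rw [cycleHeads_singleton, List.map_singleton, List.map_singleton, List.map_cons,
        cycleHeads_singleton, contractBasis_of_isCycleList hne hc (by simp)]

theorem map_vertexOrder_contract (hne : f' ≠ f) {v : List (List {x : α // x ≠ f ∧ x ≠ f'})}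
    (h : ∀ c ∈ v, IsCycleList σ (c.map Subtype.val)) :
    (vertexOrder (contractPerm σ f f' hne) v).map (contractBasis σ f f' hne) =
      vertexOrder σ (v.map (List.map Subtype.val)) := by
  rw [vertexOrder_eq, vertexOrder_eq, List.map_append, map_cycleHeads_contract hne h,
    flatten_map_map, List.map_map, List.map_map]
  rfl

theorem map_flatMap_vertexOrder_contract (hne : f' ≠ f)
    {L : List (List (List {x : α // x ≠ f ∧ x ≠ f'}))}
    (h : ∀ v ∈ L, ∀ c ∈ v, IsCycleList σ (c.map Subtype.val)) :
    (L.flatMap (vertexOrder (contractPerm σ f f' hne))).map (contractBasis σ f f' hne) =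
      (L.map (List.map (List.map Subtype.val))).flatMap (vertexOrder σ) := by
  rw [List.map_flatMap, List.flatMap_map]
  exact List.flatMap_congr fun v hv => map_vertexOrder_contract hne (h v hv)

end CycleHeads

section Contract

variable {G : StableRibbonGraph} {k A : Type*} [Field k] [NonUnitalRing A] [Module k A]
  [IsScalarTower k A A] [SMulCommClass k A A] [CharZero k]
  {𝒜 : ZMod 2 → Submodule k A} {g : A →ₗ[k] A →ₗ[k] k} {ι : Type*} [DecidableEq ι] [Fintype ι]
  (B : DualBases 𝒜 g ι) {J : A →ₗ[k] A}

/-- A vertex with one cycle and the integer `0` has at least three flags. -/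
theorem IsPresentation.three_le_length {L : List (List (List G.Flag))} (h : IsPresentation G L)
    {c : List G.Flag} (hc : [c] ∈ L) (hγ : vertexGenus G [c] = 0) : 3 ≤ c.length := by
  have hcc := h.cycle _ hc c (by simp)
  obtain ⟨x, d, rfl⟩ := List.exists_cons_of_ne_nil hcc.ne_nil
  have hset : {y | G.lam x y} = {y | y ∈ x :: d} := by
    ext y
    have := h.vertex _ hc x (by simp) y
    simp only [List.flatten_cons, List.flatten_nil, List.append_nil] at this
    exact this.symm
  have h1 : ({y | G.lam x y}).ncard = (x :: d).length := by
    rw [hset, ← List.toFinset_card_of_nodup hcc.nodup, ← Set.ncard_coe_finset]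
    congr 1
    ext y
    simp
  have h2 : cycleCount G.σ {y | G.lam x y} = 1 := by
    have : cyc G.σ '' {y | G.lam x y} = {cyc G.σ x} := by
      rw [hset]
      ext q
      simp only [Set.mem_image, Set.mem_ofPred_eq, Set.mem_singleton_iff]
      constructor
      · rintro ⟨y, hy, rfl⟩
        exact (cyc_eq_iff _).2 ((hcc.mem_iff (by simp)).1 hy).symm
      · rintro rfl
        exact ⟨x, by simp, rfl⟩
    rw [cycleCount, this, Set.ncard_singleton]
  have h3 := G.stable x
  have hγ' : G.genus x = 0 := hγ
  rw [h1, h2, hγ'] at h3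
  push_cast at h3
  simp only [List.length_cons] at h3 ⊢
  push_cast at h3
  omega

theorem contractOrient_sign (k : Type*) [Field k] (w : G.Orient) {f : G.Flag}
    (hc : G.Contractible f) (P : Presentation G) (P' : Presentation (G.contract f hc)) :
    (((G.contractOrient w f hc).sign P'.order : ℤ) : k) =
      sgn k (reorderExponent (fun _ => 1) P.order.list (contractPrefix G.σ f (G.η f) ++
        P'.order.list.map (contractBasis G.σ f (G.η f) (G.η_ne f)))) *
          ((w.sign P.order : ℤ) : k) :=
  BasisOrientation.sign_eq k w P.order _

theorem edgeList_map_val {f : G.Flag} (R : List {x : G.Flag // x ≠ f ∧ x ≠ G.η f}) :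
    edgeList G.η (R.map Subtype.val) =
      (edgeList (G.η.subtypePerm (G.η_mem_iff f)) R).map Subtype.val := by
  simp only [edgeList, List.flatMap_map, List.map_flatMap, List.map_cons, List.map_nil]
  rfl

theorem IsEdgeSystem.contract {f : G.Flag} {R : List {x : G.Flag // x ≠ f ∧ x ≠ G.η f}}
    (h : IsEdgeSystem G.η (f :: R.map Subtype.val)) :
    IsEdgeSystem (G.η.subtypePerm (G.η_mem_iff f)) R := by
  constructor
  · have := h.nodup
    rw [edgeList_cons, List.nodup_cons, List.nodup_cons, edgeList_map_val] at this
    exact List.Nodup.of_map _ this.2.2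
  · intro x
    have := h.mem x
    rw [edgeList_cons, List.mem_cons, List.mem_cons, edgeList_map_val,
      List.mem_map_of_injective Subtype.val_injective] at this
    exact (this.resolve_left x.2.1).resolve_left x.2.2

/-- The value of the cochain on a contraction in terms of a presentation. -/
theorem partitionCochain_contract (h𝒜 : IsSuperGrading 𝒜) (hg : IsOddScalarProduct 𝒜 g)
    (hK : IsEvenSymmetric B (B.propagator J)) (w : G.Orient) {f : G.Flag} (hc : G.Contractible f)
    (P : Presentation G) {R : List {x : G.Flag // x ≠ f ∧ x ≠ G.η f}}
    (hR : IsEdgeSystem (G.η.subtypePerm (G.η_mem_iff f)) R)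
    {L : List (List (List {x : G.Flag // x ≠ f ∧ x ≠ G.η f}))}
    (hL : IsPresentation (G.contract f hc) L) {ε : ZMod 2}
    (hε : reorderExponent (fun _ => 1) P.order.list (contractPrefix G.σ f (G.η f) ++
        (L.flatMap (vertexOrder (contractPerm G.σ f (G.η f) (G.η_ne f)))).map
          (contractBasis G.σ f (G.η f) (G.η_ne f))) = ε) :
    partitionCochain B J ⟨G.contract f hc, G.contractOrient w f hc⟩ =
      ((w.sign P.order : ℤ) : k) * (sgn k ε *
        ∑ m : {x : G.Flag // x ≠ f ∧ x ≠ G.η f} → ι,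
          (R.map fun x =>
            B.propagator J (m x) (m (G.η.subtypePerm (G.η_mem_iff f) x))).prod *
          (sgn k (reorderExponent (shiftedParity B m) L.flatten.flatten
            (edgeList (G.η.subtypePerm (G.η_mem_iff f)) R)) *
          (L.map fun v => B.vertexTensor (v.flatten.head?.elim 0 fun x => G.contractGenus f x)
            v m).prod)) := by
  have h1 := contractOrient_sign k w hc P hL.presentation
  have hε' : reorderExponent (fun _ => 1) P.order.list (contractPrefix G.σ f (G.η f) ++
      hL.presentation.order.list.map (contractBasis G.σ f (G.η f) (G.η_ne f))) = ε := hε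
  rw [hε'] at h1
  have h2 := hL.presentation.sign_mul_weight B hK (G.contractOrient w f hc)
    (R := R) hR
  rw [partitionCochain_eq h𝒜 hg B hK _ hL.presentation, h2, Finset.mul_sum, Finset.mul_sum]
  refine Finset.sum_congr rfl fun m _ => ?_
  rw [Presentation.colouringValue, h1]
  have key : ∀ a b c d e : k, a * (b * c * (d * e)) = c * (b * (a * (d * e))) := by
    intros; ring
  exact key _ _ _ _ _

end Contract

/-! ### Contraction of an edge in the sum over the colourings -/

section SumContract

variable {G : StableRibbonGraph} {k A : Type*} [Field k] [NonUnitalRing A] [Module k A]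
  [IsScalarTower k A A] [SMulCommClass k A A] [CharZero k]
  {𝒜 : ZMod 2 → Submodule k A} {g : A →ₗ[k] A →ₗ[k] k} {ι : Type*} [DecidableEq ι] [Fintype ι]
  (B : DualBases 𝒜 g ι) {J : A →ₗ[k] A}

theorem vertexGenus_map_val {f : G.Flag} {H : List (List (List G.Flag))}
    {rest : List (List (List {x : G.Flag // x ≠ f ∧ x ≠ G.η f}))}
    (h : IsPresentation G (H ++ rest.map (List.map (List.map Subtype.val))))
    (hH : ∀ u ∈ H, f ∈ u.flatten ∨ G.η f ∈ u.flatten)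
    (hf : f ∈ H.flatten.flatten) (hf' : G.η f ∈ H.flatten.flatten)
    {u : List (List {x : G.Flag // x ≠ f ∧ x ≠ G.η f})} (hu : u ∈ rest) :
    (u.flatten.head?.elim 0 fun x => G.contractGenus f x) =
      vertexGenus G (u.map (List.map Subtype.val)) := by
  have hfl := flatten_map_map (Subtype.val : {x : G.Flag // x ≠ f ∧ x ≠ G.η f} → G.Flag) u
  unfold vertexGenus
  rw [hfl]
  cases hx : u.flatten with
  | nil => rfl
  | cons x l =>
    change G.contractGenus f x = G.genus x
    rw [StableRibbonGraph.contractGenus, if_neg]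
    rw [← h.mem_iff_lam hH hf hf']
    intro hm
    have hn := h.nodup
    rw [List.flatten_append, List.flatten_append, List.nodup_append'] at hn
    refine hn.2.2 hm ?_
    rw [flatten_flatten_map]
    refine List.mem_map_of_mem ?_
    rw [List.mem_flatten]
    have : x ∈ u.flatten := by rw [hx]; simp
    obtain ⟨c, hc, hxc⟩ := List.mem_flatten.1 this
    exact ⟨c, List.mem_flatten.2 ⟨u, hu, hc⟩, hxc⟩

theorem IsPresentation.perm_edgeList {f : G.Flag} {H : List (List (List G.Flag))}
    {rest : List (List (List {x : G.Flag // x ≠ f ∧ x ≠ G.η f}))}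
    {v : List (List {x : G.Flag // x ≠ f ∧ x ≠ G.η f})}
    {R : List {x : G.Flag // x ≠ f ∧ x ≠ G.η f}}
    (h : IsPresentation G (H ++ rest.map (List.map (List.map Subtype.val))))
    (hR : IsEdgeSystem G.η (f :: R.map Subtype.val))
    (hperm : H.flatten.flatten.Perm (f :: G.η f :: v.flatten.map Subtype.val)) :
    (v.flatten ++ rest.flatten.flatten).Perm
      (edgeList (G.η.subtypePerm (G.η_mem_iff f)) R) := by
  have hp : (H ++ rest.map (List.map (List.map Subtype.val))).flatten.flatten.Perm
      (f :: G.η f :: (v.flatten ++ rest.flatten.flatten).map Subtype.val) := by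
    rw [List.flatten_append, List.flatten_append, flatten_flatten_map, List.map_append]
    exact hperm.append_right _
  have hn := hp.nodup_iff.1 h.nodup
  rw [List.nodup_cons, List.nodup_cons] at hn
  refine (List.perm_ext_iff_of_nodup (List.Nodup.of_map _ hn.2.2) hR.contract.nodup).2
    fun x => ⟨fun _ => hR.contract.mem x, fun _ => ?_⟩
  have hx := hp.mem_iff.1 (h.mem x)
  rw [List.mem_cons, List.mem_cons, List.mem_map_of_injective Subtype.val_injective] at hx
  exact (hx.resolve_left x.2.1).resolve_left x.2.2

/-- The common part of the three cases of the contraction theorem. The vertices `H` of the edge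
`{f, η f}` are replaced by the vertex `v` with the integer `γ`; the sums over the colourings of the
edge are compared by `hsum`, the orientations by `hε`. -/
theorem sum_contract_of (h𝒜 : IsSuperGrading 𝒜) (hg : IsOddScalarProduct 𝒜 g)
    (hK : IsEvenSymmetric B (B.propagator J)) (w : G.Orient) {f : G.Flag}
    {H : List (List (List G.Flag))}
    {rest : List (List (List {x : G.Flag // x ≠ f ∧ x ≠ G.η f}))}
    {v : List (List {x : G.Flag // x ≠ f ∧ x ≠ G.η f})} {γ : ℕ} {ε : ZMod 2}
    {R : List {x : G.Flag // x ≠ f ∧ x ≠ G.η f}}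
    (h : IsPresentation G (H ++ rest.map (List.map (List.map Subtype.val))))
    (hR : IsEdgeSystem G.η (f :: R.map Subtype.val))
    (hH : ∀ u ∈ H, f ∈ u.flatten ∨ G.η f ∈ u.flatten) (hv : v ≠ [])
    (hperm : H.flatten.flatten.Perm (f :: G.η f :: v.flatten.map Subtype.val))
    (hcyc : G.Contractible f →
      ∀ c ∈ v, IsCycleList (contractPerm G.σ f (G.η f) (G.η_ne f)) c)
    (hγ : (open Classical in if G.lam f (G.η f) then
      if G.σ.SameCycle f (G.η f) then G.genus f else G.genus f + 1
      else G.genus f + G.genus (G.η f)) = γ)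
    (hε : G.Contractible f → reorderExponent (fun _ => 1) h.presentation.order.list
      (contractPrefix G.σ f (G.η f) ++
        ((v :: rest).flatMap (vertexOrder (contractPerm G.σ f (G.η f) (G.η_ne f)))).map
          (contractBasis G.σ f (G.η f) (G.η_ne f))) = ε)
    (h0 : ¬ G.Contractible f → ∀ m : {x : G.Flag // x ≠ f ∧ x ≠ G.η f} → ι,
      B.vertexTensor γ v m = 0)
    (hsum : ∀ Q : ({x : G.Flag // x ≠ f ∧ x ≠ G.η f} → ι) → k,
      ∑ m : G.Flag → ι, g (B.dual (m f)) (B.dual (m (G.η f))) * Q (fun x => m x) *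
        (sgn k (reorderExponent (shiftedParity B m)
          (H.flatten.flatten ++ rest.flatten.flatten.map Subtype.val)
          (f :: G.η f :: (edgeList (G.η.subtypePerm (G.η_mem_iff f)) R).map Subtype.val)) *
        (H.map fun u => B.vertexTensor (vertexGenus G u) u m).prod) =
      sgn k ε * ∑ m, Q m * (sgn k (reorderExponent (shiftedParity B m)
        (v.flatten ++ rest.flatten.flatten) (edgeList (G.η.subtypePerm (G.η_mem_iff f)) R)) *
          B.vertexTensor γ v m)) :
    (∑ m : G.Flag → ι, g (B.dual (m f)) (B.dual (m (G.η f))) *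
        ((R.map Subtype.val).map fun x => B.propagator J (m x) (m (G.η x))).prod *
        h.presentation.colouringValue B w (edgeList G.η (f :: R.map Subtype.val)) m) =
      open Classical in if hc : G.Contractible f then
        partitionCochain B J ⟨G.contract f hc, G.contractOrient w f hc⟩ else 0 := by
  have hf : f ∈ H.flatten.flatten := hperm.mem_iff.2 (by simp)
  have hf' : G.η f ∈ H.flatten.flatten := hperm.mem_iff.2 (by simp)
  have key := hsum fun m => (R.map fun x =>
      B.propagator J (m x) (m (G.η.subtypePerm (G.η_mem_iff f) x))).prod *
    (rest.map fun u =>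
      B.vertexTensor (u.flatten.head?.elim 0 fun x => G.contractGenus f x) u m).prod
  have hrest : ∀ m : G.Flag → ι, (rest.map fun u =>
      B.vertexTensor (u.flatten.head?.elim 0 fun x => G.contractGenus f x) u
        fun x : {x : G.Flag // x ≠ f ∧ x ≠ G.η f} => m x).prod =
      ((rest.map (List.map (List.map Subtype.val))).map fun u =>
        B.vertexTensor (vertexGenus G u) u m).prod := by
    intro m
    rw [List.map_map]
    congr 1
    refine List.map_congr_left fun u hu => ?_
    rw [vertexGenus_map_val h hH hf hf' hu]
    exact (B.vertexTensor_map _ _ _ _).symm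
  have hL : (∑ m : G.Flag → ι, g (B.dual (m f)) (B.dual (m (G.η f))) *
        ((R.map Subtype.val).map fun x => B.propagator J (m x) (m (G.η x))).prod *
        h.presentation.colouringValue B w (edgeList G.η (f :: R.map Subtype.val)) m) =
      ((w.sign h.presentation.order : ℤ) : k) * (sgn k ε * ∑ m, ((R.map fun x =>
      B.propagator J (m x) (m (G.η.subtypePerm (G.η_mem_iff f) x))).prod *
    (rest.map fun u =>
      B.vertexTensor (u.flatten.head?.elim 0 fun x => G.contractGenus f x) u m).prod) *
        (sgn k (reorderExponent (shiftedParity B m)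
        (v.flatten ++ rest.flatten.flatten) (edgeList (G.η.subtypePerm (G.η_mem_iff f)) R)) *
          B.vertexTensor γ v m)) := by
    rw [← key, Finset.mul_sum]
    refine Finset.sum_congr rfl fun m _ => ?_
    have e1 : h.presentation.flags =
        H.flatten.flatten ++ rest.flatten.flatten.map Subtype.val := by
      change (H ++ rest.map (List.map (List.map Subtype.val))).flatten.flatten = _
      rw [List.flatten_append, List.flatten_append, flatten_flatten_map]
    have e2 : h.presentation.vertexProduct B m =
        (H.map fun u => B.vertexTensor (vertexGenus G u) u m).prod *
        ((rest.map (List.map (List.map Subtype.val))).map fun u =>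
        B.vertexTensor (vertexGenus G u) u m).prod := by
      rw [← List.prod_append, ← List.map_append]
      rfl
    have e3 : ((R.map Subtype.val).map fun x => B.propagator J (m x) (m (G.η x))) =
        R.map fun x : {x : G.Flag // x ≠ f ∧ x ≠ G.η f} => B.propagator J (m x)
          (m (G.η.subtypePerm (G.η_mem_iff f) x)) := by
      rw [List.map_map]
      rfl
    rw [Presentation.colouringValue, e1, e2, e3, edgeList_cons, edgeList_map_val, hrest]
    ring
  rw [hL]
  split_ifs with hc
  · have hP := h.contract hc hH hv (hcyc hc) hperm
    rw [partitionCochain_contract B h𝒜 hg hK w hc h.presentation hR.contract (L := v :: rest)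
      hP (hε hc)]
    congr 2
    refine Finset.sum_congr rfl fun m _ => ?_
    have hγ' : (v.flatten.head?.elim 0 fun x => G.contractGenus f x) = γ := by
      have hcv : ∃ x, x ∈ v.flatten := by
        obtain ⟨c, hcv⟩ := List.exists_mem_of_ne_nil v hv
        obtain ⟨x, hx⟩ := List.exists_mem_of_ne_nil c (hcyc hc c hcv).ne_nil
        exact ⟨x, List.mem_flatten.2 ⟨c, hcv, hx⟩⟩
      have hγ : ∀ x ∈ v.flatten, G.contractGenus f x = γ := by
        intro x hx
        rw [StableRibbonGraph.contractGenus, if_pos, ← hγ]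
        refine (h.mem_iff_lam hH hf hf' x).1 (hperm.mem_iff.2 ?_)
        exact List.mem_cons_of_mem _ (List.mem_cons_of_mem _ (List.mem_map_of_mem hx))
      cases hx : v.flatten with
      | nil => rw [hx] at hcv; simp at hcv
      | cons x l => exact hγ x (by rw [hx]; simp)
    rw [List.flatten_cons, List.flatten_append, List.map_cons, List.prod_cons, hγ']
    ring
  · have : ∀ m : {x : G.Flag // x ≠ f ∧ x ≠ G.η f} → ι, B.vertexTensor γ v m = 0 := h0 hc
    simp [this]

end SumContract

/-! ### Edges that cannot be contracted -/

section Contractible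

variable {G : StableRibbonGraph} {f : G.Flag} {A A' : List {x : G.Flag // x ≠ f ∧ x ≠ G.η f}}

theorem IsCycleList.apply_head {α : Type*} {σ : Perm α} {x y : α} {c : List α}
    (h : IsCycleList σ (x :: y :: c)) : σ x = y := by
  have := h.map_eq
  rw [List.map_cons, List.rotate_cons_succ, List.rotate_zero, List.cons_append] at this
  exact (List.cons.inj this).1

theorem IsCycleList.apply_singleton {α : Type*} {σ : Perm α} {x : α}
    (h : IsCycleList σ [x]) : σ x = x := by
  simpa using h.map_eq

theorem apply_ne_of_isCycleList_cons (h : IsCycleList G.σ (f :: A.map Subtype.val)) :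
    G.σ f ≠ G.η f ∧ (G.σ f = f ↔ A = []) := by
  cases A with
  | nil =>
    rw [List.map_nil] at h
    rw [h.apply_singleton]
    exact ⟨(G.η_ne f).symm, by simp⟩
  | cons a A =>
    rw [List.map_cons] at h
    rw [h.apply_head]
    exact ⟨a.2.2, by simp [a.2.1]⟩

theorem apply_ne_of_isCycleList_cons' (h : IsCycleList G.σ (G.η f :: A'.map Subtype.val)) :
    G.σ (G.η f) ≠ f ∧ (G.σ (G.η f) = G.η f ↔ A' = []) := by
  cases A' with
  | nil =>
    rw [List.map_nil] at h
    rw [h.apply_singleton]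
    exact ⟨G.η_ne f, by simp⟩
  | cons a A' =>
    rw [List.map_cons] at h
    rw [h.apply_head]
    exact ⟨a.2.1, by simp [a.2.2]⟩

/-- An edge that joins two cycles can be contracted if the resulting cycle is non-empty. -/
theorem contractible_iff_of_join (h : IsCycleList G.σ (f :: A.map Subtype.val))
    (h' : IsCycleList G.σ (G.η f :: A'.map Subtype.val)) :
    G.Contractible f ↔ A ++ A' ≠ [] := by
  have h1 := apply_ne_of_isCycleList_cons h
  have h2 := apply_ne_of_isCycleList_cons' h'
  rw [StableRibbonGraph.Contractible, h1.2, h2.2, ne_eq (A ++ A'), List.append_eq_nil_iff]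
  tauto

theorem apply_eq_iff_of_cut {x y : G.Flag}
    (h : IsCycleList G.σ (x :: (A.map Subtype.val ++ y :: A'.map Subtype.val)))
    (hy : y = f ∨ y = G.η f) : G.σ x = y ↔ A = [] := by
  cases A with
  | nil => exact ⟨fun _ => rfl, fun _ => h.apply_head⟩
  | cons a A =>
    rw [List.map_cons, List.cons_append] at h
    rw [h.apply_head]
    rcases hy with rfl | rfl
    · simp [a.2.1]
    · simp [a.2.2]

/-- An edge with both flags in one cycle can be contracted if it cuts this cycle into two non-empty
ones. -/
theorem contractible_iff_of_cut
    (h : IsCycleList G.σ (f :: (A.map Subtype.val ++ G.η f :: A'.map Subtype.val))) :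
    G.Contractible f ↔ A ≠ [] ∧ A' ≠ [] := by
  have h1 := apply_eq_iff_of_cut h (Or.inr rfl)
  have h' : IsCycleList G.σ (G.η f :: (A'.map Subtype.val ++ f :: A.map Subtype.val)) := by
    have := h.rotate (f :: A.map Subtype.val).length
    rwa [← List.cons_append, List.rotate_append_length_eq, List.cons_append] at this
  have h2 := apply_eq_iff_of_cut h' (Or.inl rfl)
  have h3 : G.σ f ≠ f := by
    cases A with
    | nil =>
      rw [h1.2 rfl]
      exact G.η_ne f
    | cons a A =>
      rw [List.map_cons, List.cons_append] at h
      rw [h.apply_head]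
      exact a.2.1
  rw [StableRibbonGraph.Contractible, ne_eq, h1, ne_eq, h2]
  tauto

end Contractible

section Vanishing

variable {k A : Type*} [Field k] [NonUnitalRing A] [Module k A]
  [IsScalarTower k A A] [SMulCommClass k A A] [CharZero k]
  {𝒜 : ZMod 2 → Submodule k A} {g : A →ₗ[k] A →ₗ[k] k} {ι : Type*} [DecidableEq ι] [Fintype ι]
  (B : DualBases 𝒜 g ι)

theorem vertexTensor_concat_nil (h𝒜 : IsSuperGrading 𝒜) (hg : IsOddScalarProduct 𝒜 g)
    (hTr : ∀ a : A, B.superTrace (LinearMap.mulLeft k a) = 0) {F : Type*} (γ : ℕ)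
    (cs : List (List F)) (m : F → ι) : B.vertexTensor γ (cs ++ [[]]) m = 0 := by
  rw [vertexTensor_eq_vertexValue, DualBases.vertexValue, List.map_append, List.map_singleton,
    List.map_nil, B.vertexTrace_concat_nil h𝒜 hg hTr γ (homogeneous_letters' B m cs), mul_zero]

theorem vertexTensor_nil_concat {F : Type*} (γ : ℕ) (cs : List (List F)) (c : List F)
    (m : F → ι) : B.vertexTensor γ (cs ++ [[], c]) m = 0 := by
  have e : cs ++ [[], c] = (cs ++ [[]]) ++ [c] := by simp
  rw [vertexTensor_eq_vertexValue, DualBases.vertexValue, e, List.map_append, List.map_singleton,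
    B.vertexTrace_concat, List.map_append, List.map_append, List.map_singleton,
    List.map_singleton, List.map_nil]
  obtain ⟨ψ, hψ⟩ := isLinearFunction_trace (k := k) (g := g) (B.insertionLetter []).1
    ((cs.map (List.map fun x => B.letter (m x))).map B.insertionLetter)
    (c.map (fun x => B.letter (m x)) ++ B.handleWord γ)
  have h0 : B.insertionLetter [] = ((B.insertionLetter []).1, 0) :=
    Prod.ext rfl B.insertionLetter_nil
  rw [h0]
  simp only [List.append_assoc, List.cons_append, List.nil_append]
  exact mul_eq_zero_of_right _ ((hψ 0).trans (map_zero ψ))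

end Vanishing

/-! ### The three kinds of contractions -/

section SumContract

variable {G : StableRibbonGraph} {k A : Type*} [Field k] [NonUnitalRing A] [Module k A]
  [IsScalarTower k A A] [SMulCommClass k A A] [CharZero k]
  {𝒜 : ZMod 2 → Submodule k A} {g : A →ₗ[k] A →ₗ[k] k} {ι : Type*} [DecidableEq ι] [Fintype ι]
  (B : DualBases 𝒜 g ι) {J : A →ₗ[k] A}

theorem map_inl_contractBasis {f : G.Flag} (l : List {x : G.Flag // x ≠ f ∧ x ≠ G.η f}) :
    (l.map Sum.inl).map (contractBasis G.σ f (G.η f) (G.η_ne f)) =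
      (l.map Subtype.val).map Sum.inl := by
  rw [List.map_map, List.map_map]
  rfl

/-- The contraction of an edge with both flags in one cycle. -/
theorem sum_contract_cut (h𝒜 : IsSuperGrading 𝒜) (hg : IsOddScalarProduct 𝒜 g)
    (hTr : ∀ a : A, B.superTrace (LinearMap.mulLeft k a) = 0)
    (hK : IsEvenSymmetric B (B.propagator J)) (w : G.Orient) {f : G.Flag}
    {cs : List (List {x : G.Flag // x ≠ f ∧ x ≠ G.η f})}
    {c c' R : List {x : G.Flag // x ≠ f ∧ x ≠ G.η f}}
    {rest : List (List (List {x : G.Flag // x ≠ f ∧ x ≠ G.η f}))}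
    (h : IsPresentation G ((cs.map (List.map Subtype.val) ++
      [f :: (c.map Subtype.val ++ G.η f :: c'.map Subtype.val)]) ::
        rest.map (List.map (List.map Subtype.val))))
    (hR : IsEdgeSystem G.η (f :: R.map Subtype.val))
    (hX : c' ≠ [] ∨ G.genus f ≠ 0 ∨ cs ≠ []) :
    (∑ m : G.Flag → ι, g (B.dual (m f)) (B.dual (m (G.η f))) *
        ((R.map Subtype.val).map fun x => B.propagator J (m x) (m (G.η x))).prod *
        h.presentation.colouringValue B w (edgeList G.η (f :: R.map Subtype.val)) m) =
      open Classical in if hc : G.Contractible f then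
        partitionCochain B J ⟨G.contract f hc, G.contractOrient w f hc⟩ else 0 := by
  have hcl := h.cycle _ List.mem_cons_self
    (f :: (c.map Subtype.val ++ G.η f :: c'.map Subtype.val)) (by simp)
  have hsame : G.σ.SameCycle f (G.η f) := (hcl.mem_iff (by simp)).1 (by simp)
  have hgen := h.vertexGenus_eq List.mem_cons_self (x := f) (by simp)
  have hflat : (cs.map (List.map Subtype.val) ++
      [f :: (c.map Subtype.val ++ G.η f :: c'.map Subtype.val)]).flatten =
      cs.flatten.map Subtype.val ++ f :: (c.map Subtype.val ++ G.η f :: c'.map Subtype.val) := by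
    rw [List.flatten_append, flatten_map_map, List.flatten_singleton]
  have hvflat : (cs ++ [c, c']).flatten = cs.flatten ++ (c ++ c') := by simp
  have hperm : [cs.map (List.map Subtype.val) ++
      [f :: (c.map Subtype.val ++ G.η f :: c'.map Subtype.val)]].flatten.flatten.Perm
      (f :: G.η f :: (cs ++ [c, c']).flatten.map Subtype.val) := by
    rw [List.flatten_singleton, hflat, hvflat, List.map_append, List.map_append]
    exact perm_cons_cons_of_perm (List.Perm.refl _)
  have hE := IsPresentation.perm_edgeList (H := [_]) h hR hperm
  have hcont := contractible_iff_of_cut hcl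
  refine sum_contract_of B h𝒜 hg hK w (H := [_]) (v := cs ++ [c, c']) (γ := G.genus f)
    (ε := cs.flatten.length + c'.length) h hR ?_ (by simp) hperm ?_ ?_ ?_ ?_ ?_
  · intro u hu
    rw [List.mem_singleton.1 hu]
    exact Or.inl (by simp)
  · intro hc d hd
    rw [hcont] at hc
    rw [List.mem_append, List.mem_cons, List.mem_singleton] at hd
    rcases hd with hd | rfl | rfl
    · exact (h.cycle _ List.mem_cons_self _
        (List.mem_append_left _ (List.mem_map_of_mem hd))).contract _
    · exact hcl.contract_cut_left _ hc.1
    · exact hcl.contract_cut_right _ hc.2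
  · rw [if_pos (StableRibbonGraph.lam_of_sameCycle hsame), if_pos hsame]
  · intro hc
    rw [hcont] at hc
    obtain ⟨x, d, hd⟩ := List.exists_cons_of_ne_nil hc.1
    obtain ⟨x', d', hd'⟩ := List.exists_cons_of_ne_nil hc.2
    have e1 : h.presentation.order.list =
        (cs.flatten.map Subtype.val).map .inl ++ .inl f :: ((c.map Subtype.val).map .inl ++
          .inl (G.η f) :: ((c'.map Subtype.val).map .inl ++ .inr (cyc G.σ f) ::
            (cycleHeads G.σ (cs.map (List.map Subtype.val)) ++
              (rest.map (List.map (List.map Subtype.val))).flatMap (vertexOrder G.σ)))) := by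
      change (_ :: rest.map (List.map (List.map Subtype.val))).flatMap (vertexOrder G.σ) = _
      rw [List.flatMap_cons, vertexOrder_eq, hflat, cycleHeads_append, cycleHeads_singleton]
      simp only [List.map_append, List.map_cons, List.append_assoc, List.cons_append,
        List.nil_append]
    have e2 : contractPrefix G.σ f (G.η f) ++ (((cs ++ [c, c']) :: rest).flatMap
        (vertexOrder (contractPerm G.σ f (G.η f) (G.η_ne f)))).map
          (contractBasis G.σ f (G.η f) (G.η_ne f)) = .inr (cyc G.σ f) ::
        ((cs.flatten.map Subtype.val).map .inl ++ ((c.map Subtype.val).map .inl ++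
          ((c'.map Subtype.val).map .inl ++ .inl f :: .inl (G.η f) ::
            (cycleHeads G.σ (cs.map (List.map Subtype.val)) ++
              (rest.map (List.map (List.map Subtype.val))).flatMap (vertexOrder G.σ))))) := by
      have e3 : cs ++ [c, c'] = cs ++ ([c] ++ [c']) := rfl
      rw [contractPrefix, if_pos hsame, List.flatMap_cons, List.map_append,
        map_flatMap_vertexOrder_contract _ fun u hu d hd => h.cycle _ (List.mem_cons_of_mem _
          (List.mem_map_of_mem hu)) _ (List.mem_map_of_mem hd), vertexOrder_eq, hvflat,
        List.map_append, map_inl_contractBasis, e3, cycleHeads_append, cycleHeads_append]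
      simp only [List.map_append, List.append_assoc, List.cons_append, List.nil_append]
      rw [map_cycleHeads_contract _ fun d hd =>
          h.cycle _ List.mem_cons_self _ (List.mem_append_left _ (List.mem_map_of_mem hd)),
        hd, hd', cycleHeads_singleton, cycleHeads_singleton, ← hd, ← hd',
        List.map_singleton, List.map_singleton,
        contractBasis_cut_left _ hcl (x := x) (by simp [hd]),
        contractBasis_cut_right _ hcl (x := x') (by simp [hd'])]
      simp only [List.cons_append, List.nil_append]
    have hn := h.presentation.order.nodup
    rw [e1] at hn
    rw [e1, e2, orientation_cut hn, List.length_map, List.length_map, List.length_map,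
      List.length_map]
  · intro hc m
    rw [hcont, not_and_or, not_not, not_not] at hc
    rcases hc with rfl | rfl
    · exact vertexTensor_nil_concat B _ _ _ m
    · have e : cs ++ [c, []] = (cs ++ [c]) ++ [[]] := by simp
      rw [e]
      exact vertexTensor_concat_nil B h𝒜 hg hTr _ _ m
  · intro Q
    rw [hvflat, List.append_assoc, List.append_assoc] at hE
    have key := sum_colourings_cut B (G.η_ne f) h𝒜 hg hTr (G.genus f) cs c c' rest.flatten.flatten
      (edgeList (G.η.subtypePerm (G.η_mem_iff f)) R) hR.contract.nodup hE hX Q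
    simp only [List.flatten_singleton, hflat, hvflat, List.append_assoc, List.cons_append,
      List.map_singleton, List.prod_singleton, hgen]
    exact key

/-- The contraction of a loop with flags in two cycles. -/
theorem sum_contract_join_loop (h𝒜 : IsSuperGrading 𝒜) (hg : IsOddScalarProduct 𝒜 g)
    (hTr : ∀ a : A, B.superTrace (LinearMap.mulLeft k a) = 0)
    (hK : IsEvenSymmetric B (B.propagator J)) (w : G.Orient) {f : G.Flag}
    {cs : List (List {x : G.Flag // x ≠ f ∧ x ≠ G.η f})}
    {c c' R : List {x : G.Flag // x ≠ f ∧ x ≠ G.η f}}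
    {rest : List (List (List {x : G.Flag // x ≠ f ∧ x ≠ G.η f}))}
    (h : IsPresentation G ((cs.map (List.map Subtype.val) ++
      [f :: c.map Subtype.val, G.η f :: c'.map Subtype.val]) ::
        rest.map (List.map (List.map Subtype.val))))
    (hR : IsEdgeSystem G.η (f :: R.map Subtype.val)) :
    (∑ m : G.Flag → ι, g (B.dual (m f)) (B.dual (m (G.η f))) *
        ((R.map Subtype.val).map fun x => B.propagator J (m x) (m (G.η x))).prod *
        h.presentation.colouringValue B w (edgeList G.η (f :: R.map Subtype.val)) m) =
      open Classical in if hc : G.Contractible f then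
        partitionCochain B J ⟨G.contract f hc, G.contractOrient w f hc⟩ else 0 := by
  have hcl := h.cycle _ List.mem_cons_self (f :: c.map Subtype.val) (by simp)
  have hcl' := h.cycle _ List.mem_cons_self (G.η f :: c'.map Subtype.val) (by simp)
  have hlam : G.lam f (G.η f) := (h.vertex _ List.mem_cons_self f (by simp) _).1 (by simp)
  have hgen := h.vertexGenus_eq List.mem_cons_self (x := f) (by simp)
  have hflat : (cs.map (List.map Subtype.val) ++
      [f :: c.map Subtype.val, G.η f :: c'.map Subtype.val]).flatten =
      cs.flatten.map Subtype.val ++ f :: (c.map Subtype.val ++ G.η f :: c'.map Subtype.val) := by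
    rw [List.flatten_append, flatten_map_map]
    simp
  have hvflat : (cs ++ [c ++ c']).flatten = cs.flatten ++ (c ++ c') := by simp
  have hd : (f :: c.map Subtype.val).Disjoint (G.η f :: c'.map Subtype.val) := by
    have hn := h.nodup_flatten List.mem_cons_self
    rw [hflat, List.nodup_append', ← List.cons_append, List.nodup_append'] at hn
    exact hn.2.1.2.2
  have hsame : ¬ G.σ.SameCycle f (G.η f) := fun k =>
    hd ((hcl.mem_iff (by simp)).2 k) (by simp)
  have hperm : [cs.map (List.map Subtype.val) ++
      [f :: c.map Subtype.val, G.η f :: c'.map Subtype.val]].flatten.flatten.Perm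
      (f :: G.η f :: (cs ++ [c ++ c']).flatten.map Subtype.val) := by
    rw [List.flatten_singleton, hflat, hvflat, List.map_append, List.map_append]
    exact perm_cons_cons_of_perm (List.Perm.refl _)
  have hE := IsPresentation.perm_edgeList (H := [_]) h hR hperm
  have hcont := contractible_iff_of_join hcl hcl'
  refine sum_contract_of B h𝒜 hg hK w (H := [_]) (v := cs ++ [c ++ c']) (γ := G.genus f + 1)
    (ε := cs.flatten.length + c'.length) h hR ?_ (by simp) hperm ?_ ?_ ?_ ?_ ?_
  · intro u hu
    rw [List.mem_singleton.1 hu]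
    exact Or.inl (by simp)
  · intro hc d hd'
    rw [hcont] at hc
    rw [List.mem_append, List.mem_singleton] at hd'
    rcases hd' with hd' | rfl
    · exact (h.cycle _ List.mem_cons_self _
        (List.mem_append_left _ (List.mem_map_of_mem hd'))).contract _
    · exact hcl.contract_join _ hcl' hd hc
  · rw [if_pos hlam, if_neg hsame]
  · intro hc
    rw [hcont] at hc
    obtain ⟨x, d, hx⟩ := List.exists_cons_of_ne_nil hc
    have e1 : h.presentation.order.list =
        (cs.flatten.map Subtype.val).map .inl ++ .inl f :: ((c.map Subtype.val).map .inl ++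
          .inl (G.η f) :: ((c'.map Subtype.val).map .inl ++ .inr (cyc G.σ (G.η f)) ::
            .inr (cyc G.σ f) :: (cycleHeads G.σ (cs.map (List.map Subtype.val)) ++
              (rest.map (List.map (List.map Subtype.val))).flatMap (vertexOrder G.σ)))) := by
      change (_ :: rest.map (List.map (List.map Subtype.val))).flatMap (vertexOrder G.σ) = _
      have e3 : ∀ a b : List G.Flag, [a, b] = [a] ++ [b] := fun _ _ => rfl
      rw [List.flatMap_cons, vertexOrder_eq, hflat, e3, cycleHeads_append, cycleHeads_append,
        cycleHeads_singleton, cycleHeads_singleton]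
      simp only [List.map_append, List.map_cons, List.append_assoc, List.cons_append,
        List.nil_append]
    have e2 : contractPrefix G.σ f (G.η f) ++ (((cs ++ [c ++ c']) :: rest).flatMap
        (vertexOrder (contractPerm G.σ f (G.η f) (G.η_ne f)))).map
          (contractBasis G.σ f (G.η f) (G.η_ne f)) =
        .inl f :: .inr (cyc G.σ f) :: .inl (G.η f) ::
        ((cs.flatten.map Subtype.val).map .inl ++ ((c.map Subtype.val).map .inl ++
          ((c'.map Subtype.val).map .inl ++ .inr (cyc G.σ (G.η f)) ::
            (cycleHeads G.σ (cs.map (List.map Subtype.val)) ++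
              (rest.map (List.map (List.map Subtype.val))).flatMap (vertexOrder G.σ))))) := by
      rw [contractPrefix, if_neg hsame, List.flatMap_cons, List.map_append,
        map_flatMap_vertexOrder_contract _ fun u hu d hd => h.cycle _ (List.mem_cons_of_mem _
          (List.mem_map_of_mem hu)) _ (List.mem_map_of_mem hd), vertexOrder_eq, hvflat,
        List.map_append, map_inl_contractBasis, cycleHeads_append]
      simp only [List.map_append, List.append_assoc, List.cons_append, List.nil_append]
      rw [map_cycleHeads_contract _ fun d hd =>
          h.cycle _ List.mem_cons_self _ (List.mem_append_left _ (List.mem_map_of_mem hd)),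
        hx, cycleHeads_singleton, List.map_singleton,
        contractBasis_join_eq _ hcl hcl' hd (x := x) (by rw [hx]; simp)]
      simp only [List.cons_append, List.nil_append]
    have hn := h.presentation.order.nodup
    rw [e1] at hn
    rw [e1, e2, orientation_join_loop hn, List.length_map, List.length_map, List.length_map,
      List.length_map]
  · intro hc m
    rw [hcont, not_not] at hc
    rw [hc]
    exact vertexTensor_concat_nil B h𝒜 hg hTr _ _ m
  · intro Q
    rw [hvflat, List.append_assoc, List.append_assoc] at hE
    have key := sum_colourings_join_loop B (G.η_ne f) h𝒜 hg (G.genus f) cs c c'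
      rest.flatten.flatten (edgeList (G.η.subtypePerm (G.η_mem_iff f)) R) hR.contract.nodup hE Q
    simp only [List.flatten_singleton, hflat, hvflat, List.append_assoc, List.cons_append,
      List.map_singleton, List.prod_singleton, hgen]
    exact key

/-- The contraction of an edge with two vertices. -/
theorem sum_contract_join (h𝒜 : IsSuperGrading 𝒜) (hg : IsOddScalarProduct 𝒜 g)
    (hTr : ∀ a : A, B.superTrace (LinearMap.mulLeft k a) = 0)
    (hK : IsEvenSymmetric B (B.propagator J)) (w : G.Orient) {f : G.Flag}
    {cs cs' : List (List {x : G.Flag // x ≠ f ∧ x ≠ G.η f})}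
    {c c' R : List {x : G.Flag // x ≠ f ∧ x ≠ G.η f}}
    {rest : List (List (List {x : G.Flag // x ≠ f ∧ x ≠ G.η f}))}
    (h : IsPresentation G ((cs.map (List.map Subtype.val) ++ [f :: c.map Subtype.val]) ::
      (cs'.map (List.map Subtype.val) ++ [G.η f :: c'.map Subtype.val]) ::
        rest.map (List.map (List.map Subtype.val))))
    (hR : IsEdgeSystem G.η (f :: R.map Subtype.val)) :
    (∑ m : G.Flag → ι, g (B.dual (m f)) (B.dual (m (G.η f))) *
        ((R.map Subtype.val).map fun x => B.propagator J (m x) (m (G.η x))).prod *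
        h.presentation.colouringValue B w (edgeList G.η (f :: R.map Subtype.val)) m) =
      open Classical in if hc : G.Contractible f then
        partitionCochain B J ⟨G.contract f hc, G.contractOrient w f hc⟩ else 0 := by
  have hmem' := List.mem_cons_of_mem (cs.map (List.map Subtype.val) ++ [f :: c.map Subtype.val])
    (List.mem_cons_self (a := cs'.map (List.map Subtype.val) ++ [G.η f :: c'.map Subtype.val])
      (l := rest.map (List.map (List.map Subtype.val))))
  have hcl := h.cycle _ List.mem_cons_self (f :: c.map Subtype.val) (by simp)
  have hcl' := h.cycle _ hmem' (G.η f :: c'.map Subtype.val) (by simp)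
  have hgen := h.vertexGenus_eq List.mem_cons_self (x := f) (by simp)
  have hgen' := h.vertexGenus_eq hmem' (x := G.η f) (by simp)
  have hX : c ≠ [] ∨ G.genus f ≠ 0 ∨ cs ≠ [] := by
    by_contra hX
    simp only [not_or, not_not] at hX
    obtain ⟨rfl, hγ, rfl⟩ := hX
    have h3 := h.three_le_length (c := [f]) List.mem_cons_self (hgen.trans hγ)
    simp at h3
  have hX' : c' ≠ [] ∨ G.genus (G.η f) ≠ 0 ∨ cs' ≠ [] := by
    by_contra hX
    simp only [not_or, not_not] at hX
    obtain ⟨rfl, hγ, rfl⟩ := hX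
    have h3 := h.three_le_length (c := [G.η f]) hmem' (hgen'.trans hγ)
    simp at h3
  have hflat : (cs.map (List.map Subtype.val) ++ [f :: c.map Subtype.val]).flatten =
      cs.flatten.map Subtype.val ++ f :: c.map Subtype.val := by
    rw [List.flatten_append, flatten_map_map, List.flatten_singleton]
  have hflat' : (cs'.map (List.map Subtype.val) ++ [G.η f :: c'.map Subtype.val]).flatten =
      cs'.flatten.map Subtype.val ++ G.η f :: c'.map Subtype.val := by
    rw [List.flatten_append, flatten_map_map, List.flatten_singleton]
  have hvflat : (cs ++ (cs' ++ [c ++ c'])).flatten =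
      cs.flatten ++ (cs'.flatten ++ (c ++ c')) := by simp
  have hlam : ¬ G.lam f (G.η f) := by
    intro k
    have h1 := (h.vertex _ List.mem_cons_self f (by simp) _).2 k
    have hn := h.nodup
    rw [List.flatten_cons, List.flatten_append, List.nodup_append'] at hn
    refine hn.2.2 h1 ?_
    rw [List.flatten_cons, List.flatten_append]
    exact List.mem_append_left _ (by simp)
  have hsame : ¬ G.σ.SameCycle f (G.η f) := fun k =>
    hlam (StableRibbonGraph.lam_of_sameCycle k)
  have hd : (f :: c.map Subtype.val).Disjoint (G.η f :: c'.map Subtype.val) :=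
    fun y h1 h2 => hsame (((hcl.mem_iff (by simp)).1 h1).trans ((hcl'.mem_iff (by simp)).1 h2).symm)
  have hflat2 : [cs.map (List.map Subtype.val) ++ [f :: c.map Subtype.val],
      cs'.map (List.map Subtype.val) ++ [G.η f :: c'.map Subtype.val]].flatten.flatten =
      cs.flatten.map Subtype.val ++ f :: (c.map Subtype.val ++ (cs'.flatten.map Subtype.val ++
        G.η f :: c'.map Subtype.val)) := by
    rw [List.flatten_cons, List.flatten_singleton, List.flatten_append, hflat, hflat',
      List.append_assoc, List.cons_append]
  have hperm : [cs.map (List.map Subtype.val) ++ [f :: c.map Subtype.val],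
      cs'.map (List.map Subtype.val) ++ [G.η f :: c'.map Subtype.val]].flatten.flatten.Perm
      (f :: G.η f :: (cs ++ (cs' ++ [c ++ c'])).flatten.map Subtype.val) := by
    rw [hflat2, hvflat, List.map_append, List.map_append, List.map_append,
      ← List.append_assoc (c.map Subtype.val)]
    refine perm_cons_cons_of_perm ?_
    rw [List.append_assoc]
    exact (List.perm_append_comm_assoc _ _ _).append_left _
  have hE := IsPresentation.perm_edgeList (H := [_, _]) h hR hperm
  have hcont := contractible_iff_of_join hcl hcl'
  refine sum_contract_of B h𝒜 hg hK w (H := [_, _]) (v := cs ++ (cs' ++ [c ++ c']))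
    (γ := G.genus f + G.genus (G.η f))
    (ε := cs.flatten.length + cs'.flatten.length +
      cs.length * (cs'.flatten.length + c'.length + cs'.length) + c.length * cs'.flatten.length)
    h hR ?_ (by simp) hperm ?_ ?_ ?_ ?_ ?_
  · intro u hu
    rw [List.mem_cons, List.mem_singleton] at hu
    rcases hu with rfl | rfl
    · exact Or.inl (by simp)
    · exact Or.inr (by simp)
  · intro hc d hd'
    rw [hcont] at hc
    rw [List.mem_append, List.mem_append, List.mem_singleton] at hd'
    rcases hd' with hd' | hd' | rfl
    · exact (h.cycle _ List.mem_cons_self _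
        (List.mem_append_left _ (List.mem_map_of_mem hd'))).contract _
    · exact (h.cycle _ hmem' _ (List.mem_append_left _ (List.mem_map_of_mem hd'))).contract _
    · exact hcl.contract_join _ hcl' hd hc
  · rw [if_neg hlam]
  · intro hc
    rw [hcont] at hc
    obtain ⟨x, d, hx⟩ := List.exists_cons_of_ne_nil hc
    have e1 : h.presentation.order.list =
        (cs.flatten.map Subtype.val).map .inl ++ .inl f :: ((c.map Subtype.val).map .inl ++
          .inr (cyc G.σ f) :: (cycleHeads G.σ (cs.map (List.map Subtype.val)) ++
          ((cs'.flatten.map Subtype.val).map .inl ++ .inl (G.η f) ::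
          ((c'.map Subtype.val).map .inl ++ .inr (cyc G.σ (G.η f)) ::
            (cycleHeads G.σ (cs'.map (List.map Subtype.val)) ++
              (rest.map (List.map (List.map Subtype.val))).flatMap (vertexOrder G.σ)))))) := by
      change (_ :: _ :: rest.map (List.map (List.map Subtype.val))).flatMap (vertexOrder G.σ) = _
      rw [List.flatMap_cons, List.flatMap_cons, vertexOrder_eq, vertexOrder_eq, hflat, hflat',
        cycleHeads_append, cycleHeads_append, cycleHeads_singleton, cycleHeads_singleton]
      simp only [List.map_append, List.map_cons, List.append_assoc, List.cons_append,
        List.nil_append]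
    have e2 : contractPrefix G.σ f (G.η f) ++ (((cs ++ (cs' ++ [c ++ c'])) :: rest).flatMap
        (vertexOrder (contractPerm G.σ f (G.η f) (G.η_ne f)))).map
          (contractBasis G.σ f (G.η f) (G.η_ne f)) =
        .inl f :: .inr (cyc G.σ f) :: .inl (G.η f) ::
        ((cs.flatten.map Subtype.val).map .inl ++ ((cs'.flatten.map Subtype.val).map .inl ++
          ((c.map Subtype.val).map .inl ++ ((c'.map Subtype.val).map .inl ++
            .inr (cyc G.σ (G.η f)) :: (cycleHeads G.σ (cs'.map (List.map Subtype.val)) ++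
            (cycleHeads G.σ (cs.map (List.map Subtype.val)) ++
              (rest.map (List.map (List.map Subtype.val))).flatMap (vertexOrder G.σ))))))) := by
      rw [contractPrefix, if_neg hsame, List.flatMap_cons, List.map_append,
        map_flatMap_vertexOrder_contract _ fun u hu d hd => h.cycle _ (List.mem_cons_of_mem _
          (List.mem_cons_of_mem _ (List.mem_map_of_mem hu))) _ (List.mem_map_of_mem hd),
        vertexOrder_eq, hvflat,
        List.map_append, map_inl_contractBasis, cycleHeads_append, cycleHeads_append]
      simp only [List.map_append, List.append_assoc, List.cons_append, List.nil_append]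
      rw [map_cycleHeads_contract _ fun d hd =>
          h.cycle _ List.mem_cons_self _ (List.mem_append_left _ (List.mem_map_of_mem hd)),
        map_cycleHeads_contract _ fun d hd =>
          h.cycle _ hmem' _ (List.mem_append_left _ (List.mem_map_of_mem hd)),
        hx, cycleHeads_singleton, List.map_singleton,
        contractBasis_join_eq _ hcl hcl' hd (x := x) (by rw [hx]; simp)]
      simp only [List.cons_append, List.nil_append]
    have hn := h.presentation.order.nodup
    rw [e1] at hn
    have hl := length_cycleHeads G.σ (v := cs.map (List.map Subtype.val)) fun d hd =>
      (h.cycle _ List.mem_cons_self d (List.mem_append_left _ hd)).ne_nil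
    have hl' := length_cycleHeads G.σ (v := cs'.map (List.map Subtype.val)) fun d hd =>
      (h.cycle _ hmem' d (List.mem_append_left _ hd)).ne_nil
    rw [e1, e2, orientation_join hn, hl, hl']
    simp only [List.length_map]
  · intro hc m
    rw [hcont, not_not] at hc
    rw [hc, ← List.append_assoc]
    exact vertexTensor_concat_nil B h𝒜 hg hTr _ _ m
  · intro Q
    rw [hvflat, List.append_assoc, List.append_assoc, List.append_assoc] at hE
    have key := sum_colourings_join B (G.η_ne f) h𝒜 hg (G.genus f) (G.genus (G.η f)) cs cs' c c'
      rest.flatten.flatten (edgeList (G.η.subtypePerm (G.η_mem_iff f)) R) hR.contract.nodup hE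
      hX hX' Q
    simp only [hflat2, hvflat, List.append_assoc, List.cons_append,
      List.map_cons, List.map_nil, List.prod_cons, List.prod_nil, mul_one, hgen, hgen']
    simp only [List.append_assoc] at key
    exact key

end SumContract

/-! ### The value of the cochain on a contraction -/

section EdgeSum

variable {G : StableRibbonGraph} {k A : Type*} [Field k] [NonUnitalRing A] [Module k A]
  [IsScalarTower k A A] [SMulCommClass k A A] [CharZero k]
  {𝒜 : ZMod 2 → Submodule k A} {g : A →ₗ[k] A →ₗ[k] k} {ι : Type*} [DecidableEq ι] [Fintype ι]
  (B : DualBases 𝒜 g ι) {J : A →ₗ[k] A}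

/-- The contraction of tensors for a presentation, in which the propagator of the edge `{f, η f}` is
replaced by the inverse scalar product; `R` contains a flag of every other edge. -/
noncomputable def edgeSum (J : A →ₗ[k] A) (w : G.Orient) (P : Presentation G) (f : G.Flag)
    (R : List G.Flag) : k :=
  ∑ m : G.Flag → ι, g (B.dual (m f)) (B.dual (m (G.η f))) *
    (R.map fun x => B.propagator J (m x) (m (G.η x))).prod *
      P.colouringValue B w (edgeList G.η (f :: R)) m

open Classical in
/-- The value of the cochain on the contraction of an edge, or zero if this edge cannot be
contracted. -/
noncomputable def contractionValue (J : A →ₗ[k] A) (w : G.Orient) (f : G.Flag) : k :=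
  if hc : G.Contractible f then
    partitionCochain B J ⟨G.contract f hc, G.contractOrient w f hc⟩ else 0

theorem edgeSum_eq (h𝒜 : IsSuperGrading 𝒜) (hg : IsOddScalarProduct 𝒜 g) (w : G.Orient)
    (P P' : Presentation G) {f : G.Flag} {R : List G.Flag} (hR : IsEdgeSystem G.η (f :: R)) :
    edgeSum B J w P f R = edgeSum B J w P' f R :=
  Finset.sum_congr rfl fun m _ => by
    rw [colouringValue_independent h𝒜 hg B w hR.nodup hR.mem m P P']

theorem IsEdgeSystem.swap {f : G.Flag} {R : List G.Flag} (hR : IsEdgeSystem G.η (f :: R)) :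
    IsEdgeSystem G.η (G.η f :: R) := by
  have hp : (edgeList G.η (f :: R)).Perm (edgeList G.η (G.η f :: R)) := by
    rw [edgeList_cons, edgeList_cons, G.η_η]
    exact List.Perm.swap _ _ _
  exact ⟨hp.nodup_iff.1 hR.nodup, fun x => hp.mem_iff.1 (hR.mem x)⟩

/-- The inverse scalar product is symmetric and its two factors `πe_μ`, `πe_ν` have opposite parities
where it does not vanish, so that their exchange has no sign. -/
theorem edgeSum_swap (hg : IsOddScalarProduct 𝒜 g) (w : G.Orient) (P : Presentation G) (f : G.Flag)
    (R : List G.Flag) : edgeSum B J w P f R = edgeSum B J w P (G.η f) R := by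
  refine Finset.sum_congr rfl fun m _ => ?_
  rw [G.η_η, B.pairing_comm hg (B.dual (m f))]
  by_cases hp : B.parity (m (G.η f)) + 1 + (B.parity (m f) + 1) = 1
  · rw [Presentation.colouringValue, Presentation.colouringValue, edgeList_cons, edgeList_cons,
      G.η_η]
    have hs := reorderExponent_swap (q := shiftedParity B m) P.flags []
      (edgeList G.η R) (G.η_ne f).symm (P.mem f)
    rw [List.nil_append, List.nil_append] at hs
    have h0 : shiftedParity B m f * shiftedParity B m (G.η f) = 0 := by
      change (B.parity (m f) + 1) * (B.parity (m (G.η f)) + 1) = 0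
      generalize B.parity (m f) = a at *
      generalize B.parity (m (G.η f)) = b at *
      revert a b
      decide
    rw [hs, h0, add_zero]
  · rw [hg.odd _ _ _ (B.dual_mem hg _) _ (B.dual_mem hg _) hp]
    simp only [zero_mul]

theorem forall_ne_of_isEdgeSystem {f : G.Flag} {R : List G.Flag}
    (hR : IsEdgeSystem G.η (f :: R)) : ∀ x ∈ R, x ≠ f ∧ x ≠ G.η f := by
  intro x hx
  have hn := hR.nodup
  rw [edgeList_cons, List.nodup_cons, List.nodup_cons] at hn
  have hx' : x ∈ edgeList G.η R := mem_edgeList.2 ⟨x, hx, Or.inl rfl⟩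
  refine ⟨?_, ?_⟩
  · rintro rfl
    exact hn.1 (List.mem_cons_of_mem _ hx')
  · rintro rfl
    exact hn.2.1 hx'

theorem forall_ne_of_perm {X : Type*} {l l' : List X} {a b : X} (hp : l.Perm (a :: b :: l'))
    (hn : l.Nodup) : ∀ x ∈ l', x ≠ a ∧ x ≠ b := by
  have h := hp.nodup_iff.1 hn
  rw [List.nodup_cons, List.nodup_cons] at h
  intro x hx
  refine ⟨?_, ?_⟩
  · rintro rfl
    exact h.1 (List.mem_cons_of_mem _ hx)
  · rintro rfl
    exact h.2.1 hx

theorem forall_mem_flatten {X : Type*} {p : X → Prop} {L : List (List X)}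
    (h : ∀ x ∈ L.flatten, p x) : ∀ c ∈ L, ∀ x ∈ c, p x :=
  fun _ hc _ hx => h _ (List.mem_flatten.2 ⟨_, hc, hx⟩)

theorem edgeSum_cut (h𝒜 : IsSuperGrading 𝒜) (hg : IsOddScalarProduct 𝒜 g)
    (hTr : ∀ a : A, B.superTrace (LinearMap.mulLeft k a) = 0)
    (hK : IsEvenSymmetric B (B.propagator J)) (w : G.Orient) {f : G.Flag} {R : List G.Flag}
    (hR : IsEdgeSystem G.η (f :: R)) {cs : List (List G.Flag)} {c c' : List G.Flag}
    {rest : List (List (List G.Flag))}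
    (h : IsPresentation G ((cs ++ [f :: (c ++ G.η f :: c')]) :: rest))
    (hX : c' ≠ [] ∨ G.genus f ≠ 0 ∨ cs ≠ []) :
    edgeSum B J w h.presentation f R = contractionValue B J w f := by
  have hp : ((cs ++ [f :: (c ++ G.η f :: c')]) :: rest).flatten.flatten.Perm
      (f :: G.η f :: (cs.flatten ++ (c ++ (c' ++ rest.flatten.flatten)))) := by
    rw [List.flatten_cons, List.flatten_append, List.flatten_append, List.flatten_singleton,
      List.append_assoc, List.cons_append, List.append_assoc, List.cons_append]
    exact perm_cons_cons_of_perm (List.Perm.refl _)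
  have hne := forall_ne_of_perm hp h.nodup
  simp only [List.forall_mem_append] at hne
  obtain ⟨h1, h2, h3, h4⟩ := hne
  have h1 := forall_mem_flatten h1
  have h4 := forall_mem_flatten (forall_mem_flatten h4)
  have h5 := forall_ne_of_isEdgeSystem hR
  lift cs to List (List {x : G.Flag // x ≠ f ∧ x ≠ G.η f}) using h1
  lift c to List {x : G.Flag // x ≠ f ∧ x ≠ G.η f} using h2
  lift c' to List {x : G.Flag // x ≠ f ∧ x ≠ G.η f} using h3
  lift rest to List (List (List {x : G.Flag // x ≠ f ∧ x ≠ G.η f})) using h4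
  lift R to List {x : G.Flag // x ≠ f ∧ x ≠ G.η f} using h5
  refine sum_contract_cut B h𝒜 hg hTr hK w h hR ?_
  simpa only [ne_eq, List.map_eq_nil_iff] using hX

theorem edgeSum_join_loop (h𝒜 : IsSuperGrading 𝒜) (hg : IsOddScalarProduct 𝒜 g)
    (hTr : ∀ a : A, B.superTrace (LinearMap.mulLeft k a) = 0)
    (hK : IsEvenSymmetric B (B.propagator J)) (w : G.Orient) {f : G.Flag} {R : List G.Flag}
    (hR : IsEdgeSystem G.η (f :: R)) {cs : List (List G.Flag)} {c c' : List G.Flag}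
    {rest : List (List (List G.Flag))}
    (h : IsPresentation G ((cs ++ [f :: c, G.η f :: c']) :: rest)) :
    edgeSum B J w h.presentation f R = contractionValue B J w f := by
  have hp : ((cs ++ [f :: c, G.η f :: c']) :: rest).flatten.flatten.Perm
      (f :: G.η f :: (cs.flatten ++ (c ++ (c' ++ rest.flatten.flatten)))) := by
    rw [List.flatten_cons, List.flatten_append, List.flatten_append, List.flatten_cons,
      List.flatten_singleton, List.append_assoc, List.append_assoc, List.cons_append,
      List.cons_append]
    exact perm_cons_cons_of_perm (List.Perm.refl _)
  have hne := forall_ne_of_perm hp h.nodup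
  simp only [List.forall_mem_append] at hne
  obtain ⟨h1, h2, h3, h4⟩ := hne
  have h1 := forall_mem_flatten h1
  have h4 := forall_mem_flatten (forall_mem_flatten h4)
  have h5 := forall_ne_of_isEdgeSystem hR
  lift cs to List (List {x : G.Flag // x ≠ f ∧ x ≠ G.η f}) using h1
  lift c to List {x : G.Flag // x ≠ f ∧ x ≠ G.η f} using h2
  lift c' to List {x : G.Flag // x ≠ f ∧ x ≠ G.η f} using h3
  lift rest to List (List (List {x : G.Flag // x ≠ f ∧ x ≠ G.η f})) using h4
  lift R to List {x : G.Flag // x ≠ f ∧ x ≠ G.η f} using h5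
  exact sum_contract_join_loop B h𝒜 hg hTr hK w h hR

theorem edgeSum_join (h𝒜 : IsSuperGrading 𝒜) (hg : IsOddScalarProduct 𝒜 g)
    (hTr : ∀ a : A, B.superTrace (LinearMap.mulLeft k a) = 0)
    (hK : IsEvenSymmetric B (B.propagator J)) (w : G.Orient) {f : G.Flag} {R : List G.Flag}
    (hR : IsEdgeSystem G.η (f :: R)) {cs cs' : List (List G.Flag)} {c c' : List G.Flag}
    {rest : List (List (List G.Flag))}
    (h : IsPresentation G ((cs ++ [f :: c]) :: (cs' ++ [G.η f :: c']) :: rest)) :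
    edgeSum B J w h.presentation f R = contractionValue B J w f := by
  have hp : ((cs ++ [f :: c]) :: (cs' ++ [G.η f :: c']) :: rest).flatten.flatten.Perm
      (f :: G.η f :: (cs.flatten ++ ((c ++ cs'.flatten) ++ (c' ++ rest.flatten.flatten)))) := by
    rw [List.flatten_cons, List.flatten_cons, List.flatten_append, List.flatten_append,
      List.flatten_append, List.flatten_append, List.flatten_singleton, List.flatten_singleton,
      List.append_assoc, List.append_assoc, List.cons_append, List.cons_append,
      ← List.append_assoc c]
    exact perm_cons_cons_of_perm (List.Perm.refl _)
  have hne := forall_ne_of_perm hp h.nodup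
  simp only [List.forall_mem_append] at hne
  obtain ⟨h1, ⟨h2, h1'⟩, h3, h4⟩ := hne
  have h1 := forall_mem_flatten h1
  have h1' := forall_mem_flatten h1'
  have h4 := forall_mem_flatten (forall_mem_flatten h4)
  have h5 := forall_ne_of_isEdgeSystem hR
  lift cs to List (List {x : G.Flag // x ≠ f ∧ x ≠ G.η f}) using h1
  lift cs' to List (List {x : G.Flag // x ≠ f ∧ x ≠ G.η f}) using h1'
  lift c to List {x : G.Flag // x ≠ f ∧ x ≠ G.η f} using h2
  lift c' to List {x : G.Flag // x ≠ f ∧ x ≠ G.η f} using h3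
  lift rest to List (List (List {x : G.Flag // x ≠ f ∧ x ≠ G.η f})) using h4
  lift R to List {x : G.Flag // x ≠ f ∧ x ≠ G.η f} using h5
  exact sum_contract_join B h𝒜 hg hTr hK w h hR

/-- The value of the cochain on the contraction of an edge is the contraction of tensors in which the
propagator of this edge is replaced by the inverse scalar product. -/
theorem edgeSum_eq_contractionValue (h𝒜 : IsSuperGrading 𝒜) (hg : IsOddScalarProduct 𝒜 g)
    (hTr : ∀ a : A, B.superTrace (LinearMap.mulLeft k a) = 0)
    (hK : IsEvenSymmetric B (B.propagator J)) (w : G.Orient) (P : Presentation G) {f : G.Flag}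
    {R : List G.Flag} (hR : IsEdgeSystem G.η (f :: R)) :
    edgeSum B J w P f R = contractionValue B J w f := by
  rcases P.isPresentation.exists_adapted (G.η_ne f) with ⟨cs, c, c', rest, h⟩ |
    ⟨cs, c, c', rest, h⟩ | ⟨cs, c, cs', c', rest, h⟩
  · rw [edgeSum_eq B h𝒜 hg w P h.presentation hR]
    by_cases hX : c' ≠ [] ∨ G.genus f ≠ 0 ∨ cs ≠ []
    · exact edgeSum_cut B h𝒜 hg hTr hK w hR h hX
    -- The vertex consists of one cycle, in which `f` comes right after `η f`. The edge cannot be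
    -- contracted, and the previous case applies after an exchange of `f` and `η f`.
    simp only [not_or, not_not] at hX
    obtain ⟨rfl, hγ, rfl⟩ := hX
    have hc : c ≠ [] := by
      rintro rfl
      have h3 := h.three_le_length (c := [f, G.η f]) List.mem_cons_self
        ((h.vertexGenus_eq List.mem_cons_self (x := f) (by simp)).trans hγ)
      simp at h3
    have hη : G.σ (G.η f) = f := by
      have h2 := (h.cycle _ List.mem_cons_self (f :: (c ++ [G.η f])) (by simp)).rotate
        (f :: c).length
      rw [← List.cons_append, List.rotate_append_length_eq] at h2
      exact h2.apply_head
    have h' : IsPresentation G (([] ++ [G.η f :: ([] ++ G.η (G.η f) :: c)]) :: rest) := by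
      refine h.of_reflTransGen (reflTransGen_move_of_isRotated [] rest [] [] ?_)
      refine ⟨(f :: c).length, ?_⟩
      rw [← List.cons_append, List.rotate_append_length_eq, G.η_η]
      rfl
    have h0 : ¬ G.Contractible f := fun hcon => hcon.2.1 hη
    have h0' : ¬ G.Contractible (G.η f) := fun hcon => hcon.1 (by rw [hη, G.η_η])
    rw [edgeSum_swap B hg, edgeSum_eq B h𝒜 hg w _ h'.presentation hR.swap,
      edgeSum_cut B h𝒜 hg hTr hK w hR.swap h' (Or.inl hc), contractionValue, dif_neg h0',
      contractionValue, dif_neg h0]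
  · rw [edgeSum_eq B h𝒜 hg w P h.presentation hR]
    exact edgeSum_join_loop B h𝒜 hg hTr hK w hR h
  · rw [edgeSum_eq B h𝒜 hg w P h.presentation hR]
    exact edgeSum_join B h𝒜 hg hTr hK w hR h

end EdgeSum

/-! ### The differential of the cochain -/

section Coboundary

variable {G : StableRibbonGraph}

theorem sameCycle_η_iff {x y : G.Flag} : G.η.SameCycle x y ↔ y = x ∨ y = G.η x := by
  constructor
  · intro h
    obtain ⟨n, rfl⟩ := h.exists_nat_pow_eq
    induction n with
    | zero => exact Or.inl rfl
    | succ n ih =>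
      rw [pow_succ', Perm.mul_apply]
      rcases ih ⟨n, by rw [zpow_natCast]⟩ with h | h
      · rw [h]
        exact Or.inr rfl
      · rw [h, G.η_η]
        exact Or.inl rfl
  · rintro (rfl | rfl)
    · exact SameCycle.refl _ _
    · exact (SameCycle.refl _ _).apply_right

theorem isEdgeSystem_out (G : StableRibbonGraph) :
    IsEdgeSystem G.η ((Finset.univ : Finset G.Edge).toList.map Quotient.out) := by
  have hcyc : ∀ (e : G.Edge) (y : G.Flag), y ∈ [e.out, G.η e.out] → cyc G.η y = e := by
    intro e y hy
    rw [List.mem_cons, List.mem_singleton] at hy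
    exact ((cyc_eq_iff _).2 (sameCycle_η_iff.2 hy)).symm.trans (Quotient.out_eq e)
  constructor
  · rw [edgeList, List.nodup_flatMap]
    refine ⟨fun x _ => by simpa using (G.η_ne x).symm, ?_⟩
    rw [List.pairwise_map]
    refine (Finset.nodup_toList _).imp fun {e e'} hne y hy hy' => ?_
    exact hne ((hcyc e y hy).symm.trans (hcyc e' y hy'))
  · intro x
    refine mem_edgeList.2 ⟨(cyc G.η x).out, List.mem_map_of_mem (by simp), ?_⟩
    exact sameCycle_η_iff.1 ((cyc_eq_iff _).1 (Quotient.out_eq (cyc G.η x)))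

theorem sum_map_edgeList {F M : Type*} [AddMonoid M] (η : Perm F) (φ : F → M) (R : List F) :
    ((edgeList η R).map φ).sum = (R.map fun x => φ x + φ (η x)).sum := by
  induction R with
  | nil => rfl
  | cons x R ih =>
    rw [edgeList_cons, List.map_cons, List.map_cons, List.sum_cons, List.sum_cons, ih,
      List.map_cons, List.sum_cons, add_assoc]

variable {k A : Type*} [Field k] [NonUnitalRing A] [Module k A]
  [IsScalarTower k A A] [SMulCommClass k A A] [CharZero k]
  {𝒜 : ZMod 2 → Submodule k A} {g : A →ₗ[k] A →ₗ[k] k} {ι : Type*} [DecidableEq ι] [Fintype ι]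
  (B : DualBases 𝒜 g ι) {I J : A →ₗ[k] A}

/-- The term of the flag `x` in the action of the derivation `I` on the product of the tensors of
the vertices. -/
noncomputable def flagDerivative (I : A →ₗ[k] A) (P : Presentation G) (m : G.Flag → ι)
    (x : G.Flag) : k :=
  sgn k (precedingSum (shiftedParity B m) P.flags P.flags x) *
    B.graphValue (vertexGenus G) P.list (applyAt I (fun y => B.letter (m y)) x)

theorem sum_flagDerivative (h𝒜 : IsSuperGrading 𝒜) (hg : IsOddScalarProduct 𝒜 g)
    (hI : IsOddDerivation 𝒜 g I) (P : Presentation G) (m : G.Flag → ι) :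
    (P.flags.map (flagDerivative B I P m)).sum = 0 :=
  B.derivation_prod_vertexValue h𝒜 hg hI (a := fun y => B.letter (m y))
    (fun y => B.letter_mem (m y)) (vertexGenus G)
    (fun v hv c hc => (P.isPresentation.cycle v hv c hc).ne_nil) P.nodup

/-- The inverse scalar product is `[I, I~]` applied to the propagator; the operator `I` is moved from
the edge to the two flags of the edge at the tensors of the vertices. -/
theorem edgeSum_eq_sum_flagDerivative (hg : IsOddScalarProduct 𝒜 g)
    (hI : IsOddDerivation 𝒜 g I) (hJ : IsHomotopyInverse 𝒜 g I J)
    (hK : IsEvenSymmetric B (B.propagator J)) (w : G.Orient) (P : Presentation G) {f : G.Flag}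
    {R R' : List G.Flag} (hR : IsEdgeSystem G.η (f :: R)) (hR' : IsEdgeSystem G.η R') :
    edgeSum B J w P f R = ((w.sign P.order : ℤ) : k) * ∑ m : G.Flag → ι,
      edgeFactor B J G.η P.flags R' m *
        (flagDerivative B I P m f + flagDerivative B I P m (G.η f)) := by
  have key := B.sum_pairing_edge hg hI hJ G.η_ne (vertexGenus G) P.nodup P.mem hR
  have e : edgeSum B J w P f R = ((w.sign P.order : ℤ) : k) * ∑ m : G.Flag → ι,
      g (B.dual (m f)) (B.dual (m (G.η f))) *
        (R.map fun x => B.propagator J (m x) (m (G.η x))).prod *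
        (sgn k (reorderExponent (shiftedParity B m) P.list.flatten.flatten
          (edgeList G.η (f :: R))) *
          B.graphValue (vertexGenus G) P.list fun y => B.letter (m y)) := by
    rw [edgeSum, Finset.mul_sum]
    refine Finset.sum_congr rfl fun m _ => ?_
    have h1 : P.vertexProduct B m =
        B.graphValue (vertexGenus G) P.list fun y => B.letter (m y) := by
      rw [Presentation.vertexProduct, DualBases.graphValue]
      simp only [vertexTensor_eq_vertexValue]
    have h2 : ∀ a b c d : k, a * (b * (c * d)) = b * (a * (c * d)) := by intros; ring
    rw [Presentation.colouringValue, h1]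
    exact h2 _ _ _ _
  rw [e, key]
  congr 1
  refine Finset.sum_congr rfl fun m _ => ?_
  rw [← edgeFactor_eq G.η_η G.η_ne hK (t := P.flags) P.mem hR hR' m]
  rfl

theorem coboundary_partitionCochain (h𝒜 : IsSuperGrading 𝒜) (hg : IsOddScalarProduct 𝒜 g)
    (hI : IsOddDerivation 𝒜 g I) (hJ : IsHomotopyInverse 𝒜 g I J)
    (hTr : ∀ a : A, B.superTrace (LinearMap.mulLeft k a) = 0) :
    coboundary k (partitionCochain B J) = 0 := by
  funext ⟨G, w⟩
  have hK := isEvenSymmetric_propagator hg B hJ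
  obtain ⟨P⟩ := Presentation.exists_presentation G
  have hR := isEdgeSystem_out G
  change ∑ e : G.Edge, contractionValue B J w e.out = 0
  have hterm : ∀ e : G.Edge, contractionValue B J w e.out =
      ((w.sign P.order : ℤ) : k) * ∑ m : G.Flag → ι,
        edgeFactor B J G.η P.flags ((Finset.univ : Finset G.Edge).toList.map Quotient.out) m *
          (flagDerivative B I P m e.out + flagDerivative B I P m (G.η e.out)) := by
    intro e
    have he : e.out ∈ (Finset.univ : Finset G.Edge).toList.map Quotient.out :=
      List.mem_map_of_mem (by simp)
    have hRe := hR.perm (List.perm_cons_erase he)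
    rw [← edgeSum_eq_contractionValue B h𝒜 hg hTr hK w P hRe,
      edgeSum_eq_sum_flagDerivative B hg hI hJ hK w P hRe hR]
  rw [Finset.sum_congr rfl fun e _ => hterm e, ← Finset.mul_sum, Finset.sum_comm]
  refine mul_eq_zero_of_right _ (Finset.sum_eq_zero fun m _ => ?_)
  rw [← Finset.mul_sum]
  refine mul_eq_zero_of_right _ ?_
  have hp := P.flags_perm _ hR.nodup hR.mem
  rw [← sum_flagDerivative B h𝒜 hg hI P m, (hp.map (flagDerivative B I P m)).sum_eq,
    sum_map_edgeList, List.map_map, ← Finset.sum_map_toList]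
  rfl

end Coboundary

end StableRibbon

theorem mainTheorem3 {k : Type*} [Field k] [CharZero k] {A : Type*} [NonUnitalRing A] [Module k A]
    [IsScalarTower k A A] [SMulCommClass k A A]
    (𝒜 : ZMod 2 → Submodule k A) (h𝒜 : StableRibbon.IsSuperGrading 𝒜)
    (g : A →ₗ[k] A →ₗ[k] k) (hg : StableRibbon.IsOddScalarProduct 𝒜 g)
    (I J : A →ₗ[k] A) (hI : StableRibbon.IsOddDerivation 𝒜 g I)
    (hJ : StableRibbon.IsHomotopyInverse 𝒜 g I J)
    {ι : Type*} [Fintype ι] [DecidableEq ι] (B : StableRibbon.DualBases 𝒜 g ι)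
    (hTr : ∀ a : A, B.superTrace (LinearMap.mulLeft k a) = 0) :
    (∀ (G : StableRibbon.StableRibbonGraph) (w : G.Orient) (P : StableRibbon.Presentation G),
      StableRibbon.partitionCochain B J ⟨G, w⟩ = ((w.sign P.order : ℤ) : k) * P.weight B J) ∧
    StableRibbon.partitionCochain B J ∈ StableRibbon.cochains k ∧
    StableRibbon.coboundary k (StableRibbon.partitionCochain B J) = 0 := by
  have hK := StableRibbon.isEvenSymmetric_propagator hg B hJ
  exact ⟨fun _ w P => StableRibbon.partitionCochain_eq h𝒜 hg B hK w P,
    ⟨fun _ w => StableRibbon.partitionCochain_neg B w,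
      fun _ _ i w => StableRibbon.partitionCochain_iso h𝒜 hg B hK i w⟩,
    StableRibbon.coboundary_partitionCochain B h𝒜 hg hI hJ hTr⟩
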